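/- **Setting.** Let $\mathbb L\subset\mathbb R^3$ be a lattice with unit cell $\Gamma$ and let $\rho_b$ be a smooth real $\Gamma$-periodic function. For $n\ge 1$, $L^2_n$ and $H^k_n$ denote the spaces of real $n\mathbb L$-periodic functions that are, respectively, in $L^2(n\Gamma)$ and have all weak derivatives up to order $k$ in $L^2(n\Gamma)$, with norms $\|f\|_{L^2_n}=(n^{-3}\int_{n\Gamma}|f|^2)^{1/2}$ and $\|f\|_{H^k_n}=\sum_{|\alpha|\le k}\|\partial^\alpha f\|_{L^2_n}$; triples carry the maximum of the norms of the components. For a field $g$, a triple $u=(\nu_+,\nu_-,V)\in(H^2_n)^3$ solves the Euler–Lagrange equations $\mathcal F(u;g)=0$ on $n\Gamma$ if, almost everywhere, $$-\Delta\nu_\pm+\tfrac53\nu_\pm^{7/3}-\tfrac43\nu_\pm^{5/3}+(V\mp g)\nu_\pm=0,\qquad -\Delta V=4\pi(\nu_+^2+\nu_-^2-\rho_b).$$ The linearized operator at $u$ with field $g$ is $$\mathcal L\begin{pmatrix}\omega_+\\ \omega_-\\ W\end{pmatrix}=\begin{pmatrix}-\Delta\omega_++\frac{35}9\nu_+^{4/3}\omega_+-\frac{20}9\nu_+^{2/3}\omega_++(V-g)\omega_++\nu_+W\\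 -\Delta\omega_-+\frac{35}9\nu_-^{4/3}\omega_--\frac{20}9\nu_-^{2/3}\omega_-+(V+g)\omega_-+\nu_-W\\ \nu_+\omega_++\nu_-\omega_-+\frac1{8\pi}\Delta W\end{pmatrix}.$$ Let $u_{\rm per}=(\nu_{+,\rm per},\nu_{-,\rm per},V_{\rm per})\in(H^2_1)^3$ solve $\mathcal F(u_{\rm per};0)=0$ on $\Gamma$ with $\nu_{\pm,\rm per}\ge C_\nu$ for a constant $C_\nu>0$ (for instance, minimizers of the periodic spin-polarized TFDW energy with this lower bound, together with their potential, the Lagrange multiplier being included in $V_{\rm per}$). Let $\mathcal L_{\rm per}$ be the linearized operator at $u_{\rm per}$ with field $0$. **Stability assumption.** There is a constant $M$ such that for every $n\ge1$ the operator $\mathcal L_{\rm per}:(H^2_n)^3\to(L^2_n)^3$ is bijective and $\|\mathcal L_{\rm per}^{-1}f\|_{(L^2_n)^3}\le M\|f\|_{(L^2_n)^3}$ for all $f\in(L^2_n)^3$. **Theorem.** Under the stability assumption there are $h_0>0$, $\delta_1>0$ and a $C^\infty$ map $[-h_0,h_0]\ni\eta\mapsto u_{\rm CB}(\cdot;\eta)\in(H^3_1)^3$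 with $u_{\rm CB}(\cdot;0)=u_{\rm per}$ such that, for each $\eta\in[-h_0,h_0]$, $u_{\rm CB}(\cdot;\eta)$ is the unique $v\in(H^3_1)^3$ with $\|v-u_{\rm per}\|_{(H^3_1)^3}\le\delta_1$ and $\mathcal F(v;\eta)=0$ on $\Gamma$. Moreover, for every $K$ there are $\varepsilon_0>0$ and $\delta>0$ such that the following holds for every smooth $\Gamma$-periodic $h$ with $\|h\|_\infty\le h_0$ and $\sup_x|D^jh(x)|\le K$ for $0\le j\le4$. (i) Put $u_0(x,z)=u_{\rm CB}(z;h(x))=(\nu_{+,0},\nu_{-,0},V_0)$, and let $\mathcal L_\eta$ be the linearized operator on $\Gamma$ at $u_{\rm CB}(\cdot;\eta)$ with constant field $\eta$. There are unique $u_j=(\nu_{+,j},\nu_{-,j},V_j)\in C^\infty(\mathbb R^3;(H^3_1)^3)$, $j=1,2$, where $u_j(x,\cdot)$ denotes the value at $x$, such that for every $x$, in the variable $z$, $$\mathcal L_{h(x)}u_1=\bigl(2\nabla_x\!\cdot\!\nabla_z\nu_{+,0},\ 2\nabla_x\!\cdot\!\nabla_z\nu_{-,0},\ -\tfrac1{4\pi}\nabla_x\!\cdot\!\nabla_zV_0\bigr),\qquad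 \mathcal L_{h(x)}u_2=(f_+,f_-,g),$$ $$f_\pm=2\nabla_x\!\cdot\!\nabla_z\nu_{\pm,1}+\Delta_x\nu_{\pm,0}-\tfrac{70}{27}\nu_{\pm,0}^{1/3}\nu_{\pm,1}^2+\tfrac{20}{27}\nu_{\pm,0}^{-1/3}\nu_{\pm,1}^2-V_1\nu_{\pm,1},$$ $$g=-\tfrac1{8\pi}\bigl(2\nabla_x\!\cdot\!\nabla_zV_1+\Delta_xV_0\bigr)-\tfrac12\bigl(\nu_{+,1}^2+\nu_{-,1}^2\bigr).$$ (ii) For every $n\ge1$ with $\varepsilon=1/n\le\varepsilon_0$, the approximate solution $u^0(x)=u_0(\varepsilon x,x)+\varepsilon u_1(\varepsilon x,x)+\varepsilon^2u_2(\varepsilon x,x)$ and the Cauchy–Born state $x\mapsto u_{\rm CB}(x;h(\varepsilon x))$ (both formed with the continuous representatives in $z$) lie in $(H^2_n)^3$, and there is a unique $u=(\nu_+,\nu_-,V)\in(H^2_n)^3$ with $$\mathcal F\bigl(u;h(\varepsilon\,\cdot)\bigr)=0\ \text{ on } n\Gamma\qquad\text{and}\qquad \|u-u^0\|_{(H^2_n)^3}\le\delta\varepsilon^3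 .$$ This $u$ also satisfies $\|u-u_{\rm CB}(\cdot;h(\varepsilon\,\cdot))\|_{(H^2_n)^3}\le\delta\varepsilon$. -/

import Mathlib

open MeasureTheory Set Filter
open scoped ContDiff

noncomputable section

namespace TFDW

/-- Physical space `ℝ³` with its Euclidean norm. -/
abbrev Space : Type := EuclideanSpace ℝ (Fin 3)

/-- The supercell `nΓ`, where `Γ` is the unit cell (fundamental parallelepiped) of the lattice
`𝕃` generated by the basis `b` of `ℝ³`. -/
def cell (b : Module.Basis (Fin 3) ℝ Space) (n : ℕ) : Set Space :=
  {x | ∀ i, b.repr x i ∈ Ico (0 : ℝ) n}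

/-- The measure `n⁻³ dx` on `nΓ`; the `L²` norm for it is the norm of `L²ₙ`. -/
def cellMeasure (b : Module.Basis (Fin 3) ℝ Space) (n : ℕ) : Measure Space :=
  ((n : ENNReal) ^ 3)⁻¹ • volume.restrict (cell b n)

/-- Periodicity with respect to the lattice `n𝕃`. -/
def IsPeriodic (b : Module.Basis (Fin 3) ℝ Space) (n : ℕ) (f : Space → ℝ) : Prop :=
  ∀ (i : Fin 3) (x : Space), f (x + (n : ℝ) • b i) = f x

/-- `L²ₙ`: an `n𝕃`-periodic function is identified with its restriction to the cell `nΓ`. -/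
abbrev L2 (b : Module.Basis (Fin 3) ℝ Space) (n : ℕ) : Type := Lp ℝ 2 (cellMeasure b n)

/-- Multi-indices `α ∈ ℕ³` with `|α| ≤ k`. -/
abbrev MultiIndex (k : ℕ) : Type := {α : Fin 3 → Fin (k + 1) // ∑ i, (α i : ℕ) ≤ k}

/-- The order `|α|`. -/
def MultiIndex.order {k : ℕ} (α : MultiIndex k) : ℕ := ∑ i, (α.1 i : ℕ)

/-- The zero multi-index. -/
def MultiIndex.nil (k : ℕ) : MultiIndex k := ⟨fun _ => 0, by simp⟩

/-- The unit vector `e_j`. -/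
def unitVec (j : Fin 3) : Space := EuclideanSpace.single j 1

/-- The classical partial derivative `∂_j φ`. -/
def pderiv (j : Fin 3) (φ : Space → ℝ) : Space → ℝ := fun x => fderiv ℝ φ x (unitVec j)

/-- The classical partial derivative `∂^α φ`. -/
def pderivMulti {k : ℕ} (α : MultiIndex k) (φ : Space → ℝ) : Space → ℝ :=
  (pderiv 0)^[(α.1 0 : ℕ)] ((pderiv 1)^[(α.1 1 : ℕ)] ((pderiv 2)^[(α.1 2 : ℕ)] φ))

theorem contDiff_pderiv_iterate (j : Fin 3) (m : ℕ) {φ : Space → ℝ} (hφ : ContDiff ℝ ∞ φ) :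
    ContDiff ℝ ∞ ((pderiv j)^[m] φ) := by
  induction m with
  | zero => simpa using hφ
  | succ m ih =>
    rw [Function.iterate_succ_apply']
    exact (ih.fderiv_right (m := ∞) (by simp)).clm_apply contDiff_const

theorem continuous_pderivMulti {k : ℕ} (α : MultiIndex k) {φ : Space → ℝ}
    (hφ : ContDiff ℝ ∞ φ) : Continuous (pderivMulti α φ) :=
  (contDiff_pderiv_iterate 0 _ (contDiff_pderiv_iterate 1 _
    (contDiff_pderiv_iterate 2 _ hφ))).continuous

theorem exists_compact_cell (b : Module.Basis (Fin 3) ℝ Space) (n : ℕ) :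
    ∃ S : Set Space, IsCompact S ∧ cell b n ⊆ S := by
  have hc : Continuous (b.equivFun.symm : (Fin 3 → ℝ) → Space) :=
    b.equivFun.symm.toLinearMap.continuous_of_finiteDimensional
  refine ⟨b.equivFun.symm '' (Set.pi univ fun _ => Icc (0 : ℝ) n),
    (isCompact_univ_pi fun _ => isCompact_Icc).image hc, fun x hx => ?_⟩
  refine ⟨b.equivFun x, fun i _ => ?_, by simp⟩
  exact Ico_subset_Icc_self (hx i)

theorem measurableSet_cell (b : Module.Basis (Fin 3) ℝ Space) (n : ℕ) :
    MeasurableSet (cell b n) := by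
  have hc : Continuous (b.equivFun : Space → (Fin 3 → ℝ)) :=
    b.equivFun.toLinearMap.continuous_of_finiteDimensional
  have : cell b n = b.equivFun ⁻¹' (Set.pi univ fun _ => Ico (0 : ℝ) n) := by
    ext x; simp [cell]
  rw [this]
  exact hc.measurable (MeasurableSet.univ_pi fun _ => measurableSet_Ico)

instance isFiniteMeasure_cellMeasure (b : Module.Basis (Fin 3) ℝ Space) (n : ℕ) :
    IsFiniteMeasure (cellMeasure b n) := by
  obtain ⟨S, hS, hsub⟩ := exists_compact_cell b n
  refine ⟨?_⟩
  have hv : volume (cell b n) < ⊤ := (measure_mono hsub).trans_lt hS.measure_lt_top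
  rcases Nat.eq_zero_or_pos n with rfl | hn
  · have : cell b 0 = ∅ := by
      ext x; simp [cell]
    simp [cellMeasure, this]
  · simp only [cellMeasure, Measure.smul_apply, Measure.restrict_apply MeasurableSet.univ,
      univ_inter, smul_eq_mul]
    refine ENNReal.mul_lt_top ?_ hv
    rw [ENNReal.inv_lt_top, pos_iff_ne_zero]
    exact pow_ne_zero 3 (by exact_mod_cast hn.ne')

theorem integrable_mul_test (b : Module.Basis (Fin 3) ℝ Space) (n : ℕ) (f : L2 b n)
    {φ : Space → ℝ} (hφ : Continuous φ) :
    Integrable (fun x => f x * φ x) (cellMeasure b n) := by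
  obtain ⟨S, hS, hsub⟩ := exists_compact_cell b n
  obtain ⟨C, hC⟩ := hS.exists_bound_of_continuousOn hφ.continuousOn
  refine ((Lp.memLp f).integrable (by norm_num)).mul_bdd (c := C) hφ.aestronglyMeasurable ?_
  refine Measure.ae_smul_measure ?_ _
  filter_upwards [ae_restrict_mem (measurableSet_cell b n)] with x hx
  exact hC x (hsub hx)

/-- The periodic Sobolev space `H^k_n`. An element is the family `(∂^α f)_{|α| ≤ k}` of the weak
derivatives of an `n𝕃`-periodic function `f`, all in `L²ₙ`; weak derivatives are taken
against smooth `n𝕃`-periodic test functions. The norm is `∑_{|α| ≤ k} ‖∂^α f‖_{L²ₙ}`. -/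
def sobolev (b : Module.Basis (Fin 3) ℝ Space) (k n : ℕ) :
    Submodule ℝ (PiLp 1 fun _ : MultiIndex k => L2 b n) where
  carrier := {F | ∀ (α : MultiIndex k) (φ : Space → ℝ), ContDiff ℝ ∞ φ → IsPeriodic b n φ →
    ∫ x, F (MultiIndex.nil k) x * pderivMulti α φ x ∂(cellMeasure b n)
      = (-1) ^ α.order * ∫ x, F α x * φ x ∂(cellMeasure b n)}
  zero_mem' := by
    intro α φ _ _
    have h0 : ∀ ψ : Space → ℝ,
        ∫ x, (0 : L2 b n) x * ψ x ∂(cellMeasure b n) = 0 := by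
      intro ψ
      refine integral_eq_zero_of_ae ?_
      filter_upwards [Lp.coeFn_zero ℝ 2 (cellMeasure b n)] with x hx
      rw [hx]
      simp
    simp only [PiLp.zero_apply, h0, mul_zero]
  add_mem' := by
    intro F G hF hG α φ hφ hper
    have hadd : ∀ (f g : L2 b n) (ψ : Space → ℝ), Continuous ψ →
        ∫ x, (f + g : L2 b n) x * ψ x ∂(cellMeasure b n)
          = ∫ x, f x * ψ x ∂(cellMeasure b n) + ∫ x, g x * ψ x ∂(cellMeasure b n) := by
      intro f g ψ hψ
      rw [← integral_add (integrable_mul_test b n f hψ) (integrable_mul_test b n g hψ)]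
      refine integral_congr_ae ?_
      filter_upwards [Lp.coeFn_add f g] with x hx
      rw [hx, Pi.add_apply, add_mul]
    simp only [PiLp.add_apply]
    rw [hadd _ _ _ (continuous_pderivMulti α hφ), hadd _ _ _ hφ.continuous,
      hF α φ hφ hper, hG α φ hφ hper, mul_add]
  smul_mem' := by
    intro c F hF α φ hφ hper
    have hsmul : ∀ (f : L2 b n) (ψ : Space → ℝ),
        ∫ x, (c • f : L2 b n) x * ψ x ∂(cellMeasure b n)
          = c * ∫ x, f x * ψ x ∂(cellMeasure b n) := by
      intro f ψ
      rw [← integral_const_mul]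
      refine integral_congr_ae ?_
      filter_upwards [Lp.coeFn_smul c f] with x hx
      rw [hx, Pi.smul_apply, smul_eq_mul, mul_assoc]
    simp only [PiLp.smul_apply]
    rw [hsmul, hsmul, hF α φ hφ hper]
    ring

/-- The normed space `H^k_n`. -/
abbrev H (b : Module.Basis (Fin 3) ℝ Space) (k n : ℕ) : Type := sobolev b k n

section Operators

variable {b : Module.Basis (Fin 3) ℝ Space} {k n : ℕ}

/-- The underlying `L²ₙ` function of an element of `H^k_n`. -/
def toL2 (f : H b k n) : L2 b n := f.1 (MultiIndex.nil k)

/-- The weak derivative `∂^α f` of `f ∈ H^k_n` (only used for `|α| ≤ k`). -/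
def wderiv (α : Fin 3 → ℕ) (f : H b k n) : L2 b n :=
  if h : ∑ i, α i ≤ k then
    f.1 ⟨fun i => ⟨α i, Nat.lt_succ_of_le
      ((Finset.single_le_sum (fun _ _ => Nat.zero_le _) (Finset.mem_univ i)).trans h)⟩, h⟩
  else 0

/-- The weak Laplacian of `f ∈ H^k_n`, `k ≥ 2`. -/
def lap (f : H b k n) : L2 b n := ∑ j : Fin 3, wderiv (Pi.single j 2) f

/-- The periodic extension to `ℝ³` of a function on the unit cell. -/
def perExt (f : H b k 1) : Space → ℝ := fun x => toL2 f (ZSpan.fract b x)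

open Classical in
/-- The continuous periodic representative of `f` (it exists and is unique for `k ≥ 2` by the
Sobolev embedding in dimension three). -/
def contRep (f : H b k n) : Space → ℝ :=
  if h : ∃ g : Space → ℝ, Continuous g ∧ IsPeriodic b n g ∧ toL2 f =ᵐ[cellMeasure b n] g
  then h.choose else 0

/-- The triple `u ∈ (H^k_n)³` is represented by the triple `w` of functions. -/
def Represents (u : Fin 3 → H b k n) (w : Fin 3 → Space → ℝ) : Prop :=
  ∀ i, toL2 (u i) =ᵐ[cellMeasure b n] w i

/-- The Euler--Lagrange equations on `nΓ` with periodic boundary conditions, for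
`u = (ν₊, ν₋, V) = (u 0, u 1, u 2)`, charge background `ρb` and magnetic field `g`. -/
def EulerLagrange (ρb g : Space → ℝ) (u : Fin 3 → H b k n) : Prop :=
  ∀ᵐ x ∂(cellMeasure b n),
    (-(lap (u 0) x) + 5 / 3 * (toL2 (u 0) x) ^ (7 / 3 : ℝ) - 4 / 3 * (toL2 (u 0) x) ^ (5 / 3 : ℝ)
        + (toL2 (u 2) x - g x) * toL2 (u 0) x = 0) ∧
    (-(lap (u 1) x) + 5 / 3 * (toL2 (u 1) x) ^ (7 / 3 : ℝ) - 4 / 3 * (toL2 (u 1) x) ^ (5 / 3 : ℝ)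
        + (toL2 (u 2) x + g x) * toL2 (u 1) x = 0) ∧
    (-(lap (u 2) x) = 4 * Real.pi * ((toL2 (u 0) x) ^ 2 + (toL2 (u 1) x) ^ 2 - ρb x))

/-- `w ∈ (H^k_n)³` solves `𝓛 w = f` on `nΓ`, where `𝓛` is the linearization of the
Euler--Lagrange equations (third equation multiplied by `-1/(8π)`) with field `g` at the state
`c = (ν₊, ν₋, V)`. -/
def LinearizedEq (c : Fin 3 → Space → ℝ) (g : Space → ℝ) (w : Fin 3 → H b k n)
    (f : Fin 3 → Space → ℝ) : Prop :=
  ∀ᵐ x ∂(cellMeasure b n),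
    (-(lap (w 0) x) + 35 / 9 * (c 0 x) ^ (4 / 3 : ℝ) * toL2 (w 0) x
        - 20 / 9 * (c 0 x) ^ (2 / 3 : ℝ) * toL2 (w 0) x + (c 2 x - g x) * toL2 (w 0) x
        + c 0 x * toL2 (w 2) x = f 0 x) ∧
    (-(lap (w 1) x) + 35 / 9 * (c 1 x) ^ (4 / 3 : ℝ) * toL2 (w 1) x
        - 20 / 9 * (c 1 x) ^ (2 / 3 : ℝ) * toL2 (w 1) x + (c 2 x + g x) * toL2 (w 1) x
        + c 1 x * toL2 (w 2) x = f 1 x) ∧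
    (c 0 x * toL2 (w 0) x + c 1 x * toL2 (w 1) x + 1 / (8 * Real.pi) * lap (w 2) x = f 2 x)

end Operators

section Model

variable {b : Module.Basis (Fin 3) ℝ Space}

/-- Stability of the electronic structure: on every supercell `nΓ` the operator
`𝓛_per : (H²ₙ)³ → (L²ₙ)³` is bijective, and its inverse is bounded on `(L²ₙ)³` by a constant `M`
independent of `n`. -/
def Stability (uper : Fin 3 → H b 2 1) : Prop :=
  ∃ M : ℝ, ∀ n : ℕ, 1 ≤ n → ∀ f : Fin 3 → L2 b n, ∃ w : Fin 3 → H b 2 n,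
    LinearizedEq (fun i => perExt (uper i)) (fun _ => 0) w (fun i => f i) ∧
    (∀ w' : Fin 3 → H b 2 n,
      LinearizedEq (fun i => perExt (uper i)) (fun _ => 0) w' (fun i => f i) → w' = w) ∧
    ‖fun i => toL2 (w i)‖ ≤ M * ‖f‖

/-- `η ↦ uCB η = u_CB(·; η)` is the Cauchy--Born branch for constant fields `η ∈ [-h₀, h₀]`: a
`C^∞` map into `(H³₁)³` that starts at `u_per`, and `uCB η` is the only solution in `(H³₁)³` of the
cell problem with constant field `η` at distance at most `δ₁` from `u_per`. -/
structure IsCauchyBorn (ρb : Space → ℝ) (uper : Fin 3 → H b 2 1) (h₀ δ₁ : ℝ)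
    (uCB : ℝ → Fin 3 → H b 3 1) : Prop where
  smooth : ContDiffOn ℝ ∞ uCB (Icc (-h₀) h₀)
  initial : ∀ i, toL2 (uCB 0 i) = toL2 (uper i)
  solves : ∀ η ∈ Icc (-h₀) h₀, ∀ v : Fin 3 → H b 3 1,
    (EulerLagrange ρb (fun _ => η) v ∧ ‖v - uCB 0‖ ≤ δ₁) ↔ v = uCB η

/-- The macroscopic derivative `∂_{x_j} U` of a map `U : x ↦ U(x, ·) ∈ (H³₁)³`. -/
def dx (j : Fin 3) (U : Space → Fin 3 → H b 3 1) : Space → Fin 3 → H b 3 1 :=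
  fun x => fderiv ℝ U x (unitVec j)

/-- `∇_x · ∇_z U(x, ·)`, componentwise. -/
def mixed (U : Space → Fin 3 → H b 3 1) (x : Space) (i : Fin 3) : L2 b 1 :=
  ∑ j : Fin 3, wderiv (Pi.single j 1) (dx j U x i)

/-- `Δ_x U(x, ·)`, componentwise. -/
def lapx (U : Space → Fin 3 → H b 3 1) (x : Space) (i : Fin 3) : L2 b 1 :=
  ∑ j : Fin 3, toL2 (dx j (dx j U) x i)

/-- Right-hand side of the first order cell problem. -/
def rhs1 (u₀ : Space → Fin 3 → H b 3 1) (x : Space) : Fin 3 → Space → ℝ :=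
  ![fun z => 2 * mixed u₀ x 0 z,
    fun z => 2 * mixed u₀ x 1 z,
    fun z => -(1 / (4 * Real.pi)) * mixed u₀ x 2 z]

/-- Right-hand side of the second order cell problem. -/
def rhs2 (u₀ u₁ : Space → Fin 3 → H b 3 1) (x : Space) : Fin 3 → Space → ℝ :=
  ![fun z => 2 * mixed u₁ x 0 z + lapx u₀ x 0 z
      - 70 / 27 * (toL2 (u₀ x 0) z) ^ (1 / 3 : ℝ) * (toL2 (u₁ x 0) z) ^ 2
      + 20 / 27 * (toL2 (u₀ x 0) z) ^ (-(1 / 3) : ℝ) * (toL2 (u₁ x 0) z) ^ 2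
      - toL2 (u₁ x 2) z * toL2 (u₁ x 0) z,
    fun z => 2 * mixed u₁ x 1 z + lapx u₀ x 1 z
      - 70 / 27 * (toL2 (u₀ x 1) z) ^ (1 / 3 : ℝ) * (toL2 (u₁ x 1) z) ^ 2
      + 20 / 27 * (toL2 (u₀ x 1) z) ^ (-(1 / 3) : ℝ) * (toL2 (u₁ x 1) z) ^ 2
      - toL2 (u₁ x 2) z * toL2 (u₁ x 1) z,
    fun z => -(1 / (8 * Real.pi)) * (2 * mixed u₁ x 2 z + lapx u₀ x 2 z)
      - 1 / 2 * ((toL2 (u₁ x 0) z) ^ 2 + (toL2 (u₁ x 1) z) ^ 2)]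

/-- `u₁, u₂ ∈ C^∞(ℝ³; (H³₁)³)` are the first and second order terms of the two-scale expansion
with leading term `u₀(x, z) = u_CB(z; h(x))`: for every `x` they solve the cell problems
`𝓛_{h(x)} u₁(x, ·) = rhs1` and `𝓛_{h(x)} u₂(x, ·) = rhs2`. -/
structure IsTwoScale (uCB : ℝ → Fin 3 → H b 3 1) (h : Space → ℝ)
    (u₁ u₂ : Space → Fin 3 → H b 3 1) : Prop where
  smooth₁ : ContDiff ℝ ∞ u₁
  smooth₂ : ContDiff ℝ ∞ u₂
  order₁ : ∀ x, LinearizedEq (fun i => toL2 (uCB (h x) i)) (fun _ => h x) (u₁ x)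
    (rhs1 (fun y => uCB (h y)) x)
  order₂ : ∀ x, LinearizedEq (fun i => toL2 (uCB (h x) i)) (fun _ => h x) (u₂ x)
    (rhs2 (fun y => uCB (h y)) u₁ x)

/-- The function `x ↦ U(εx, x)` (componentwise) for `U : x ↦ U(x, ·) ∈ (H³₁)³`. -/
def diag (ε : ℝ) (U : Space → Fin 3 → H b 3 1) : Fin 3 → Space → ℝ :=
  fun i x => contRep (U (ε • x) i) x

/-- The Cauchy--Born state `x ↦ u_CB(x; h(εx))`. -/
def cauchyBornState (uCB : ℝ → Fin 3 → H b 3 1) (h : Space → ℝ) (ε : ℝ) : Fin 3 → Space → ℝ :=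
  diag ε fun y => uCB (h y)

/-- The two-scale approximate solution
`u⁰(x) = u_CB(x; h(εx)) + ε u₁(εx, x) + ε² u₂(εx, x)`. -/
def approxSolution (uCB : ℝ → Fin 3 → H b 3 1) (h : Space → ℝ)
    (u₁ u₂ : Space → Fin 3 → H b 3 1) (ε : ℝ) : Fin 3 → Space → ℝ :=
  fun i x => cauchyBornState uCB h ε i x + ε * diag ε u₁ i x + ε ^ 2 * diag ε u₂ i x

end Model

end TFDW

end

open TFDW

/-!
# The Cauchy--Born approximation for the spin-polarized TFDW model

**The unperturbed state and the branch.** The problem on the unit cell is studied in a weighted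
Wiener algebra `A` of periodic functions, whose Fourier coefficients are summable against the weight
`2 (1 + |ξ|)`. It is a Banach algebra on which `(1 - Δ)⁻¹` is compact, `(1 - Δ)⁻¹ : A → H³` is
bounded, and `H³` embeds into `A`. The fractional powers in the Euler--Lagrange equations are removed
by the substitution `ν_± = w_±³`: the equations become `cube y = (1 - Δ)⁻¹ (source ρ η y)` for
`y = (w₊, w₋, V) ∈ A³`, where `cube` and `source` are polynomial (`cellMap`). The given state has
this form by elliptic regularity: `ν`, `∇ν` and `Δν` are in `H¹`, hence so is `ν^a - Δ ν^a` for
every real `a`, and a continuous function with this property is in `A` (`exists_rpow`,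
`exists_state`). In particular `w_±` is invertible in `A`. The derivative of `cellMap` in `y` is the
composition of the invertible multiplication operator `cubeMat` with `linOp = 1 - (1 - Δ)⁻¹ B`. The
latter is a compact perturbation of the identity, and it is injective because the linearized operator
on the unit cell is injective; so it is invertible (`isUnit_linOp`). The implicit function theorem
gives a smooth branch `η ↦ Y η` in `A³`, and `(1 - Δ)⁻¹` turns it into a smooth branch in `H³`,
which inherits local uniqueness since `H³` embeds into `A` (`exists_branch`,
`exists_isCauchyBorn`).

**The correctors.** Along the branch the linearized cell problem has a unique solution
(`linearizedEq_branch_iff`). It is convenient to describe every function of the expansion by its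
source `U_j = (1 - Δ_z) u_j ∈ A³`: the cell problems for `u₁` and `u₂` say precisely that `U₁`, `U₂`
are given by `src1`, `src2` (`isTwoScale_iff`). These are obtained from `h` by composition with maps
that are smooth on the range of `h`, at most two derivatives in `x`, and products, so they are bounded
in terms of four derivatives of `h` alone (`UniformlySmooth`).

**The residual.** By the chain rule, `1 - Δ` applied to `x ↦ u(εx, x)` is again a two-scale function
(`twoScaleOp`); this shows that the approximate solution is in `H²ₙ` (`exists_twoScale`). Inserting
`u₀ + ε u₁ + ε² u₂` into the equations, the orders `1`, `ε`, `ε²` cancel, and the residual is at most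
`C ε³` pointwise, by Taylor's formula for the nonlinearity (`residual_eq`, `exists_taylor`,
`exists_approx`).

**The exact solution.** The stability assumption, together with the elliptic estimate, bounds the
inverse of the linearized operator at the unperturbed state from `L²ₙ` to `H²ₙ` uniformly in `n`
(`exists_solvesLin`). The Cauchy--Born states are uniformly close to the unperturbed state, so the
nonlinear equation near `u⁰` is a fixed point problem for a contraction (`exists_unique_near`). The
contraction property needs that corrections are small in `L^∞`. The Sobolev inequality used here loses
a factor `n² = ε⁻²` (`ae_abs_le_H2`), which is harmless since corrections have size `ε³` in `H²ₙ`.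

Fourier series are expanded in the real modes `cos θ + sin θ`, `θ = ξ · x`, which form a single
orthonormal family indexed by the frequencies; differentiation maps the mode of frequency `k` to a
multiple of the mode of frequency `-k`.
-/

open scoped Topology

noncomputable section

namespace TFDW

variable {b : Module.Basis (Fin 3) ℝ Space}

section

variable {n : ℕ}

/-! ### The supercell as a torus -/

/-- The normalised Haar measure of the three-dimensional torus. -/
def torusMeasure : Measure (UnitAddTorus (Fin 3)) := Measure.pi fun _ => AddCircle.haarAddCircle

instance : IsProbabilityMeasure torusMeasure := by unfold torusMeasure; infer_instance

/-- The coordinates of a point with respect to the basis `n • b`. -/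
def cellCoord (b : Module.Basis (Fin 3) ℝ Space) (n : ℕ) [NeZero n] : Space ≃L[ℝ] (Fin 3 → ℝ) :=
  (b.equivFun.trans (LinearEquiv.smulOfNeZero ℝ (Fin 3 → ℝ) ((n : ℝ)⁻¹)
    (inv_ne_zero (NeZero.ne _)))).toContinuousLinearEquiv

theorem cellCoord_apply [NeZero n] (x : Space) (i : Fin 3) :
    cellCoord b n x i = (n : ℝ)⁻¹ * b.repr x i := by
  rfl

/-- The projection of `ℝ³` onto `ℝ³ / n𝕃`, identified with the standard torus. -/
def toTorus (b : Module.Basis (Fin 3) ℝ Space) (n : ℕ) [NeZero n] (x : Space) :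
    UnitAddTorus (Fin 3) := fun i => (cellCoord b n x i : UnitAddCircle)

theorem toTorus_add [NeZero n] (x y : Space) :
    toTorus b n (x + y) = toTorus b n x + toTorus b n y := by
  ext i; simp [toTorus]

theorem measurable_toTorus [NeZero n] : Measurable (toTorus b n) :=
  measurable_pi_lambda _ fun i => AddCircle.measurable_mk'.comp
    ((measurable_pi_apply i).comp (cellCoord b n).continuous.measurable)

theorem cell_eq_preimage [NeZero n] :
    cell b n = cellCoord b n ⁻¹' (Set.pi univ fun _ => Ico (0 : ℝ) 1) := by
  have hn : (0 : ℝ) < n := by exact_mod_cast Nat.pos_of_ne_zero (NeZero.ne n)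
  ext x
  simp only [cell, mem_ofPred_eq, mem_preimage, Set.mem_pi, mem_univ, true_imp_iff,
    cellCoord_apply, mem_Ico]
  refine forall_congr' fun i => and_congr ?_ ?_
  · rw [mul_nonneg_iff_of_pos_left (inv_pos.2 hn)]
  · rw [inv_mul_lt_iff₀ hn, mul_one]

/-- The volume of the unit cell. -/
def cellVol (b : Module.Basis (Fin 3) ℝ Space) : ℝ := volume.real (cell b 1)

theorem volume_cell_lt_top (b : Module.Basis (Fin 3) ℝ Space) (n : ℕ) :
    volume (cell b n) < ⊤ := by
  obtain ⟨S, hS, hsub⟩ := exists_compact_cell b n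
  exact (measure_mono hsub).trans_lt hS.measure_lt_top

theorem cell_one_eq_fundamentalDomain : cell b 1 = ZSpan.fundamentalDomain b := by
  ext x; simp [cell, ZSpan.mem_fundamentalDomain]

theorem cellVol_pos (b : Module.Basis (Fin 3) ℝ Space) : 0 < cellVol b := by
  refine ENNReal.toReal_pos ?_ (volume_cell_lt_top b 1).ne
  rw [cell_one_eq_fundamentalDomain]
  exact ZSpan.measure_fundamentalDomain_ne_zero b

theorem cellMeasure_univ [NeZero n] : cellMeasure b n univ = volume (cell b 1) := by
  have hn : (n : ℝ) ≠ 0 := NeZero.ne _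
  have h1 : cell b n = (fun x => (n : ℝ)⁻¹ • x) ⁻¹' cell b 1 := by
    rw [cell_eq_preimage, cell_eq_preimage, ← preimage_comp]
    congr 1
    ext x i
    simp [cellCoord_apply]
  simp only [cellMeasure, Measure.smul_apply, Measure.restrict_apply MeasurableSet.univ,
    univ_inter, smul_eq_mul]
  rw [h1, Measure.addHaar_preimage_smul _ (inv_ne_zero hn), ← mul_assoc]
  have h3 : ENNReal.ofReal |(((n : ℝ)⁻¹) ^ Module.finrank ℝ Space)⁻¹| = (n : ENNReal) ^ 3 := by
    have : Module.finrank ℝ Space = 3 := by simp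
    rw [this, inv_pow, inv_inv, abs_of_nonneg (by positivity), ENNReal.ofReal_pow (by positivity),
      ENNReal.ofReal_natCast]
  rw [h3, ENNReal.inv_mul_cancel, one_mul]
  · exact pow_ne_zero 3 (by exact_mod_cast NeZero.ne n)
  · exact ENNReal.pow_ne_top (ENNReal.natCast_ne_top n)

theorem cellMeasure_real_univ [NeZero n] : (cellMeasure b n).real univ = cellVol b := by
  simp [Measure.real, cellMeasure_univ, cellVol]

/-- The projection to the torus maps the normalized measure of `nΓ` to a multiple of the Haar
measure, so that integration over a supercell becomes integration over a compact group. -/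
theorem map_toTorus [NeZero n] :
    (cellMeasure b n).map (toTorus b n) = ENNReal.ofReal (cellVol b) • torusMeasure := by
  -- Both sides are multiples of the Haar measure, with the same total mass.
  have hmk : MeasurePreserving (fun (a : Fin 3 → ℝ) i => (a i : UnitAddCircle))
      (volume.restrict (Set.pi univ fun _ => Ico (0 : ℝ) 1)) torusMeasure := by
    have h1 : ∀ i : Fin 3, MeasurePreserving (fun a : ℝ => (a : UnitAddCircle))
        (volume.restrict (Ico (0 : ℝ) 1)) AddCircle.haarAddCircle := by
      intro i
      have := AddCircle.measurePreserving_mk 1 0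
      rw [zero_add, AddCircle.volume_eq_smul_haarAddCircle, ENNReal.ofReal_one, one_smul] at this
      rwa [restrict_Ico_eq_restrict_Ioc]
    have h2 := measurePreserving_pi _ _ h1
    rwa [← Measure.restrict_pi_pi] at h2
  have hlin : ∃ c : ENNReal, volume.map (cellCoord b n) = c • (volume : Measure (Fin 3 → ℝ)) := by
    have : (volume.map (cellCoord b n)).IsAddHaarMeasure :=
      (cellCoord b n).isAddHaarMeasure_map _
    exact ⟨_, Measure.isAddLeftInvariant_eq_smul _ _⟩
  obtain ⟨c, hc⟩ := hlin
  have hmeas : MeasurableSet (Set.pi univ fun _ : Fin 3 => Ico (0 : ℝ) 1) :=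
    MeasurableSet.univ_pi fun _ => measurableSet_Ico
  have h3 : ∃ c : ENNReal, (cellMeasure b n).map (toTorus b n) = c • torusMeasure := by
    have e : toTorus b n = (fun (a : Fin 3 → ℝ) i => (a i : UnitAddCircle)) ∘ cellCoord b n := rfl
    refine ⟨((n : ENNReal) ^ 3)⁻¹ * c, ?_⟩
    rw [e, ← Measure.map_map hmk.measurable (cellCoord b n).continuous.measurable]
    rw [cellMeasure, cell_eq_preimage, Measure.map_smul,
      ← Measure.restrict_map (cellCoord b n).continuous.measurable hmeas, hc,
      Measure.restrict_smul, Measure.map_smul, Measure.map_smul, hmk.map_eq, smul_smul]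
  obtain ⟨c', hc'⟩ := h3
  have h4 := congrArg (fun m => m univ) hc'
  simp only [Measure.map_apply measurable_toTorus MeasurableSet.univ, preimage_univ,
    cellMeasure_univ, Measure.smul_apply, measure_univ, smul_eq_mul, mul_one] at h4
  rw [hc', ← h4, cellVol, ofReal_measureReal (volume_cell_lt_top b 1).ne]

/-- The point of the cell `nΓ` above a point of the torus. -/
def ofTorus (b : Module.Basis (Fin 3) ℝ Space) (n : ℕ) [NeZero n] (t : UnitAddTorus (Fin 3)) :
    Space := (cellCoord b n).symm fun i => ((AddCircle.measurableEquivIco 1 0 (t i) : Ico _ _) : ℝ)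

theorem measurable_ofTorus [NeZero n] : Measurable (ofTorus b n) :=
  (cellCoord b n).symm.continuous.measurable.comp <| measurable_pi_lambda _ fun i =>
    measurable_subtype_coe.comp
      ((AddCircle.measurableEquivIco 1 0).measurable.comp (measurable_pi_apply i))

theorem toTorus_ofTorus [NeZero n] (t : UnitAddTorus (Fin 3)) :
    toTorus b n (ofTorus b n t) = t := by
  ext i
  simp only [toTorus, ofTorus, ContinuousLinearEquiv.apply_symm_apply]
  exact (AddCircle.equivIco 1 0).symm_apply_apply (t i)

theorem ofTorus_toTorus [NeZero n] {x : Space} (hx : x ∈ cell b n) :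
    ofTorus b n (toTorus b n x) = x := by
  rw [ofTorus, ContinuousLinearEquiv.symm_apply_eq]
  ext i
  rw [cell_eq_preimage] at hx
  have := hx i trivial
  rw [← zero_add (1 : ℝ)] at this
  exact congrArg Subtype.val (AddCircle.equivIco_coe_eq (p := 1) (a := 0) this)

theorem ae_mem_cell : ∀ᵐ x ∂(cellMeasure b n), x ∈ cell b n :=
  Measure.ae_smul_measure (ae_restrict_mem (measurableSet_cell b n)) _

theorem IsPeriodic.add_lattice {φ : Space → ℝ} (hφ : IsPeriodic b n φ) (m : Fin 3 → ℤ)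
    (x : Space) : φ (x + ∑ i, (m i : ℝ) • (n : ℝ) • b i) = φ x := by
  have h1 : ∀ (i : Fin 3) (m : ℤ) (x : Space), φ (x + (m : ℝ) • (n : ℝ) • b i) = φ x := by
    intro i m
    induction m with
    | zero => simp
    | succ k ih =>
      intro x
      rw [← ih x, ← hφ i (x + ((k : ℤ) : ℝ) • _)]
      congr 1; push_cast; module
    | pred k ih =>
      intro x
      rw [← ih x, ← hφ i (x + ((-(k : ℤ) - 1 : ℤ) : ℝ) • (n : ℝ) • b i)]
      congr 1; push_cast; module
  rw [Fin.sum_univ_three, ← add_assoc, ← add_assoc, h1, h1, h1]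

theorem isPeriodic_comp_ofTorus [NeZero n] {φ : Space → ℝ} (hφ : IsPeriodic b n φ) (x : Space) :
    φ (ofTorus b n (toTorus b n x)) = φ x := by
  -- Two points over the same point of the torus differ by an element of the lattice.
  have hn : (n : ℝ) ≠ 0 := NeZero.ne _
  have h : ∀ i, ∃ m : ℤ, cellCoord b n (ofTorus b n (toTorus b n x)) i
      = cellCoord b n x i + m := by
    intro i
    have h1 := congrFun (toTorus_ofTorus (b := b) (n := n) (toTorus b n x)) i
    simp only [toTorus] at h1
    rw [← sub_eq_zero, ← AddCircle.coe_sub, AddCircle.coe_eq_zero_iff] at h1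
    obtain ⟨m, hm⟩ := h1
    refine ⟨m, ?_⟩
    rw [zsmul_eq_mul, mul_one] at hm
    linarith
  choose m hm using h
  have hz : ofTorus b n (toTorus b n x) = x + ∑ i, (m i : ℝ) • (n : ℝ) • b i := by
    refine (cellCoord b n).injective ?_
    ext i
    rw [hm, map_add, Pi.add_apply, cellCoord_apply (∑ i, _)]
    simp only [map_sum, map_smul, Module.Basis.repr_self, Finsupp.coe_finsetSum,
      Finset.sum_apply, Finsupp.smul_apply, Finsupp.single_apply, smul_eq_mul]
    simp
    field_simp
  rw [hz, hφ.add_lattice]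

theorem memLp_of_continuous {φ : Space → ℝ} (hφ : Continuous φ) (p : ENNReal) :
    MemLp φ p (cellMeasure b n) := by
  obtain ⟨S, hS, hsub⟩ := exists_compact_cell b n
  obtain ⟨C, hC⟩ := hS.exists_bound_of_continuousOn hφ.continuousOn
  refine MemLp.of_bound hφ.aestronglyMeasurable C ?_
  filter_upwards [ae_mem_cell] with x hx using hC x (hsub hx)

theorem integrable_of_continuous {φ : Space → ℝ} (hφ : Continuous φ) :
    Integrable φ (cellMeasure b n) := memLp_one_iff_integrable.1 (memLp_of_continuous hφ 1)

theorem integral_comp_toTorus [NeZero n] {g : UnitAddTorus (Fin 3) → ℝ} (hg : Measurable g) :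
    ∫ x, g (toTorus b n x) ∂(cellMeasure b n) = cellVol b * ∫ t, g t ∂torusMeasure := by
  rw [← integral_map measurable_toTorus.aemeasurable hg.aestronglyMeasurable, map_toTorus,
    integral_smul_measure, ENNReal.toReal_ofReal (cellVol_pos b).le, smul_eq_mul]

/-- Translation invariance of the integral over a period cell, inherited from the Haar measure of
the torus. -/
theorem integral_translate [NeZero n] {φ : Space → ℝ} (hφ : Measurable φ)
    (hp : IsPeriodic b n φ) (y : Space) :
    ∫ x, φ (x + y) ∂(cellMeasure b n) = ∫ x, φ x ∂(cellMeasure b n) := by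
  have h1 : ∀ x, φ (x + y) = (fun t => φ (ofTorus b n (t + toTorus b n y))) (toTorus b n x) := by
    intro x
    simp only [← toTorus_add, isPeriodic_comp_ofTorus hp]
  have h2 : ∀ x, φ x = (fun t => φ (ofTorus b n t)) (toTorus b n x) := by
    intro x
    simp only [isPeriodic_comp_ofTorus hp]
  have hm := hφ.comp (measurable_ofTorus (b := b) (n := n))
  have : torusMeasure.IsAddRightInvariant := by
    unfold torusMeasure; infer_instance
  rw [integral_congr_ae (Eventually.of_forall h1), integral_congr_ae (Eventually.of_forall h2),
    integral_comp_toTorus (g := fun t => φ (ofTorus b n (t + toTorus b n y)))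
      (hm.comp (measurable_add_const _)),
    integral_comp_toTorus (g := fun t => φ (ofTorus b n t)) hm]
  congr 1
  exact integral_add_right_eq_self (fun t => φ (ofTorus b n t)) _

/-- `ψ` is the classical partial derivative `∂_j φ`, at every point. -/
def HasPartial (j : Fin 3) (φ ψ : Space → ℝ) : Prop :=
  ∀ x, HasLineDerivAt ℝ φ (ψ x) x (unitVec j)

theorem HasPartial.hasDerivAt {j : Fin 3} {φ ψ : Space → ℝ} (h : HasPartial j φ ψ) (x : Space)
    (t : ℝ) : HasDerivAt (fun s => φ (x + s • unitVec j)) (ψ (x + t • unitVec j)) t := by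
  have h1 : HasDerivAt (fun s => φ (x + t • unitVec j + s • unitVec j))
      (ψ (x + t • unitVec j)) (t - t) := by rw [sub_self]; exact h _
  have h2 := HasDerivAt.scomp (h := fun s => s - t) t h1 ((hasDerivAt_id' t).sub_const t)
  rw [one_smul] at h2
  refine h2.congr_of_eventuallyEq (Eventually.of_forall fun s => ?_)
  simp only [Function.comp]
  congr 1; module

theorem HasPartial.mul {j : Fin 3} {φ ψ φ' ψ' : Space → ℝ} (h : HasPartial j φ ψ)
    (h' : HasPartial j φ' ψ') :
    HasPartial j (fun x => φ x * φ' x) (fun x => ψ x * φ' x + φ x * ψ' x) := by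
  intro x
  have := HasDerivAt.fun_mul (h x) (h' x)
  simpa only [HasLineDerivAt, zero_smul, add_zero] using this

theorem HasPartial.isPeriodic {j : Fin 3} {φ ψ : Space → ℝ} (h : HasPartial j φ ψ)
    (hp : IsPeriodic b n φ) : IsPeriodic b n ψ := by
  intro i x
  have h1 := h (x + (n : ℝ) • b i)
  have h2 : HasLineDerivAt ℝ φ (ψ (x + (n : ℝ) • b i)) x (unitVec j) := by
    refine HasDerivAt.congr_of_eventuallyEq h1 (Eventually.of_forall fun t => ?_)
    simp only
    rw [← hp i]; congr 1; abel
  exact HasDerivAt.unique h2 (h x)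

theorem IsPeriodic.exists_bound {φ : Space → ℝ} [NeZero n] (hp : IsPeriodic b n φ)
    (hc : Continuous φ) : ∃ C, ∀ x, |φ x| ≤ C := by
  obtain ⟨S, hS, hsub⟩ := exists_compact_cell b n
  obtain ⟨C, hC⟩ := hS.exists_bound_of_continuousOn hc.continuousOn
  refine ⟨C, fun x => ?_⟩
  rw [← isPeriodic_comp_ofTorus hp]
  refine hC _ (hsub ?_)
  rw [cell_eq_preimage]
  intro i _
  simp only [ofTorus, ContinuousLinearEquiv.apply_symm_apply]
  simpa using (AddCircle.measurableEquivIco 1 0 (toTorus b n x i)).2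

/-- The integral of a partial derivative over a period cell vanishes. -/
theorem integral_partial [NeZero n] {j : Fin 3} {φ ψ : Space → ℝ} (h : HasPartial j φ ψ)
    (hφ : Continuous φ) (hψ : Continuous ψ) (hp : IsPeriodic b n φ) :
    ∫ x, ψ x ∂(cellMeasure b n) = 0 := by
  -- `t ↦ ∫ φ(x + t e_j) dx` is constant and has derivative `∫ ψ` at `0`.
  obtain ⟨C, hC⟩ := (h.isPeriodic hp).exists_bound hψ
  have h1 := (hasDerivAt_integral_of_dominated_loc_of_deriv_le (μ := cellMeasure b n)
    (F := fun (t : ℝ) x => φ (x + t • unitVec j)) (F' := fun (t : ℝ) x => ψ (x + t • unitVec j))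
    (x₀ := 0) (bound := fun _ => C) (s := univ) univ_mem
    (Eventually.of_forall fun t => (Continuous.aestronglyMeasurable (by fun_prop)))
    (integrable_of_continuous (by fun_prop)) (Continuous.aestronglyMeasurable (by fun_prop))
    (Eventually.of_forall fun x t _ => hC _) (integrable_const C)
    (Eventually.of_forall fun x t _ => h.hasDerivAt x t)).2
  have h2 : (fun t : ℝ => ∫ x, φ (x + t • unitVec j) ∂(cellMeasure b n))
      = fun _ => ∫ x, φ x ∂(cellMeasure b n) := by
    ext t; exact integral_translate hφ.measurable hp _
  rw [h2] at h1
  simpa using h1.unique (hasDerivAt_const _ _)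

/-- A lattice-periodic property that holds almost everywhere in the cell holds almost
everywhere. -/
theorem ae_of_ae_cell [NeZero n] {P : Space → Prop} (hP : ∀ᵐ x ∂(cellMeasure b n), P x)
    (hper : ∀ x (m : Fin 3 → ℤ), P (x + ∑ i, (m i : ℝ) • (n : ℝ) • b i) ↔ P x) :
    ∀ᵐ x, P x := by
  have hn : (n : ℝ) ≠ 0 := NeZero.ne _
  have hv : volume ({x | ¬ P x} ∩ cell b n) = 0 := by
    have h1 : cellMeasure b n {x | ¬ P x} = 0 := hP
    rw [cellMeasure, Measure.smul_apply, smul_eq_mul, mul_eq_zero,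
      Measure.restrict_apply' (measurableSet_cell b n)] at h1
    refine h1.resolve_left ?_
    exact ENNReal.inv_ne_zero.2 (ENNReal.pow_ne_top (ENNReal.natCast_ne_top n))
  set c : Module.Basis (Fin 3) ℝ Space := b.isUnitSMul (w := fun _ => (n : ℝ))
    (fun _ => hn.isUnit) with hcdef
  have hc : ∀ i, c i = (n : ℝ) • b i := fun i => Module.Basis.isUnitSMul_apply _ i
  have hcell : cell b n = ZSpan.fundamentalDomain c := by
    ext x
    have e : ∀ i, c.repr x i = cellCoord b n x i := by
      intro i
      rw [cellCoord_apply, hcdef, Module.Basis.repr_isUnitSMul, Units.smul_def, smul_eq_mul,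
        Units.val_inv_eq_inv_val, IsUnit.unit_spec]
    rw [cell_eq_preimage, ZSpan.mem_fundamentalDomain]
    simp [e]
  rw [hcell] at hv
  have : VAddInvariantMeasure (Submodule.span ℤ (range c)) Space volume :=
    inferInstanceAs (VAddInvariantMeasure (Submodule.span ℤ (range c)).toAddSubgroup Space volume)
  refine (ZSpan.isAddFundamentalDomain c volume).measure_zero_of_invariant _ (fun g => ?_) hv
  obtain ⟨g, hg⟩ := g
  obtain ⟨m, hm⟩ := (Submodule.mem_span_range_iff_exists_fun ℤ).1 hg
  have hg' : g = ∑ i, (m i : ℝ) • (n : ℝ) • b i := by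
    rw [← hm]
    exact Finset.sum_congr rfl fun i _ => by rw [hc, Int.cast_smul_eq_zsmul]
  ext x
  rw [mem_vadd_set_iff_neg_vadd_mem]
  have : x = ((-(⟨g, hg⟩ : Submodule.span ℤ (range c))) +ᵥ x) + ∑ i, (m i : ℝ) • (n : ℝ) • b i := by
    rw [← hg', Submodule.vadd_def]
    simp
  change ¬ P _ ↔ ¬ P _
  rw [not_iff_not]
  nth_rw 2 [this]
  exact (hper (-(⟨g, hg⟩ : Submodule.span ℤ (range c)) +ᵥ x) m).symm

/-- Continuous periodic functions that agree almost everywhere on the cell are equal. -/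
theorem IsPeriodic.eq_of_ae [NeZero n] {φ ψ : Space → ℝ} (hφ : IsPeriodic b n φ)
    (hψ : IsPeriodic b n ψ) (hcφ : Continuous φ) (hcψ : Continuous ψ)
    (h : φ =ᵐ[cellMeasure b n] ψ) : φ = ψ := by
  have : φ =ᵐ[volume] ψ := ae_of_ae_cell h fun x m => by
    rw [hφ.add_lattice, hψ.add_lattice]
  exact (hcφ.ae_eq_iff_eq volume hcψ).1 this

end

section

variable {n : ℕ}

/-! ### Real Fourier modes -/

/-- Frequencies: the dual lattice in the coordinates of the dual basis. -/
abbrev Freq : Type := Fin 3 → ℤ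

/-- The linear phase `x ↦ ξ_k · x` of the mode of index `k` on `nΓ`. -/
def phase (b : Module.Basis (Fin 3) ℝ Space) (n : ℕ) (k : Freq) : Space →L[ℝ] ℝ :=
  LinearMap.toContinuousLinearMap ((2 * Real.pi / n) • ∑ j, (k j : ℝ) • b.coord j)

theorem phase_apply (k : Freq) (x : Space) :
    phase b n k x = 2 * Real.pi / n * ∑ j, (k j : ℝ) * b.repr x j := by
  simp [phase]

theorem phase_add (k l : Freq) : phase b n (k + l) = phase b n k + phase b n l := by
  ext x
  simp only [phase_apply, add_apply, ← mul_add, ← Finset.sum_add_distrib]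
  simp [add_mul]

theorem phase_neg (k : Freq) : phase b n (-k) = -phase b n k := by
  ext x
  simp [phase_apply]

/-- The frequency vector `ξ_k`. -/
def wave (b : Module.Basis (Fin 3) ℝ Space) (n : ℕ) (k : Freq) : Space :=
  WithLp.toLp 2 fun j => phase b n k (unitVec j)

theorem wave_apply (k : Freq) (j : Fin 3) : wave b n k j = phase b n k (unitVec j) := rfl

theorem wave_add (k l : Freq) : wave b n (k + l) = wave b n k + wave b n l := by
  ext j; simp [wave_apply, phase_add]

theorem wave_neg (k : Freq) : wave b n (-k) = -wave b n k := by
  ext j; simp [wave_apply, phase_neg]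

theorem wave_zero : wave b n 0 = 0 := by
  ext j; simp [wave_apply, phase_apply]

theorem eq_sum_unitVec (x : Space) : x = ∑ j, x j • unitVec j := by
  ext i
  simp [unitVec, Finset.sum_apply, Pi.single_apply]

theorem phase_eq_sum (k : Freq) (x : Space) : phase b n k x = ∑ j, wave b n k j * x j := by
  conv_lhs => rw [eq_sum_unitVec x]
  simp [wave_apply, mul_comm]

theorem norm_wave_sq (k : Freq) : ‖wave b n k‖ ^ 2 = ∑ j, wave b n k j ^ 2 := by
  rw [EuclideanSpace.norm_sq_eq]; simp

theorem abs_phase_le (k : Freq) (x : Space) : |phase b n k x| ≤ ‖wave b n k‖ * ‖x‖ := by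
  have : phase b n k x = inner ℝ (wave b n k) x := by
    rw [phase_eq_sum, PiLp.inner_apply]
    simp [mul_comm]
  rw [this]
  exact abs_real_inner_le_norm _ _

theorem abs_wave_le (k : Freq) (j : Fin 3) : |wave b n k j| ≤ ‖wave b n k‖ := by
  simpa using PiLp.norm_apply_le (wave b n k) j

theorem wave_eq_inv_smul (k : Freq) : wave b n k = (n : ℝ)⁻¹ • wave b 1 k := by
  ext j
  simp only [wave_apply, phase_apply, PiLp.smul_apply, smul_eq_mul]
  simp; ring

/-- `cos t + sin t`. -/
def cas (t : ℝ) : ℝ := Real.cos t + Real.sin t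

/-- The real Fourier (Hartley) mode `cos(ξ_k · x) + sin(ξ_k · x)`. These functions form an
orthogonal basis of real `L²(nΓ)`. -/
def mode (b : Module.Basis (Fin 3) ℝ Space) (n : ℕ) (k : Freq) (x : Space) : ℝ :=
  cas (phase b n k x)

theorem continuous_mode (k : Freq) : Continuous (mode b n k) := by
  unfold mode cas; fun_prop

theorem contDiff_mode (k : Freq) : ContDiff ℝ ∞ (mode b n k) := by
  unfold mode cas
  exact (Real.contDiff_cos.comp (phase b n k).contDiff).add
    (Real.contDiff_sin.comp (phase b n k).contDiff)

theorem abs_cas_le (t : ℝ) : |cas t| ≤ 2 := by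
  unfold cas
  have h1 := abs_le.1 (Real.abs_cos_le_one t)
  have h2 := abs_le.1 (Real.abs_sin_le_one t)
  rw [abs_le]; constructor <;> linarith

theorem abs_mode_le (k : Freq) (x : Space) : |mode b n k x| ≤ 2 := abs_cas_le _

theorem mode_zero (x : Space) : mode b n 0 x = 1 := by
  simp [mode, cas, phase_apply]

theorem mode_neg (k : Freq) (x : Space) :
    mode b n (-k) x = Real.cos (phase b n k x) - Real.sin (phase b n k x) := by
  simp [mode, cas, phase_neg, sub_eq_add_neg]

/-- A product of two modes is a combination of four modes, since `cas s * cas t` is half of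
`cas (s - t) + cas (t - s) + cas (s + t) - cas (-(s + t))`. -/
theorem mode_mul (k l : Freq) (x : Space) : mode b n k x * mode b n l x
    = 1 / 2 * (mode b n (k - l) x + mode b n (l - k) x + mode b n (k + l) x
      - mode b n (-(k + l)) x) := by
  have e : l - k = -(k - l) := by abel
  rw [e, mode_neg, mode_neg]
  simp only [mode, cas, sub_eq_add_neg, phase_add, phase_neg, add_apply,
    neg_apply, Real.cos_add, Real.sin_add, Real.cos_neg, Real.sin_neg]
  ring

theorem hasPartial_mode (k : Freq) (j : Fin 3) :
    HasPartial j (mode b n k) (fun x => wave b n k j * mode b n (-k) x) := by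
  intro x
  have h1 : HasDerivAt (fun t : ℝ => phase b n k (x + t • unitVec j)) (wave b n k j) 0 := by
    have : (fun t : ℝ => phase b n k (x + t • unitVec j))
        = fun t => phase b n k x + t * wave b n k j := by
      ext t; simp [wave_apply]
    rw [this]
    simpa using ((hasDerivAt_id (0 : ℝ)).mul_const (wave b n k j)).const_add (phase b n k x)
  have h2 := h1.cos.add h1.sin
  simp only [zero_smul, add_zero] at h2
  have e : wave b n k j * mode b n (-k) x = -Real.sin (phase b n k x) * wave b n k j
      + Real.cos (phase b n k x) * wave b n k j := by rw [mode_neg]; ring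
  change HasDerivAt _ (wave b n k j * mode b n (-k) x) 0
  rw [e]
  exact h2

theorem isPeriodic_mode [NeZero n] (k : Freq) : IsPeriodic b n (mode b n k) := by
  intro i x
  have hn : (n : ℝ) ≠ 0 := NeZero.ne _
  have : phase b n k (x + (n : ℝ) • b i) = phase b n k x + k i * (2 * Real.pi) := by
    rw [map_add, map_smul, phase_apply k (b i)]
    simp [Finsupp.single_apply]
    field_simp
  simp only [mode, cas, this, Real.cos_add_int_mul_two_pi, Real.sin_add_int_mul_two_pi]

theorem wave_ne_zero [NeZero n] {k : Freq} (hk : k ≠ 0) : wave b n k ≠ 0 := by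
  have hn : (n : ℝ) ≠ 0 := NeZero.ne _
  obtain ⟨i, hi⟩ := Function.ne_iff.1 hk
  intro h
  have h1 : phase b n k (b i) = 0 := by simp [phase_eq_sum, h]
  rw [phase_apply] at h1
  simp [Finsupp.single_apply, hn, Real.pi_ne_zero] at h1
  exact hi h1

theorem integral_mode [NeZero n] (k : Freq) :
    ∫ x, mode b n k x ∂(cellMeasure b n) = if k = 0 then cellVol b else 0 := by
  split_ifs with hk
  · simp [hk, mode_zero, cellMeasure_real_univ]
  · obtain ⟨j, hj⟩ : ∃ j, wave b n (-k) j ≠ 0 := by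
      by_contra! h
      exact wave_ne_zero (b := b) (n := n) (neg_ne_zero.2 hk) (by ext j; simpa using h j)
    have h1 := integral_partial (hasPartial_mode (b := b) (n := n) (-k) j) (continuous_mode _)
      (continuous_const.mul (continuous_mode _)) (isPeriodic_mode _)
    rw [neg_neg, integral_const_mul] at h1
    exact (mul_eq_zero.1 h1).resolve_left hj

theorem integral_mode_mul_mode [NeZero n] (k l : Freq) :
    ∫ x, mode b n k x * mode b n l x ∂(cellMeasure b n) = if k = l then cellVol b else 0 := by
  have hi : ∀ k, Integrable (mode b n k) (cellMeasure b n) := fun k =>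
    integrable_of_continuous (continuous_mode k)
  simp only [mode_mul]
  rw [integral_const_mul, integral_sub (by exact ((hi _).add (hi _)).add (hi _)) (hi _),
    integral_add (by exact (hi _).add (hi _)) (hi _), integral_add (hi _) (hi _)]
  simp only [integral_mode, neg_eq_zero, sub_eq_zero, eq_comm (a := l) (b := k)]
  split_ifs <;> ring

/-! ### Fourier coefficients and the Hilbert basis -/

/-- The square root of the volume of the unit cell. -/
def sqrtVol (b : Module.Basis (Fin 3) ℝ Space) : ℝ := √(cellVol b)

theorem sqrtVol_pos : 0 < sqrtVol b := Real.sqrt_pos.2 (cellVol_pos b)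

theorem sqrtVol_mul_self : sqrtVol b * sqrtVol b = cellVol b :=
  Real.mul_self_sqrt (cellVol_pos b).le

/-- The Fourier coefficients with respect to the normalised modes. -/
def coef (b : Module.Basis (Fin 3) ℝ Space) (n : ℕ) (f : Space → ℝ) (k : Freq) : ℝ :=
  (∫ x, f x * mode b n k x ∂(cellMeasure b n)) / sqrtVol b

/-- The normalised modes as elements of `L²ₙ`. -/
def modeL2 (b : Module.Basis (Fin 3) ℝ Space) (n : ℕ) (k : Freq) : L2 b n :=
  (sqrtVol b)⁻¹ • (memLp_of_continuous (continuous_mode (b := b) (n := n) k) 2).toLp _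

theorem coeFn_modeL2 (k : Freq) :
    modeL2 b n k =ᵐ[cellMeasure b n] fun x => (sqrtVol b)⁻¹ * mode b n k x := by
  unfold modeL2
  filter_upwards [Lp.coeFn_smul (sqrtVol b)⁻¹
    ((memLp_of_continuous (continuous_mode (b := b) (n := n) k) 2).toLp _),
    (memLp_of_continuous (continuous_mode (b := b) (n := n) k) 2).coeFn_toLp] with x h1 h2
  rw [h1, Pi.smul_apply, h2, smul_eq_mul]

theorem inner_modeL2 (f : L2 b n) (k : Freq) : inner ℝ (modeL2 b n k) f = coef b n f k := by
  rw [L2.inner_def, coef, div_eq_inv_mul, ← integral_const_mul]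
  refine integral_congr_ae ?_
  filter_upwards [coeFn_modeL2 (b := b) (n := n) k] with x hx
  rw [hx]
  simp; ring

theorem orthonormal_modeL2 [NeZero n] : Orthonormal ℝ (modeL2 b n) := by
  classical
  rw [orthonormal_iff_ite]
  intro k l
  rw [inner_modeL2, coef]
  have : ∫ x, modeL2 b n l x * mode b n k x ∂(cellMeasure b n)
      = (sqrtVol b)⁻¹ * ∫ x, mode b n k x * mode b n l x ∂(cellMeasure b n) := by
    rw [← integral_const_mul]
    refine integral_congr_ae ?_
    filter_upwards [coeFn_modeL2 (b := b) (n := n) l] with x hx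
    rw [hx]; ring
  rw [this, integral_mode_mul_mode]
  have h0 := (sqrtVol_pos (b := b)).ne'
  split_ifs
  · rw [← sqrtVol_mul_self]; field_simp
  · simp

theorem mFourier_toTorus [NeZero n] (k : Freq) (x : Space) :
    UnitAddTorus.mFourier k (toTorus b n x) = Complex.exp (phase b n k x * Complex.I) := by
  simp only [UnitAddTorus.mFourier, ContinuousMap.coe_mk, toTorus, fourier_coe_apply,
    ← Complex.exp_sum]
  congr 1
  simp only [phase_apply, cellCoord_apply]
  push_cast
  rw [Finset.mul_sum, Finset.sum_mul]
  refine Finset.sum_congr rfl fun i _ => ?_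
  ring

theorem torus_eq_zero (F : Lp ℂ 2 torusMeasure)
    (h : ∀ k, ∫ t, UnitAddTorus.mFourier (-k) t • F t ∂torusMeasure = 0) : F = 0 :=
  (LinearIsometryEquiv.map_eq_zero_iff (UnitAddTorus.mFourierBasis (d := Fin 3)).repr).1
    (lp.ext (funext fun k => (UnitAddTorus.mFourierBasis_repr F k).trans (h k)))

/-- The modes are complete: this is transported from the complex Fourier basis on the torus. -/
theorem eq_zero_of_coef_eq_zero [NeZero n] (f : L2 b n) (hf : ∀ k, coef b n f k = 0) : f = 0 := by
  have hint : ∀ k, ∫ x, f x * mode b n k x ∂(cellMeasure b n) = 0 := fun k => by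
    have := hf k
    rw [coef, div_eq_zero_iff] at this
    exact this.resolve_right sqrtVol_pos.ne'
  -- the modes `k` and `-k` together separate `cos` from `sin`
  have hcs : ∀ k, ∫ x, f x * Real.cos (phase b n k x) ∂(cellMeasure b n) = 0 ∧
      ∫ x, f x * Real.sin (phase b n k x) ∂(cellMeasure b n) = 0 := by
    intro k
    have i1 := integrable_mul_test b n f (φ := fun x => Real.cos (phase b n k x)) (by fun_prop)
    have i2 := integrable_mul_test b n f (φ := fun x => Real.sin (phase b n k x)) (by fun_prop)
    have h1 := hint k
    have h2 := hint (-k)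
    simp only [mode_neg, mul_sub] at h2
    simp only [mode, cas, mul_add] at h1
    rw [integral_add i1 i2] at h1
    rw [integral_sub i1 i2] at h2
    constructor <;> linarith
  have hfm : StronglyMeasurable f := Lp.stronglyMeasurable f
  -- the function on the torus that corresponds to `f`
  set g : UnitAddTorus (Fin 3) → ℂ := fun t => (f (ofTorus b n t) : ℂ) with hg
  have hgm : Measurable g :=
    Complex.measurable_ofReal.comp (hfm.measurable.comp measurable_ofTorus)
  have hgf : ∀ᵐ x ∂(cellMeasure b n), g (toTorus b n x) = (f x : ℂ) := by
    filter_upwards [ae_mem_cell] with x hx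
    simp only [hg, ofTorus_toTorus hx]
  have hc0 : ENNReal.ofReal (cellVol b) ≠ 0 := by
    simpa using cellVol_pos b
  have hgL : MemLp g 2 torusMeasure := by
    have h1 : MemLp g 2 ((cellMeasure b n).map (toTorus b n)) := by
      rw [memLp_map_measure_iff hgm.aestronglyMeasurable measurable_toTorus.aemeasurable]
      refine (memLp_congr_ae hgf).2 (Lp.memLp f).ofReal
    rw [map_toTorus] at h1
    have h2 := h1.smul_measure (c := (ENNReal.ofReal (cellVol b))⁻¹) (ENNReal.inv_ne_top.2 hc0)
    rwa [smul_smul, ENNReal.inv_mul_cancel hc0 ENNReal.ofReal_ne_top, one_smul] at h2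
  have hcoef : ∀ k : Freq, ∫ t, UnitAddTorus.mFourier (-k) t • g t ∂torusMeasure = 0 := by
    intro k
    have h1 : ∫ t, UnitAddTorus.mFourier (-k) t • g t ∂((cellMeasure b n).map (toTorus b n)) = 0 := by
      rw [integral_map measurable_toTorus.aemeasurable
        (by exact ((UnitAddTorus.mFourier (-k)).continuous.measurable.smul
          hgm).aestronglyMeasurable)]
      have h2 : ∀ᵐ x ∂(cellMeasure b n), UnitAddTorus.mFourier (-k) (toTorus b n x)
          • g (toTorus b n x) = ((f x * Real.cos (phase b n k x) : ℝ) : ℂ)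
            - Complex.I * ((f x * Real.sin (phase b n k x) : ℝ) : ℂ) := by
        filter_upwards [hgf] with x hx
        rw [hx, mFourier_toTorus, phase_neg, neg_apply, Complex.exp_mul_I]
        push_cast
        rw [Complex.cos_neg, Complex.sin_neg, smul_eq_mul]
        ring
      have i1 := integrable_mul_test b n f (φ := fun x => Real.cos (phase b n k x)) (by fun_prop)
      have i2 := integrable_mul_test b n f (φ := fun x => Real.sin (phase b n k x)) (by fun_prop)
      rw [integral_congr_ae h2, integral_sub i1.ofReal (i2.ofReal.const_mul _),
        integral_const_mul, integral_complex_ofReal, integral_complex_ofReal, (hcs k).1, (hcs k).2]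
      simp
    rw [map_toTorus, integral_smul_measure, smul_eq_zero] at h1
    refine h1.resolve_left ?_
    rw [ENNReal.toReal_ofReal (cellVol_pos b).le]
    exact (cellVol_pos b).ne'
  have hg0 : hgL.toLp g = 0 := by
    refine torus_eq_zero _ fun k => ?_
    refine (integral_congr_ae ?_).trans (hcoef k)
    filter_upwards [hgL.coeFn_toLp] with t ht
    exact congrArg _ ht
  have hg1 : ∀ᵐ t ∂torusMeasure, g t = 0 := by
    have := hgL.coeFn_toLp
    rw [hg0] at this
    filter_upwards [this, Lp.coeFn_zero ℂ 2 torusMeasure] with t h1 h2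
    rw [← h1, h2]; rfl
  have hg2 : ∀ᵐ x ∂(cellMeasure b n), g (toTorus b n x) = 0 := by
    refine ae_of_ae_map measurable_toTorus.aemeasurable (p := fun t => g t = 0) ?_
    rw [map_toTorus]
    exact Measure.ae_smul_measure hg1 _
  refine Lp.ext ?_
  filter_upwards [hg2, hgf, Lp.coeFn_zero ℝ 2 (cellMeasure b n)] with x h1 h2 h3
  rw [h3]
  rw [h2] at h1
  exact_mod_cast h1

/-- The Hilbert basis of `L²ₙ` made of the normalised modes. -/
def modeBasis (b : Module.Basis (Fin 3) ℝ Space) (n : ℕ) [NeZero n] :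
    HilbertBasis Freq ℝ (L2 b n) :=
  HilbertBasis.mkOfOrthogonalEqBot orthonormal_modeL2 (by
    rw [Submodule.eq_bot_iff]
    intro f hf
    refine eq_zero_of_coef_eq_zero f fun k => ?_
    rw [← inner_modeL2]
    exact (Submodule.mem_orthogonal _ _).1 hf _ (Submodule.subset_span ⟨k, rfl⟩))

theorem modeBasis_apply [NeZero n] (k : Freq) : modeBasis b n k = modeL2 b n k := by
  simp [modeBasis]

theorem modeBasis_repr [NeZero n] (f : L2 b n) (k : Freq) :
    (modeBasis b n).repr f k = coef b n f k := by
  rw [HilbertBasis.repr_apply_apply, modeBasis_apply, inner_modeL2]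

end

section

variable {n : ℕ}

/-! ### Parseval's identity -/

theorem coef_congr {f g : Space → ℝ} (h : f =ᵐ[cellMeasure b n] g) : coef b n f = coef b n g := by
  ext k
  unfold coef
  congr 1
  refine integral_congr_ae ?_
  filter_upwards [h] with x hx
  rw [hx]

theorem L2.ext_coef [NeZero n] {f g : L2 b n} (h : coef b n f = coef b n g) : f = g := by
  refine (modeBasis b n).repr.injective (lp.ext (funext fun k => ?_))
  rw [modeBasis_repr, modeBasis_repr, h]

theorem coef_L2_add [NeZero n] (f g : L2 b n) :
    coef b n (f + g : L2 b n) = coef b n f + coef b n g := by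
  ext k
  simp only [← inner_modeL2, inner_add_right, Pi.add_apply]

theorem coef_L2_sub [NeZero n] (f g : L2 b n) :
    coef b n (f - g : L2 b n) = coef b n f - coef b n g := by
  ext k
  simp only [← inner_modeL2, inner_sub_right, Pi.sub_apply]

theorem coef_L2_smul [NeZero n] (c : ℝ) (f : L2 b n) :
    coef b n (c • f : L2 b n) = c • coef b n f := by
  ext k
  simp only [← inner_modeL2, inner_smul_right, Pi.smul_apply, smul_eq_mul]

theorem summable_coef_sq [NeZero n] (f : L2 b n) : Summable fun k => coef b n f k ^ 2 := by
  have := lp.memℓp ((modeBasis b n).repr f)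
  have := (memℓp_gen_iff (p := 2) (by norm_num)).1 this
  simpa [modeBasis_repr] using this

theorem tsum_coef_sq [NeZero n] (f : L2 b n) : ∑' k, coef b n f k ^ 2 = ‖f‖ ^ 2 := by
  rw [← LinearIsometryEquiv.norm_map (modeBasis b n).repr f]
  have := lp.norm_rpow_eq_tsum (p := 2) (by norm_num) ((modeBasis b n).repr f)
  simp only [ENNReal.toReal_ofNat, Real.rpow_two, modeBasis_repr, Real.norm_eq_abs, sq_abs] at this
  rw [this]

/-- The element of `L²ₙ` with given square summable Fourier coefficients. -/
def ofCoef (b : Module.Basis (Fin 3) ℝ Space) (n : ℕ) [NeZero n] (c : Freq → ℝ)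
    (hc : Summable fun k => c k ^ 2) : L2 b n :=
  (modeBasis b n).repr.symm ⟨c, memℓp_gen (by simpa using hc)⟩

theorem coef_ofCoef [NeZero n] (c : Freq → ℝ) (hc : Summable fun k => c k ^ 2) :
    coef b n (ofCoef b n c hc) = c := by
  ext k
  rw [← modeBasis_repr, ofCoef, LinearIsometryEquiv.apply_symm_apply]

theorem norm_le_of_coef [NeZero n] {f : L2 b n} {c : Freq → ℝ} {B : ℝ} (hB : 0 ≤ B)
    (hc : Summable fun k => c k ^ 2) (h : ∀ k, |coef b n f k| ≤ |c k|)
    (hb : ∑' k, c k ^ 2 ≤ B ^ 2) : ‖f‖ ≤ B := by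
  refine (sq_le_sq₀ (norm_nonneg _) hB).1 ?_
  rw [← tsum_coef_sq]
  exact ((summable_coef_sq f).tsum_le_tsum (fun k => sq_le_sq.2 (h k)) hc).trans hb

theorem integral_mul_eq_tsum [NeZero n] (f g : L2 b n) :
    ∫ x, f x * g x ∂(cellMeasure b n) = ∑' k, coef b n f k * coef b n g k := by
  have := (modeBasis b n).tsum_inner_mul_inner f g
  rw [L2.inner_def] at this
  simp only [modeBasis_apply, inner_modeL2, real_inner_comm (modeL2 b n _) f] at this
  rw [this]
  refine integral_congr_ae (Eventually.of_forall fun x => ?_)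
  simp [mul_comm]

theorem integral_mul_eq_tsum' [NeZero n] (f : L2 b n) {φ : Space → ℝ} (hφ : Continuous φ) :
    ∫ x, f x * φ x ∂(cellMeasure b n) = ∑' k, coef b n f k * coef b n φ k := by
  have h := (memLp_of_continuous (b := b) (n := n) hφ 2).coeFn_toLp
  rw [← coef_congr h, ← integral_mul_eq_tsum]
  refine integral_congr_ae ?_
  filter_upwards [h] with x hx
  rw [hx]

theorem coef_mode [NeZero n] (k : Freq) :
    coef b n (mode b n k) = fun l => if k = l then sqrtVol b else 0 := by
  ext l
  have h0 := (sqrtVol_pos (b := b)).ne'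
  rw [coef, integral_mode_mul_mode]
  split_ifs
  · rw [← sqrtVol_mul_self]; field_simp
  · simp

/-! ### Differentiation on the Fourier side -/

/-- The action of `∂_j` on Fourier coefficients; `∂_j` maps a mode to a multiple of the mode of
opposite frequency. -/
def dcoef (b : Module.Basis (Fin 3) ℝ Space) (n : ℕ) (j : Fin 3) (c : Freq → ℝ) : Freq → ℝ :=
  fun k => -(wave b n k j * c (-k))

theorem dcoef_comm (i j : Fin 3) (c : Freq → ℝ) :
    dcoef b n i (dcoef b n j c) = dcoef b n j (dcoef b n i c) := by
  ext k
  simp only [dcoef, wave_neg, neg_neg, PiLp.neg_apply]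
  ring

theorem dcoef_dcoef_self (j : Fin 3) (c : Freq → ℝ) (k : Freq) :
    dcoef b n j (dcoef b n j c) k = -(wave b n k j ^ 2 * c k) := by
  simp only [dcoef, wave_neg, neg_neg, PiLp.neg_apply]
  ring

/-- The operator `dcoef` is antisymmetric. -/
theorem tsum_mul_dcoef (j : Fin 3) (c d : Freq → ℝ) :
    ∑' k, c k * dcoef b n j d k = -∑' k, dcoef b n j c k * d k := by
  rw [← tsum_neg, ← (Equiv.neg Freq).tsum_eq]
  refine tsum_congr fun k => ?_
  simp only [dcoef, Equiv.neg_apply, wave_neg, neg_neg, PiLp.neg_apply]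
  ring

/-- Integration by parts: differentiation acts on Fourier coefficients by `dcoef`. -/
theorem coef_partial [NeZero n] {j : Fin 3} {φ ψ : Space → ℝ} (h : HasPartial j φ ψ)
    (hφ : Continuous φ) (hψ : Continuous ψ) (hp : IsPeriodic b n φ) :
    coef b n ψ = dcoef b n j (coef b n φ) := by
  ext k
  have hper : IsPeriodic b n fun x => φ x * mode b n k x := fun i x => by
    simp only [hp i x, isPeriodic_mode k i x]
  have h1 := integral_partial (h.mul (hasPartial_mode (b := b) (n := n) k j))
    (hφ.mul (continuous_mode k))
    ((hψ.mul (continuous_mode k)).add (hφ.mul (continuous_const.mul (continuous_mode _)))) hper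
  have i1 : Integrable (fun x => ψ x * mode b n k x) (cellMeasure b n) :=
    integrable_of_continuous (hψ.mul (continuous_mode k))
  have i2 : Integrable (fun x => φ x * (wave b n k j * mode b n (-k) x)) (cellMeasure b n) :=
    integrable_of_continuous (hφ.mul (continuous_const.mul (continuous_mode _)))
  rw [integral_add i1 i2] at h1
  have h2 : ∫ x, φ x * (wave b n k j * mode b n (-k) x) ∂(cellMeasure b n)
      = wave b n k j * ∫ x, φ x * mode b n (-k) x ∂(cellMeasure b n) := by
    rw [← integral_const_mul]; congr 1; ext x; ring
  rw [h2] at h1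
  simp only [coef, dcoef]
  rw [eq_neg_of_add_eq_zero_left h1]
  ring

/-- The action of `∂^α` on Fourier coefficients. -/
def dmulti (b : Module.Basis (Fin 3) ℝ Space) (n : ℕ) (α : Fin 3 → ℕ) (c : Freq → ℝ) :
    Freq → ℝ :=
  (dcoef b n 0)^[α 0] ((dcoef b n 1)^[α 1] ((dcoef b n 2)^[α 2] c))

theorem dmulti_single (j : Fin 3) (m : ℕ) (c : Freq → ℝ) :
    dmulti b n (Pi.single j m) c = (dcoef b n j)^[m] c := by
  fin_cases j <;> simp [dmulti]

/-- Integration by parts on the Fourier side; the sign is the one in the definition of weak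
derivatives. -/
theorem tsum_mul_dmulti (α : Fin 3 → ℕ) (c d : Freq → ℝ) :
    ∑' k, c k * dmulti b n α d k = (-1) ^ (∑ i, α i) * ∑' k, dmulti b n α c k * d k := by
  have h1 : ∀ j m (c d : Freq → ℝ), ∑' k, c k * (dcoef b n j)^[m] d k
      = (-1) ^ m * ∑' k, (dcoef b n j)^[m] c k * d k := by
    intro j m
    induction m with
    | zero => intro c d; simp
    | succ m ih =>
      intro c d
      rw [Function.iterate_succ_apply', tsum_mul_dcoef, ih, Function.iterate_succ_apply, pow_succ]
      ring
  have hc : ∀ i j m m' (c : Freq → ℝ), (dcoef b n i)^[m] ((dcoef b n j)^[m'] c)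
      = (dcoef b n j)^[m'] ((dcoef b n i)^[m] c) := by
    intro i j m m' c
    exact Function.Commute.iterate_iterate (f := dcoef b n i) (g := dcoef b n j)
      (fun c => dcoef_comm i j c) m m' c
  simp only [dmulti]
  rw [h1, h1, h1, Fin.sum_univ_three, pow_add, pow_add]
  simp only [hc 2 1, hc 2 0, hc 1 0]
  ring

/-- The majorant involves both `k` and `-k`, because `dcoef` exchanges the two. -/
theorem abs_dmulti_le (α : Fin 3 → ℕ) (c : Freq → ℝ) (k : Freq) :
    |dmulti b n α c k| ≤ ‖wave b n k‖ ^ (∑ i, α i) * (|c k| + |c (-k)|) := by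
  have h1 : ∀ j m p (c : Freq → ℝ) (g : Freq → ℝ), (∀ k, g (-k) = g k) →
      (∀ k, |c k| ≤ ‖wave b n k‖ ^ p * g k) →
      ∀ k, |(dcoef b n j)^[m] c k| ≤ ‖wave b n k‖ ^ (m + p) * g k := by
    intro j m p c g hg h
    induction m with
    | zero => simpa using h
    | succ m ih =>
      intro k
      rw [Function.iterate_succ_apply', dcoef, abs_neg, abs_mul]
      have h2 := ih (-k)
      rw [hg, wave_neg, norm_neg] at h2
      calc _ ≤ ‖wave b n k‖ * (‖wave b n k‖ ^ (m + p) * g k) :=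
            mul_le_mul (abs_wave_le k j) h2 (abs_nonneg _) (norm_nonneg _)
        _ = _ := by ring
  have h0 : ∀ k, |c k| ≤ ‖wave b n k‖ ^ 0 * (|c k| + |c (-k)|) := fun k => by
    simp
  have hg : ∀ k, |c (-k)| + |c (-(-k))| = |c k| + |c (-k)| := fun k => by
    rw [neg_neg, add_comm]
  have h := h1 0 (α 0) _ _ _ hg (h1 1 (α 1) _ _ _ hg (h1 2 (α 2) _ _ _ hg h0)) k
  rw [Fin.sum_univ_three, add_assoc]
  exact h

theorem hasPartial_pderiv (j : Fin 3) {φ : Space → ℝ} (hφ : ContDiff ℝ ∞ φ) :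
    HasPartial j φ (pderiv j φ) := fun x =>
  ((hφ.differentiable (by simp)) x).hasFDerivAt.hasLineDerivAt _

theorem contDiff_pderiv (j : Fin 3) {φ : Space → ℝ} (hφ : ContDiff ℝ ∞ φ) :
    ContDiff ℝ ∞ (pderiv j φ) := contDiff_pderiv_iterate j 1 hφ

theorem coef_pderiv_iterate [NeZero n] (j : Fin 3) (m : ℕ) {φ : Space → ℝ}
    (hφ : ContDiff ℝ ∞ φ) (hp : IsPeriodic b n φ) :
    IsPeriodic b n ((pderiv j)^[m] φ) ∧
      coef b n ((pderiv j)^[m] φ) = (dcoef b n j)^[m] (coef b n φ) := by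
  induction m with
  | zero => exact ⟨hp, rfl⟩
  | succ m ih =>
    have h1 := contDiff_pderiv_iterate j m hφ
    have h2 := hasPartial_pderiv j h1
    rw [Function.iterate_succ_apply', Function.iterate_succ_apply']
    exact ⟨h2.isPeriodic ih.1, by
      rw [coef_partial h2 h1.continuous (contDiff_pderiv j h1).continuous ih.1, ih.2]⟩

theorem coef_pderivMulti [NeZero n] {k : ℕ} (α : MultiIndex k) {φ : Space → ℝ}
    (hφ : ContDiff ℝ ∞ φ) (hp : IsPeriodic b n φ) :
    coef b n (pderivMulti α φ) = dmulti b n (fun i => α.1 i) (coef b n φ) := by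
  have h2 := contDiff_pderiv_iterate 2 (α.1 2 : ℕ) hφ
  have h1 := contDiff_pderiv_iterate 1 (α.1 1 : ℕ) h2
  have p2 := coef_pderiv_iterate 2 (α.1 2 : ℕ) hφ hp
  have p1 := coef_pderiv_iterate 1 (α.1 1 : ℕ) h2 p2.1
  have p0 := coef_pderiv_iterate 0 (α.1 0 : ℕ) h1 p1.1
  rw [pderivMulti, p0.2, p1.2, p2.2, dmulti]

/-! ### Periodic Sobolev spaces on the Fourier side -/

/-- Membership in the Sobolev space is the relation `coef (F α) = ∂^α coef (F 0)`. -/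
theorem mem_sobolev_iff [NeZero n] {k : ℕ} (F : PiLp 1 fun _ : MultiIndex k => L2 b n) :
    F ∈ sobolev b k n ↔ ∀ α : MultiIndex k,
      coef b n (F α) = dmulti b n (fun i => α.1 i) (coef b n (F (MultiIndex.nil k))) := by
  constructor
  · intro h α
    ext l
    have h1 := h α _ (contDiff_mode l) (isPeriodic_mode l)
    rw [integral_mul_eq_tsum' _ (continuous_pderivMulti α (contDiff_mode l)),
      integral_mul_eq_tsum' _ (continuous_mode l), coef_pderivMulti α (contDiff_mode l)
      (isPeriodic_mode l), tsum_mul_dmulti] at h1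
    have h2 := mul_left_cancel₀ (pow_ne_zero _ (by norm_num : (-1 : ℝ) ≠ 0)) h1
    simp only [coef_mode, mul_ite, mul_zero] at h2
    rw [tsum_ite_eq' , tsum_ite_eq'] at h2
    exact (mul_right_cancel₀ sqrtVol_pos.ne' h2).symm
  · intro h α φ hφ hp
    rw [integral_mul_eq_tsum' _ (continuous_pderivMulti α hφ),
      integral_mul_eq_tsum' _ hφ.continuous, coef_pderivMulti α hφ hp, tsum_mul_dmulti, h α]
    rfl

variable {k : ℕ}

theorem coef_wderiv [NeZero n] (α : Fin 3 → ℕ) (hα : ∑ i, α i ≤ k) (f : H b k n) :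
    coef b n (wderiv α f) = dmulti b n α (coef b n (toL2 f)) := by
  rw [wderiv, dif_pos hα]
  exact (mem_sobolev_iff f.1).1 f.2 _

theorem coef_lap [NeZero n] (hk : 2 ≤ k) (f : H b k n) (l : Freq) :
    coef b n (lap f) l = -(‖wave b n l‖ ^ 2 * coef b n (toL2 f) l) := by
  have h : ∀ j, coef b n (wderiv (Pi.single j 2) f) l
      = -(wave b n l j ^ 2 * coef b n (toL2 f) l) := by
    intro j
    rw [coef_wderiv _ (by simpa using hk), dmulti_single]
    exact dcoef_dcoef_self j _ l
  rw [lap, Fin.sum_univ_three, coef_L2_add, coef_L2_add, Pi.add_apply, Pi.add_apply, h, h, h,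
    norm_wave_sq, Fin.sum_univ_three]
  ring

theorem H.ext_coef [NeZero n] {f g : H b k n} (h : coef b n (toL2 f) = coef b n (toL2 g)) :
    f = g := by
  refine Subtype.ext (PiLp.ext fun α => L2.ext_coef ?_)
  rw [(mem_sobolev_iff f.1).1 f.2 α, (mem_sobolev_iff g.1).1 g.2 α]
  exact congrArg _ h

theorem H.ext_toL2 [NeZero n] {f g : H b k n} (h : toL2 f = toL2 g) : f = g :=
  H.ext_coef (by rw [h])

theorem norm_H_eq_sum (f : H b k n) : ‖f‖ = ∑ α, ‖f.1 α‖ := by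
  change ‖f.1‖ = _
  exact PiLp.norm_eq_of_L1 _

theorem norm_component_le (f : H b k n) (α : MultiIndex k) : ‖f.1 α‖ ≤ ‖f‖ := by
  rw [norm_H_eq_sum]
  exact Finset.single_le_sum (f := fun α => ‖f.1 α‖) (fun _ _ => norm_nonneg _) (Finset.mem_univ α)

theorem norm_toL2_le (f : H b k n) : ‖toL2 f‖ ≤ ‖f‖ := norm_component_le f _

theorem norm_wderiv_le (α : Fin 3 → ℕ) (f : H b k n) : ‖wderiv α f‖ ≤ ‖f‖ := by
  unfold wderiv
  split_ifs
  · exact norm_component_le f _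
  · simp

theorem norm_lap_le (f : H b k n) : ‖lap f‖ ≤ 3 * ‖f‖ := by
  rw [lap]
  refine (norm_sum_le _ _).trans ?_
  refine (Finset.sum_le_sum fun j _ => norm_wderiv_le (Pi.single j 2) f).trans ?_
  simp

/-- The weight `1 + |ξ_k|`. -/
def wt (b : Module.Basis (Fin 3) ℝ Space) (n : ℕ) (k : Freq) : ℝ := 1 + ‖wave b n k‖

theorem one_le_wt (k : Freq) : 1 ≤ wt b n k := by simp [wt]

theorem wt_pos (k : Freq) : 0 < wt b n k := zero_lt_one.trans_le (one_le_wt k)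

theorem wt_neg (k : Freq) : wt b n (-k) = wt b n k := by simp [wt, wave_neg]

theorem wt_add_le (k l : Freq) : wt b n (k + l) ≤ wt b n k * wt b n l := by
  have := norm_add_le (wave b n k) (wave b n l)
  simp only [wt, wave_add]
  nlinarith [mul_nonneg (norm_nonneg (wave b n k)) (norm_nonneg (wave b n l))]

theorem abs_dmulti_le_wt (α : Fin 3 → ℕ) (hα : ∑ i, α i ≤ k) (c : Freq → ℝ) (l : Freq) :
    |dmulti b n α c l| ≤ |wt b n l ^ k * c l| + |wt b n (-l) ^ k * c (-l)| := by
  refine (abs_dmulti_le α c l).trans ?_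
  rw [abs_mul, abs_mul, wt_neg, abs_of_pos (pow_pos (wt_pos l) k), ← mul_add]
  refine mul_le_mul_of_nonneg_right ?_ (by positivity)
  calc ‖wave b n l‖ ^ (∑ i, α i) ≤ wt b n l ^ (∑ i, α i) :=
        pow_le_pow_left₀ (norm_nonneg _) (by simp [wt]) _
    _ ≤ _ := pow_le_pow_right₀ (one_le_wt l) hα

/-- The majorant of `abs_dmulti_le`, with its two frequencies `k` and `-k`, costs a factor `4` in
the sum of squares. -/
theorem summable_symm_sq {c : Freq → ℝ} (hc : Summable fun l => c l ^ 2) :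
    (Summable fun l => (|c l| + |c (-l)|) ^ 2) ∧
      ∑' l, (|c l| + |c (-l)|) ^ 2 ≤ 4 * ∑' l, c l ^ 2 := by
  have h2 : Summable fun l => c (-l) ^ 2 := (Equiv.neg Freq).summable_iff.2 hc
  have h3 : ∑' l, c (-l) ^ 2 = ∑' l, c l ^ 2 := (Equiv.neg Freq).tsum_eq fun l => c l ^ 2
  have hb : ∀ l, (|c l| + |c (-l)|) ^ 2 ≤ 2 * c l ^ 2 + 2 * c (-l) ^ 2 := fun l => by
    nlinarith [sq_nonneg (|c l| - |c (-l)|), sq_abs (c l), sq_abs (c (-l))]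
  have hs := (hc.mul_left 2).add (h2.mul_left 2)
  have h1 : Summable fun l => (|c l| + |c (-l)|) ^ 2 :=
    Summable.of_nonneg_of_le (fun l => sq_nonneg _) hb hs
  refine ⟨h1, (h1.tsum_le_tsum hb hs).trans ?_⟩
  rw [(hc.mul_left 2).tsum_add (h2.mul_left 2), tsum_mul_left, tsum_mul_left, h3]
  linarith

theorem summable_dmulti_sq (α : Fin 3 → ℕ) (hα : ∑ i, α i ≤ k) {c : Freq → ℝ}
    (hc : Summable fun l => (wt b n l ^ k * c l) ^ 2) :
    Summable fun l => dmulti b n α c l ^ 2 := by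
  refine Summable.of_nonneg_of_le (fun l => sq_nonneg _) (fun l => ?_) (summable_symm_sq hc).1
  rw [← sq_abs]
  exact pow_le_pow_left₀ (abs_nonneg _) (abs_dmulti_le_wt α hα c l) 2

/-- The element of `H^k_n` with given Fourier coefficients. -/
def sobolevOfCoef (b : Module.Basis (Fin 3) ℝ Space) (k n : ℕ) [NeZero n] (c : Freq → ℝ)
    (hc : Summable fun l => (wt b n l ^ k * c l) ^ 2) : H b k n :=
  ⟨WithLp.toLp 1 fun α : MultiIndex k =>
      ofCoef b n (dmulti b n (fun i => α.1 i) c) (summable_dmulti_sq _ α.2 hc), by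
    rw [mem_sobolev_iff]
    intro α
    simp only [coef_ofCoef]
    rfl⟩

theorem coef_sobolevOfCoef [NeZero n] (c : Freq → ℝ)
    (hc : Summable fun l => (wt b n l ^ k * c l) ^ 2) :
    coef b n (toL2 (sobolevOfCoef b k n c hc)) = c :=
  coef_ofCoef (b := b) (n := n) c (summable_dmulti_sq (fun _ => 0) (by simp) hc)

/-- The `H^k` norm is controlled by the Fourier coefficients with weight `(1 + |ξ|)^k`; with
`summable_dmulti_sq`, this allows Sobolev functions to be constructed from coefficients. -/
theorem norm_H_le [NeZero n] (f : H b k n) {B : ℝ} (hB : 0 ≤ B)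
    (hc : Summable fun l => (wt b n l ^ k * coef b n (toL2 f) l) ^ 2)
    (hb : ∑' l, (wt b n l ^ k * coef b n (toL2 f) l) ^ 2 ≤ B ^ 2) :
    ‖f‖ ≤ Fintype.card (MultiIndex k) * (2 * B) := by
  rw [norm_H_eq_sum]
  have : ∀ α ∈ Finset.univ, ‖f.1 α‖ ≤ 2 * B := by
    intro α _
    refine norm_le_of_coef (by positivity) (summable_symm_sq hc).1 (fun l => ?_)
      ((summable_symm_sq hc).2.trans (by nlinarith))
    rw [(mem_sobolev_iff f.1).1 f.2 α]
    exact (abs_dmulti_le_wt _ α.2 _ l).trans (le_abs_self _)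
  refine (Finset.sum_le_card_nsmul _ _ _ this).trans ?_
  rw [nsmul_eq_mul, Finset.card_univ]

end

section

variable {n : ℕ}

/-! ### Absolutely convergent Fourier series -/

/-- Cauchy--Schwarz for series. -/
theorem summable_abs_mul_of_sq {ι : Type*} {u v : ι → ℝ} (hu : Summable fun i => u i ^ 2)
    (hv : Summable fun i => v i ^ 2) : (Summable fun i => |u i * v i|) ∧
      ∑' i, |u i * v i| ≤ √(∑' i, u i ^ 2) * √(∑' i, v i ^ 2) := by
  have hc : Real.HolderConjugate 2 2 := Real.HolderConjugate.two_two
  have e : ∀ w : ι → ℝ, (fun i => |w i| ^ (2 : ℝ)) = fun i => w i ^ 2 := fun w => by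
    ext i; rw [Real.rpow_two, sq_abs]
  simp only [abs_mul]
  refine ⟨Real.summable_mul_of_Lp_Lq_of_nonneg hc (fun i => abs_nonneg _) (fun i => abs_nonneg _)
    (by rw [e]; exact hu) (by rw [e]; exact hv), ?_⟩
  have := Real.inner_le_Lp_mul_Lq_tsum_of_nonneg hc (fun i => abs_nonneg (u i))
    (fun i => abs_nonneg (v i)) (by rw [e]; exact hu) (by rw [e]; exact hv)
  rwa [e, e, ← Real.sqrt_eq_rpow, ← Real.sqrt_eq_rpow] at this

/-- The integer coordinates of a frequency are controlled by the length of its wave vector. -/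
theorem exists_abs_le_mul_norm_wave (b : Module.Basis (Fin 3) ℝ Space) :
    ∃ C : ℝ, 0 < C ∧ ∀ (k : Freq) (i : Fin 3), |(k i : ℝ)| ≤ C * ‖wave b 1 k‖ := by
  refine ⟨1 + ∑ i, ‖b i‖ / (2 * Real.pi), by positivity, fun k i => ?_⟩
  have h1 : phase b 1 k (b i) = 2 * Real.pi * k i := by
    rw [phase_apply]; simp [Finsupp.single_apply]
  have h2 := abs_phase_le (b := b) (n := 1) k (b i)
  rw [h1, abs_mul, abs_of_pos (by positivity)] at h2
  have h3 : |(k i : ℝ)| ≤ ‖b i‖ / (2 * Real.pi) * ‖wave b 1 k‖ := by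
    rw [div_mul_eq_mul_div, le_div_iff₀ (by positivity)]; linarith
  refine h3.trans (mul_le_mul_of_nonneg_right ?_ (norm_nonneg _))
  have := Finset.single_le_sum (f := fun i => ‖b i‖ / (2 * Real.pi))
    (fun _ _ => by positivity) (Finset.mem_univ i)
  linarith

/-- The weight `(1 + |ξ|)⁻⁴` is summable over the dual lattice in dimension three. This is what
makes `H²` a space of continuous functions. -/
theorem summable_wt (b : Module.Basis (Fin 3) ℝ Space) :
    Summable fun k : Freq => ((wt b 1 k ^ 2)⁻¹) ^ 2 := by
  -- comparison with the sum of `‖z‖⁻⁴` over the standard lattice; the frequency `0` is separate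
  obtain ⟨C, hC, hk⟩ := exists_abs_le_mul_norm_wave b
  set L := Submodule.span ℤ (range (Pi.basisFun ℝ (Fin 3)))
  have hL : Summable fun z : L => ‖z‖⁻¹ ^ 4 := by
    refine ZLattice.summable_norm_pow_inv L 4 ?_
    rw [ZLattice.rank ℝ L]; simp
  have hmem : ∀ k : Freq, (fun i => (k i : ℝ)) ∈ L := fun k => by
    refine (Submodule.mem_span_range_iff_exists_fun ℤ).2 ⟨k, ?_⟩
    ext i
    simp [Finset.sum_apply, Pi.single_apply]
  have hinj : Function.Injective fun k : Freq => (⟨_, hmem k⟩ : L) := by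
    intro k l h
    ext i
    have := congrFun (congrArg Subtype.val h) i
    exact Int.cast_injective (α := ℝ) this
  have h1 := hL.comp_injective hinj
  have h2 : Summable fun k : Freq => if k = 0 then (1 : ℝ) else 0 :=
    summable_of_ne_finset_zero (s := {0}) (by
      intro k hk; rw [if_neg]; simpa using hk)
  refine Summable.of_nonneg_of_le (fun k => by positivity) (fun k => ?_)
    ((h1.mul_left (C ^ 4)).add h2)
  have hw := wt_pos (b := b) (n := 1) k
  simp only [Function.comp]
  rcases eq_or_ne k 0 with rfl | hk0
  · have h3 : ((wt b 1 0 ^ 2)⁻¹) ^ 2 = 1 := by simp [wt, wave_zero]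
    rw [h3, if_pos rfl]
    have : (0 : ℝ) ≤ C ^ 4 * ‖(⟨_, hmem 0⟩ : L)‖⁻¹ ^ 4 := by positivity
    linarith
  · rw [if_neg hk0, add_zero]
    have hle : ‖(⟨_, hmem k⟩ : L)‖ ≤ C * wt b 1 k := by
      rw [Submodule.coe_norm]
      refine (pi_norm_le_iff_of_nonneg (by positivity)).2 fun i => ?_
      refine (hk k i).trans (mul_le_mul_of_nonneg_left ?_ hC.le)
      simp [wt]
    have hpos : 0 < ‖(⟨_, hmem k⟩ : L)‖ := by
      rw [norm_pos_iff]
      intro h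
      exact hk0 (hinj (h.trans (by ext i; simp)))
    have e1 : ((wt b 1 k ^ 2)⁻¹) ^ 2 = C ^ 4 * ((C * wt b 1 k)⁻¹) ^ 4 := by
      field_simp
    rw [e1]
    gcongr

/-- The function with Fourier series `∑ a_k mode_k`. -/
def synth (b : Module.Basis (Fin 3) ℝ Space) (n : ℕ) (a : Freq → ℝ) (x : Space) : ℝ :=
  ∑' k, a k * mode b n k x

theorem abs_mul_mode_le (a : Freq → ℝ) (k : Freq) (x : Space) :
    |a k * mode b n k x| ≤ 2 * |a k| := by
  rw [abs_mul, mul_comm]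
  exact mul_le_mul_of_nonneg_right (abs_mode_le k x) (abs_nonneg _)

theorem summable_mul_mode {a : Freq → ℝ} (ha : Summable fun k => |a k|) (x : Space) :
    Summable fun k => a k * mode b n k x :=
  Summable.of_norm_bounded (ha.mul_left 2) fun k => abs_mul_mode_le a k x

theorem continuous_synth {a : Freq → ℝ} (ha : Summable fun k => |a k|) :
    Continuous (synth b n a) :=
  continuous_tsum (fun k => continuous_const.mul (continuous_mode k)) (ha.mul_left 2)
    fun k x => abs_mul_mode_le a k x

theorem isPeriodic_synth [NeZero n] (a : Freq → ℝ) : IsPeriodic b n (synth b n a) := by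
  intro i x
  unfold synth
  exact tsum_congr fun k => by rw [isPeriodic_mode k i x]

theorem abs_synth_le {a : Freq → ℝ} (ha : Summable fun k => |a k|) (x : Space) :
    |synth b n a x| ≤ 2 * ∑' k, |a k| := by
  have h : Summable fun k => ‖a k * mode b n k x‖ :=
    Summable.of_nonneg_of_le (fun k => norm_nonneg _) (fun k => abs_mul_mode_le a k x)
      (ha.mul_left 2)
  rw [← tsum_mul_left]
  refine (norm_tsum_le_tsum_norm h).trans ?_
  exact h.tsum_le_tsum (fun k => abs_mul_mode_le a k x) (ha.mul_left 2)

theorem coef_synth [NeZero n] {a : Freq → ℝ} (ha : Summable fun k => |a k|) (l : Freq) :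
    coef b n (synth b n a) l = sqrtVol b * a l := by
  have h1 : ∫ x, synth b n a x * mode b n l x ∂(cellMeasure b n)
      = ∑' k, ∫ x, a k * mode b n k x * mode b n l x ∂(cellMeasure b n) := by
    rw [integral_tsum_of_summable_integral_norm]
    · refine integral_congr_ae (Eventually.of_forall fun x => ?_)
      simp only [synth, tsum_mul_right]
    · intro k
      exact integrable_of_continuous ((continuous_const.mul (continuous_mode k)).mul
        (continuous_mode l))
    · refine Summable.of_nonneg_of_le (fun k => integral_nonneg fun x => norm_nonneg _)
        (fun k => ?_) (ha.mul_left (4 * cellVol b))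
      have : ∀ x, ‖a k * mode b n k x * mode b n l x‖ ≤ 4 * |a k| := by
        intro x
        rw [norm_mul]
        calc _ ≤ (2 * |a k|) * 2 := mul_le_mul (abs_mul_mode_le a k x) (abs_mode_le l x)
              (abs_nonneg _) (by positivity)
          _ = _ := by ring
      refine (integral_mono_of_nonneg (Eventually.of_forall fun x => norm_nonneg _)
        (integrable_const (4 * |a k|)) (Eventually.of_forall this)).trans ?_
      rw [integral_const, cellMeasure_real_univ, smul_eq_mul]
      exact le_of_eq (by ring)
  have h2 : ∀ k, ∫ x, a k * mode b n k x * mode b n l x ∂(cellMeasure b n)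
      = if k = l then a k * cellVol b else 0 := by
    intro k
    simp only [mul_assoc]
    rw [integral_const_mul, integral_mode_mul_mode, mul_ite, mul_zero]
  rw [coef, h1]
  simp only [h2]
  rw [tsum_ite_eq]
  have h0 := (sqrtVol_pos (b := b)).ne'
  rw [← sqrtVol_mul_self]
  field_simp

theorem hasFDerivAt_mode (k : Freq) (x : Space) :
    HasFDerivAt (mode b n k) (mode b n (-k) x • phase b n k) x := by
  have h := (phase b n k).hasFDerivAt (x := x)
  have h2 := h.cos.add h.sin
  have e : mode b n (-k) x • phase b n k = -Real.sin (phase b n k x) • phase b n k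
      + Real.cos (phase b n k x) • phase b n k := by
    rw [mode_neg, sub_eq_add_neg, add_smul, add_comm]
  rw [e]
  exact h2

theorem norm_phase_le (k : Freq) : ‖phase b n k‖ ≤ ‖wave b n k‖ :=
  ContinuousLinearMap.opNorm_le_bound _ (norm_nonneg _) fun x => abs_phase_le k x

/-- `φ` is Fréchet differentiable at every point, with partial derivatives `ψ j`. -/
def HasGrad (φ : Space → ℝ) (ψ : Fin 3 → Space → ℝ) : Prop :=
  ∀ x, ∃ L : Space →L[ℝ] ℝ, HasFDerivAt φ L x ∧ ∀ j, L (unitVec j) = ψ j x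

theorem HasGrad.hasPartial {φ : Space → ℝ} {ψ : Fin 3 → Space → ℝ} (h : HasGrad φ ψ) (j : Fin 3) :
    HasPartial j φ (ψ j) := by
  intro x
  obtain ⟨L, hL, hj⟩ := h x
  rw [← hj j]
  exact hL.hasLineDerivAt _

theorem summable_dcoef {a : Freq → ℝ} (ha : Summable fun k => wt b n k * |a k|) (j : Fin 3) :
    Summable fun k => |dcoef b n j a k| := by
  refine Summable.of_nonneg_of_le (fun k => abs_nonneg _) (fun k => ?_)
    ((Equiv.neg Freq).summable_iff.2 ha)
  simp only [Function.comp, Equiv.neg_apply, dcoef, abs_neg, abs_mul, wt_neg]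
  refine mul_le_mul_of_nonneg_right ((abs_wave_le k j).trans ?_) (abs_nonneg _)
  simp [wt]

/-- Termwise differentiation of a Fourier series whose coefficients are summable against
`1 + |ξ|`. -/
theorem hasGrad_synth {a : Freq → ℝ} (ha : Summable fun k => wt b n k * |a k|) :
    HasGrad (synth b n a) (fun j => synth b n (dcoef b n j a)) := by
  intro x
  have ha0 : Summable fun k => |a k| := Summable.of_nonneg_of_le (fun k => abs_nonneg _)
    (fun k => le_mul_of_one_le_left (abs_nonneg _) (one_le_wt k)) ha
  have hb : ∀ k (x : Space), ‖a k • mode b n (-k) x • phase b n k‖ ≤ 2 * (wt b n k * |a k|) := by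
    intro k x
    rw [norm_smul, norm_smul]
    have h1 : ‖mode b n (-k) x‖ ≤ 2 := abs_mode_le _ _
    have h2 : ‖phase b n k‖ ≤ wt b n k := (norm_phase_le k).trans (by simp [wt])
    calc _ ≤ |a k| * (2 * wt b n k) := by
          refine mul_le_mul_of_nonneg_left ?_ (abs_nonneg _)
          exact mul_le_mul h1 h2 (norm_nonneg _) (by norm_num)
      _ = _ := by ring
  refine ⟨_, hasFDerivAt_tsum (ha.mul_left 2)
    (fun k x => (hasFDerivAt_mode (b := b) (n := n) k x).const_mul (a k)) hb
    (summable_mul_mode ha0 x) x, fun j => ?_⟩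
  have hs : Summable fun k => a k • mode b n (-k) x • phase b n k :=
    Summable.of_norm_bounded (ha.mul_left 2) fun k => hb k x
  rw [← ContinuousLinearMap.apply_apply (unitVec j) (∑' k, _), ContinuousLinearMap.map_tsum _ hs]
  simp only [synth]
  rw [← (Equiv.neg Freq).tsum_eq]
  refine tsum_congr fun k => ?_
  simp [dcoef, wave_apply, phase_neg]
  ring

/-- A square integrable function with absolutely summable coefficients has a continuous
representative. -/
theorem L2.ae_eq_synth [NeZero n] (f : L2 b n) (h : Summable fun k => |coef b n f k|) :
    f =ᵐ[cellMeasure b n] synth b n (fun k => coef b n f k / sqrtVol b) := by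
  have h0 := (sqrtVol_pos (b := b)).ne'
  have hs : Summable fun k => |coef b n f k / sqrtVol b| := by
    simp only [abs_div]; exact h.div_const _
  have h1 := memLp_of_continuous (b := b) (n := n) (continuous_synth (b := b) (n := n) hs) 2
  have : f = h1.toLp _ := by
    refine L2.ext_coef ?_
    rw [coef_congr h1.coeFn_toLp]
    ext k
    rw [coef_synth hs]
    field_simp
  conv_lhs => rw [this]
  exact h1.coeFn_toLp

/-- Refining the dual lattice by `n` shrinks wave vectors by the same factor; this is the source
of the powers of `n` in the Sobolev inequality. -/
theorem wt_one_le [NeZero n] (k : Freq) : wt b 1 k ≤ n * wt b n k := by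
  have hn : (0 : ℝ) < n := by exact_mod_cast Nat.pos_of_ne_zero (NeZero.ne n)
  have hn1 : (1 : ℝ) ≤ n := by exact_mod_cast Nat.pos_of_ne_zero (NeZero.ne n)
  have : ‖wave b n k‖ = (n : ℝ)⁻¹ * ‖wave b 1 k‖ := by
    rw [wave_eq_inv_smul, norm_smul, Real.norm_of_nonneg (by positivity)]
  rw [wt, wt, this, mul_add, mul_inv_cancel_left₀ hn.ne']
  linarith

/-- The Sobolev embedding on the Fourier side. The dependence on `n` is not optimal, but any
power of `n` below `n³` suffices for the error analysis. -/
theorem summable_abs_of_wt [NeZero n] {c : Freq → ℝ}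
    (hc : Summable fun k => (wt b n k ^ 2 * c k) ^ 2) :
    (Summable fun k => |c k|) ∧ ∑' k, |c k| ≤ (n : ℝ) ^ 2 *
      √(∑' k, ((wt b 1 k ^ 2)⁻¹) ^ 2) * √(∑' k, (wt b n k ^ 2 * c k) ^ 2) := by
  obtain ⟨h1, h2⟩ := summable_abs_mul_of_sq (summable_wt b) hc
  have hle : ∀ k, |c k| ≤ (n : ℝ) ^ 2 * |(wt b 1 k ^ 2)⁻¹ * (wt b n k ^ 2 * c k)| := by
    intro k
    have hw := wt_pos (b := b) (n := 1) k
    have hw' := wt_pos (b := b) (n := n) k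
    rw [abs_mul, abs_mul, abs_of_pos (a := (wt b 1 k ^ 2)⁻¹) (by positivity),
      abs_of_pos (a := wt b n k ^ 2) (by positivity)]
    rw [← mul_assoc, ← mul_assoc, ← div_eq_mul_inv, div_mul_eq_mul_div]
    refine le_mul_of_one_le_left (abs_nonneg _) ?_
    rw [one_le_div (by positivity), ← mul_pow]
    exact pow_le_pow_left₀ hw.le (wt_one_le k) 2
  have h3 := h1.mul_left ((n : ℝ) ^ 2)
  have h4 : Summable fun k => |c k| := Summable.of_nonneg_of_le (fun k => abs_nonneg _) hle h3
  refine ⟨h4, (h4.tsum_le_tsum hle h3).trans ?_⟩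
  rw [tsum_mul_left, mul_assoc]
  exact mul_le_mul_of_nonneg_left h2 (by positivity)

/-! ### The resolvent `(1 - Δ)⁻¹` on the supercell -/

theorem wt_sq_le (k : Freq) : wt b n k ^ 2 ≤ 2 * (1 + ‖wave b n k‖ ^ 2) := by
  unfold wt; nlinarith [sq_nonneg (1 - ‖wave b n k‖)]

theorem coef_sub_lap [NeZero n] {k : ℕ} (hk : 2 ≤ k) (f : H b k n) (l : Freq) :
    coef b n (toL2 f - lap f : L2 b n) l = (1 + ‖wave b n l‖ ^ 2) * coef b n (toL2 f) l := by
  rw [coef_L2_sub, Pi.sub_apply, coef_lap hk]; ring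

/-- If `c` are the coefficients of `(1 - Δ)⁻¹ r` with `r` in `L²ₙ`, they are square summable against
the weight of `H²ₙ`. -/
theorem summable_wt_of_resolvent [NeZero n] (r : L2 b n) {c : Freq → ℝ}
    (hc : ∀ l, coef b n r l = (1 + ‖wave b n l‖ ^ 2) * c l) :
    (Summable fun l => (wt b n l ^ 2 * c l) ^ 2) ∧
      ∑' l, (wt b n l ^ 2 * c l) ^ 2 ≤ (2 * ‖r‖) ^ 2 := by
  have hle : ∀ l, (wt b n l ^ 2 * c l) ^ 2 ≤ 4 * coef b n r l ^ 2 := by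
    intro l
    rw [hc, mul_pow, mul_pow]
    have h1 := pow_le_pow_left₀ (by positivity) (wt_sq_le (b := b) (n := n) l) 2
    nlinarith [sq_nonneg (c l)]
  have h2 := (summable_coef_sq r).mul_left 4
  have h1 := Summable.of_nonneg_of_le (fun l => sq_nonneg _) hle h2
  refine ⟨h1, (h1.tsum_le_tsum hle h2).trans ?_⟩
  rw [tsum_mul_left, tsum_coef_sq]
  linarith [mul_pow 2 ‖r‖ 2]

/-- The equation `f - Δf = r` is solvable in `H²ₙ` for every `r ∈ L²ₙ`. -/
theorem exists_resolvent [NeZero n] (r : L2 b n) : ∃ f : H b 2 n, toL2 f - lap f = r := by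
  have hc : ∀ l, coef b n r l
      = (1 + ‖wave b n l‖ ^ 2) * (coef b n r l / (1 + ‖wave b n l‖ ^ 2)) := fun l => by
    field_simp
  refine ⟨sobolevOfCoef b 2 n _ (summable_wt_of_resolvent r hc).1, L2.ext_coef ?_⟩
  ext l
  rw [coef_sub_lap le_rfl, coef_sobolevOfCoef, ← hc]

/-- The elliptic estimate, uniform in the size of the supercell. -/
theorem norm_H2_le [NeZero n] (f : H b 2 n) :
    ‖f‖ ≤ 4 * Fintype.card (MultiIndex 2) * ‖toL2 f - lap f‖ := by
  obtain ⟨h1, h2⟩ := summable_wt_of_resolvent _ (coef_sub_lap le_rfl f)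
  refine (norm_H_le f (by positivity) h1 h2).trans (le_of_eq ?_)
  ring

theorem norm_sub_lap_le {k : ℕ} (f : H b k n) : ‖toL2 f - lap f‖ ≤ 4 * ‖f‖ := by
  have := norm_sub_le (toL2 f) (lap f)
  linarith [norm_toL2_le f, norm_lap_le f]

theorem summable_coef_H2 [NeZero n] (f : H b 2 n) : Summable fun k => |coef b n (toL2 f) k| :=
  (summable_abs_of_wt (summable_wt_of_resolvent _ (coef_sub_lap le_rfl f)).1).1

/-- The constant of the Sobolev embedding `H²ₙ ⊂ L^∞`. -/
def sobolevConst (b : Module.Basis (Fin 3) ℝ Space) : ℝ :=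
  16 / sqrtVol b * √(∑' k, ((wt b 1 k ^ 2)⁻¹) ^ 2)

theorem sobolevConst_nonneg : 0 ≤ sobolevConst b := by
  have := sqrtVol_pos (b := b)
  unfold sobolevConst; positivity

/-- The Sobolev inequality `H²ₙ ⊂ L^∞`. The factor `n²` reflects the number of frequencies of
bounded size on the supercell, in the crude form of `wt_one_le`. -/
theorem ae_abs_le_H2 [NeZero n] (f : H b 2 n) :
    ∀ᵐ x ∂(cellMeasure b n), |toL2 f x| ≤ sobolevConst b * (n : ℝ) ^ 2 * ‖f‖ := by
  have hv := sqrtVol_pos (b := b)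
  obtain ⟨h1, h2⟩ := summable_wt_of_resolvent _ (coef_sub_lap le_rfl f)
  obtain ⟨h3, h4⟩ := summable_abs_of_wt h1
  have hs : Summable fun k => |coef b n (toL2 f) k / sqrtVol b| := by
    simp only [abs_div]; exact h3.div_const _
  filter_upwards [L2.ae_eq_synth (toL2 f) h3] with x hx
  rw [hx]
  refine (abs_synth_le hs x).trans ?_
  simp only [abs_div, tsum_div_const, abs_of_pos hv]
  have h5 : √(∑' l, (wt b n l ^ 2 * coef b n (toL2 f) l) ^ 2) ≤ 8 * ‖f‖ := by
    refine Real.sqrt_le_iff.2 ⟨by positivity, h2.trans ?_⟩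
    refine pow_le_pow_left₀ (by positivity) ?_ 2
    linarith [norm_sub_lap_le f]
  calc 2 * ((∑' k, |coef b n (toL2 f) k|) / sqrtVol b)
      ≤ 2 * (((n : ℝ) ^ 2 * √(∑' k, ((wt b 1 k ^ 2)⁻¹) ^ 2) * (8 * ‖f‖)) / sqrtVol b) := by
        gcongr
        exact h4.trans (mul_le_mul_of_nonneg_left h5 (by positivity))
    _ = _ := by unfold sobolevConst; ring

end

/-! ### The weighted Wiener algebra of the unit cell -/

/-- The real weighted Wiener algebra of `Γ`-periodic functions whose Fourier coefficients `c`
satisfy `∑ (1 + |ξ_k|) |c_k| < ∞`. An element is stored as the summable sequence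
`2 (1 + |ξ_k|) c_k`; the factor `2` makes the norm submultiplicative. -/
def Wiener (_b : Module.Basis (Fin 3) ℝ Space) : Type := lp (fun _ : Freq => ℝ) 1

namespace Wiener

instance : NormedAddCommGroup (Wiener b) := inferInstanceAs (NormedAddCommGroup (lp _ 1))
instance : NormedSpace ℝ (Wiener b) := inferInstanceAs (NormedSpace ℝ (lp _ 1))
instance : CompleteSpace (Wiener b) := inferInstanceAs (CompleteSpace (lp _ 1))

/-- The weight of the Wiener algebra. -/
def weight (b : Module.Basis (Fin 3) ℝ Space) (k : Freq) : ℝ := 2 * wt b 1 k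

theorem weight_pos (k : Freq) : 0 < weight b k := mul_pos two_pos (wt_pos k)

theorem two_le_weight (k : Freq) : 2 ≤ weight b k := by
  have := one_le_wt (b := b) (n := 1) k
  unfold weight; linarith

theorem weight_neg (k : Freq) : weight b (-k) = weight b k := by simp [weight, wt_neg]

/-- The Fourier coefficients of an element of the Wiener algebra. -/
def cf (a : Wiener b) (k : Freq) : ℝ := (show lp (fun _ : Freq => ℝ) 1 from a) k / weight b k

theorem cf_add (a a' : Wiener b) : cf (a + a') = cf a + cf a' := by
  ext k; exact add_div _ _ _

theorem cf_sub (a a' : Wiener b) : cf (a - a') = cf a - cf a' := by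
  ext k; exact sub_div _ _ _

theorem cf_smul (r : ℝ) (a : Wiener b) : cf (r • a) = r • cf a := by
  ext k; exact mul_div_assoc _ _ _

theorem weight_mul_cf (a : Wiener b) (k : Freq) :
    weight b k * cf a k = (show lp (fun _ : Freq => ℝ) 1 from a) k :=
  mul_div_cancel₀ _ (weight_pos k).ne'

theorem ext_cf {a a' : Wiener b} (h : cf a = cf a') : a = a' := by
  refine lp.ext (funext fun k => ?_)
  have := weight_mul_cf a k
  rw [h, weight_mul_cf] at this
  exact this.symm

theorem summable_cf (a : Wiener b) : Summable fun k => weight b k * |cf a k| := by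
  have h := (memℓp_gen_iff (p := 1) (by norm_num)).1
    (lp.memℓp (show lp (fun _ : Freq => ℝ) 1 from a))
  simp only [ENNReal.toReal_one, Real.rpow_one] at h
  refine h.congr fun k => ?_
  rw [← weight_mul_cf, norm_mul, Real.norm_of_nonneg (weight_pos k).le]
  rfl

theorem norm_eq (a : Wiener b) : ‖a‖ = ∑' k, weight b k * |cf a k| := by
  have h := lp.norm_eq_tsum_rpow (p := 1) (by norm_num) (show lp (fun _ : Freq => ℝ) 1 from a)
  simp only [ENNReal.toReal_one, Real.rpow_one, div_one] at h
  refine h.trans (tsum_congr fun k => ?_)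
  rw [← weight_mul_cf, norm_mul, Real.norm_of_nonneg (weight_pos k).le]
  rfl

/-- The element of the Wiener algebra with given Fourier coefficients. -/
def mk (c : Freq → ℝ) (hc : Summable fun k => weight b k * |c k|) : Wiener b :=
  (⟨fun k => weight b k * c k, memℓp_gen (by
    simpa [abs_mul, abs_of_pos (weight_pos _)] using hc)⟩ : lp (fun _ : Freq => ℝ) 1)

theorem cf_mk (c : Freq → ℝ) (hc : Summable fun k => weight b k * |c k|) : cf (mk c hc) = c := by
  ext k; exact mul_div_cancel_left₀ _ (weight_pos k).ne'

theorem summable_abs_cf (a : Wiener b) : Summable fun k => |cf a k| :=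
  Summable.of_nonneg_of_le (fun k => abs_nonneg _)
    (fun k => le_mul_of_one_le_left (abs_nonneg _) (by linarith [two_le_weight (b := b) k]))
    (summable_cf a)

theorem summable_wt_cf (a : Wiener b) : Summable fun k => wt b 1 k * |cf a k| := by
  refine ((summable_cf a).mul_left 2⁻¹).congr fun k => ?_
  rw [weight]; ring

theorem two_mul_tsum_abs_cf_le (a : Wiener b) : 2 * ∑' k, |cf a k| ≤ ‖a‖ := by
  rw [norm_eq, ← tsum_mul_left]
  exact ((summable_abs_cf a).mul_left 2).tsum_le_tsum
    (fun k => mul_le_mul_of_nonneg_right (two_le_weight k) (abs_nonneg _)) (summable_cf a)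

/-- The function represented by an element of the Wiener algebra, as the continuous linear
functional of evaluation at a point. -/
def ev (x : Space) : Wiener b →L[ℝ] ℝ :=
  LinearMap.mkContinuous
    { toFun := fun a => synth b 1 (cf a) x
      map_add' := fun a a' => by
        simp only [synth, cf_add, Pi.add_apply, add_mul]
        exact (summable_mul_mode (summable_abs_cf a) x).tsum_add
          (summable_mul_mode (summable_abs_cf a') x)
      map_smul' := fun r a => by
        simp only [synth, cf_smul, Pi.smul_apply, smul_eq_mul, mul_assoc, tsum_mul_left,
          RingHom.id_apply] } 1
    (fun a => by
      rw [one_mul]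
      exact (abs_synth_le (summable_abs_cf a) x).trans (two_mul_tsum_abs_cf_le a))

theorem ev_apply (x : Space) (a : Wiener b) : ev x a = synth b 1 (cf a) x := rfl

theorem abs_ev_le (x : Space) (a : Wiener b) : |ev x a| ≤ ‖a‖ :=
  (abs_synth_le (summable_abs_cf a) x).trans (two_mul_tsum_abs_cf_le a)

theorem continuous_ev (a : Wiener b) : Continuous fun x => ev x a :=
  continuous_synth (summable_abs_cf a)

theorem isPeriodic_ev (a : Wiener b) : IsPeriodic b 1 fun x => ev x a := isPeriodic_synth _

theorem coef_ev (a : Wiener b) (k : Freq) :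
    coef b 1 (fun x => ev x a) k = sqrtVol b * cf a k := coef_synth (summable_abs_cf a) k

/-- Evaluation at points is injective, so identities in the Wiener algebra are checked pointwise. -/
theorem ext_ev {a a' : Wiener b} (h : ∀ x, ev x a = ev x a') : a = a' := by
  refine ext_cf (funext fun k => ?_)
  have h1 := coef_ev a k
  rw [funext h, coef_ev] at h1
  exact (mul_left_cancel₀ sqrtVol_pos.ne' h1).symm

theorem ext_ev_ae {a a' : Wiener b} (h : ∀ᵐ x ∂(cellMeasure b 1), ev x a = ev x a') : a = a' :=
  ext_ev (congrFun ((isPeriodic_ev a).eq_of_ae (isPeriodic_ev a') (continuous_ev a)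
    (continuous_ev a') h))

/-- Elements of the Wiener algebra are Lipschitz functions: the weight controls the gradient. -/
theorem abs_ev_sub_le (a : Wiener b) (x y : Space) : |ev x a - ev y a| ≤ ‖a‖ * ‖x - y‖ := by
  have hm : ∀ k, |mode b 1 k x - mode b 1 k y| ≤ 2 * (wt b 1 k * ‖x - y‖) := by
    intro k
    have h1 := abs_phase_le (b := b) (n := 1) k (x - y)
    have h2 : ‖wave b 1 k‖ * ‖x - y‖ ≤ wt b 1 k * ‖x - y‖ :=
      mul_le_mul_of_nonneg_right (by simp [wt]) (norm_nonneg _)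
    rw [map_sub] at h1
    have h3 : |Real.cos (phase b 1 k x) - Real.cos (phase b 1 k y)|
        ≤ |phase b 1 k x - phase b 1 k y| := Real.abs_cos_sub_cos_le _ _
    have h4 : |Real.sin (phase b 1 k x) - Real.sin (phase b 1 k y)|
        ≤ |phase b 1 k x - phase b 1 k y| := Real.abs_sin_sub_sin_le _ _
    have h5 : mode b 1 k x - mode b 1 k y
        = (Real.cos (phase b 1 k x) - Real.cos (phase b 1 k y))
          + (Real.sin (phase b 1 k x) - Real.sin (phase b 1 k y)) := by
      simp only [mode, cas]; ring
    rw [h5]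
    exact (abs_add_le _ _).trans (by linarith)
  have hs : Summable fun k => ‖cf a k * (mode b 1 k x - mode b 1 k y)‖ := by
    refine Summable.of_nonneg_of_le (fun k => norm_nonneg _) (fun k => ?_)
      ((summable_cf a).mul_right ‖x - y‖)
    rw [norm_mul, Real.norm_eq_abs, Real.norm_eq_abs]
    calc _ ≤ |cf a k| * (2 * (wt b 1 k * ‖x - y‖)) :=
          mul_le_mul_of_nonneg_left (hm k) (abs_nonneg _)
      _ = _ := by rw [weight]; ring
  have he : ev x a - ev y a = ∑' k, cf a k * (mode b 1 k x - mode b 1 k y) := by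
    rw [ev_apply, ev_apply, synth, synth, ← (summable_mul_mode (summable_abs_cf a) x).tsum_sub
      (summable_mul_mode (summable_abs_cf a) y)]
    exact tsum_congr fun k => by ring
  rw [he, norm_eq, ← tsum_mul_right]
  refine (norm_tsum_le_tsum_norm hs).trans (hs.tsum_le_tsum (fun k => ?_)
    ((summable_cf a).mul_right _))
  rw [norm_mul, Real.norm_eq_abs, Real.norm_eq_abs]
  calc _ ≤ |cf a k| * (2 * (wt b 1 k * ‖x - y‖)) :=
        mul_le_mul_of_nonneg_left (hm k) (abs_nonneg _)
    _ = _ := by rw [weight]; ring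

/-- The mode of index `k` as an element of the Wiener algebra. -/
def single (b : Module.Basis (Fin 3) ℝ Space) (k : Freq) : Wiener b :=
  mk (Pi.single k 1) (summable_of_ne_finset_zero (s := {k}) (by
    intro l hl
    rw [Pi.single_eq_of_ne (by simpa using hl)]; simp))

theorem norm_single (k : Freq) : ‖single b k‖ = weight b k := by
  rw [norm_eq, single, cf_mk, tsum_eq_single k]
  · simp
  · intro l hl
    rw [Pi.single_eq_of_ne hl]; simp

theorem ev_single (x : Space) (k : Freq) : ev x (single b k) = mode b 1 k x := by
  rw [ev_apply, single, cf_mk, synth, tsum_eq_single k]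
  · simp
  · intro l hl
    rw [Pi.single_eq_of_ne hl]; simp

/-- The product of two modes. -/
def modeMul (b : Module.Basis (Fin 3) ℝ Space) (k l : Freq) : Wiener b :=
  (1 / 2 : ℝ) • (single b (k - l) + single b (l - k) + single b (k + l) - single b (-(k + l)))

theorem ev_modeMul (x : Space) (k l : Freq) :
    ev x (modeMul b k l) = mode b 1 k x * mode b 1 l x := by
  simp only [modeMul, map_smul, map_sub, map_add, ev_single, mode_mul, smul_eq_mul]

/-- The weight is submultiplicative; the factor `2` in `weight` absorbs the four terms of the
product formula for modes. -/
theorem norm_modeMul_le (k l : Freq) : ‖modeMul b k l‖ ≤ weight b k * weight b l := by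
  have h : ∀ k l : Freq, weight b (k + l) ≤ 2 * (wt b 1 k * wt b 1 l) := fun k l =>
    mul_le_mul_of_nonneg_left (wt_add_le k l) two_pos.le
  have h1 := h k l
  have h2 := h k (-l)
  have h3 := h l (-k)
  rw [wt_neg, ← sub_eq_add_neg] at h2 h3
  rw [modeMul, norm_smul]
  have h4 : ‖single b (k - l) + single b (l - k) + single b (k + l) - single b (-(k + l))‖
      ≤ weight b (k - l) + weight b (l - k) + weight b (k + l) + weight b (k + l) := by
    refine (norm_sub_le _ _).trans ?_
    rw [norm_single (-(k + l)), weight_neg]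
    gcongr
    refine (norm_add_le _ _).trans ?_
    rw [norm_single (k + l)]
    gcongr
    refine (norm_add_le _ _).trans ?_
    rw [norm_single, norm_single]
  rw [Real.norm_of_nonneg (by norm_num)]
  unfold weight at *
  nlinarith

/-- The double series that defines the product converges absolutely, and the norm is
submultiplicative. -/
theorem summable_norm_mul (a a' : Wiener b) :
    (Summable fun p : Freq × Freq => ‖(cf a p.1 * cf a' p.2) • modeMul b p.1 p.2‖) ∧
    ∑' p : Freq × Freq, ‖(cf a p.1 * cf a' p.2) • modeMul b p.1 p.2‖ ≤ ‖a‖ * ‖a'‖ := by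
  have hs := (summable_cf a).mul_of_nonneg (summable_cf a')
    (fun k => mul_nonneg (weight_pos k).le (abs_nonneg _))
    (fun k => mul_nonneg (weight_pos k).le (abs_nonneg _))
  have hle : ∀ p : Freq × Freq, ‖(cf a p.1 * cf a' p.2) • modeMul b p.1 p.2‖
      ≤ (weight b p.1 * |cf a p.1|) * (weight b p.2 * |cf a' p.2|) := by
    intro p
    rw [norm_smul, norm_mul, Real.norm_eq_abs, Real.norm_eq_abs]
    calc _ ≤ |cf a p.1| * |cf a' p.2| * (weight b p.1 * weight b p.2) :=
          mul_le_mul_of_nonneg_left (norm_modeMul_le _ _) (by positivity)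
      _ = _ := by ring
  have h1 := Summable.of_nonneg_of_le (fun p => norm_nonneg _) hle hs
  refine ⟨h1, (h1.tsum_le_tsum hle hs).trans (le_of_eq ?_)⟩
  rw [norm_eq, norm_eq, (summable_cf a).tsum_mul_tsum (summable_cf a') hs]

instance : Mul (Wiener b) :=
  ⟨fun a a' => ∑' p : Freq × Freq, (cf a p.1 * cf a' p.2) • modeMul b p.1 p.2⟩

theorem mul_def (a a' : Wiener b) :
    a * a' = ∑' p : Freq × Freq, (cf a p.1 * cf a' p.2) • modeMul b p.1 p.2 := rfl

instance : One (Wiener b) := ⟨single b 0⟩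

@[simp]
theorem ev_mul (x : Space) (a a' : Wiener b) : ev x (a * a') = ev x a * ev x a' := by
  rw [mul_def, ContinuousLinearMap.map_tsum _ (summable_norm_mul a a').1.of_norm]
  simp only [ev_apply x a, ev_apply x a', synth]
  have h : ∀ a : Wiener b, Summable fun k => ‖cf a k * mode b 1 k x‖ := fun a =>
    (summable_mul_mode (summable_abs_cf a) x).norm
  rw [tsum_mul_tsum_of_summable_norm (h a) (h a')]
  refine tsum_congr fun p => ?_
  rw [map_smul, ev_modeMul, smul_eq_mul]
  ring

@[simp]
theorem ev_one (x : Space) : ev x (1 : Wiener b) = 1 :=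
  (ev_single x 0).trans (mode_zero x)

instance : CommRing (Wiener b) :=
  { (inferInstance : AddCommGroup (Wiener b)) with
    mul := (· * ·)
    one := 1
    left_distrib := fun a a' a'' => ext_ev fun x => by
      simp only [ev_mul, map_add, mul_add]
    right_distrib := fun a a' a'' => ext_ev fun x => by
      simp only [ev_mul, map_add, add_mul]
    zero_mul := fun a => ext_ev fun x => by
      simp only [ev_mul, map_zero, zero_mul]
    mul_zero := fun a => ext_ev fun x => by
      simp only [ev_mul, map_zero, mul_zero]
    mul_assoc := fun a a' a'' => ext_ev fun x => by
      simp only [ev_mul, mul_assoc]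
    one_mul := fun a => ext_ev fun x => by
      simp only [ev_mul, ev_one, one_mul]
    mul_one := fun a => ext_ev fun x => by
      simp only [ev_mul, ev_one, mul_one]
    mul_comm := fun a a' => ext_ev fun x => by
      simp only [ev_mul, mul_comm] }

instance : NormedCommRing (Wiener b) :=
  { (inferInstance : NormedAddCommGroup (Wiener b)), (inferInstance : CommRing (Wiener b)) with
    norm_mul_le := fun a a' =>
      (norm_tsum_le_tsum_norm (summable_norm_mul a a').1).trans (summable_norm_mul a a').2 }

instance : NormedAlgebra ℝ (Wiener b) :=
  { Algebra.ofModule (R := ℝ) (A := Wiener b)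
      (fun r a a' => ext_ev fun x => by
        simp only [ev_mul, map_smul, smul_eq_mul, mul_assoc])
      (fun r a a' => ext_ev fun x => by
        simp only [ev_mul, map_smul, smul_eq_mul, mul_left_comm]) with
    norm_smul_le := fun r a => norm_smul_le r a }

@[simp]
theorem ev_pow (x : Space) (a : Wiener b) (m : ℕ) : ev x (a ^ m) = ev x a ^ m := by
  induction m with
  | zero => simp
  | succ m ih => rw [pow_succ, pow_succ, ev_mul, ih]

end Wiener

theorem toL2_add {k n : ℕ} (f g : H b k n) : toL2 (f + g) = toL2 f + toL2 g := rfl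

theorem toL2_sub {k n : ℕ} (f g : H b k n) : toL2 (f - g) = toL2 f - toL2 g := rfl

theorem toL2_smul {k n : ℕ} (r : ℝ) (f : H b k n) : toL2 (r • f) = r • toL2 f := rfl

namespace Wiener

/-! ### The resolvent on the Wiener algebra -/

theorem summable_multiplier {m : Freq → ℝ} {s : Freq ≃ Freq}
    (hs : ∀ k, weight b (s k) = weight b k) (hm : ∀ k, |m k| ≤ 1) (a : Wiener b) :
    (Summable fun k => weight b k * |m k * cf a (s k)|) ∧
      ∑' k, weight b k * |m k * cf a (s k)| ≤ ‖a‖ := by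
  have hle : ∀ k, weight b k * |m k * cf a (s k)| ≤ weight b (s k) * |cf a (s k)| := fun k => by
    rw [hs, abs_mul]
    exact mul_le_mul_of_nonneg_left (mul_le_of_le_one_left (abs_nonneg _) (hm k))
      (weight_pos k).le
  have h2 := s.summable_iff.2 (summable_cf a)
  have h1 := Summable.of_nonneg_of_le
    (fun k => mul_nonneg (weight_pos k).le (abs_nonneg _)) hle h2
  refine ⟨h1, (h1.tsum_le_tsum hle h2).trans (le_of_eq ?_)⟩
  rw [norm_eq]
  exact s.tsum_eq fun k => weight b k * |cf a k|

/-- The Fourier multiplier `c ↦ (m_k c_{s k})_k` on the Wiener algebra, for bounded `m` and a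
permutation `s` of the frequencies that preserves the weight. -/
def multiplier (b : Module.Basis (Fin 3) ℝ Space) (m : Freq → ℝ) (s : Freq ≃ Freq)
    (hs : ∀ k, weight b (s k) = weight b k) (hm : ∀ k, |m k| ≤ 1) : Wiener b →L[ℝ] Wiener b :=
  LinearMap.mkContinuous
    { toFun := fun a => mk (fun k => m k * cf a (s k)) (summable_multiplier hs hm a).1
      map_add' := fun a a' => ext_cf (by
        simp only [cf_mk, cf_add]; ext k; simp [mul_add])
      map_smul' := fun r a => ext_cf (by
        simp only [cf_mk, cf_smul]; ext k; simp [mul_left_comm]) } 1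
    (fun a => by
      rw [one_mul, norm_eq]
      simp only [LinearMap.coe_mk, AddHom.coe_mk, cf_mk]
      exact (summable_multiplier hs hm a).2)

theorem cf_multiplier (m : Freq → ℝ) (s : Freq ≃ Freq)
    (hs : ∀ k, weight b (s k) = weight b k) (hm : ∀ k, |m k| ≤ 1) (a : Wiener b) :
    cf (multiplier b m s hs hm a) = fun k => m k * cf a (s k) :=
  cf_mk _ (summable_multiplier hs hm a).1

theorem weight_equivRefl (k : Freq) : weight b (Equiv.refl Freq k) = weight b k := rfl

theorem weight_equivNeg (k : Freq) : weight b (Equiv.neg Freq k) = weight b k := weight_neg k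

/-- The symbol `1 + |ξ_k|²` of `1 - Δ`. -/
def symb (b : Module.Basis (Fin 3) ℝ Space) (k : Freq) : ℝ := 1 + ‖wave b 1 k‖ ^ 2

theorem symb_pos (k : Freq) : 0 < symb b k := by unfold symb; positivity

theorem symb_neg (k : Freq) : symb b (-k) = symb b k := by simp [symb, wave_neg]

/-- The resolvent `(1 - Δ)⁻¹`. -/
def res (b : Module.Basis (Fin 3) ℝ Space) : Wiener b →L[ℝ] Wiener b :=
  multiplier b (fun k => (symb b k)⁻¹) (Equiv.refl Freq) weight_equivRefl fun k => by
    rw [abs_of_pos (inv_pos.2 (symb_pos k))]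
    exact inv_le_one_of_one_le₀ (by simp [symb])

theorem cf_res (a : Wiener b) (k : Freq) : cf (res b a) k = (symb b k)⁻¹ * cf a k := by
  rw [res, cf_multiplier]; rfl

/-- The operator `∂_j (1 - Δ)⁻¹`. -/
def resD (b : Module.Basis (Fin 3) ℝ Space) (j : Fin 3) : Wiener b →L[ℝ] Wiener b :=
  multiplier b (fun k => -(wave b 1 k j * (symb b k)⁻¹)) (Equiv.neg Freq) weight_equivNeg fun k => by
    rw [abs_neg, abs_mul, abs_inv, abs_of_pos (symb_pos k), ← div_eq_mul_inv,
      div_le_one (symb_pos k)]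
    refine (abs_wave_le k j).trans ?_
    unfold symb; nlinarith [sq_nonneg (‖wave b 1 k‖ - 1)]

theorem cf_resD (j : Fin 3) (a : Wiener b) :
    cf (resD b j a) = dcoef b 1 j (cf (res b a)) := by
  rw [resD, cf_multiplier]
  ext k
  simp only [dcoef, cf_res, Equiv.neg_apply, symb_neg]
  ring

/-- The operator `∂_i ∂_j (1 - Δ)⁻¹`. -/
def resDD (b : Module.Basis (Fin 3) ℝ Space) (i j : Fin 3) : Wiener b →L[ℝ] Wiener b :=
  multiplier b (fun k => -(wave b 1 k i * wave b 1 k j * (symb b k)⁻¹)) (Equiv.refl Freq)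
    weight_equivRefl fun k => by
    rw [abs_neg, abs_mul, abs_inv, abs_of_pos (symb_pos k), ← div_eq_mul_inv,
      div_le_one (symb_pos k), abs_mul]
    have := mul_le_mul (abs_wave_le (b := b) (n := 1) k i) (abs_wave_le (b := b) (n := 1) k j)
      (abs_nonneg _) (norm_nonneg _)
    unfold symb; nlinarith

theorem cf_resDD (i j : Fin 3) (a : Wiener b) :
    cf (resDD b i j a) = dcoef b 1 i (cf (resD b j a)) := by
  rw [resDD, cf_multiplier, cf_resD]
  ext k
  simp only [dcoef, cf_res, Equiv.refl_apply, wave_neg, neg_neg, PiLp.neg_apply]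
  ring

/-- The relation `Δ (1 - Δ)⁻¹ = (1 - Δ)⁻¹ - 1`. -/
theorem sum_resDD (a : Wiener b) : ∑ j, resDD b j j a = res b a - a := by
  refine ext_cf (funext fun k => ?_)
  have h : ∀ j, cf (resDD b j j a) k = -(wave b 1 k j ^ 2 * cf (res b a) k) := fun j => by
    rw [cf_resDD, cf_resD, dcoef_dcoef_self]
  rw [Fin.sum_univ_three, cf_add, cf_add, cf_sub]
  simp only [Pi.add_apply, Pi.sub_apply, h, cf_res]
  have h0 := (symb_pos (b := b) k).ne'
  have h1 : symb b k = 1 + ∑ j, wave b 1 k j ^ 2 := by rw [symb, norm_wave_sq]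
  rw [Fin.sum_univ_three] at h1
  field_simp
  rw [h1]; ring

theorem hasGrad_res (a : Wiener b) :
    HasGrad (fun x => ev x (res b a)) fun j x => ev x (resD b j a) := by
  simp only [ev_apply, cf_resD]
  exact hasGrad_synth (summable_wt_cf _)

theorem hasGrad_resD (j : Fin 3) (a : Wiener b) :
    HasGrad (fun x => ev x (resD b j a)) fun i x => ev x (resDD b i j a) := by
  simp only [ev_apply, cf_resDD]
  exact hasGrad_synth (summable_wt_cf _)

theorem norm_mul_le_of_cf {T : Wiener b →L[ℝ] Wiener b} {C : ℝ} (hC : 0 ≤ C)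
    (h : ∀ a k, |cf (T a) k| ≤ C * |cf a k|) : ‖T‖ ≤ C := by
  refine ContinuousLinearMap.opNorm_le_bound _ hC fun a => ?_
  rw [norm_eq, norm_eq, ← tsum_mul_left]
  refine (summable_cf _).tsum_le_tsum (fun k => ?_) ((summable_cf a).mul_left C)
  calc _ ≤ weight b k * (C * |cf a k|) := mul_le_mul_of_nonneg_left (h a k) (weight_pos k).le
    _ = _ := by ring

/-- The coefficient functional. -/
def cfL (b : Module.Basis (Fin 3) ℝ Space) (k : Freq) : Wiener b →L[ℝ] ℝ :=
  LinearMap.mkContinuous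
    { toFun := fun a => cf a k
      map_add' := fun a a' => by rw [cf_add]; rfl
      map_smul' := fun r a => by rw [cf_smul]; rfl } 1
    (fun a => by
      rw [one_mul]
      have h1 : |cf a k| ≤ ∑' k, |cf a k| := (summable_abs_cf a).le_tsum k fun _ _ => abs_nonneg _
      have h2 := two_mul_tsum_abs_cf_le a
      change |cf a k| ≤ ‖a‖
      linarith [abs_nonneg (cf a k)])

theorem finite_symb_le (b : Module.Basis (Fin 3) ℝ Space) (C : ℝ) : {k | symb b k ≤ C}.Finite := by
  have h := (summable_wt b).tendsto_cofinite_zero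
  have h2 : ∀ᶠ k in cofinite, ((wt b 1 k ^ 2)⁻¹) ^ 2 < ((2 * (|C| + 1))⁻¹) ^ 2 :=
    h.eventually_lt_const (by positivity)
  rw [eventually_cofinite] at h2
  refine h2.subset fun k hk => ?_
  simp only [mem_ofPred_eq, not_lt] at hk ⊢
  have hw := wt_pos (b := b) (n := 1) k
  gcongr
  have := wt_sq_le (b := b) (n := 1) k
  have h3 : 1 + ‖wave b 1 k‖ ^ 2 ≤ C := hk
  linarith [le_abs_self C]

/-- The resolvent is compact: it is a limit of operators of finite rank. -/
theorem isCompactOperator_res (b : Module.Basis (Fin 3) ℝ Space) :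
    IsCompactOperator (res b) := by
  classical
  -- the truncation of the resolvent to the frequencies with `1 + |ξ|² ≤ N`
  set T : ℕ → Wiener b →L[ℝ] Wiener b := fun N =>
    ∑ k ∈ (finite_symb_le b N).toFinset,
      ContinuousLinearMap.smulRight (cfL b k) ((symb b k)⁻¹ • single b k) with hT
  have hcfT : ∀ N a k, cf (T N a) k = if symb b k ≤ N then (symb b k)⁻¹ * cf a k else 0 := by
    intro N a k
    change cfL b k (T N a) = _
    have hsing : ∀ l, cfL b k (single b l) = if l = k then 1 else 0 := fun l => by
      change cf (single b l) k = _
      rw [single, cf_mk, Pi.single_apply]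
      simp [eq_comm]
    simp only [hT, FunLike.coe_sum, Finset.sum_apply, map_sum,
      ContinuousLinearMap.smulRight_apply, map_smul, hsing, smul_eq_mul, mul_ite, mul_one, mul_zero]
    rw [Finset.sum_ite_eq']
    simp only [Finite.mem_toFinset, mem_ofPred_eq]
    split_ifs
    · exact mul_comm _ _
    · rfl
  refine isCompactOperator_of_tendsto (l := atTop) (F := T) ?_ (Eventually.of_forall fun N => ?_)
  · rw [tendsto_iff_norm_sub_tendsto_zero]
    refine squeeze_zero_norm' ?_ (tendsto_inv_atTop_nhds_zero_nat (𝕜 := ℝ))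
    filter_upwards [eventually_gt_atTop 0] with N hN
    rw [norm_norm]
    refine norm_mul_le_of_cf (by positivity) fun a k => ?_
    rw [sub_apply, cf_sub, Pi.sub_apply, hcfT, cf_res]
    have hp := symb_pos (b := b) k
    split_ifs with h
    · simp; positivity
    · rw [zero_sub, abs_neg, abs_mul, abs_of_pos (inv_pos.2 hp)]
      refine mul_le_mul_of_nonneg_right ?_ (abs_nonneg _)
      exact inv_anti₀ (by exact_mod_cast hN) (le_of_not_ge h)
  · have : ∀ s : Finset Freq, IsCompactOperator (∑ k ∈ s,
        ContinuousLinearMap.smulRight (cfL b k) ((symb b k)⁻¹ • single b k) :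
          Wiener b →L[ℝ] Wiener b) := by
      intro s
      induction s using Finset.induction_on with
      | empty => simpa using isCompactOperator_zero
      | insert k s hk ih =>
        rw [Finset.sum_insert hk]
        refine IsCompactOperator.add ?_ ih
        have h1 : IsCompactOperator (cfL b k) :=
          isCompactOperator_of_locallyCompactSpace_dom (cfL b k)
        exact h1.clm_comp (ContinuousLinearMap.smulRight (1 : ℝ →L[ℝ] ℝ)
          ((symb b k)⁻¹ • single b k))
    exact this _

/-! ### The Wiener algebra and the Sobolev space `H³` -/

theorem summable_sq_of_summable_abs {u : Freq → ℝ} (hu : Summable fun k => |u k|) :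
    (Summable fun k => u k ^ 2) ∧ ∑' k, u k ^ 2 ≤ (∑' k, |u k|) ^ 2 := by
  have hle : ∀ k, u k ^ 2 ≤ (∑' k, |u k|) * |u k| := fun k => by
    rw [← sq_abs, sq]
    exact mul_le_mul_of_nonneg_right (hu.le_tsum k fun _ _ => abs_nonneg _) (abs_nonneg _)
  have h1 := Summable.of_nonneg_of_le (fun k => sq_nonneg _) hle (hu.mul_left _)
  refine ⟨h1, (h1.tsum_le_tsum hle (hu.mul_left _)).trans ?_⟩
  rw [tsum_mul_left, sq]

/-- The resolvent gains two derivatives: from the weight `1 + |ξ|` in `ℓ¹` to the weight `(1 +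
|ξ|)³` in `ℓ¹`, hence in `ℓ²`. -/
theorem summable_res_H3 (a : Wiener b) :
    (Summable fun k => (wt b 1 k ^ 3 * (sqrtVol b * cf (res b a) k)) ^ 2) ∧
      ∑' k, (wt b 1 k ^ 3 * (sqrtVol b * cf (res b a) k)) ^ 2 ≤ (sqrtVol b * ‖a‖) ^ 2 := by
  have hv := sqrtVol_pos (b := b)
  have h0 : ∀ k, |wt b 1 k ^ 3 * (sqrtVol b * cf (res b a) k)|
      ≤ sqrtVol b * (weight b k * |cf a k|) := by
    intro k
    have hw := wt_pos (b := b) (n := 1) k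
    have hp := symb_pos (b := b) k
    rw [cf_res, abs_mul, abs_mul, abs_mul, abs_of_pos hv, abs_of_pos (pow_pos hw 3),
      abs_of_pos (inv_pos.2 hp)]
    have h1 : wt b 1 k ^ 3 * (symb b k)⁻¹ ≤ weight b k := by
      rw [← div_eq_mul_inv, div_le_iff₀ hp, weight]
      have := mul_le_mul_of_nonneg_left (wt_sq_le (b := b) (n := 1) k) hw.le
      unfold symb; nlinarith
    calc _ = sqrtVol b * ((wt b 1 k ^ 3 * (symb b k)⁻¹) * |cf a k|) := by ring
      _ ≤ _ := by gcongr
  have hs := (summable_cf a).mul_left (sqrtVol b)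
  have h1 : Summable fun k => |wt b 1 k ^ 3 * (sqrtVol b * cf (res b a) k)| :=
    Summable.of_nonneg_of_le (fun k => abs_nonneg _) h0 hs
  obtain ⟨h2, h3⟩ := summable_sq_of_summable_abs h1
  refine ⟨h2, h3.trans (pow_le_pow_left₀ (tsum_nonneg fun k => abs_nonneg _) ?_ 2)⟩
  rw [norm_eq, ← tsum_mul_left]
  exact h1.tsum_le_tsum h0 hs

/-- The element `(1 - Δ)⁻¹ a` of `H³`. -/
def resHFun (a : Wiener b) : H b 3 1 :=
  sobolevOfCoef b 3 1 (fun k => sqrtVol b * cf (res b a) k) (summable_res_H3 a).1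

theorem coef_toL2_resHFun (a : Wiener b) :
    coef b 1 (toL2 (resHFun a)) = fun k => sqrtVol b * cf (res b a) k := coef_sobolevOfCoef _ _

theorem norm_resHFun_le (a : Wiener b) :
    ‖resHFun a‖ ≤ Fintype.card (MultiIndex 3) * (2 * sqrtVol b) * ‖a‖ := by
  have hv := sqrtVol_pos (b := b)
  have h := summable_res_H3 a
  have e := coef_toL2_resHFun a
  refine (norm_H_le (resHFun a) (B := sqrtVol b * ‖a‖) (by positivity) ?_ ?_).trans
    (le_of_eq (by ring))
  · rw [e]; exact h.1
  · rw [e]; exact h.2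

/-- The resolvent as an operator from the Wiener algebra to `H³`. -/
def resH (b : Module.Basis (Fin 3) ℝ Space) : Wiener b →L[ℝ] H b 3 1 :=
  LinearMap.mkContinuous
    { toFun := resHFun
      map_add' := fun a a' => H.ext_coef (by
        rw [toL2_add, coef_L2_add, coef_toL2_resHFun, coef_toL2_resHFun, coef_toL2_resHFun]
        ext k
        simp [cf_add, mul_add])
      map_smul' := fun r a => H.ext_coef (by
        rw [toL2_smul, coef_L2_smul, coef_toL2_resHFun, coef_toL2_resHFun]
        ext k
        simp [cf_smul, mul_left_comm]) }
    (Fintype.card (MultiIndex 3) * (2 * sqrtVol b)) norm_resHFun_le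

theorem coef_toL2_resH (a : Wiener b) :
    coef b 1 (toL2 (resH b a)) = fun k => sqrtVol b * cf (res b a) k := coef_toL2_resHFun a

/-- An element of `L²` with the Fourier coefficients of an element of the Wiener algebra. -/
theorem ae_eq_ev {f : L2 b 1} {a : Wiener b} (h : ∀ k, coef b 1 f k = sqrtVol b * cf a k) :
    f =ᵐ[cellMeasure b 1] fun x => ev x a := by
  have hv := (sqrtVol_pos (b := b)).ne'
  have h1 := L2.ae_eq_synth f (by
    simp only [h, abs_mul]; exact (summable_abs_cf a).mul_left _)
  have h2 : (fun k => coef b 1 f k / sqrtVol b) = cf a := by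
    ext k; rw [h]; field_simp
  rwa [h2] at h1

theorem coef_of_ae_eq_ev {f : L2 b 1} {a : Wiener b}
    (h : f =ᵐ[cellMeasure b 1] fun x => ev x a) (k : Freq) :
    coef b 1 f k = sqrtVol b * cf a k := by
  rw [coef_congr h, coef_ev]

theorem toL2_resH (a : Wiener b) :
    toL2 (resH b a) =ᵐ[cellMeasure b 1] fun x => ev x (res b a) :=
  ae_eq_ev fun k => by rw [coef_toL2_resH]

theorem wderiv_resH (j : Fin 3) (a : Wiener b) :
    wderiv (Pi.single j 1) (resH b a) =ᵐ[cellMeasure b 1] fun x => ev x (resD b j a) :=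
  ae_eq_ev fun k => by
    rw [coef_wderiv _ (by simp), dmulti_single, coef_toL2_resH, cf_resD]
    simp only [Function.iterate_one, dcoef]
    ring

theorem lap_resH (a : Wiener b) :
    lap (resH b a) =ᵐ[cellMeasure b 1] fun x => ev x (res b a - a) :=
  ae_eq_ev fun k => by
    rw [coef_lap (by norm_num), coef_toL2_resH, cf_sub, Pi.sub_apply]
    simp only [cf_res]
    have h0 := (symb_pos (b := b) k).ne'
    have h1 : cf a k = symb b k * ((symb b k)⁻¹ * cf a k) := by rw [mul_inv_cancel_left₀ h0]
    set y := (symb b k)⁻¹ * cf a k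
    rw [h1, symb]; ring

/-- A solution of `f - Δf = a` in a Sobolev space, with `a` in the Wiener algebra, is the
resolvent of `a`. -/
theorem toL2_eq_of_sub_lap {k : ℕ} (hk : 2 ≤ k) (f : H b k 1) {a : Wiener b}
    (h : ∀ᵐ x ∂(cellMeasure b 1), toL2 f x - lap f x = ev x a) :
    toL2 f = toL2 (resH b a) := by
  refine L2.ext_coef (funext fun l => ?_)
  have h1 : (toL2 f - lap f : L2 b 1) =ᵐ[cellMeasure b 1] fun x => ev x a := by
    filter_upwards [h, Lp.coeFn_sub (toL2 f) (lap f)] with x h1 h2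
    rw [h2, Pi.sub_apply, h1]
  have h2 := coef_of_ae_eq_ev h1 l
  rw [coef_sub_lap hk] at h2
  rw [coef_toL2_resH]
  simp only [cf_res]
  have h0 := (symb_pos (b := b) l).ne'
  have h3 : coef b 1 (toL2 f) l = (symb b l)⁻¹ * (sqrtVol b * cf a l) := by
    rw [← h2, symb, inv_mul_cancel_left₀]
    exact h0
  rw [h3]; ring

theorem eq_resH_of_sub_lap (f : H b 3 1) {a : Wiener b}
    (h : ∀ᵐ x ∂(cellMeasure b 1), toL2 f x - lap f x = ev x a) : f = resH b a :=
  H.ext_toL2 (toL2_eq_of_sub_lap (by norm_num) f h)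

/-- The weight of `H³` is controlled by the function and its pure third derivatives. -/
theorem wt_cube_sq_le (k : Freq) :
    (wt b 1 k ^ 3) ^ 2 ≤ 32 + 288 * ∑ j, (wave b 1 k j ^ 3) ^ 2 := by
  have h1 : (wt b 1 k ^ 3) ^ 2 ≤ 32 * (1 + (‖wave b 1 k‖ ^ 2) ^ 3) := by
    have h2 := wt_sq_le (b := b) (n := 1) k
    set y := ‖wave b 1 k‖ ^ 2
    have hy : 0 ≤ y := sq_nonneg _
    have h3 : (wt b 1 k ^ 2) ^ 3 ≤ (2 * (1 + y)) ^ 3 := pow_le_pow_left₀ (by positivity) h2 3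
    nlinarith [mul_nonneg (by positivity : 0 ≤ 1 + y) (sq_nonneg (1 - y))]
  have h2 : (‖wave b 1 k‖ ^ 2) ^ 3 ≤ 9 * ∑ j, (wave b 1 k j ^ 3) ^ 2 := by
    rw [norm_wave_sq]
    simp only [Fin.sum_univ_three]
    have hx := sq_nonneg (wave b 1 k 0)
    have hy := sq_nonneg (wave b 1 k 1)
    have hz := sq_nonneg (wave b 1 k 2)
    simp only [← pow_mul, mul_comm 3 2]
    simp only [pow_mul]
    generalize wave b 1 k 0 ^ 2 = x at *
    generalize wave b 1 k 1 ^ 2 = y at *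
    generalize wave b 1 k 2 ^ 2 = z at *
    nlinarith [mul_nonneg (add_nonneg hx hy) (sq_nonneg (x - y)),
      mul_nonneg (add_nonneg hy hz) (sq_nonneg (y - z)),
      mul_nonneg (add_nonneg hx hz) (sq_nonneg (x - z)),
      mul_nonneg (add_nonneg (add_nonneg hx hy) hz) (sq_nonneg (x - y)),
      mul_nonneg (add_nonneg (add_nonneg hx hy) hz) (sq_nonneg (y - z)),
      mul_nonneg (add_nonneg (add_nonneg hx hy) hz) (sq_nonneg (x - z))]
  linarith

/-- Square summability of the pure third derivatives implies that the Fourier coefficients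
belong to the Wiener algebra. -/
theorem summable_of_third {c : Freq → ℝ} (h0 : Summable fun k => c k ^ 2)
    (h : ∀ j, Summable fun k => (wave b 1 k j ^ 3 * c k) ^ 2) :
    (Summable fun k => weight b k * |c k|) ∧
      ∑' k, weight b k * |c k| ≤ 2 * √(∑' k, ((wt b 1 k ^ 2)⁻¹) ^ 2) *
        √(32 * ∑' k, c k ^ 2 + 288 * ∑ j, ∑' k, (wave b 1 k j ^ 3 * c k) ^ 2) := by
  have hle : ∀ k, (wt b 1 k ^ 2 * (wt b 1 k * c k)) ^ 2
      ≤ 32 * c k ^ 2 + 288 * ∑ j, (wave b 1 k j ^ 3 * c k) ^ 2 := by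
    intro k
    have h1 := mul_le_mul_of_nonneg_right (wt_cube_sq_le (b := b) k) (sq_nonneg (c k))
    calc _ = (wt b 1 k ^ 3) ^ 2 * c k ^ 2 := by ring
      _ ≤ _ := h1
      _ = _ := by simp only [mul_pow, ← Finset.sum_mul]; ring
  have hsum : Summable fun k => ∑ j, (wave b 1 k j ^ 3 * c k) ^ 2 := summable_sum fun j _ => h j
  have hs := (h0.mul_left 32).add (hsum.mul_left 288)
  have h1 := Summable.of_nonneg_of_le (fun k => sq_nonneg _) hle hs
  obtain ⟨h2, h3⟩ := summable_abs_of_wt h1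
  have e : ∀ k, weight b k * |c k| = 2 * |wt b 1 k * c k| := fun k => by
    rw [abs_mul, abs_of_pos (wt_pos k), weight]; ring
  simp only [e, tsum_mul_left]
  refine ⟨h2.mul_left 2, ?_⟩
  rw [mul_assoc]
  refine mul_le_mul_of_nonneg_left (h3.trans ?_) two_pos.le
  rw [Nat.cast_one, one_pow, one_mul]
  refine mul_le_mul_of_nonneg_left (Real.sqrt_le_sqrt ((h1.tsum_le_tsum hle hs).trans ?_))
    (Real.sqrt_nonneg _)
  rw [(h0.mul_left 32).tsum_add (hsum.mul_left 288), tsum_mul_left, tsum_mul_left,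
    Summable.tsum_finsetSum fun j _ => h j]

theorem third_wderiv (f : H b 3 1) (j : Fin 3) :
    (Summable fun k => (wave b 1 k j ^ 3 * coef b 1 (toL2 f) k) ^ 2) ∧
      ∑' k, (wave b 1 k j ^ 3 * coef b 1 (toL2 f) k) ^ 2 ≤ ‖f‖ ^ 2 := by
  have e : ∀ k, (wave b 1 k j ^ 3 * coef b 1 (toL2 f) k) ^ 2
      = coef b 1 (wderiv (Pi.single j 3) f) (-k) ^ 2 := by
    intro k
    rw [coef_wderiv _ (by simp), dmulti_single]
    simp only [Function.iterate_succ_apply, Function.iterate_zero, id, dcoef, wave_neg, neg_neg,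
      PiLp.neg_apply]
    ring
  simp only [e]
  refine ⟨(Equiv.neg Freq).summable_iff.2 (summable_coef_sq _), ?_⟩
  refine (le_of_eq ((Equiv.neg Freq).tsum_eq fun k =>
    coef b 1 (wderiv (Pi.single j 3) f) k ^ 2)).trans ?_
  rw [tsum_coef_sq]
  exact pow_le_pow_left₀ (norm_nonneg _) (norm_wderiv_le _ _) 2

/-- The Sobolev embedding of `H³` into the Wiener algebra. -/
def ofH3Fun (f : H b 3 1) : Wiener b :=
  (sqrtVol b)⁻¹ • mk (coef b 1 (toL2 f))
    (summable_of_third (summable_coef_sq _) fun j => (third_wderiv f j).1).1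

theorem cf_ofH3Fun (f : H b 3 1) : cf (ofH3Fun f) = (sqrtVol b)⁻¹ • coef b 1 (toL2 f) := by
  rw [ofH3Fun, cf_smul, cf_mk]

theorem norm_ofH3Fun_le (f : H b 3 1) : ‖ofH3Fun f‖
    ≤ (sqrtVol b)⁻¹ * (2 * √(∑' k, ((wt b 1 k ^ 2)⁻¹) ^ 2) * 30) * ‖f‖ := by
  have hv := sqrtVol_pos (b := b)
  rw [ofH3Fun, norm_smul, norm_eq, cf_mk, Real.norm_of_nonneg (by positivity), mul_assoc]
  refine mul_le_mul_of_nonneg_left ?_ (by positivity)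
  refine (summable_of_third (summable_coef_sq _) fun j => (third_wderiv f j).1).2.trans ?_
  rw [mul_assoc (2 * _)]
  refine mul_le_mul_of_nonneg_left ?_ (by positivity)
  refine Real.sqrt_le_iff.2 ⟨by positivity, ?_⟩
  have h0 : ‖toL2 f‖ ^ 2 ≤ ‖f‖ ^ 2 := pow_le_pow_left₀ (norm_nonneg _) (norm_toL2_le f) 2
  rw [tsum_coef_sq, Fin.sum_univ_three]
  have h1 := (third_wderiv f 0).2
  have h2 := (third_wderiv f 1).2
  have h3 := (third_wderiv f 2).2
  nlinarith

/-- The Sobolev embedding of `H³` into the Wiener algebra, as a continuous linear map. -/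
def ofH3 (b : Module.Basis (Fin 3) ℝ Space) : H b 3 1 →L[ℝ] Wiener b :=
  LinearMap.mkContinuous
    { toFun := ofH3Fun
      map_add' := fun f g => ext_cf (by
        rw [cf_add, cf_ofH3Fun, cf_ofH3Fun, cf_ofH3Fun, toL2_add, coef_L2_add, smul_add])
      map_smul' := fun r f => ext_cf (by
        rw [cf_smul, cf_ofH3Fun, cf_ofH3Fun, toL2_smul, coef_L2_smul, smul_comm]; rfl) }
    _ norm_ofH3Fun_le

theorem toL2_ae_eq_ofH3 (f : H b 3 1) :
    toL2 f =ᵐ[cellMeasure b 1] fun x => ev x (ofH3 b f) :=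
  ae_eq_ev fun k => by
    change _ = _ * cf (ofH3Fun f) k
    rw [cf_ofH3Fun, Pi.smul_apply, smul_eq_mul, mul_inv_cancel_left₀ sqrtVol_pos.ne']

theorem ofH3_resH (a : Wiener b) : ofH3 b (resH b a) = res b a :=
  ext_ev_ae (by
    filter_upwards [toL2_ae_eq_ofH3 (resH b a), toL2_resH a] with x h1 h2
    rw [← h1, h2])

end Wiener

/-! ### Regularity of the unperturbed state -/

theorem integral_mul_continuous {φ ψ : Space → ℝ} (hφ : Continuous φ) (hψ : Continuous ψ) :
    (Summable fun k => coef b 1 φ k * coef b 1 ψ k) ∧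
      ∫ x, φ x * ψ x ∂(cellMeasure b 1) = ∑' k, coef b 1 φ k * coef b 1 ψ k := by
  have h := (memLp_of_continuous (b := b) (n := 1) hφ 2).coeFn_toLp
  have h' := (memLp_of_continuous (b := b) (n := 1) hψ 2).coeFn_toLp
  rw [← coef_congr h]
  constructor
  · rw [← coef_congr h']
    exact (summable_abs_mul_of_sq (summable_coef_sq _) (summable_coef_sq _)).1.of_abs
  rw [← integral_mul_eq_tsum' _ hψ]
  exact integral_congr_ae (by filter_upwards [h] with x hx; rw [hx])

/-- Translation rotates the coefficients of `k` and `-k` into each other. -/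
theorem coef_translate {φ : Space → ℝ} (hφ : Continuous φ) (hp : IsPeriodic b 1 φ) (y : Space)
    (k : Freq) : coef b 1 (fun x => φ (x + y)) k
      = Real.cos (phase b 1 k y) * coef b 1 φ k - Real.sin (phase b 1 k y) * coef b 1 φ (-k) := by
  have hm : ∀ x, mode b 1 k (x - y) = Real.cos (phase b 1 k y) * mode b 1 k x
      - Real.sin (phase b 1 k y) * mode b 1 (-k) x := by
    intro x
    rw [mode_neg, mode, mode, cas, cas, map_sub, Real.cos_sub, Real.sin_sub]; ring
  have hc : Continuous fun x => φ x * mode b 1 k (x - y) :=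
    hφ.mul ((continuous_mode k).comp (continuous_id.sub continuous_const))
  have h := integral_translate (b := b) (n := 1) hc.measurable (fun i x => by
    simp only [hp i x, add_sub_right_comm, isPeriodic_mode k i _]) y
  simp only [add_sub_cancel_right] at h
  have i1 : Integrable (fun x => Real.cos (phase b 1 k y) * (φ x * mode b 1 k x))
      (cellMeasure b 1) := integrable_of_continuous (by have := continuous_mode (b := b) (n := 1) k; fun_prop)
  have i2 : Integrable (fun x => Real.sin (phase b 1 k y) * (φ x * mode b 1 (-k) x))
      (cellMeasure b 1) := integrable_of_continuous (by have := continuous_mode (b := b) (n := 1) (-k); fun_prop)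
  have e : ∫ x, φ x * mode b 1 k (x - y) ∂(cellMeasure b 1)
      = Real.cos (phase b 1 k y) * ∫ x, φ x * mode b 1 k x ∂(cellMeasure b 1)
        - Real.sin (phase b 1 k y) * ∫ x, φ x * mode b 1 (-k) x ∂(cellMeasure b 1) := by
    rw [← integral_const_mul, ← integral_const_mul, ← integral_sub i1 i2]
    exact integral_congr_ae (ae_of_all _ fun x => by simp only [hm]; ring)
  rw [coef, h, e, coef, coef]
  ring

/-- A continuous periodic function in `H¹`, characterized by its difference quotients. -/
structure HasH1 (b : Module.Basis (Fin 3) ℝ Space) (φ : Space → ℝ) : Prop where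
  cont : Continuous φ
  per : IsPeriodic b 1 φ
  diff : ∃ A, ∀ (j : Fin 3) (t : ℝ),
    ∫ x, (φ (x + t • unitVec j) - φ x) ^ 2 ∂(cellMeasure b 1) ≤ A * t ^ 2

/-- Parseval's identity for a difference `φ(· + y) - φ`. -/
theorem integral_translate_sub_sq {φ : Space → ℝ} (hφ : Continuous φ) (hp : IsPeriodic b 1 φ)
    (y : Space) :
    let e := fun k => (Real.cos (phase b 1 k y) - 1) * coef b 1 φ k
      - Real.sin (phase b 1 k y) * coef b 1 φ (-k)
    (Summable fun k => e k ^ 2) ∧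
      ∫ x, (φ (x + y) - φ x) ^ 2 ∂(cellMeasure b 1) = ∑' k, e k ^ 2 := by
  intro e
  have hc : Continuous fun x => φ (x + y) := by fun_prop
  have he : coef b 1 (fun x => φ (x + y) - φ x) = e := by
    ext k
    have i1 : Integrable (fun x => φ (x + y) * mode b 1 k x) (cellMeasure b 1) :=
      integrable_of_continuous (hc.mul (continuous_mode k))
    have i2 : Integrable (fun x => φ x * mode b 1 k x) (cellMeasure b 1) :=
      integrable_of_continuous (hφ.mul (continuous_mode k))
    have h1 : coef b 1 (fun x => φ (x + y) - φ x) k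
        = coef b 1 (fun x => φ (x + y)) k - coef b 1 φ k := by
      rw [coef, coef, coef, ← sub_div, ← integral_sub i1 i2]
      simp only [sub_mul]
    rw [h1, coef_translate hφ hp]
    simp only [e]; ring
  have hd : Continuous fun x => φ (x + y) - φ x := by fun_prop
  have h := integral_mul_continuous (b := b) hd hd
  rw [he] at h
  simpa only [← sq] using h

theorem tsum_sq_neg {e : Freq → ℝ} (he : Summable fun k => e k ^ 2) :
    (Summable fun k => e (-k) ^ 2) ∧ ∑' k, e (-k) ^ 2 = ∑' k, e k ^ 2 :=
  ⟨(Equiv.neg Freq).summable_iff.2 he, (Equiv.neg Freq).tsum_eq fun k => e k ^ 2⟩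

/-- A bound `Σ |ξ_j c|² < ∞` for the Fourier coefficients controls difference quotients, by
`2 - 2 cos θ ≤ θ²`. -/
theorem HasH1.of_summable {φ : Space → ℝ} (hφ : Continuous φ) (hp : IsPeriodic b 1 φ)
    (h : ∀ j, Summable fun k => (wave b 1 k j * coef b 1 φ k) ^ 2) : HasH1 b φ := by
  refine ⟨hφ, hp, ∑ j, 2 * ∑' k, (wave b 1 k j * coef b 1 φ k) ^ 2, fun j t => ?_⟩
  obtain ⟨h1, h2⟩ := integral_translate_sub_sq hφ hp (t • unitVec j)
  rw [h2]
  have h3 := (h j).mul_left (t ^ 2)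
  have h4 := tsum_sq_neg (h j)
  have h5 := h4.1.mul_left (t ^ 2)
  refine (h1.tsum_le_tsum (fun k => ?_) (h3.add h5)).trans ?_
  · simp only [map_smul, ← wave_apply, smul_eq_mul]
    set θ := t * wave b 1 k j
    have hw : t ^ 2 * (wave b 1 k j * coef b 1 φ k) ^ 2
        + t ^ 2 * (wave b 1 (-k) j * coef b 1 φ (-k)) ^ 2
        = θ ^ 2 * (coef b 1 φ k ^ 2 + coef b 1 φ (-k) ^ 2) := by
      simp only [wave_neg, PiLp.neg_apply, θ]; ring
    rw [hw]
    have hcos : 2 - 2 * Real.cos θ ≤ θ ^ 2 := by linarith [Real.one_sub_sq_div_two_le_cos (x := θ)]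
    have hsc := Real.sin_sq_add_cos_sq θ
    have h6 := mul_le_mul_of_nonneg_right hcos
      (add_nonneg (sq_nonneg (coef b 1 φ k)) (sq_nonneg (coef b 1 φ (-k))))
    refine le_trans ?_ h6
    have : 2 - 2 * Real.cos θ = (Real.cos θ - 1) ^ 2 + Real.sin θ ^ 2 := by linarith
    rw [this]
    nlinarith [sq_nonneg ((Real.cos θ - 1) * coef b 1 φ (-k) + Real.sin θ * coef b 1 φ k)]
  · rw [h3.tsum_add h5, tsum_mul_left, tsum_mul_left, h4.2, mul_comm _ (t ^ 2), ← mul_add,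
      ← two_mul]
    refine mul_le_mul_of_nonneg_left ?_ (sq_nonneg t)
    exact Finset.single_le_sum (f := fun j => 2 * ∑' k, (wave b 1 k j * coef b 1 φ k) ^ 2)
      (fun i _ => mul_nonneg two_pos.le (tsum_nonneg fun k => sq_nonneg _)) (Finset.mem_univ j)

/-- Conversely, difference quotients control `Σ |ξ_j c|²`: on finitely many frequencies, by Jordan's
inequality `1 - cos θ ≥ 2 θ² / π²` for `|θ| ≤ π` and a small step. -/
theorem HasH1.summable {φ : Space → ℝ} (h : HasH1 b φ) (j : Fin 3) :
    Summable fun k => (wave b 1 k j * coef b 1 φ k) ^ 2 := by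
  obtain ⟨A, hA⟩ := h.diff
  refine summable_of_sum_le (c := Real.pi ^ 2 / 2 * A) (fun k => sq_nonneg _) fun F => ?_
  -- a step `t` so small that `|t ξ_j| ≤ π` for all frequencies in `F`
  obtain ⟨t, ht, htF⟩ : ∃ t : ℝ, 0 < t ∧ ∀ k ∈ F, |t * wave b 1 k j| ≤ Real.pi := by
    have hS : 0 ≤ ∑ k ∈ F, |wave b 1 k j| := Finset.sum_nonneg fun _ _ => abs_nonneg _
    refine ⟨Real.pi / (1 + ∑ k ∈ F, |wave b 1 k j|), by positivity, fun k hk => ?_⟩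
    have := Finset.single_le_sum (f := fun k => |wave b 1 k j|) (fun _ _ => abs_nonneg _) hk
    rw [abs_mul, abs_of_pos (by positivity), div_mul_eq_mul_div, div_le_iff₀ (by positivity)]
    have hpi := Real.pi_pos
    simp only at this
    nlinarith
  obtain ⟨h1, h2⟩ := integral_translate_sub_sq h.cont h.per (t • unitVec j)
  have h3 := tsum_sq_neg h1
  have h4 := hA j t
  rw [h2] at h4
  have h5 := (h1.add h3.1).sum_le_tsum F fun k _ => add_nonneg (sq_nonneg _) (sq_nonneg _)
  rw [h1.tsum_add h3.1, h3.2] at h5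
  have h6 : ∑ k ∈ F, 4 / Real.pi ^ 2 * t ^ 2 * (wave b 1 k j * coef b 1 φ k) ^ 2
      ≤ 2 * (A * t ^ 2) := by
    refine le_trans (Finset.sum_le_sum fun k hk => ?_) (h5.trans (by linarith))
    simp only [map_smul, ← wave_apply, smul_eq_mul, wave_neg, PiLp.neg_apply, mul_neg, neg_neg,
      Real.cos_neg, Real.sin_neg]
    have hq := Real.cos_le_one_sub_mul_cos_sq (htF k hk)
    set θ := t * wave b 1 k j with hθ
    have e1 : 4 / Real.pi ^ 2 * t ^ 2 * (wave b 1 k j * coef b 1 φ k) ^ 2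
        = (2 * (2 / Real.pi ^ 2 * θ ^ 2)) * coef b 1 φ k ^ 2 := by rw [hθ]; ring
    have e2 : 2 * (2 / Real.pi ^ 2 * θ ^ 2) ≤ (Real.cos θ - 1) ^ 2 + Real.sin θ ^ 2 := by
      linarith [Real.sin_sq_add_cos_sq θ]
    rw [e1]
    refine (mul_le_mul_of_nonneg_right e2 (sq_nonneg _)).trans ?_
    nlinarith [mul_nonneg (add_nonneg (sq_nonneg (Real.cos θ - 1)) (sq_nonneg (Real.sin θ)))
      (sq_nonneg (coef b 1 φ (-k)))]
  rw [← Finset.mul_sum] at h6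
  have hpi := Real.pi_pos
  have h7 : (4 / Real.pi ^ 2 * t ^ 2) * ∑ k ∈ F, (wave b 1 k j * coef b 1 φ k) ^ 2
      ≤ (4 / Real.pi ^ 2 * t ^ 2) * (Real.pi ^ 2 / 2 * A) := by
    refine h6.trans (le_of_eq ?_)
    field_simp; ring
  exact le_of_mul_le_mul_left h7 (by positivity)

namespace HasH1

variable {φ ψ χ : Space → ℝ}

/-- The difference quotients of `χ` are controlled by those of `φ` and `ψ`. -/
theorem of_le (hφ : HasH1 b φ) (hψ : HasH1 b ψ) (hc : Continuous χ) (hp : IsPeriodic b 1 χ)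
    (K : ℝ) (h : ∀ x y, |χ x - χ y| ≤ K * (|φ x - φ y| + |ψ x - ψ y|)) : HasH1 b χ := by
  obtain ⟨A, hA⟩ := hφ.diff
  obtain ⟨B, hB⟩ := hψ.diff
  refine ⟨hc, hp, K ^ 2 * (2 * A + 2 * B), fun j t => ?_⟩
  have hcφ := hφ.cont
  have hcψ := hψ.cont
  have i1 : Integrable (fun x => K ^ 2 * (2 * (φ (x + t • unitVec j) - φ x) ^ 2))
    (cellMeasure b 1) := integrable_of_continuous (by fun_prop)
  have i2 : Integrable (fun x => K ^ 2 * (2 * (ψ (x + t • unitVec j) - ψ x) ^ 2))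
    (cellMeasure b 1) := integrable_of_continuous (by fun_prop)
  have i3 : Integrable (fun x => (χ (x + t • unitVec j) - χ x) ^ 2)
    (cellMeasure b 1) := integrable_of_continuous (by fun_prop)
  have h1 := integral_mono i3 (i1.add i2) fun x => by
    have h2 := h (x + t • unitVec j) x
    set p := |φ (x + t • unitVec j) - φ x|
    set q := |ψ (x + t • unitVec j) - ψ x|
    have h3 : (χ (x + t • unitVec j) - χ x) ^ 2 ≤ (K * (p + q)) ^ 2 := by
      rw [← sq_abs (χ _ - _)]; exact pow_le_pow_left₀ (abs_nonneg _) h2 2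
    change _ ≤ K ^ 2 * (2 * (φ (x + t • unitVec j) - φ x) ^ 2)
      + K ^ 2 * (2 * (ψ (x + t • unitVec j) - ψ x) ^ 2)
    rw [← sq_abs (φ _ - _), ← sq_abs (ψ _ - _)]
    nlinarith [mul_nonneg (sq_nonneg K) (sq_nonneg (p - q))]
  rw [integral_add' i1 i2, integral_const_mul, integral_const_mul, integral_const_mul,
    integral_const_mul] at h1
  nlinarith [hA j t, hB j t, mul_le_mul_of_nonneg_left (hA j t) (sq_nonneg K),
    mul_le_mul_of_nonneg_left (hB j t) (sq_nonneg K)]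

theorem add (hφ : HasH1 b φ) (hψ : HasH1 b ψ) : HasH1 b fun x => φ x + ψ x :=
  hφ.of_le hψ (hφ.cont.add hψ.cont) (fun i x => by rw [hφ.per, hψ.per]) 1 fun x y => by
    rw [one_mul, add_sub_add_comm]; exact abs_add_le _ _

theorem mul (hφ : HasH1 b φ) (hψ : HasH1 b ψ) : HasH1 b fun x => φ x * ψ x := by
  obtain ⟨C, hC⟩ := hφ.per.exists_bound hφ.cont
  obtain ⟨D, hD⟩ := hψ.per.exists_bound hψ.cont
  refine hφ.of_le hψ (hφ.cont.mul hψ.cont) (fun i x => by rw [hφ.per, hψ.per]) (C + D)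
    fun x y => ?_
  have e : φ x * ψ x - φ y * ψ y = φ x * (ψ x - ψ y) + ψ y * (φ x - φ y) := by ring
  rw [e]
  refine (abs_add_le _ _).trans ?_
  rw [abs_mul, abs_mul]
  have h1 := mul_le_mul_of_nonneg_right (hC x) (abs_nonneg (ψ x - ψ y))
  have h2 := mul_le_mul_of_nonneg_right (hD y) (abs_nonneg (φ x - φ y))
  have h3 := mul_nonneg ((abs_nonneg _).trans (hC x)) (abs_nonneg (φ x - φ y))
  have h4 := mul_nonneg ((abs_nonneg _).trans (hD x)) (abs_nonneg (ψ x - ψ y))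
  linarith

theorem const (c : ℝ) : HasH1 b fun _ => c :=
  ⟨continuous_const, fun _ _ => rfl, 0, fun j t => by simp⟩

theorem const_mul (c : ℝ) (hφ : HasH1 b φ) : HasH1 b fun x => c * φ x := (const c).mul hφ

theorem sub (hφ : HasH1 b φ) (hψ : HasH1 b ψ) : HasH1 b fun x => φ x - ψ x := by
  simpa [sub_eq_add_neg] using hφ.add (hψ.const_mul (-1))

/-- Positive functions in `H¹` are stable under real powers, which are Lipschitz on compact
subsets of `(0, ∞)`. -/
theorem rpow (hφ : HasH1 b φ) {c : ℝ} (hc : 0 < c) (h : ∀ x, c ≤ φ x) (a : ℝ) :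
    HasH1 b fun x => φ x ^ a := by
  obtain ⟨C, hC⟩ := hφ.per.exists_bound hφ.cont
  have hd : ContDiffOn ℝ 1 (fun t : ℝ => t ^ a) (Icc c C) := fun t ht =>
    (Real.contDiffAt_rpow_const_of_ne (hc.trans_le ht.1).ne').contDiffWithinAt
  obtain ⟨K, hK⟩ := hd.exists_lipschitzOnWith one_ne_zero (convex_Icc c C) isCompact_Icc
  have hm : ∀ x, φ x ∈ Icc c C := fun x => ⟨h x, (le_abs_self _).trans (hC x)⟩
  refine hφ.of_le (const 0) (hφ.cont.rpow_const fun x => Or.inl (hc.trans_le (h x)).ne')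
    (fun i x => by rw [hφ.per]) K fun x y => ?_
  have := hK.dist_le_mul _ (hm x) _ (hm y)
  simpa [Real.dist_eq] using this

theorem of_hasPartial {d : Fin 3 → Space → ℝ} (hφ : Continuous φ) (hp : IsPeriodic b 1 φ)
    (hd : ∀ j, Continuous (d j)) (h : ∀ j, HasPartial j φ (d j)) : HasH1 b φ := by
  refine of_summable hφ hp fun j => ?_
  have h2 := (integral_mul_continuous (b := b) (hd j) (hd j)).1
  rw [coef_partial (h j) hφ (hd j) hp] at h2
  have h3 := (Equiv.neg Freq).summable_iff.2 h2
  refine h3.congr fun k => ?_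
  simp only [Function.comp, Equiv.neg_apply, dcoef, wave_neg, neg_neg, PiLp.neg_apply]
  ring

theorem of_contDiff (hφ : ContDiff ℝ ∞ φ) (hp : IsPeriodic b 1 φ) : HasH1 b φ :=
  of_hasPartial hφ.continuous hp (fun j => (contDiff_pderiv j hφ).continuous)
    fun j => hasPartial_pderiv j hφ

end HasH1

theorem eq_of_coef_eq {φ ψ : Space → ℝ} (hφ : Continuous φ) (hψ : Continuous ψ)
    (hpφ : IsPeriodic b 1 φ) (hpψ : IsPeriodic b 1 ψ) (h : ∀ k, coef b 1 φ k = coef b 1 ψ k) :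
    φ = ψ := by
  have h1 := (memLp_of_continuous (b := b) (n := 1) hφ 2).coeFn_toLp
  have h2 := (memLp_of_continuous (b := b) (n := 1) hψ 2).coeFn_toLp
  refine hpφ.eq_of_ae hpψ hφ hψ (h1.symm.trans ?_)
  rw [L2.ext_coef ((coef_congr h1).trans ((funext h).trans (coef_congr h2).symm))]
  exact h2

/-- If `g` is in `H¹`, then `(1 - Δ)⁻¹ g` is in `H³`. -/
theorem summable_wt_cube {g : Space → ℝ} (hg : HasH1 b g) {c : Freq → ℝ}
    (h : ∀ k, coef b 1 g k = (1 + ‖wave b 1 k‖ ^ 2) * c k) :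
    Summable fun k => (wt b 1 k ^ 3 * c k) ^ 2 := by
  have h0 : Summable fun k => coef b 1 g k ^ 2 := by
    simpa only [← sq] using (integral_mul_continuous (b := b) hg.cont hg.cont).1
  refine Summable.of_nonneg_of_le (fun k => sq_nonneg _) (fun k => ?_)
    ((h0.add (summable_sum fun j (_ : j ∈ Finset.univ) => hg.summable j)).mul_left 8)
  have h1 : ∑ j, (wave b 1 k j * coef b 1 g k) ^ 2 = ‖wave b 1 k‖ ^ 2 * coef b 1 g k ^ 2 := by
    rw [norm_wave_sq, Finset.sum_mul]; simp only [mul_pow]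
  rw [h1, h]
  have h2 := wt_sq_le (b := b) (n := 1) k
  have e1 : (wt b 1 k ^ 3 * c k) ^ 2 = (wt b 1 k ^ 2) ^ 3 * c k ^ 2 := by ring
  rw [e1]
  refine (mul_le_mul_of_nonneg_right (pow_le_pow_left₀ (sq_nonneg _) h2 3) (sq_nonneg _)).trans
    (le_of_eq ?_)
  ring

namespace Wiener

/-- A continuous periodic function `φ` for which `φ - Δφ` is in `H¹` belongs to the Wiener
algebra, and its gradient is in `H¹`. -/
theorem exists_of_hasH1 {φ g : Space → ℝ} (hφ : Continuous φ) (hp : IsPeriodic b 1 φ)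
    (hg : HasH1 b g) (h : ∀ k, coef b 1 g k = (1 + ‖wave b 1 k‖ ^ 2) * coef b 1 φ k) :
    ∃ w : Wiener b, (∀ x, ev x w = φ x) ∧ ∀ j, HasH1 b (synth b 1 (dcoef b 1 j (cf w))) := by
  have h1 := summable_wt_cube hg h
  have hv := sqrtVol_pos (b := b)
  have h2 : Summable fun k => |wt b 1 k * coef b 1 φ k| :=
    (summable_abs_of_wt (h1.congr fun k => by ring)).1
  have h3 : Summable fun k => weight b k * |coef b 1 φ k / sqrtVol b| :=
    (h2.mul_left (2 / sqrtVol b)).congr fun k => by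
      rw [abs_mul, abs_of_pos (wt_pos k), abs_div, abs_of_pos hv, weight]; ring
  refine ⟨mk _ h3, fun x => ?_, fun j => ?_⟩
  · refine congrFun (eq_of_coef_eq (continuous_ev (mk _ h3)) hφ (isPeriodic_ev _) hp fun k => ?_) x
    rw [coef_ev, cf_mk]; field_simp
  · have h4 := summable_dcoef (summable_wt_cf (mk _ h3)) j
    refine HasH1.of_summable (continuous_synth h4) (isPeriodic_synth _) fun i => ?_
    have h5 := (Equiv.neg Freq).summable_iff.2 h1
    refine Summable.of_nonneg_of_le (fun k => sq_nonneg _) (fun k => ?_) h5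
    have e1 : wave b 1 k i * coef b 1 (synth b 1 (dcoef b 1 j (cf (mk _ h3)))) k
        = -(wave b 1 k i * wave b 1 k j * coef b 1 φ (-k)) := by
      rw [coef_synth h4, dcoef, cf_mk]; field_simp
    rw [e1, neg_sq, Function.comp, Equiv.neg_apply, wt_neg, mul_pow, mul_pow (wt b 1 k ^ 3)]
    refine mul_le_mul_of_nonneg_right ?_ (sq_nonneg _)
    rw [← sq_abs]
    refine pow_le_pow_left₀ (abs_nonneg _) ?_ 2
    have h6 := one_le_wt (b := b) (n := 1) k
    have h7 : ∀ i, |wave b 1 k i| ≤ wt b 1 k := fun i =>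
      (abs_wave_le k i).trans (by unfold wt; linarith)
    calc |wave b 1 k i * wave b 1 k j| = |wave b 1 k i| * |wave b 1 k j| := abs_mul _ _
      _ ≤ wt b 1 k * wt b 1 k := mul_le_mul (h7 i) (h7 j) (abs_nonneg _) (wt_pos k).le
      _ ≤ wt b 1 k ^ 3 := by nlinarith [mul_pos (wt_pos (b := b) (n := 1) k) (wt_pos (b := b) (n := 1) k)]

/-- Real powers of a positive function in the Wiener algebra with gradient and Laplacian in `H¹`
belong to the Wiener algebra. -/
theorem exists_rpow {n : Wiener b} {c : ℝ} (hc : 0 < c) (hn : ∀ x, c ≤ ev x n)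
    (hd : ∀ j, HasH1 b (synth b 1 (dcoef b 1 j (cf n)))) {l : Space → ℝ} (hl : HasH1 b l)
    (h : ∀ k, coef b 1 l k = -(‖wave b 1 k‖ ^ 2 * coef b 1 (fun x => ev x n) k)) (a : ℝ) :
    ∃ w : Wiener b, ∀ x, ev x w = ev x n ^ a := by
  set d : Fin 3 → Space → ℝ := fun j => synth b 1 (dcoef b 1 j (cf n)) with hdef
  have hgrad : HasGrad (fun x => ev x n) d := hasGrad_synth (summable_wt_cf n)
  have hpos : ∀ x, ev x n ≠ 0 := fun x => (hc.trans_le (hn x)).ne'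
  have hpow : ∀ (e : ℝ) (j : Fin 3), HasPartial j (fun x => ev x n ^ e)
      fun x => e * ev x n ^ (e - 1) * d j x := fun e j x => by
    have h1 := (hgrad.hasPartial j).hasDerivAt x 0
    have h2 := h1.rpow_const (p := e) (Or.inl (hpos _))
    simp only [zero_smul, add_zero] at h2
    exact h2.congr_deriv (by ring)
  have hc0 : ∀ e : ℝ, Continuous fun x => ev x n ^ e := fun e =>
    (continuous_ev n).rpow_const fun x => Or.inl (hpos x)
  have hcd : ∀ j, Continuous (d j) := fun j => (hd j).cont
  have hN : HasH1 b fun x => ev x n :=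
    HasH1.of_hasPartial (continuous_ev n) (isPeriodic_ev n) hcd hgrad.hasPartial
  -- `ν^a - Δ(ν^a)` in terms of `ν`, `∇ν` and `Δν`
  set g : Space → ℝ := fun x => ev x n ^ a - a * (ev x n ^ (a - 1) * l x)
    - a * (a - 1) * (ev x n ^ (a - 2) * (d 0 x * d 0 x + d 1 x * d 1 x + d 2 x * d 2 x)) with hg
  have hH : ∀ e : ℝ, HasH1 b fun x => ev x n ^ e := fun e => hN.rpow hc hn e
  have hgH : HasH1 b g :=
    ((hH a).sub (((hH _).mul hl).const_mul a)).sub (((hH _).mul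
      ((((hd 0).mul (hd 0)).add ((hd 1).mul (hd 1))).add ((hd 2).mul (hd 2)))).const_mul _)
  have hpa := (hH a).per
  suffices H : ∀ k, coef b 1 g k = (1 + ‖wave b 1 k‖ ^ 2) * coef b 1 (fun x => ev x n ^ a) k by
    obtain ⟨w, hw, -⟩ := exists_of_hasH1 (hc0 a) hpa hgH H
    exact ⟨w, hw⟩
  intro k
  -- weak form of the Laplacian
  have hweak : ∀ (ψ : Space → ℝ) (ψ' : Fin 3 → Space → ℝ), Continuous ψ → IsPeriodic b 1 ψ →
      (∀ j, Continuous (ψ' j)) → (∀ j, HasPartial j ψ (ψ' j)) →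
      ∑ j, ∫ x, d j x * ψ' j x ∂(cellMeasure b 1) = -∫ x, l x * ψ x ∂(cellMeasure b 1) := by
    intro ψ ψ' hψ hpψ hψ' hpart
    have hcd' : ∀ j, coef b 1 (d j) = dcoef b 1 j (coef b 1 fun x => ev x n) := fun j =>
      coef_partial (hgrad.hasPartial j) (continuous_ev n) (hcd j) (isPeriodic_ev n)
    have hcψ : ∀ j, coef b 1 (ψ' j) = dcoef b 1 j (coef b 1 ψ) := fun j =>
      coef_partial (hpart j) hψ (hψ' j) hpψ
    have e1 : ∀ j, ∫ x, d j x * ψ' j x ∂(cellMeasure b 1)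
        = ∑' k, wave b 1 k j ^ 2 * coef b 1 (fun x => ev x n) k * coef b 1 ψ k := fun j => by
      rw [(integral_mul_continuous (hcd j) (hψ' j)).2, hcd', hcψ, tsum_mul_dcoef, ← tsum_neg]
      refine tsum_congr fun k => ?_
      rw [dcoef_dcoef_self]; ring
    have s1 : ∀ j, Summable fun k =>
        wave b 1 k j ^ 2 * coef b 1 (fun x => ev x n) k * coef b 1 ψ k := fun j => by
      have := (integral_mul_continuous (b := b) (hcd j) (hψ' j)).1
      rw [hcd', hcψ] at this
      have h2 := (Equiv.neg Freq).summable_iff.2 this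
      refine h2.congr fun k => ?_
      simp only [Function.comp, Equiv.neg_apply, dcoef, wave_neg, neg_neg, PiLp.neg_apply]
      ring
    simp only [e1]
    rw [(integral_mul_continuous hl.cont hψ).2, ← Summable.tsum_finsetSum fun j _ => s1 j,
      ← tsum_neg]
    refine tsum_congr fun k => ?_
    rw [h, norm_wave_sq, ← Finset.sum_mul, ← Finset.sum_mul]; ring
  -- the weak form, tested with `ν^(a-1)` times a Fourier mode
  have hm := continuous_mode (b := b) (n := 1) k
  have hm' := continuous_mode (b := b) (n := 1) (-k)
  have hw1 := hweak (fun x => ev x n ^ (a - 1) * mode b 1 k x)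
    (fun j x => (a - 1) * ev x n ^ (a - 2) * d j x * mode b 1 k x
      + ev x n ^ (a - 1) * (wave b 1 k j * mode b 1 (-k) x))
    ((hc0 _).mul hm) (fun i x => by simp only [(hH (a - 1)).per i x, isPeriodic_mode k i x])
    (fun j => by have := hc0 (a - 2); have := hc0 (a - 1); have := hcd j; fun_prop)
    (fun j => by
      have := (hpow (a - 1) j).mul (hasPartial_mode (b := b) (n := 1) k j)
      rwa [show a - 1 - 1 = a - 2 by ring] at this)
  have hpart := fun j => coef_partial (hpow a j) (hc0 a)
    (by have := hc0 (a - 1); have := hcd j; fun_prop) hpa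
  have hv := (sqrtVol_pos (b := b)).ne'
  have hI : ∀ j, ∫ x, a * ev x n ^ (a - 1) * d j x * mode b 1 (-k) x ∂(cellMeasure b 1)
      = wave b 1 k j * ∫ x, ev x n ^ a * mode b 1 k x ∂(cellMeasure b 1) := fun j => by
    have h1 := congrFun (hpart j) (-k)
    rw [dcoef, coef, coef, neg_neg, wave_neg, PiLp.neg_apply] at h1
    field_simp at h1
    simpa using h1
  have c0 := hc0 a
  have c1 := hc0 (a - 1)
  have c2 := hc0 (a - 2)
  have cl := hl.cont
  have cd0 := hcd 0
  have cd1 := hcd 1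
  have cd2 := hcd 2
  have J : ∀ F : Space → ℝ, Continuous F → Integrable F (cellMeasure b 1) :=
    fun F hF => integrable_of_continuous hF
  have key : ∫ x, g x * mode b 1 k x ∂(cellMeasure b 1)
      = (1 + ‖wave b 1 k‖ ^ 2) * ∫ x, ev x n ^ a * mode b 1 k x ∂(cellMeasure b 1) := by
    set I0 := ∫ x, ev x n ^ a * mode b 1 k x ∂(cellMeasure b 1)
    set Q : Fin 3 → ℝ := fun j =>
      ∫ x, ev x n ^ (a - 2) * (d j x * d j x) * mode b 1 k x ∂(cellMeasure b 1) with hQ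
    set P := ∫ x, l x * (ev x n ^ (a - 1) * mode b 1 k x) ∂(cellMeasure b 1)
    have e1 : ∫ x, g x * mode b 1 k x ∂(cellMeasure b 1)
        = I0 - a * P - a * (a - 1) * (Q 0 + Q 1 + Q 2) := by
      have q : ∀ j, Integrable (fun x => ev x n ^ (a - 2) * (d j x * d j x) * mode b 1 k x)
        (cellMeasure b 1) := fun j => J _ (by have := hcd j; fun_prop)
      have p : Integrable (fun x => a * (l x * (ev x n ^ (a - 1) * mode b 1 k x)))
        (cellMeasure b 1) := J _ (by fun_prop)
      have i0 : Integrable (fun x => ev x n ^ a * mode b 1 k x) (cellMeasure b 1) :=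
        J _ (by fun_prop)
      have q01 : Integrable (fun x => ev x n ^ (a - 2) * (d 0 x * d 0 x) * mode b 1 k x
        + ev x n ^ (a - 2) * (d 1 x * d 1 x) * mode b 1 k x) (cellMeasure b 1) := (q 0).add (q 1)
      have q012 : Integrable (fun x => a * (a - 1) *
        (ev x n ^ (a - 2) * (d 0 x * d 0 x) * mode b 1 k x
        + ev x n ^ (a - 2) * (d 1 x * d 1 x) * mode b 1 k x
        + ev x n ^ (a - 2) * (d 2 x * d 2 x) * mode b 1 k x)) (cellMeasure b 1) :=
        (q01.add (q 2)).const_mul _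
      have ip : Integrable (fun x => ev x n ^ a * mode b 1 k x
        - a * (l x * (ev x n ^ (a - 1) * mode b 1 k x))) (cellMeasure b 1) := i0.sub p
      simp only [hQ]
      rw [← integral_add (q 0) (q 1), ← integral_add q01 (q 2), ← integral_const_mul,
        ← integral_const_mul, ← integral_sub i0 p, ← integral_sub ip q012]
      exact integral_congr_ae (ae_of_all _ fun x => by simp only [hg]; ring)
    have e2 : ∀ j, a * ∫ x, d j x * ((a - 1) * ev x n ^ (a - 2) * d j x * mode b 1 k x
        + ev x n ^ (a - 1) * (wave b 1 k j * mode b 1 (-k) x)) ∂(cellMeasure b 1)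
        = a * (a - 1) * Q j + wave b 1 k j ^ 2 * I0 := by
      intro j
      have cdj := hcd j
      have i1 : Integrable (fun x => a * (a - 1) *
        (ev x n ^ (a - 2) * (d j x * d j x) * mode b 1 k x)) (cellMeasure b 1) :=
        J _ (by fun_prop)
      have i2 : Integrable (fun x => wave b 1 k j *
        (a * ev x n ^ (a - 1) * d j x * mode b 1 (-k) x)) (cellMeasure b 1) := J _ (by fun_prop)
      rw [sq, mul_assoc (wave b 1 k j), ← hI j]
      simp only [hQ]
      rw [← integral_const_mul, ← integral_const_mul, ← integral_const_mul, ← integral_add i1 i2]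
      exact integral_congr_ae (ae_of_all _ fun x => by ring)
    have e3 := congrArg (a * ·) hw1
    simp only [Finset.mul_sum, e2] at e3
    simp only [Fin.sum_univ_three] at e3
    rw [e1, norm_wave_sq, Fin.sum_univ_three]
    linarith
  rw [coef, key, coef]; ring

/-- Functions in `H²` have a continuous representative, which is in `H¹`. -/
theorem exists_hasH1_of_H2 (f : H b 2 1) : ∃ φ, HasH1 b φ ∧ toL2 f =ᵐ[cellMeasure b 1] φ := by
  have h := summable_coef_H2 f
  have hv := sqrtVol_pos (b := b)
  have h' : Summable fun k => |coef b 1 (toL2 f) k / sqrtVol b| :=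
    (h.div_const (sqrtVol b)).congr fun k => by rw [abs_div, abs_of_pos hv]
  refine ⟨_, HasH1.of_summable (continuous_synth h') (isPeriodic_synth _) fun j => ?_,
    L2.ae_eq_synth (toL2 f) h⟩
  have h1 := (summable_wt_of_resolvent (toL2 f - lap f) (coef_sub_lap le_rfl f)).1
  refine Summable.of_nonneg_of_le (fun k => sq_nonneg _) (fun k => ?_) h1
  rw [coef_synth h', mul_div_cancel₀ _ hv.ne', mul_pow, mul_pow (wt b 1 k ^ 2)]
  refine mul_le_mul_of_nonneg_right ?_ (sq_nonneg _)
  rw [← sq_abs]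
  refine pow_le_pow_left₀ (abs_nonneg _) ((abs_wave_le k j).trans ?_) 2
  have := norm_nonneg (wave b 1 k)
  unfold wt; nlinarith

/-- A function in `H²` whose Laplacian is in `H¹` belongs to the Wiener algebra. -/
theorem exists_of_lap (f : H b 2 1) {l : Space → ℝ} (hl : HasH1 b l)
    (h : lap f =ᵐ[cellMeasure b 1] l) : ∃ n : Wiener b,
      toL2 f =ᵐ[cellMeasure b 1] (fun x => ev x n) ∧
      (∀ j, HasH1 b (synth b 1 (dcoef b 1 j (cf n)))) ∧
      ∀ k, coef b 1 l k = -(‖wave b 1 k‖ ^ 2 * coef b 1 (fun x => ev x n) k) := by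
  obtain ⟨φ, hφ, hfφ⟩ := exists_hasH1_of_H2 f
  have hlk : ∀ k, coef b 1 l k = -(‖wave b 1 k‖ ^ 2 * coef b 1 φ k) := fun k => by
    rw [← coef_congr h, ← coef_congr hfφ, coef_lap le_rfl]
  obtain ⟨n, hn, hd⟩ := exists_of_hasH1 hφ.cont hφ.per (hφ.sub hl) fun k => by
    have h1 : (toL2 f - lap f : L2 b 1) =ᵐ[cellMeasure b 1] fun x => φ x - l x := by
      filter_upwards [h, hfφ, Lp.coeFn_sub (toL2 f) (lap f)] with x h1 h2 h3
      rw [h3, Pi.sub_apply, h1, h2]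
    rw [← coef_congr h1, coef_sub_lap le_rfl, coef_congr hfφ]
  have e : (fun x => ev x n) = φ := funext hn
  exact ⟨n, by rwa [e], hd, by rwa [e]⟩

/-- Smooth periodic functions belong to the Wiener algebra, since `ρ - Δρ` is in `H¹`. -/
theorem exists_of_contDiff {ρ : Space → ℝ} (hρ : ContDiff ℝ ∞ ρ) (hp : IsPeriodic b 1 ρ) :
    ∃ r : Wiener b, ∀ x, ev x r = ρ x := by
  have h2 : ∀ j k, coef b 1 ((pderiv j)^[2] ρ) k = -(wave b 1 k j ^ 2 * coef b 1 ρ k) :=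
    fun j k => by
      rw [(coef_pderiv_iterate j 2 hρ hp).2, ← dcoef_dcoef_self]; rfl
  have hc : ∀ j, ContDiff ℝ ∞ ((pderiv j)^[2] ρ) := fun j => contDiff_pderiv_iterate j 2 hρ
  have hH : ∀ j, HasH1 b ((pderiv j)^[2] ρ) := fun j =>
    HasH1.of_contDiff (hc j) (coef_pderiv_iterate j 2 hρ hp).1
  obtain ⟨r, hr, -⟩ := exists_of_hasH1 hρ.continuous hp
    ((((HasH1.of_contDiff hρ hp).sub (hH 0)).sub (hH 1)).sub (hH 2)) fun k => by
      have J : ∀ F : Space → ℝ, Continuous F → Integrable (fun x => F x * mode b 1 k x)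
        (cellMeasure b 1) := fun F hF => integrable_of_continuous (hF.mul (continuous_mode k))
      have i0 := J _ hρ.continuous
      have i1 := J _ (hρ.continuous.sub (hc 0).continuous)
      have i2 := J _ ((hρ.continuous.sub (hc 0).continuous).sub (hc 1).continuous)
      have e : coef b 1 (fun x => ρ x - (pderiv 0)^[2] ρ x - (pderiv 1)^[2] ρ x
          - (pderiv 2)^[2] ρ x) k = coef b 1 ρ k - coef b 1 ((pderiv 0)^[2] ρ) k
            - coef b 1 ((pderiv 1)^[2] ρ) k - coef b 1 ((pderiv 2)^[2] ρ) k := by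
        simp only [coef, ← sub_div]
        rw [← integral_sub i0 (J _ (hc 0).continuous), ← integral_sub ?_ (J _ (hc 1).continuous),
          ← integral_sub ?_ (J _ (hc 2).continuous)]
        · simp only [sub_mul]
        · simpa [sub_mul] using i2
        · simpa [sub_mul] using i1
      rw [e]
      simp only [h2]
      rw [norm_wave_sq, Fin.sum_univ_three]; ring
  exact ⟨r, hr⟩

theorem ev_ge_of_ae {n : Wiener b} {c : ℝ} (h : ∀ᵐ x ∂(cellMeasure b 1), c ≤ ev x n) (x : Space) :
    c ≤ ev x n := by
  have hp := isPeriodic_ev n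
  have h1 : (fun x => max c (ev x n)) = fun x => ev x n :=
    IsPeriodic.eq_of_ae (b := b) (n := 1) (fun i x => by simp only [hp i x]) hp
      (continuous_const.max (continuous_ev n)) (continuous_ev n)
      (by filter_upwards [h] with x hx; exact max_eq_right hx)
  rw [← congrFun h1 x]
  exact le_max_left _ _

/-- A spin density with `-Δν + 5/3 ν^{7/3} - 4/3 ν^{5/3} + V ν = 0` and a positive lower bound is
the cube of an invertible element of the Wiener algebra. -/
theorem exists_cbrt (f V : H b 2 1) {c : ℝ} (hc : 0 < c)
    (hf : ∀ᵐ x ∂(cellMeasure b 1), c ≤ toL2 f x)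
    (h : ∀ᵐ x ∂(cellMeasure b 1), -(lap f x) + 5 / 3 * (toL2 f x) ^ (7 / 3 : ℝ)
      - 4 / 3 * (toL2 f x) ^ (5 / 3 : ℝ) + toL2 V x * toL2 f x = 0) :
    ∃ w w' : Wiener b, w * w' = 1 ∧ (∀ x, 0 < ev x w) ∧ (∀ x, c ≤ ev x w ^ 3) ∧
      toL2 f =ᵐ[cellMeasure b 1] fun x => ev x w ^ 3 := by
  obtain ⟨φ, hφ, hfφ⟩ := exists_hasH1_of_H2 f
  obtain ⟨v, hv, hVv⟩ := exists_hasH1_of_H2 V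
  -- the lower bound holds everywhere for the continuous representative
  have hmax : (fun x => max c (φ x)) = φ :=
    IsPeriodic.eq_of_ae (b := b) (n := 1) (fun i x => by rw [hφ.per i x]) hφ.per
      (continuous_const.max hφ.cont) hφ.cont
      (by filter_upwards [hf, hfφ] with x h1 h2; exact max_eq_right (h2 ▸ h1))
  have hφc : ∀ x, c ≤ φ x := fun x => by rw [← congrFun hmax x]; exact le_max_left _ _
  have hl : HasH1 b fun x => 5 / 3 * φ x ^ (7 / 3 : ℝ) - 4 / 3 * φ x ^ (5 / 3 : ℝ) + v x * φ x :=
    (((hφ.rpow hc hφc _).const_mul _).sub ((hφ.rpow hc hφc _).const_mul _)).add (hv.mul hφ)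
  obtain ⟨n, hn, hd, hk⟩ := exists_of_lap f hl (by
    filter_upwards [h, hfφ, hVv] with x h1 h2 h3
    rw [h2, h3] at h1
    linarith)
  have hnc : ∀ x, c ≤ ev x n := ev_ge_of_ae (by
    filter_upwards [hf, hn] with x h1 h2; rwa [← h2])
  obtain ⟨w, hw⟩ := exists_rpow hc hnc hd hl hk (1 / 3)
  obtain ⟨w', hw'⟩ := exists_rpow hc hnc hd hl hk (-(1 / 3))
  have hpos : ∀ x, 0 < ev x n := fun x => hc.trans_le (hnc x)
  have h3 : ∀ x, ev x w ^ 3 = ev x n := fun x => by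
    rw [hw, ← Real.rpow_natCast, ← Real.rpow_mul (hpos x).le]; norm_num
  refine ⟨w, w', ext_ev fun x => ?_, fun x => ?_, fun x => ?_, ?_⟩
  · rw [ev_mul, hw, hw', ← Real.rpow_add (hpos x), ev_one]; norm_num
  · rw [hw]; exact Real.rpow_pos_of_pos (hpos x) _
  · rw [h3]; exact hnc x
  · simpa only [h3] using hn

/-- The potential of a solution of the Poisson equation belongs to the Wiener algebra. -/
theorem exists_potential (f₀ f₁ V : H b 2 1) {ρ : Space → ℝ} (hρ : HasH1 b ρ)
    (h : ∀ᵐ x ∂(cellMeasure b 1), -(lap V x) = 4 * Real.pi * ((toL2 f₀ x) ^ 2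
      + (toL2 f₁ x) ^ 2 - ρ x)) :
    ∃ v : Wiener b, toL2 V =ᵐ[cellMeasure b 1] fun x => ev x v := by
  obtain ⟨φ₀, hφ₀, h₀⟩ := exists_hasH1_of_H2 f₀
  obtain ⟨φ₁, hφ₁, h₁⟩ := exists_hasH1_of_H2 f₁
  obtain ⟨v, hv, -⟩ := exists_of_lap V
    ((((hφ₀.mul hφ₀).add (hφ₁.mul hφ₁)).sub hρ).const_mul (-(4 * Real.pi))) (by
      filter_upwards [h, h₀, h₁] with x h1 h2 h3
      rw [h2, h3] at h1
      linear_combination -h1)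
  exact ⟨v, hv⟩

end Wiener

/-! ### The cell problem as an equation in the Wiener algebra -/

theorem forall_fin_three {P : Fin 3 → Prop} (h0 : P 0) (h1 : P 1) (h2 : P 2) (i : Fin 3) :
    P i := by
  fin_cases i
  exacts [h0, h1, h2]

namespace Wiener

theorem ev_natCast (x : Space) (m : ℕ) : ev x (m : Wiener b) = m := by
  induction m with
  | zero => simp
  | succ m ih => rw [Nat.cast_succ, map_add, ih, ev_one, Nat.cast_succ]

/-- Triples `(w₊, w₋, V)` of elements of the Wiener algebra. The spin densities are `ν_± = w_±³`,
so that the powers in the Euler--Lagrange equations become polynomials in `w_±`. -/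
abbrev Triple (b : Module.Basis (Fin 3) ℝ Space) : Type := Fin 3 → Wiener b

/-- The triple `(ν₊, ν₋, V) = (w₊³, w₋³, V)`. -/
def cube (y : Triple b) : Triple b := ![y 0 ^ 3, y 1 ^ 3, y 2]

/-- The value of `ν - Δν` prescribed by the equation for a spin density `ν = w³` in the potential
`V` with field `e`. -/
def spinSource (e : ℝ) (w V : Wiener b) : Wiener b :=
  w ^ 3 - (5 / 3 : ℝ) • w ^ 7 + (4 / 3 : ℝ) • w ^ 5 - (V - e • 1) * w ^ 3

/-- The value of `u - Δu` prescribed by the Euler--Lagrange equations with constant field `η`. -/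
def source (ρ : Wiener b) (η : ℝ) (y : Triple b) : Triple b :=
  ![spinSource η (y 0) (y 2), spinSource (-η) (y 1) (y 2),
    y 2 + (4 * Real.pi) • (y 0 ^ 6 + y 1 ^ 6 - ρ)]

/-- The coefficient of `ω` in the linearization of `spinSource`. -/
def spinCoef (e : ℝ) (w V : Wiener b) : Wiener b :=
  1 - (35 / 9 : ℝ) • w ^ 4 + (20 / 9 : ℝ) • w ^ 2 - (V - e • 1)

/-- The matrix of the linearized source. -/
def linMat (η : ℝ) (y : Triple b) : Fin 3 → Fin 3 → Wiener b :=
  ![![spinCoef η (y 0) (y 2), 0, -y 0 ^ 3], ![0, spinCoef (-η) (y 1) (y 2), -y 1 ^ 3],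
    ![(8 * Real.pi) • y 0 ^ 3, (8 * Real.pi) • y 1 ^ 3, 1]]

/-- The matrix of the derivative of `cube`. -/
def cubeMat (y : Triple b) : Fin 3 → Fin 3 → Wiener b :=
  ![![(3 : ℝ) • y 0 ^ 2, 0, 0], ![0, (3 : ℝ) • y 1 ^ 2, 0], ![0, 0, 1]]

/-- The operator on triples defined by a matrix of multipliers. -/
def matOp (m : Fin 3 → Fin 3 → Wiener b) : Triple b →L[ℝ] Triple b :=
  ∑ i, ∑ j, (ContinuousLinearMap.single ℝ (fun _ : Fin 3 => Wiener b) i).comp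
    ((ContinuousLinearMap.mul ℝ (Wiener b) (m i j)).comp (ContinuousLinearMap.proj j))

theorem matOp_apply (m : Fin 3 → Fin 3 → Wiener b) (z : Triple b) (i : Fin 3) :
    matOp m z i = m i 0 * z 0 + m i 1 * z 1 + m i 2 * z 2 := by
  fin_cases i <;> simp [matOp, Fin.sum_univ_three]

/-- The resolvent `(1 - Δ)⁻¹` on triples. -/
def res3 (b : Module.Basis (Fin 3) ℝ Space) : Triple b →L[ℝ] Triple b :=
  ContinuousLinearMap.pi fun i => (res b).comp (ContinuousLinearMap.proj i)

theorem res3_apply (y : Triple b) (i : Fin 3) : res3 b y i = res b (y i) := rfl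

theorem isCompactOperator_res3 (b : Module.Basis (Fin 3) ℝ Space) :
    IsCompactOperator (res3 b) := by
  let S := fun i : Fin 3 => ContinuousLinearMap.single ℝ (fun _ : Fin 3 => Wiener b) i
  let P := fun i : Fin 3 => ContinuousLinearMap.proj (R := ℝ) (φ := fun _ : Fin 3 => Wiener b) i
  have h : ∀ i : Fin 3, IsCompactOperator (⇑(S i) ∘ (⇑(res b) ∘ ⇑(P i))) := fun i =>
    ((isCompactOperator_res b).comp_clm (P i)).clm_comp (S i)
  have e : (res3 b : Triple b → Triple b) = (S 0 ∘ (res b ∘ P 0)) + (S 1 ∘ (res b ∘ P 1))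
      + (S 2 ∘ (res b ∘ P 2)) := by
    refine funext fun y => funext (forall_fin_three ?_ ?_ ?_) <;>
      simp [res3, S, P]
  rw [e]
  exact ((h 0).add (h 1)).add (h 2)

/-- The operator `1 - (1 - Δ)⁻¹ B`, where `B` is the linearized source. -/
def linOp (η : ℝ) (y : Triple b) : Triple b →L[ℝ] Triple b :=
  1 - (res3 b).comp (matOp (linMat η y))

/-- The cell problem with field `η` reads `cellMap ρ (η, y) = 0`. -/
def cellMap (ρ : Wiener b) (p : ℝ × Triple b) : Triple b :=
  cube p.2 - res3 b (source ρ p.1 p.2)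

theorem contDiff_cube {m : WithTop ℕ∞} : ContDiff ℝ m (cube : Triple b → Triple b) := by
  rw [contDiff_pi]
  refine forall_fin_three ?_ ?_ ?_
  · change ContDiff ℝ m fun y : Triple b => y 0 ^ 3
    fun_prop
  · change ContDiff ℝ m fun y : Triple b => y 1 ^ 3
    fun_prop
  · change ContDiff ℝ m fun y : Triple b => y 2
    fun_prop

theorem contDiff_spinSource {m : WithTop ℕ∞} :
    ContDiff ℝ m fun p : ℝ × Wiener b × Wiener b => spinSource p.1 p.2.1 p.2.2 := by
  unfold spinSource; fun_prop

theorem contDiff_spinCoef {m : WithTop ℕ∞} :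
    ContDiff ℝ m fun p : ℝ × Wiener b × Wiener b => spinCoef p.1 p.2.1 p.2.2 := by
  unfold spinCoef; fun_prop

theorem contDiff_source (ρ : Wiener b) {m : WithTop ℕ∞} :
    ContDiff ℝ m fun p : ℝ × Triple b => source ρ p.1 p.2 := by
  rw [contDiff_pi]
  refine forall_fin_three ?_ ?_ ?_
  · exact contDiff_spinSource.comp (f := fun p : ℝ × Triple b => (p.1, p.2 0, p.2 2))
      (by fun_prop)
  · exact contDiff_spinSource.comp (f := fun p : ℝ × Triple b => (-p.1, p.2 1, p.2 2))
      (by fun_prop)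
  · change ContDiff ℝ m fun p : ℝ × Triple b =>
      p.2 2 + (4 * Real.pi) • (p.2 0 ^ 6 + p.2 1 ^ 6 - ρ)
    fun_prop

theorem contDiff_cellMap (ρ : Wiener b) {m : WithTop ℕ∞} : ContDiff ℝ m (cellMap ρ) :=
  (contDiff_cube.comp contDiff_snd).sub ((res3 b).contDiff.comp (contDiff_source ρ))

theorem contDiff_matOp_linMat {m : WithTop ℕ∞} :
    ContDiff ℝ m fun p : ℝ × Triple b => matOp (linMat p.1 p.2) := by
  have h : ContDiff ℝ m fun p : ℝ × Triple b => linMat p.1 p.2 := by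
    rw [contDiff_pi]
    refine forall_fin_three ?_ ?_ ?_ <;> rw [contDiff_pi] <;> refine forall_fin_three ?_ ?_ ?_
    · exact contDiff_spinCoef.comp (f := fun p : ℝ × Triple b => (p.1, p.2 0, p.2 2))
        (by fun_prop)
    · exact contDiff_const
    · change ContDiff ℝ m fun p : ℝ × Triple b => -p.2 0 ^ 3
      fun_prop
    · exact contDiff_const
    · exact contDiff_spinCoef.comp (f := fun p : ℝ × Triple b => (-p.1, p.2 1, p.2 2))
        (by fun_prop)
    · change ContDiff ℝ m fun p : ℝ × Triple b => -p.2 1 ^ 3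
      fun_prop
    · change ContDiff ℝ m fun p : ℝ × Triple b => (8 * Real.pi) • p.2 0 ^ 3
      fun_prop
    · change ContDiff ℝ m fun p : ℝ × Triple b => (8 * Real.pi) • p.2 1 ^ 3
      fun_prop
    · exact contDiff_const
  have h2 : ∀ i j, ContDiff ℝ m fun p : ℝ × Triple b =>
      ContinuousLinearMap.mul ℝ (Wiener b) (linMat p.1 p.2 i j) := fun i j =>
    (ContinuousLinearMap.mul ℝ (Wiener b)).contDiff.comp
      (contDiff_pi.1 (contDiff_pi.1 h i) j)
  simp only [matOp]
  refine ContDiff.sum fun i _ => ContDiff.sum fun j _ => ?_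
  exact contDiff_const.clm_comp ((h2 i j).clm_comp contDiff_const)

theorem contDiff_linOp {m : WithTop ℕ∞} :
    ContDiff ℝ m fun p : ℝ × Triple b => linOp p.1 p.2 :=
  contDiff_const.sub (contDiff_const.clm_comp contDiff_matOp_linMat)

theorem hasDerivAt_cube_line (y z : Triple b) :
    HasDerivAt (fun t : ℝ => cube (y + t • z)) (matOp (cubeMat y) z) 0 := by
  have h : ∀ i, HasDerivAt (fun t : ℝ => y i + t • z i) (z i) 0 := fun i => by
    simpa using ((hasDerivAt_id (0 : ℝ)).smul_const (z i)).const_add (y i)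
  rw [hasDerivAt_pi]
  intro i
  rw [matOp_apply]
  revert i
  refine forall_fin_three ?_ ?_ ?_
  · refine ((h 0).fun_pow 3).congr_deriv (ext_ev fun x => ?_)
    simp [cubeMat, ev_natCast, -Nat.cast_ofNat]
    norm_num [mul_assoc]
  · refine ((h 1).fun_pow 3).congr_deriv (ext_ev fun x => ?_)
    simp [cubeMat, ev_natCast, -Nat.cast_ofNat]
    norm_num [mul_assoc]
  · refine (h 2).congr_deriv (ext_ev fun x => ?_)
    simp [cubeMat]

/-- The derivative of the source in direction `z` of `y` is the linearized source applied to the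
variation of `cube y`: by the chain rule through the substitution `ν = w³`. -/
theorem hasDerivAt_source_line (ρ : Wiener b) (η : ℝ) (y z : Triple b) :
    HasDerivAt (fun t : ℝ => source ρ η (y + t • z))
      (matOp (linMat η y) (matOp (cubeMat y) z)) 0 := by
  have h : ∀ i, HasDerivAt (fun t : ℝ => y i + t • z i) (z i) 0 := fun i => by
    simpa using ((hasDerivAt_id (0 : ℝ)).smul_const (z i)).const_add (y i)
  have hspin : ∀ (e : ℝ) (i : Fin 3), HasDerivAt
      (fun t : ℝ => spinSource e (y i + t • z i) (y 2 + t • z 2))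
      (spinCoef e (y i) (y 2) * ((3 : ℝ) • y i ^ 2 * z i) - y i ^ 3 * z 2) 0 := by
    intro e i
    have h1 := ((((h i).fun_pow 3).sub (((h i).fun_pow 7).const_smul (5 / 3 : ℝ))).add
      (((h i).fun_pow 5).const_smul (4 / 3 : ℝ))).sub
      (((h 2).sub_const (e • 1)).mul ((h i).fun_pow 3))
    refine h1.congr_deriv ?_
    refine ext_ev fun x => ?_
    simp [spinCoef, ev_natCast, -Nat.cast_ofNat]
    ring
  rw [hasDerivAt_pi]
  intro i
  rw [matOp_apply, matOp_apply, matOp_apply, matOp_apply]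
  revert i
  refine forall_fin_three ?_ ?_ ?_
  · refine (hspin η 0).congr_deriv ?_
    simp [linMat, cubeMat, sub_eq_add_neg]
  · refine (hspin (-η) 1).congr_deriv ?_
    simp [linMat, cubeMat, sub_eq_add_neg]
  · refine ((h 2).add (((((h 0).fun_pow 6).add ((h 1).fun_pow 6)).sub_const ρ).const_smul
      (4 * Real.pi))).congr_deriv ?_
    refine ext_ev fun x => ?_
    simp [linMat, cubeMat, ev_natCast, -Nat.cast_ofNat]
    ring

/-- The derivative of a differentiable map is computed along lines. -/
theorem fderiv_eq_of_line {E F : Type*} [NormedAddCommGroup E] [NormedSpace ℝ E]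
    [NormedAddCommGroup F] [NormedSpace ℝ F] {f : E → F} {u v : E} {d : F}
    (hf : DifferentiableAt ℝ f u) (h : HasDerivAt (fun t : ℝ => f (u + t • v)) d 0) :
    fderiv ℝ f u v = d := by
  have h1 : HasDerivAt (fun t : ℝ => u + t • v) v 0 := by
    simpa using ((hasDerivAt_id (0 : ℝ)).smul_const v).const_add u
  have h2 : HasFDerivAt f (fderiv ℝ f u) (u + (0 : ℝ) • v) := by simpa using hf.hasFDerivAt
  exact (h2.comp_hasDerivAt (0 : ℝ) h1).unique h

theorem fderiv_cube (y : Triple b) : fderiv ℝ cube y = matOp (cubeMat y) :=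
  ContinuousLinearMap.ext fun z => fderiv_eq_of_line
    ((contDiff_cube (m := 1)).differentiable one_ne_zero y) (hasDerivAt_cube_line y z)

/-- The derivative of the cell problem with respect to the state factors through the linearization
in the densities. -/
theorem fderiv_cellMap_inr (ρ : Wiener b) (η : ℝ) (y : Triple b) :
    fderiv ℝ (cellMap ρ) (η, y) ∘L .inr ℝ ℝ (Triple b)
      = (linOp η y).comp (matOp (cubeMat y)) := by
  refine ContinuousLinearMap.ext fun z => ?_
  refine fderiv_eq_of_line ((contDiff_cellMap ρ (m := 1)).differentiable one_ne_zero _) ?_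
  have h := (hasDerivAt_cube_line y z).sub
    (((res3 b).hasFDerivAt).comp_hasDerivAt (0 : ℝ) (hasDerivAt_source_line ρ η y z))
  refine (HasDerivAt.congr_deriv h ?_).congr_of_eventuallyEq (Eventually.of_forall fun t => ?_)
  · simp [linOp]
  · simp [cellMap]

/-- The derivative of `w ↦ w³` is multiplication by `3 w²`, which is invertible if `w` is. -/
theorem isInvertible_cubeMat {y : Triple b} {y' : Fin 3 → Wiener b} (h0 : y 0 * y' 0 = 1)
    (h1 : y 1 * y' 1 = 1) : (matOp (cubeMat y)).IsInvertible := by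
  have e : ∀ i, y i * y' i = 1 → ∀ a : Wiener b,
      (3 : ℝ) • y i ^ 2 * ((1 / 3 : ℝ) • y' i ^ 2 * a) = a := fun i hi a => by
    rw [smul_mul_assoc, smul_mul_assoc, mul_smul_comm, smul_smul, ← mul_assoc, ← mul_pow, hi]
    norm_num
  have e' : ∀ i, y i * y' i = 1 → ∀ a : Wiener b,
      (1 / 3 : ℝ) • y' i ^ 2 * ((3 : ℝ) • y i ^ 2 * a) = a := fun i hi a => by
    rw [smul_mul_assoc, smul_mul_assoc, mul_smul_comm, smul_smul, ← mul_assoc, ← mul_pow,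
      mul_comm (y' i), hi]
    norm_num
  refine ContinuousLinearMap.IsInvertible.of_inverse
    (g := matOp ![![(1 / 3 : ℝ) • y' 0 ^ 2, 0, 0], ![0, (1 / 3 : ℝ) • y' 1 ^ 2, 0], ![0, 0, 1]])
    ?_ ?_
  · refine ContinuousLinearMap.ext fun z => funext fun i => ?_
    rw [ContinuousLinearMap.comp_apply, matOp_apply, matOp_apply, matOp_apply, matOp_apply]
    revert i
    refine forall_fin_three ?_ ?_ ?_
    · simpa [cubeMat] using e 0 h0 (z 0)
    · simpa [cubeMat] using e 1 h1 (z 1)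
    · simp [cubeMat]
  · refine ContinuousLinearMap.ext fun z => funext fun i => ?_
    rw [ContinuousLinearMap.comp_apply, matOp_apply, matOp_apply, matOp_apply, matOp_apply]
    revert i
    refine forall_fin_three ?_ ?_ ?_
    · simpa [cubeMat] using e' 0 h0 (z 0)
    · simpa [cubeMat] using e' 1 h1 (z 1)
    · simp [cubeMat]

/-! ### The differential equations in terms of the Wiener algebra -/

theorem ev_cube0 (x : Space) (y : Triple b) : ev x (cube y 0) = ev x (y 0) ^ 3 := by simp [cube]

theorem ev_cube1 (x : Space) (y : Triple b) : ev x (cube y 1) = ev x (y 1) ^ 3 := by simp [cube]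

theorem cube_two (y : Triple b) : cube y 2 = y 2 := rfl

/-- On `ν = w³` the powers that occur in the equations are polynomial in `w` and `w⁻¹`. -/
theorem cube_rpow {w : ℝ} (hw : 0 < w) :
    (w ^ 3) ^ (7 / 3 : ℝ) = w ^ 7 ∧ (w ^ 3) ^ (5 / 3 : ℝ) = w ^ 5 ∧ (w ^ 3) ^ (4 / 3 : ℝ) = w ^ 4 ∧
      (w ^ 3) ^ (2 / 3 : ℝ) = w ^ 2 ∧ (w ^ 3) ^ (1 / 3 : ℝ) = w ∧
      (w ^ 3) ^ (-(1 / 3) : ℝ) = w⁻¹ := by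
  have h : ∀ a : ℝ, (w ^ 3) ^ a = w ^ (3 * a) := fun a => by
    rw [← Real.rpow_natCast, ← Real.rpow_mul hw.le]; norm_num
  have h' : ∀ m : ℕ, w ^ m = w ^ (m : ℝ) := fun m => (Real.rpow_natCast w m).symm
  refine ⟨?_, ?_, ?_, ?_, ?_, ?_⟩ <;> rw [h]
  · rw [h' 7]; norm_num
  · rw [h' 5]; norm_num
  · rw [h' 4]; norm_num
  · rw [h' 2]; norm_num
  · norm_num
  · rw [← Real.rpow_neg_one]; norm_num

/-- Solutions of the Euler--Lagrange equations with constant field, in terms of the prescribed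
values of `u - Δu`. -/
theorem eulerLagrange_iff {k : ℕ} {ρb : Space → ℝ} {ρ : Wiener b} (hρ : ∀ x, ev x ρ = ρb x) (η : ℝ)
    {y : Triple b} (hy0 : ∀ x, 0 < ev x (y 0)) (hy1 : ∀ x, 0 < ev x (y 1)) {u : Fin 3 → H b k 1}
    (hu : ∀ i, toL2 (u i) =ᵐ[cellMeasure b 1] fun x => ev x (cube y i)) :
    EulerLagrange ρb (fun _ => η) u ↔ ∀ i, ∀ᵐ x ∂(cellMeasure b 1),
      toL2 (u i) x - lap (u i) x = ev x (source ρ η y i) := by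
  have h0 := hu 0
  have h1 := hu 1
  have h2 := hu 2
  have hiff : EulerLagrange ρb (fun _ => η) u ↔ ∀ᵐ x ∂(cellMeasure b 1),
      ∀ i, toL2 (u i) x - lap (u i) x = ev x (source ρ η y i) := by
    have : ∀ᵐ x ∂(cellMeasure b 1), ((-(lap (u 0) x) + 5 / 3 * (toL2 (u 0) x) ^ (7 / 3 : ℝ)
        - 4 / 3 * (toL2 (u 0) x) ^ (5 / 3 : ℝ) + (toL2 (u 2) x - η) * toL2 (u 0) x = 0) ∧
      (-(lap (u 1) x) + 5 / 3 * (toL2 (u 1) x) ^ (7 / 3 : ℝ) - 4 / 3 * (toL2 (u 1) x) ^ (5 / 3 : ℝ)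
        + (toL2 (u 2) x + η) * toL2 (u 1) x = 0) ∧
      (-(lap (u 2) x) = 4 * Real.pi * ((toL2 (u 0) x) ^ 2 + (toL2 (u 1) x) ^ 2 - ρb x))) ↔
        ∀ i, toL2 (u i) x - lap (u i) x = ev x (source ρ η y i) := by
      filter_upwards [h0, h1, h2] with x h0 h1 h2
      rw [h0, h1, h2, ev_cube0, ev_cube1, cube_two]
      obtain ⟨a7, a5, -⟩ := cube_rpow (hy0 x)
      obtain ⟨b7, b5, -⟩ := cube_rpow (hy1 x)
      rw [a7, a5, b7, b5]
      have e0 : ev x (source ρ η y 0) = ev x (y 0) ^ 3 - 5 / 3 * ev x (y 0) ^ 7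
          + 4 / 3 * ev x (y 0) ^ 5 - (ev x (y 2) - η) * ev x (y 0) ^ 3 := by
        simp [source, spinSource]
      have e1 : ev x (source ρ η y 1) = ev x (y 1) ^ 3 - 5 / 3 * ev x (y 1) ^ 7
          + 4 / 3 * ev x (y 1) ^ 5 - (ev x (y 2) + η) * ev x (y 1) ^ 3 := by
        simp [source, spinSource]
      have e2 : ev x (source ρ η y 2) = ev x (y 2) + 4 * Real.pi * (ev x (y 0) ^ 6
          + ev x (y 1) ^ 6 - ρb x) := by
        simp [source, hρ]
      constructor
      · rintro ⟨g0, g1, g2⟩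
        refine forall_fin_three ?_ ?_ ?_
        · rw [e0, h0, ev_cube0]; linarith
        · rw [e1, h1, ev_cube1]; linarith
        · rw [e2, h2, cube_two]; linear_combination g2
      · intro g
        have g0 := g 0
        have g1 := g 1
        have g2 := g 2
        rw [e0, h0, ev_cube0] at g0
        rw [e1, h1, ev_cube1] at g1
        rw [e2, h2, cube_two] at g2
        exact ⟨by linarith, by linarith, by linear_combination g2⟩
    constructor
    · intro h
      filter_upwards [this, h] with x hx h
      exact hx.1 h
    · intro h
      filter_upwards [this, h] with x hx h
      exact hx.2 h
  rw [hiff, ae_all_iff]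

/-- The right-hand side of the linearized equations after solving for `ω - Δω`. -/
def linRhs (f : Fin 3 → ℝ) : Fin 3 → ℝ := ![f 0, f 1, -(8 * Real.pi) * f 2]

/-- The linearized equations at a state of the Wiener algebra with constant field, in terms of
the prescribed values of `ω - Δω`. -/
theorem linearizedEq_iff {k : ℕ} (η : ℝ) {y : Triple b} (hy0 : ∀ x, 0 < ev x (y 0))
    (hy1 : ∀ x, 0 < ev x (y 1)) {c : Fin 3 → Space → ℝ}
    (hc : ∀ i, c i =ᵐ[cellMeasure b 1] fun x => ev x (cube y i)) {z : Triple b}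
    {w : Fin 3 → H b k 1} (hw : ∀ i, toL2 (w i) =ᵐ[cellMeasure b 1] fun x => ev x (z i))
    (f : Fin 3 → Space → ℝ) :
    LinearizedEq c (fun _ => η) w f ↔ ∀ i, ∀ᵐ x ∂(cellMeasure b 1),
      toL2 (w i) x - lap (w i) x
        = ev x (matOp (linMat η y) z i) + linRhs (fun j => f j x) i := by
  have hiff : LinearizedEq c (fun _ => η) w f ↔ ∀ᵐ x ∂(cellMeasure b 1), ∀ i,
      toL2 (w i) x - lap (w i) x
        = ev x (matOp (linMat η y) z i) + linRhs (fun j => f j x) i := by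
    have : ∀ᵐ x ∂(cellMeasure b 1),
      ((-(lap (w 0) x) + 35 / 9 * (c 0 x) ^ (4 / 3 : ℝ) * toL2 (w 0) x
        - 20 / 9 * (c 0 x) ^ (2 / 3 : ℝ) * toL2 (w 0) x + (c 2 x - η) * toL2 (w 0) x
        + c 0 x * toL2 (w 2) x = f 0 x) ∧
      (-(lap (w 1) x) + 35 / 9 * (c 1 x) ^ (4 / 3 : ℝ) * toL2 (w 1) x
        - 20 / 9 * (c 1 x) ^ (2 / 3 : ℝ) * toL2 (w 1) x + (c 2 x + η) * toL2 (w 1) x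
        + c 1 x * toL2 (w 2) x = f 1 x) ∧
      (c 0 x * toL2 (w 0) x + c 1 x * toL2 (w 1) x + 1 / (8 * Real.pi) * lap (w 2) x = f 2 x)) ↔
      ∀ i, toL2 (w i) x - lap (w i) x
        = ev x (matOp (linMat η y) z i) + linRhs (fun j => f j x) i := by
      filter_upwards [hc 0, hc 1, hc 2, hw 0, hw 1, hw 2] with x c0 c1 c2 w0 w1 w2
      rw [c0, c1, c2, w0, w1, w2, ev_cube0, ev_cube1, cube_two]
      obtain ⟨-, -, a4, a2, -⟩ := cube_rpow (hy0 x)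
      obtain ⟨-, -, b4, b2, -⟩ := cube_rpow (hy1 x)
      rw [a4, a2, b4, b2]
      have e0 : ev x (matOp (linMat η y) z 0) = (1 - 35 / 9 * ev x (y 0) ^ 4
          + 20 / 9 * ev x (y 0) ^ 2 - (ev x (y 2) - η)) * ev x (z 0)
          - ev x (y 0) ^ 3 * ev x (z 2) := by
        rw [matOp_apply]; simp [linMat, spinCoef, sub_eq_add_neg]
      have e1 : ev x (matOp (linMat η y) z 1) = (1 - 35 / 9 * ev x (y 1) ^ 4
          + 20 / 9 * ev x (y 1) ^ 2 - (ev x (y 2) + η)) * ev x (z 1)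
          - ev x (y 1) ^ 3 * ev x (z 2) := by
        rw [matOp_apply]; simp [linMat, spinCoef, sub_eq_add_neg]
      have e2 : ev x (matOp (linMat η y) z 2) = 8 * Real.pi * ev x (y 0) ^ 3 * ev x (z 0)
          + 8 * Real.pi * ev x (y 1) ^ 3 * ev x (z 1) + ev x (z 2) := by
        rw [matOp_apply]; simp [linMat, mul_assoc]
      have hpi := Real.pi_pos
      have r0 : linRhs (fun j => f j x) 0 = f 0 x := rfl
      have r1 : linRhs (fun j => f j x) 1 = f 1 x := rfl
      have r2 : linRhs (fun j => f j x) 2 = -(8 * Real.pi) * f 2 x := rfl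
      constructor
      · rintro ⟨g0, g1, g2⟩
        refine forall_fin_three ?_ ?_ ?_
        · rw [e0, w0, r0]; linarith
        · rw [e1, w1, r1]; linarith
        · rw [e2, w2, r2, ← g2]; field_simp; ring
      · intro g
        have g0 := g 0
        have g1 := g 1
        have g2 := g 2
        rw [e0, w0, r0] at g0
        rw [e1, w1, r1] at g1
        rw [e2, w2, r2] at g2
        refine ⟨by linarith, by linarith, ?_⟩
        have : lap (w 2) x = ev x (z 2) - (8 * Real.pi * ev x (y 0) ^ 3 * ev x (z 0)
          + 8 * Real.pi * ev x (y 1) ^ 3 * ev x (z 1) + ev x (z 2) + -(8 * Real.pi) * f 2 x) := by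
          linarith
        rw [this]; field_simp; ring
    constructor
    · intro h
      filter_upwards [this, h] with x hx h
      exact hx.1 h
    · intro h
      filter_upwards [this, h] with x hx h
      exact hx.2 h
  rw [hiff, ae_all_iff]

/-- The resolvent of an element of the Wiener algebra, as an element of `H²`. -/
theorem exists_res_H2 (a : Wiener b) : ∃ f : H b 2 1,
    (toL2 f =ᵐ[cellMeasure b 1] fun x => ev x (res b a)) ∧
    ∀ᵐ x ∂(cellMeasure b 1), toL2 f x - lap f x = ev x a := by
  have hc := memLp_of_continuous (b := b) (n := 1) (continuous_ev a) 2
  obtain ⟨f, hf⟩ := exists_resolvent hc.toLp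
  have h1 : ∀ᵐ x ∂(cellMeasure b 1), toL2 f x - lap f x = ev x a := by
    filter_upwards [Lp.coeFn_sub (toL2 f) (lap f), hc.coeFn_toLp] with x h1 h2
    rw [← h2, ← hf, h1, Pi.sub_apply]
  refine ⟨f, ?_, h1⟩
  rw [toL2_eq_of_sub_lap le_rfl f h1]
  exact toL2_resH a

/-- On the unit cell the periodic extension is the function itself. -/
theorem perExt_ae_eq {k : ℕ} (f : H b k 1) {φ : Space → ℝ} (h : toL2 f =ᵐ[cellMeasure b 1] φ) :
    perExt f =ᵐ[cellMeasure b 1] φ := by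
  filter_upwards [h, ae_mem_cell (b := b) (n := 1)] with x hx hm
  have : (ZSpan.fract b x : Space) = x := by
    rw [cell_one_eq_fundamentalDomain] at hm
    exact ZSpan.fract_eq_self.2 hm
  rw [perExt, this, hx]

/-- Under the stability assumption the linearized cell problem is uniquely solvable: the operator
is a compact perturbation of the identity, so that uniqueness suffices. -/
theorem isUnit_linOp {uper : Fin 3 → H b 2 1} (hstab : Stability uper) {y : Triple b}
    (hy0 : ∀ x, 0 < ev x (y 0)) (hy1 : ∀ x, 0 < ev x (y 1))
    (hu : ∀ i, toL2 (uper i) =ᵐ[cellMeasure b 1] fun x => ev x (cube y i)) :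
    IsUnit (linOp 0 y) := by
  have hcomp : IsCompactOperator ((res3 b).comp (matOp (linMat 0 y))) :=
    (isCompactOperator_res3 b).comp_clm (matOp (linMat 0 y))
  have hc : ∀ i, perExt (uper i) =ᵐ[cellMeasure b 1] fun x => ev x (cube y i) := fun i =>
    perExt_ae_eq _ (hu i)
  -- Fredholm alternative: otherwise there is `z ≠ 0` with `(1 - Δ)⁻¹ B z = z`, and `z` would be a
  -- nontrivial solution of the homogeneous linearized equations in `H²`
  rcases hcomp.hasEigenvalue_or_mem_resolventSet (μ := (1 : ℝ)) one_ne_zero with h | h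
  · exfalso
    obtain ⟨z, hz⟩ := h.exists_hasEigenvector
    have hz1 : res3 b (matOp (linMat 0 y) z) = z := by
      have := hz.apply_eq_smul
      simpa using this
    choose f hf1 hf2 using fun i => exists_res_H2 (matOp (linMat 0 y) z i)
    have hf3 : ∀ i, toL2 (f i) =ᵐ[cellMeasure b 1] fun x => ev x (z i) := fun i => by
      have := congrFun hz1 i
      rw [res3_apply] at this
      simpa only [this] using hf1 i
    obtain ⟨M, hM⟩ := hstab
    obtain ⟨w, -, hw, -⟩ := hM 1 le_rfl 0
    have h0 : ∀ i, ((0 : Fin 3 → L2 b 1) i : Space → ℝ) =ᵐ[cellMeasure b 1] fun _ => 0 := fun i =>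
      Lp.coeFn_zero ℝ 2 (cellMeasure b 1)
    have hr : ∀ i, ∀ᵐ x ∂(cellMeasure b 1),
        linRhs (fun j => ((0 : Fin 3 → L2 b 1) j : Space → ℝ) x) i = 0 := fun i => by
      filter_upwards [h0 0, h0 1, h0 2] with x h0 h1 h2
      have e : (fun j => ((0 : Fin 3 → L2 b 1) j : Space → ℝ) x) = 0 :=
        funext (forall_fin_three h0 h1 h2)
      rw [e]
      revert i
      refine forall_fin_three ?_ ?_ ?_ <;> simp [linRhs]
    have e1 := hw f ((linearizedEq_iff 0 hy0 hy1 hc hf3 _).2 fun i => by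
      filter_upwards [hf2 i, hr i] with x h1 h2
      rw [h1, h2, add_zero])
    have hz0 : ∀ i, toL2 (0 : H b 2 1) =ᵐ[cellMeasure b 1] fun x => ev x ((0 : Triple b) i) := fun i => by
      filter_upwards [Lp.coeFn_zero ℝ 2 (cellMeasure b 1)] with x h1
      rw [Pi.zero_apply, map_zero]; exact h1
    have hlap : lap (0 : H b 2 1) =ᵐ[cellMeasure b 1] fun _ => 0 := by
      have : lap (0 : H b 2 1) = 0 := by
        have h1 := norm_lap_le (0 : H b 2 1)
        rw [norm_zero, mul_zero] at h1
        exact norm_le_zero_iff.1 h1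
      rw [this]
      exact Lp.coeFn_zero ℝ 2 (cellMeasure b 1)
    have e2 := hw 0 ((linearizedEq_iff (w := fun _ => (0 : H b 2 1)) 0 hy0 hy1 hc hz0 _).2 fun i => by
      filter_upwards [hz0 i, hlap, hr i] with x h1 h2 h3
      rw [h1, h2, h3]; simp)
    refine hz.2 (funext fun i => ext_ev_ae ?_)
    have e3 := congrFun (e1.trans e2.symm) i
    filter_upwards [hf3 i, hz0 i] with x h1 h2
    rw [← h1, e3]
    exact h2
  · have := spectrum.mem_resolventSet_iff.1 h
    simpa [linOp] using this

end Wiener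

namespace Wiener

/-! ### The Cauchy--Born branch -/

/-- An element with an inverse in the algebra is bounded away from zero, so positivity is an open
condition there. -/
theorem eventually_pos {w w' : Wiener b} (h : w * w' = 1) (hw : ∀ x, 0 < ev x w) :
    ∀ᶠ v in 𝓝 w, ∀ x, 0 < ev x v := by
  have hp : 0 < ‖w'‖ + 1 := by positivity
  have hlow : ∀ x, (‖w'‖ + 1)⁻¹ ≤ ev x w := fun x => by
    have h1 : ev x w * ev x w' = 1 := by rw [← ev_mul, h, ev_one]
    have h2 := (le_abs_self _).trans (abs_ev_le x w')
    rw [inv_le_iff_one_le_mul₀ hp]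
    nlinarith [hw x]
  filter_upwards [Metric.ball_mem_nhds w (inv_pos.2 hp)] with v hv x
  have h1 := abs_ev_le x (v - w)
  rw [map_sub] at h1
  rw [Metric.mem_ball, dist_eq_norm] at hv
  have := (abs_le.1 h1).1
  linarith [hlow x]

/-- The implicit function theorem for `cellMap` at the unperturbed state, with the uniqueness
neighbourhood written as a product. -/
theorem exists_implicit (ρ : Wiener b) {y y' : Triple b} (h0 : y 0 * y' 0 = 1)
    (h1 : y 1 * y' 1 = 1) (hy : cellMap ρ (0, y) = 0) (hunit : IsUnit (linOp 0 y)) :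
    ∃ Y : ℝ → Triple b, Y 0 = y ∧ ContDiffAt ℝ ω Y 0 ∧ (∀ᶠ η in 𝓝 (0 : ℝ), cellMap ρ (η, Y η) = 0) ∧
      ∃ p : ℝ → Prop, (∀ᶠ η in 𝓝 (0 : ℝ), p η) ∧ ∃ q : Triple b → Prop, (∀ᶠ v in 𝓝 y, q v) ∧
        ∀ {η}, p η → ∀ {v}, q v → (cellMap ρ (η, v) = 0 ↔ Y η = v) := by
  have hcube := isInvertible_cubeMat h0 h1
  have hlin : (linOp 0 y).IsInvertible := by
    obtain ⟨u, hu⟩ := hunit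
    rw [← hu]
    exact ContinuousLinearMap.IsInvertible.of_inverse (g := (↑u⁻¹ : Triple b →L[ℝ] Triple b))
      u.mul_inv u.inv_mul
  have cdf : ContDiffAt ℝ ω (cellMap ρ) ((0 : ℝ), y) := (contDiff_cellMap ρ).contDiffAt
  have if₂ : (fderiv ℝ (cellMap ρ) ((0 : ℝ), y) ∘L .inr ℝ ℝ (Triple b)).IsInvertible := by
    rw [fderiv_cellMap_inr]; exact hlin.comp hcube
  have hn : (ω : WithTop ℕ∞) ≠ 0 := by simp
  have hY1 := cdf.eventually_apply_implicitFunction hn if₂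
  rw [hy] at hY1
  have hYu := cdf.eventually_apply_eq_iff_implicitFunction hn if₂
  rw [nhds_prod_eq, hy] at hYu
  exact ⟨cdf.implicitFunction hn if₂, cdf.implicitFunction_apply_self hn if₂,
    cdf.contDiffAt_implicitFunction hn if₂, hY1, eventually_prod_iff.1 hYu⟩

/-- The implicit function theorem for the cell problem: a smooth branch of solutions through the
unperturbed state, which is locally unique also in terms of the densities. -/
theorem exists_branch (ρ : Wiener b) {y y' : Triple b} (h0 : y 0 * y' 0 = 1) (h1 : y 1 * y' 1 = 1)
    (hy0 : ∀ x, 0 < ev x (y 0)) (hy1 : ∀ x, 0 < ev x (y 1)) (hy : cellMap ρ (0, y) = 0)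
    (hunit : IsUnit (linOp 0 y)) :
    ∃ Y : ℝ → Triple b, Y 0 = y ∧ ∃ s > 0, ∀ᶠ η in 𝓝 (0 : ℝ),
      ContDiffAt ℝ ∞ Y η ∧ cellMap ρ (η, Y η) = 0 ∧ IsUnit (linOp η (Y η)) ∧
      IsUnit (Y η 0) ∧ IsUnit (Y η 1) ∧ (∀ x, 0 < ev x (Y η 0)) ∧ (∀ x, 0 < ev x (Y η 1)) ∧
      ∀ z : Triple b, ‖z - cube y‖ ≤ s → ∃ σ, cube σ = z ∧ (∀ x, 0 < ev x (σ 0)) ∧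
        (∀ x, 0 < ev x (σ 1)) ∧ (cellMap ρ (η, σ) = 0 → σ = Y η) := by
  obtain ⟨Y, hY0, hYs, hY1, p, hp, q, hq, hpq⟩ := exists_implicit ρ h0 h1 hy hunit
  have hYc : Tendsto Y (𝓝 0) (𝓝 y) := by
    have := hYs.continuousAt
    rwa [ContinuousAt, hY0] at this
  have hpos0 : ∀ᶠ v in 𝓝 y, ∀ x, 0 < ev x (v 0) :=
    (continuous_apply (0 : Fin 3)).continuousAt.eventually (eventually_pos h0 hy0)
  have hpos1 : ∀ᶠ v in 𝓝 y, ∀ x, 0 < ev x (v 1) :=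
    (continuous_apply (1 : Fin 3)).continuousAt.eventually (eventually_pos h1 hy1)
  have hu0 : ∀ᶠ v in 𝓝 y, IsUnit (v 0) :=
    (continuous_apply (0 : Fin 3)).continuousAt.eventually
      (Units.isOpen.mem_nhds (IsUnit.of_mul_eq_one _ h0))
  have hu1 : ∀ᶠ v in 𝓝 y, IsUnit (v 1) :=
    (continuous_apply (1 : Fin 3)).continuousAt.eventually
      (Units.isOpen.mem_nhds (IsUnit.of_mul_eq_one _ h1))
  have hul : ∀ᶠ η in 𝓝 (0 : ℝ), IsUnit (linOp η (Y η)) := by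
    have h2 : Tendsto (fun η => (η, Y η)) (𝓝 0) (𝓝 ((0 : ℝ), y)) := by
      rw [nhds_prod_eq]; exact tendsto_id.prodMk hYc
    have h3 : ∀ᶠ p in 𝓝 ((0 : ℝ), y), IsUnit (linOp p.1 p.2) :=
      (contDiff_linOp (b := b) (m := 0)).continuous.continuousAt.eventually
        (Units.isOpen.mem_nhds hunit)
    exact h2.eventually h3
  -- the local inverse of `cube`
  have hcube := isInvertible_cubeMat h0 h1
  obtain ⟨e, he⟩ := hcube
  have hcd : ContDiffAt ℝ 1 (cube : Triple b → Triple b) y := contDiff_cube.contDiffAt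
  have hfd : HasStrictFDerivAt (cube : Triple b → Triple b) (e : Triple b →L[ℝ] Triple b) y := by
    rw [he, ← fderiv_cube]
    exact hcd.hasStrictFDerivAt one_ne_zero
  have hinv := hfd.eventually_right_inverse
  have htend := hfd.localInverse_tendsto
  have hz : ∀ᶠ z in 𝓝 (cube y), ∃ σ, cube σ = z ∧ (∀ x, 0 < ev x (σ 0)) ∧
        (∀ x, 0 < ev x (σ 1)) ∧ q σ := by
    filter_upwards [hinv, htend.eventually hpos0, htend.eventually hpos1, htend.eventually hq]
      with z h1 h2 h3 h4
    exact ⟨_, h1, h2, h3, h4⟩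
  obtain ⟨s, hs, hsz⟩ := Metric.eventually_nhds_iff_ball.1 hz
  refine ⟨Y, hY0, s / 2, by positivity, ?_⟩
  filter_upwards [hYs.eventually (by simp), hY1, hul, hYc.eventually hu0, hYc.eventually hu1,
    hYc.eventually hpos0, hYc.eventually hpos1, hp] with η g1 g2 g3 g4 g5 g6 g7 g8
  refine ⟨g1.of_le le_top, g2, g3, g4, g5, g6, g7, fun z hz => ?_⟩
  obtain ⟨σ, k1, k2, k3, k4⟩ := hsz z (by
    rw [Metric.mem_ball, dist_eq_norm]; linarith)
  exact ⟨σ, k1, k2, k3, fun hσ => ((hpq g8 k4).1 hσ).symm⟩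

end Wiener

namespace Wiener

/-! ### The Cauchy--Born states in `H³` -/

/-- The resolvent from triples in the Wiener algebra to triples in `H³`. -/
def resH3 (b : Module.Basis (Fin 3) ℝ Space) : Triple b →L[ℝ] (Fin 3 → H b 3 1) :=
  ContinuousLinearMap.pi fun i => (resH b).comp (ContinuousLinearMap.proj i)

/-- The Sobolev embedding of triples in `H³` into triples in the Wiener algebra. -/
def ofH3Triple (b : Module.Basis (Fin 3) ℝ Space) : (Fin 3 → H b 3 1) →L[ℝ] Triple b :=
  ContinuousLinearMap.pi fun i => (ofH3 b).comp (ContinuousLinearMap.proj i)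

theorem contDiff_resH3 {m : WithTop ℕ∞} : ContDiff ℝ m (resH3 b) :=
  contDiff_pi.2 fun i => (resH b).contDiff.comp (contDiff_apply ℝ (Wiener b) i)

theorem ofH3Triple_resH3 (a : Triple b) : ofH3Triple b (resH3 b a) = res3 b a :=
  funext fun i => ofH3_resH (a i)

theorem sub_lap_resH (a : Wiener b) : ∀ᵐ x ∂(cellMeasure b 1),
    toL2 (resH b a) x - lap (resH b a) x = ev x a := by
  filter_upwards [toL2_resH a, lap_resH a] with x h1 h2
  rw [h1, h2, map_sub]; ring

/-- A smooth branch `η ↦ Y η` of solutions of the cell problem for `|η| < r` with invertible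
linearization. -/
structure IsBranch (ρ : Wiener b) (r : ℝ) (Y : ℝ → Triple b) : Prop where
  smooth : ∀ η ∈ Ioo (-r) r, ContDiffAt ℝ ∞ Y η
  solves : ∀ η ∈ Ioo (-r) r, cellMap ρ (η, Y η) = 0
  isUnit : ∀ η ∈ Ioo (-r) r, IsUnit (linOp η (Y η))
  isUnit0 : ∀ η ∈ Ioo (-r) r, IsUnit (Y η 0)
  isUnit1 : ∀ η ∈ Ioo (-r) r, IsUnit (Y η 1)
  pos0 : ∀ η ∈ Ioo (-r) r, ∀ x, 0 < ev x (Y η 0)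
  pos1 : ∀ η ∈ Ioo (-r) r, ∀ x, 0 < ev x (Y η 1)

/-- The Cauchy--Born state given by a branch. -/
def branchState (ρ : Wiener b) (Y : ℝ → Triple b) (η : ℝ) : Fin 3 → H b 3 1 :=
  resH3 b (source ρ η (Y η))

variable {ρ : Wiener b} {r : ℝ} {Y : ℝ → Triple b}

theorem IsBranch.res3_source (hY : IsBranch ρ r Y) {η : ℝ} (hη : η ∈ Ioo (-r) r) :
    res3 b (source ρ η (Y η)) = cube (Y η) :=
  (sub_eq_zero.1 (hY.solves η hη)).symm

theorem IsBranch.contDiffAt_source (hY : IsBranch ρ r Y) {η : ℝ} (hη : η ∈ Ioo (-r) r) :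
    ContDiffAt ℝ ∞ (fun η => source ρ η (Y η)) η :=
  ContDiffAt.comp (g := fun p : ℝ × Triple b => source ρ p.1 p.2) (f := fun η => (η, Y η)) η
    (contDiff_source ρ (m := ∞)).contDiffAt (contDiffAt_id.prodMk (hY.smooth η hη))

theorem IsBranch.contDiffAt_branchState (hY : IsBranch ρ r Y) {η : ℝ} (hη : η ∈ Ioo (-r) r) :
    ContDiffAt ℝ ∞ (branchState ρ Y) η :=
  (contDiff_resH3 (m := ∞)).contDiffAt.comp η (hY.contDiffAt_source hη)

theorem IsBranch.toL2_branchState (hY : IsBranch ρ r Y) {η : ℝ} (hη : η ∈ Ioo (-r) r) (i : Fin 3) :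
    toL2 (branchState ρ Y η i) =ᵐ[cellMeasure b 1] fun x => ev x (cube (Y η) i) := by
  rw [← hY.res3_source hη]
  exact toL2_resH _

/-- The cell problem is locally uniquely solved by the states of the branch. -/
theorem exists_isCauchyBorn {ρb : Space → ℝ} (hρ : ∀ x, ev x ρ = ρb x) {uper : Fin 3 → H b 2 1}
    (huper : EulerLagrange ρb (fun _ => 0) uper) {y y' : Triple b} (h0 : y 0 * y' 0 = 1)
    (h1 : y 1 * y' 1 = 1) (hy0 : ∀ x, 0 < ev x (y 0)) (hy1 : ∀ x, 0 < ev x (y 1))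
    (hu : ∀ i, toL2 (uper i) =ᵐ[cellMeasure b 1] fun x => ev x (cube y i))
    (hstab : Stability uper) {τ : ℝ} (hτ : 0 < τ) :
    ∃ r, ∃ Y : ℝ → Triple b, IsBranch ρ r Y ∧ ∃ h₀, 0 < h₀ ∧ h₀ < r ∧ h₀ ≤ τ ∧
      (∀ η ∈ Icc (-h₀) h₀, ‖cube (Y η) - cube y‖ ≤ τ) ∧ ∃ δ₁, 0 < δ₁ ∧
        IsCauchyBorn ρb uper h₀ δ₁ (branchState ρ Y) := by
  -- the unperturbed state is the zero `y` of the cell problem at `η = 0`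
  have hsrc := (eulerLagrange_iff hρ 0 hy0 hy1 hu).1 huper
  have hper : ∀ i, toL2 (uper i) = toL2 (resH3 b (source ρ 0 y) i) := fun i =>
    toL2_eq_of_sub_lap le_rfl (uper i) (hsrc i)
  have hy : cellMap ρ (0, y) = 0 := by
    refine sub_eq_zero.2 (funext fun i => ext_ev_ae ?_)
    filter_upwards [hu i, toL2_resH (source ρ 0 y i)] with x h1 h2
    have h3 : toL2 (uper i) x = toL2 (resH b (source ρ 0 y i)) x := by rw [hper i]; rfl
    rw [← h1, h3, h2]
    rfl
  obtain ⟨Y, hY0, s, hs, hev⟩ := exists_branch ρ h0 h1 hy0 hy1 hy (isUnit_linOp hstab hy0 hy1 hu)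
  obtain ⟨r, hr, hball⟩ := Metric.eventually_nhds_iff_ball.1 hev
  have hmem : ∀ {η}, η ∈ Ioo (-r) r → η ∈ Metric.ball (0 : ℝ) r := fun {η} h => by
    rw [Metric.mem_ball, dist_zero_right, Real.norm_eq_abs, abs_lt]; exact h
  have hB : IsBranch ρ r Y :=
    ⟨fun η h => (hball η (hmem h)).1, fun η h => (hball η (hmem h)).2.1,
      fun η h => (hball η (hmem h)).2.2.1, fun η h => (hball η (hmem h)).2.2.2.1,
      fun η h => (hball η (hmem h)).2.2.2.2.1, fun η h => (hball η (hmem h)).2.2.2.2.2.1,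
      fun η h => (hball η (hmem h)).2.2.2.2.2.2.1⟩
  have h0r : (0 : ℝ) ∈ Ioo (-r) r := ⟨by linarith, hr⟩
  -- `δ₁`-balls in `H³` are mapped into the uniqueness ball of radius `s` in the Wiener algebra
  set δ₁ := s / (‖ofH3Triple b‖ + 1) with hδ
  have hδ₁ : 0 < δ₁ := by positivity
  have c1 : ∀ᶠ η in 𝓝 (0 : ℝ), ‖branchState ρ Y η - branchState ρ Y 0‖ < δ₁ := by
    have := (hB.contDiffAt_branchState h0r).continuousAt
    have h2 := Metric.tendsto_nhds.1 this δ₁ hδ₁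
    simpa only [dist_eq_norm] using h2
  have c2 : ∀ᶠ η in 𝓝 (0 : ℝ), ‖cube (Y η) - cube y‖ < τ := by
    have : ContinuousAt (fun η => cube (Y η)) 0 :=
      ((contDiff_cube (m := 0)).continuous.continuousAt).comp (hB.smooth 0 h0r).continuousAt
    have h2 := Metric.tendsto_nhds.1 this τ hτ
    simpa only [dist_eq_norm, hY0] using h2
  obtain ⟨t, ht, htball⟩ := Metric.eventually_nhds_iff_ball.1 (c1.and c2)
  set h₀ := min (min (t / 2) (r / 2)) τ with hh
  have hh0 : 0 < h₀ := by positivity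
  have hht : h₀ ≤ t / 2 := (min_le_left _ _).trans (min_le_left _ _)
  have hhr : h₀ ≤ r / 2 := (min_le_left _ _).trans (min_le_right _ _)
  have hIt : ∀ η ∈ Icc (-h₀) h₀, η ∈ Metric.ball (0 : ℝ) t := fun η h => by
    rw [Metric.mem_ball, dist_zero_right, Real.norm_eq_abs, abs_lt]
    exact ⟨by linarith [h.1], by linarith [h.2]⟩
  have hIr : ∀ η ∈ Icc (-h₀) h₀, η ∈ Ioo (-r) r := fun η h =>
    ⟨by linarith [h.1], by linarith [h.2]⟩
  refine ⟨r, Y, hB, h₀, hh0, by linarith, min_le_right _ _,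
    fun η h => (htball η (hIt η h)).2.le, δ₁, hδ₁, ?_, ?_, ?_⟩
  · exact fun η h => (hB.contDiffAt_branchState (hIr η h)).contDiffWithinAt
  · intro i
    rw [hper i, branchState, hY0]
  · intro η hη v
    have hηr := hIr η hη
    constructor
    · -- a nearby solution `v` is `cube σ` with `σ` near `y`, and `σ` solves the cell problem
      rintro ⟨hEL, hv⟩
      have e0 : ofH3Triple b (branchState ρ Y 0) = cube y := by
        rw [branchState, ofH3Triple_resH3, hB.res3_source h0r, hY0]
      have hclose : ‖ofH3Triple b v - cube y‖ ≤ s := by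
        rw [← e0, ← map_sub]
        refine ((ofH3Triple b).le_opNorm _).trans ?_
        calc ‖ofH3Triple b‖ * ‖v - branchState ρ Y 0‖ ≤ (‖ofH3Triple b‖ + 1) * δ₁ := by
              gcongr; linarith
          _ = s := by rw [hδ]; field_simp
      obtain ⟨σ, k1, k2, k3, k4⟩ := (hball η (hmem hηr)).2.2.2.2.2.2.2 _ hclose
      have hv2 : ∀ i, toL2 (v i) =ᵐ[cellMeasure b 1] fun x => ev x (cube σ i) := fun i => by
        rw [k1]; exact toL2_ae_eq_ofH3 (v i)
      have h3 := (eulerLagrange_iff hρ η k2 k3 hv2).1 hEL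
      have h4 : v = resH3 b (source ρ η σ) := funext fun i => eq_resH_of_sub_lap (v i) (h3 i)
      have h5 : σ = Y η := k4 (by
        rw [cellMap, k1, h4, ofH3Triple_resH3, sub_self])
      rw [h4, h5, branchState]
    · rintro rfl
      refine ⟨?_, (htball η (hIt η hη)).1.le⟩
      exact (eulerLagrange_iff hρ η (hB.pos0 η hηr) (hB.pos1 η hηr)
        (hB.toL2_branchState hηr)).2 fun i => sub_lap_resH _

/-! ### Solving the linearized cell problem -/

/-- The operator that maps `g` to the value of `ω - Δω` for the solution `ω` of the linearized
equations with right-hand side `g`. -/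
def solveOp (η : ℝ) (y : Triple b) : Triple b →L[ℝ] Triple b :=
  1 + (matOp (linMat η y)).comp ((Ring.inverse (linOp η y)).comp (res3 b))

/-- The linearized cell problem for the source `a = ω - Δω` reads `a = B (1 - Δ)⁻¹ a + g`, with
`B` the linearized source. -/
theorem eq_solveOp_iff {η : ℝ} {y : Triple b} (h : IsUnit (linOp η y)) (g a : Triple b) :
    a = matOp (linMat η y) (res3 b a) + g ↔ a = solveOp η y g := by
  obtain ⟨u, hu⟩ := h
  have hinv : Ring.inverse (linOp η y) = (↑u⁻¹ : Triple b →L[ℝ] Triple b) := by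
    rw [← hu, Ring.inverse_unit]
  have h1 : ∀ z, (↑u⁻¹ : Triple b →L[ℝ] Triple b) (linOp η y z) = z := fun z => by
    rw [← hu]; exact congrArg (fun T : Triple b →L[ℝ] Triple b => T z) u.inv_mul
  have h2 : ∀ z, linOp η y ((↑u⁻¹ : Triple b →L[ℝ] Triple b) z) = z := fun z => by
    rw [← hu]; exact congrArg (fun T : Triple b →L[ℝ] Triple b => T z) u.mul_inv
  have hlin : ∀ z, linOp η y z = z - res3 b (matOp (linMat η y) z) := fun z => rfl
  have hsol : solveOp η y g = g + matOp (linMat η y) ((↑u⁻¹ : Triple b →L[ℝ] Triple b) (res3 b g)) := by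
    rw [solveOp, hinv]; rfl
  constructor
  · intro ha
    have h3 : linOp η y (res3 b a) = res3 b g := by
      rw [hlin]
      nth_rewrite 1 [ha]
      rw [map_add]; abel
    rw [hsol, ← h3, h1, add_comm]
    exact ha
  · intro ha
    have h3 : res3 b a = (↑u⁻¹ : Triple b →L[ℝ] Triple b) (res3 b g) := by
      have := h2 (res3 b g)
      rw [hlin, sub_eq_iff_eq_add] at this
      rw [ha, hsol, map_add]
      exact this.symm
    rw [h3, ha, hsol, add_comm]

/-- Unique solvability of the linearized cell problem along the branch, for right-hand sides in the
Wiener algebra. -/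
theorem linearizedEq_branch_iff (hY : IsBranch ρ r Y) {η : ℝ} (hη : η ∈ Ioo (-r) r)
    (w : Fin 3 → H b 3 1) {f : Fin 3 → Space → ℝ} {g : Triple b}
    (hf : ∀ i, ∀ᵐ x ∂(cellMeasure b 1), linRhs (fun j => f j x) i = ev x (g i)) :
    LinearizedEq (fun i => toL2 (branchState ρ Y η i)) (fun _ => η) w f
      ↔ w = resH3 b (solveOp η (Y η) g) := by
  have h1 := linearizedEq_iff η (hY.pos0 η hη) (hY.pos1 η hη)
    (c := fun i => toL2 (branchState ρ Y η i)) (hY.toL2_branchState hη)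
    (z := ofH3Triple b w) (w := w) (fun i => toL2_ae_eq_ofH3 (w i)) f
  rw [h1]
  constructor
  · intro h
    have h2 : w = resH3 b (matOp (linMat η (Y η)) (ofH3Triple b w) + g) :=
      funext fun i => eq_resH_of_sub_lap (w i) (by
        filter_upwards [h i, hf i] with x h1 h2
        rw [h1, h2, ← map_add]; rfl)
    set a := matOp (linMat η (Y η)) (ofH3Triple b w) + g with ha
    have h3 : ofH3Triple b w = res3 b a := by rw [h2, ofH3Triple_resH3]
    rw [h3] at ha
    rw [h2, (eq_solveOp_iff (hY.isUnit η hη) g a).1 ha]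
  · rintro rfl i
    rw [ofH3Triple_resH3]
    have h3 := (eq_solveOp_iff (hY.isUnit η hη) g (solveOp η (Y η) g)).2 rfl
    filter_upwards [sub_lap_resH (solveOp η (Y η) g i), hf i] with x h1 h2
    rw [h2, ← map_add, ← Pi.add_apply, ← h3]
    exact h1

end Wiener

/-! ### Families of maps with uniformly bounded derivatives -/

section UniformlySmooth

variable {ι : Type*} {E F G : Type*} [NormedAddCommGroup E] [NormedSpace ℝ E]
  [NormedAddCommGroup F] [NormedSpace ℝ F] [NormedAddCommGroup G] [NormedSpace ℝ G]

/-- A family of smooth maps on `Space` whose derivatives up to order `m` are bounded, uniformly in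
the point and in the parameter of the family. -/
def UniformlySmooth (m : ℕ) (U : ι → Space → E) : Prop :=
  (∀ h, ContDiff ℝ ∞ (U h)) ∧ ∃ C, ∀ h, ∀ i ≤ m, ∀ x, ‖iteratedFDeriv ℝ i (U h) x‖ ≤ C

theorem natCast_le_smooth (i : ℕ) : (i : WithTop ℕ∞) ≤ ∞ := by exact_mod_cast le_top

namespace UniformlySmooth

variable {m : ℕ} {U : ι → Space → E} {V : ι → Space → F}

theorem mono {m' : ℕ} (hU : UniformlySmooth m U) (h : m' ≤ m) : UniformlySmooth m' U :=
  ⟨hU.1, hU.2.choose, fun s i hi => hU.2.choose_spec s i (hi.trans h)⟩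

theorem bound (hU : UniformlySmooth m U) : ∃ C, ∀ h x, ‖U h x‖ ≤ C := by
  obtain ⟨C, hC⟩ := hU.2
  exact ⟨C, fun h x => by simpa using hC h 0 (Nat.zero_le _) x⟩

theorem clm (L : E →L[ℝ] F) (hU : UniformlySmooth m U) :
    UniformlySmooth m fun h x => L (U h x) := by
  obtain ⟨C, hC⟩ := hU.2
  refine ⟨fun h => L.contDiff.comp (hU.1 h), ‖L‖ * C, fun h i hi x => ?_⟩
  refine (L.norm_iteratedFDeriv_comp_left (hU.1 h).contDiffAt (natCast_le_smooth i)).trans ?_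
  exact mul_le_mul_of_nonneg_left (hC h i hi x) (norm_nonneg _)

/-- Leibniz' rule. -/
theorem bilin (B : E →L[ℝ] F →L[ℝ] G) (hU : UniformlySmooth m U) (hV : UniformlySmooth m V) :
    UniformlySmooth m fun h x => B (U h x) (V h x) := by
  obtain ⟨C, hC⟩ := hU.2
  obtain ⟨D, hD⟩ := hV.2
  refine ⟨fun h => (B.contDiff.comp (hU.1 h)).clm_apply (hV.1 h), ‖B‖ * (2 ^ m * |C| * |D|),
    fun h i hi x => ?_⟩
  refine (B.norm_iteratedFDeriv_le_of_bilinear (hU.1 h) (hV.1 h) x (natCast_le_smooth i)).trans ?_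
  refine mul_le_mul_of_nonneg_left ?_ (norm_nonneg B)
  have h1 : ∀ j ∈ Finset.range (i + 1), (i.choose j : ℝ) * ‖iteratedFDeriv ℝ j (U h) x‖
      * ‖iteratedFDeriv ℝ (i - j) (V h) x‖ ≤ (i.choose j : ℝ) * (|C| * |D|) := fun j hj => by
    rw [mul_assoc]
    have hj' := Finset.mem_range_succ_iff.1 hj
    refine mul_le_mul_of_nonneg_left (mul_le_mul ((hC h j (hj'.trans hi) x).trans (le_abs_self C))
      ((hD h (i - j) ((Nat.sub_le _ _).trans hi) x).trans (le_abs_self D)) (norm_nonneg _)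
      (abs_nonneg _)) (Nat.cast_nonneg _)
  refine (Finset.sum_le_sum h1).trans ?_
  rw [← Finset.sum_mul, mul_assoc]
  refine mul_le_mul_of_nonneg_right ?_ (by positivity)
  have h2 := Nat.sum_range_choose i
  have h3 : (∑ j ∈ Finset.range (i + 1), (i.choose j : ℝ)) = 2 ^ i := by exact_mod_cast h2
  rw [h3]
  exact pow_le_pow_right₀ one_le_two hi

theorem add {W : ι → Space → E} (hU : UniformlySmooth m U) (hW : UniformlySmooth m W) :
    UniformlySmooth m fun h x => U h x + W h x := by
  obtain ⟨C, hC⟩ := hU.2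
  obtain ⟨D, hD⟩ := hW.2
  refine ⟨fun h => (hU.1 h).add (hW.1 h), C + D, fun h i hi x => ?_⟩
  have e := fun_iteratedFDeriv_add_apply (𝕜 := ℝ) (i := i) (x := x)
    ((hU.1 h).of_le (natCast_le_smooth i)).contDiffAt
    ((hW.1 h).of_le (natCast_le_smooth i)).contDiffAt
  rw [e]
  exact (norm_add_le _ _).trans (add_le_add (hC h i hi x) (hD h i hi x))

theorem const (c : E) : UniformlySmooth m fun (_ : ι) (_ : Space) => c := by
  refine ⟨fun h => contDiff_const, ‖c‖, fun h i _ x => ?_⟩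
  rcases Nat.eq_zero_or_pos i with rfl | hi
  · simp
  · rw [iteratedFDeriv_const_of_ne (Nat.pos_iff_ne_zero.1 hi)]; simp

theorem sum {κ : Type*} (s : Finset κ) {W : κ → ι → Space → E}
    (h : ∀ k, UniformlySmooth m (W k)) : UniformlySmooth m fun p x => ∑ k ∈ s, W k p x := by
  classical
  induction s using Finset.induction_on with
  | empty => simpa using const (0 : E)
  | insert k s hk ih => simpa only [Finset.sum_insert hk] using (h k).add ih

theorem pi {U : ι → Space → Fin 3 → E} (h : ∀ i, UniformlySmooth m fun p x => U p x i) :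
    UniformlySmooth m U := by
  have h1 := sum Finset.univ fun i => (h i).clm (ContinuousLinearMap.single ℝ (fun _ : Fin 3 => E) i)
  have e : (fun p x => ∑ i, ContinuousLinearMap.single ℝ (fun _ : Fin 3 => E) i (U p x i)) = U := by
    funext p x
    exact Finset.univ_sum_single (U p x)
  rwa [e] at h1

theorem fderiv (hU : UniformlySmooth (m + 1) U) (v : Space) :
    UniformlySmooth m fun h x => fderiv ℝ (U h) x v := by
  obtain ⟨C, hC⟩ := hU.2
  refine clm (ContinuousLinearMap.apply ℝ E v) (U := fun h x => _root_.fderiv ℝ (U h) x)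
    ⟨fun h => (hU.1 h).fderiv_right (by simp), C, fun h i hi x => ?_⟩
  rw [norm_iteratedFDeriv_fderiv]
  exact hC h (i + 1) (by omega) x

/-- Composition with a smooth function on a compact interval: Faà di Bruno's formula bounds the
derivatives of order at most `m` by those of the inner maps. -/
theorem comp {F : ℝ → E} {h₀ : ℝ} (hh₀ : 0 < h₀) (hF : ContDiffOn ℝ ∞ F (Icc (-h₀) h₀))
    {φ : ι → Space → ℝ} (hφ : UniformlySmooth m φ) (hmem : ∀ h x, φ h x ∈ Icc (-h₀) h₀)
    (hsm : ∀ h, ContDiff ℝ ∞ fun x => F (φ h x)) :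
    UniformlySmooth m fun h x => F (φ h x) := by
  obtain ⟨D, hD⟩ := hφ.2
  have hu : UniqueDiffOn ℝ (Icc (-h₀) h₀) := uniqueDiffOn_Icc (by linarith)
  have hb : ∀ i : ℕ, ∃ C, ∀ t ∈ Icc (-h₀) h₀, ‖iteratedFDerivWithin ℝ i F (Icc (-h₀) h₀) t‖ ≤ C :=
    fun i => isCompact_Icc.exists_bound_of_continuousOn
      (hF.continuousOn_iteratedFDerivWithin (natCast_le_smooth i) hu)
  choose C hC using hb
  set C' := ∑ i ∈ Finset.range (m + 1), |C i| with hC'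
  set D' := max |D| 1 with hD'
  have hD1 : 1 ≤ D' := le_max_right _ _
  have hC0 : 0 ≤ C' := Finset.sum_nonneg fun _ _ => abs_nonneg _
  refine ⟨hsm, m.factorial * C' * D' ^ m, fun h i hi x => ?_⟩
  have h1 := norm_iteratedFDeriv_comp_le' (t := Icc (-h₀) h₀) (n := i)
    (range_subset_iff.2 fun y => hmem h y) hu hF (hφ.1 h) (natCast_le_smooth i) x (C := C') (D := D')
    (fun j hj => (hC j _ (hmem h x)).trans ((le_abs_self _).trans
      (Finset.single_le_sum (f := fun i => |C i|) (fun _ _ => abs_nonneg _)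
        (Finset.mem_range.2 (by omega)))))
    (fun j hj1 hj => (hD h j (hj.trans hi) x).trans ((le_abs_self D).trans ((le_max_left _ _).trans
      (le_self_pow₀ hD1 (by omega)))))
  refine h1.trans ?_
  have h2 : (i.factorial : ℝ) ≤ m.factorial := by exact_mod_cast Nat.factorial_le hi
  have h3 : D' ^ i ≤ D' ^ m := pow_le_pow_right₀ hD1 hi
  gcongr

end UniformlySmooth

end UniformlySmooth

namespace Wiener

section Partial

variable {E F : Type*} [NormedAddCommGroup E] [NormedSpace ℝ E] [NormedAddCommGroup F]
  [NormedSpace ℝ F]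

/-! ### Sources of the two-scale expansion -/

/-- The macroscopic partial derivative of a map with values in a normed space. -/
def pd (j : Fin 3) (U : Space → E) : Space → E := fun x => fderiv ℝ U x (unitVec j)

theorem contDiff_pd (j : Fin 3) {U : Space → E} (hU : ContDiff ℝ ∞ U) :
    ContDiff ℝ ∞ (pd j U) := (hU.fderiv_right (m := ∞) (by simp)).clm_apply contDiff_const

theorem pd_clm (j : Fin 3) (L : E →L[ℝ] F) {U : Space → E} (hU : ContDiff ℝ ∞ U) :
    pd j (fun x => L (U x)) = fun x => L (pd j U x) := by
  funext x
  have h := L.hasFDerivAt.comp x (hU.differentiable (by simp) x).hasFDerivAt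
  unfold pd
  have e : fderiv ℝ (fun x => L (U x)) x = L.comp (fderiv ℝ U x) := h.fderiv
  rw [e]
  rfl

theorem pd_add_smul (j : Fin 3) (ε : ℝ) {U V : Space → E} (hU : ContDiff ℝ ∞ U)
    (hV : ContDiff ℝ ∞ V) :
    pd j (fun x => U x + ε • V x) = fun x => pd j U x + ε • pd j V x := by
  funext x
  have h := (hU.differentiable (by simp) x).hasFDerivAt.add
    ((hV.differentiable (by simp) x).hasFDerivAt.const_smul ε)
  unfold pd
  have e : fderiv ℝ (fun x => U x + ε • V x) x = fderiv ℝ U x + ε • fderiv ℝ V x := h.fderiv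
  rw [e]
  rfl

theorem pd_add_period (j : Fin 3) {U : Space → E} (hU : ∀ i x, U (x + b i) = U x) :
    ∀ i x, pd j U (x + b i) = pd j U x := by
  intro i x
  have h : (fun y => U (y + b i)) = U := funext (hU i)
  unfold pd
  rw [← fderiv_comp_add_right, h]

end Partial

/-- The operator `∂_j (1 - Δ)⁻¹` on triples. -/
def resD3 (b : Module.Basis (Fin 3) ℝ Space) (j : Fin 3) : Triple b →L[ℝ] Triple b :=
  ContinuousLinearMap.pi fun i => (resD b j).comp (ContinuousLinearMap.proj i)

theorem resD3_apply (j : Fin 3) (y : Triple b) (i : Fin 3) : resD3 b j y i = resD b j (y i) := rfl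

/-- `2 ∇_x · ∇_z (1 - Δ_z)⁻¹ U`. -/
def mixOp (U : Space → Triple b) (x : Space) : Triple b :=
  ∑ j, (2 : ℝ) • resD3 b j (pd j U x)

/-- `Δ_x (1 - Δ_z)⁻¹ U`. -/
def lapOp (U : Space → Triple b) (x : Space) : Triple b := ∑ j, res3 b (pd j (pd j U) x)

/-- The coefficient of `ν₁²` in the second order cell problem at the state `ν₀ = w³`. -/
def quadCoef (w : Wiener b) : Wiener b :=
  (-(70 / 27) : ℝ) • w + (20 / 27 : ℝ) • Ring.inverse w

/-- The quadratic terms of the second order cell problem at the state `y` with first corrector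
`v`. -/
def quad (y v : Triple b) : Triple b :=
  ![quadCoef (y 0) * (v 0 * v 0) - v 2 * v 0, quadCoef (y 1) * (v 1 * v 1) - v 2 * v 1,
    (4 * Real.pi) • (v 0 * v 0 + v 1 * v 1)]

variable (ρ : Wiener b) (Y : ℝ → Triple b) (h : Space → ℝ)

/-- The value of `(1 - Δ_z) u₀`. -/
def src0 (x : Space) : Triple b := source ρ (h x) (Y (h x))

/-- The value of `(1 - Δ_z) u₁`. -/
def src1 (x : Space) : Triple b := solveOp (h x) (Y (h x)) (mixOp (src0 ρ Y h) x)

/-- The value of `(1 - Δ_z) u₂`. -/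
def src2 (x : Space) : Triple b :=
  solveOp (h x) (Y (h x)) (mixOp (src1 ρ Y h) x + lapOp (src0 ρ Y h) x
    + quad (Y (h x)) (res3 b (src1 ρ Y h x)))

variable {ρ Y h} {r : ℝ}

theorem IsBranch.contDiffAt_linOp (hY : IsBranch ρ r Y) {η : ℝ} (hη : η ∈ Ioo (-r) r) :
    ContDiffAt ℝ ∞ (fun η => linOp η (Y η)) η :=
  ContDiffAt.comp (g := fun p : ℝ × Triple b => linOp p.1 p.2) (f := fun η => (η, Y η)) η
    (contDiff_linOp (m := ∞)).contDiffAt (contDiffAt_id.prodMk (hY.smooth η hη))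

theorem IsBranch.contDiffAt_solveOp (hY : IsBranch ρ r Y) {η : ℝ} (hη : η ∈ Ioo (-r) r) :
    ContDiffAt ℝ ∞ (fun η => solveOp η (Y η)) η := by
  have h1 : ContDiffAt ℝ ∞ (fun η => matOp (linMat η (Y η))) η :=
    ContDiffAt.comp (g := fun p : ℝ × Triple b => matOp (linMat p.1 p.2)) (f := fun η => (η, Y η)) η
      (contDiff_matOp_linMat (m := ∞)).contDiffAt (contDiffAt_id.prodMk (hY.smooth η hη))
  obtain ⟨u, hu⟩ := hY.isUnit η hη
  have h2 : ContDiffAt ℝ ∞ (fun η => Ring.inverse (linOp η (Y η))) η :=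
    ContDiffAt.comp (g := Ring.inverse) (f := fun η => linOp η (Y η)) η
      (by rw [← hu]; exact contDiffAt_ringInverse ℝ u) (hY.contDiffAt_linOp hη)
  exact contDiffAt_const.add (h1.clm_comp (h2.clm_comp contDiffAt_const))

theorem contDiffAt_quadCoef {Z : ℝ → Wiener b} {η : ℝ} (hZ : ContDiffAt ℝ ∞ Z η)
    (hu : IsUnit (Z η)) : ContDiffAt ℝ ∞ (fun η => quadCoef (Z η)) η := by
  obtain ⟨u, hu⟩ := hu
  have h2 : ContDiffAt ℝ ∞ (fun η => Ring.inverse (Z η)) η :=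
    ContDiffAt.comp (g := Ring.inverse) (f := Z) η
      (by rw [← hu]; exact contDiffAt_ringInverse ℝ u) hZ
  exact (hZ.const_smul _).add (h2.const_smul _)

/-- An admissible field: smooth, with values in `[-h₀, h₀]` and derivatives up to order four bounded
by `K`. -/
structure Admissible (h₀ K : ℝ) (h : Space → ℝ) : Prop where
  smooth : ContDiff ℝ ∞ h
  abs_le : ∀ x, |h x| ≤ h₀
  deriv_le : ∀ j : ℕ, j ≤ 4 → ∀ x, ‖iteratedFDeriv ℝ j h x‖ ≤ K

section Uniform

variable {h₀ K : ℝ}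

theorem Admissible.mem {h : Space → ℝ} (hh : Admissible h₀ K h) (x : Space) :
    h x ∈ Icc (-h₀) h₀ := _root_.abs_le.1 (hh.abs_le x)

theorem uniformlySmooth_admissible (h₀ K : ℝ) :
    UniformlySmooth 4 fun h : {h : Space → ℝ // Admissible h₀ K h} => h.1 :=
  ⟨fun h => h.2.smooth, K, fun h j hj x => h.2.deriv_le j hj x⟩

/-- Composition of a smooth function on `(-r, r)` with the admissible fields. -/
theorem uniformlySmooth_comp {E : Type*} [NormedAddCommGroup E] [NormedSpace ℝ E] (hh₀ : 0 < h₀)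
    (hr : h₀ < r) {F : ℝ → E} (hF : ∀ η ∈ Ioo (-r) r, ContDiffAt ℝ ∞ F η) :
    UniformlySmooth 4 fun (h : {h : Space → ℝ // Admissible h₀ K h}) x => F (h.1 x) := by
  have hsub : ∀ η ∈ Icc (-h₀) h₀, η ∈ Ioo (-r) r := fun η hη =>
    ⟨by linarith [hη.1], by linarith [hη.2]⟩
  refine UniformlySmooth.comp hh₀ (fun η hη => (hF η (hsub η hη)).contDiffWithinAt)
    (uniformlySmooth_admissible h₀ K) (fun h x => h.2.mem x) fun h => ?_
  exact contDiff_iff_contDiffAt.2 fun x =>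
    (hF _ (hsub _ (h.2.mem x))).comp x h.2.smooth.contDiffAt

theorem uniformlySmooth_mixOp {ι : Type*} {m : ℕ} {U : ι → Space → Triple b}
    (hU : UniformlySmooth (m + 1) U) : UniformlySmooth m fun h => mixOp (U h) :=
  UniformlySmooth.sum Finset.univ fun j =>
    ((hU.fderiv (unitVec j)).clm (resD3 b j)).clm ((2 : ℝ) • ContinuousLinearMap.id ℝ (Triple b))

theorem uniformlySmooth_lapOp {ι : Type*} {m : ℕ} {U : ι → Space → Triple b}
    (hU : UniformlySmooth (m + 2) U) : UniformlySmooth m fun h => lapOp (U h) :=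
  UniformlySmooth.sum Finset.univ fun j =>
    ((hU.fderiv (unitVec j)).fderiv (unitVec j)).clm (res3 b)

theorem uniformlySmooth_src0 (hY : IsBranch ρ r Y) (hh₀ : 0 < h₀) (hr : h₀ < r) :
    UniformlySmooth 4 fun h : {h : Space → ℝ // Admissible h₀ K h} => src0 ρ Y h.1 :=
  uniformlySmooth_comp hh₀ hr fun _ hη => hY.contDiffAt_source hη

/-- Each corrector costs one derivative of the field. -/
theorem uniformlySmooth_src1 (hY : IsBranch ρ r Y) (hh₀ : 0 < h₀) (hr : h₀ < r) :
    UniformlySmooth 3 fun h : {h : Space → ℝ // Admissible h₀ K h} => src1 ρ Y h.1 :=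
  UniformlySmooth.bilin (ContinuousLinearMap.id ℝ (Triple b →L[ℝ] Triple b))
    ((uniformlySmooth_comp hh₀ hr fun _ hη => hY.contDiffAt_solveOp hη).mono (by norm_num))
    (uniformlySmooth_mixOp (uniformlySmooth_src0 hY hh₀ hr))

/-- Products of uniformly smooth families with values in the Wiener algebra. -/
theorem _root_.TFDW.UniformlySmooth.wienerMul {ι : Type*} {m : ℕ} {U V : ι → Space → Wiener b}
    (hU : UniformlySmooth m U) (hV : UniformlySmooth m V) :
    UniformlySmooth m fun h x => U h x * V h x :=
  UniformlySmooth.bilin (ContinuousLinearMap.mul ℝ (Wiener b)) hU hV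

theorem _root_.TFDW.UniformlySmooth.smul_const {ι E : Type*} [NormedAddCommGroup E]
    [NormedSpace ℝ E] {m : ℕ} {U : ι → Space → E} (c : ℝ) (hU : UniformlySmooth m U) :
    UniformlySmooth m fun h x => c • U h x :=
  hU.clm (c • ContinuousLinearMap.id ℝ E)

theorem _root_.TFDW.UniformlySmooth.sub {ι E : Type*} [NormedAddCommGroup E]
    [NormedSpace ℝ E] {m : ℕ} {U V : ι → Space → E} (hU : UniformlySmooth m U)
    (hV : UniformlySmooth m V) : UniformlySmooth m fun h x => U h x - V h x := by
  simpa [sub_eq_add_neg] using hU.add (hV.smul_const (-1))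

theorem uniformlySmooth_quad (hY : IsBranch ρ r Y) (hh₀ : 0 < h₀) (hr : h₀ < r) :
    UniformlySmooth 2 fun (h : {h : Space → ℝ // Admissible h₀ K h}) x =>
      quad (Y (h.1 x)) (res3 b (src1 ρ Y h.1 x)) := by
  have hv := ((uniformlySmooth_src1 (K := K) hY hh₀ hr).mono (m' := 2) (by norm_num)).clm (res3 b)
  have hv' : ∀ i, UniformlySmooth 2 fun (h : {h : Space → ℝ // Admissible h₀ K h}) x =>
      res3 b (src1 ρ Y h.1 x) i := fun i => hv.clm (ContinuousLinearMap.proj i)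
  have hq0 : UniformlySmooth 2 fun (h : {h : Space → ℝ // Admissible h₀ K h}) x =>
      quadCoef (Y (h.1 x) 0) := (uniformlySmooth_comp hh₀ hr fun η hη =>
    contDiffAt_quadCoef (Z := fun η => Y η 0) ((contDiffAt_pi.1 (hY.smooth η hη)) 0)
      (hY.isUnit0 η hη)).mono (by norm_num)
  have hq1 : UniformlySmooth 2 fun (h : {h : Space → ℝ // Admissible h₀ K h}) x =>
      quadCoef (Y (h.1 x) 1) := (uniformlySmooth_comp hh₀ hr fun η hη =>
    contDiffAt_quadCoef (Z := fun η => Y η 1) ((contDiffAt_pi.1 (hY.smooth η hη)) 1)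
      (hY.isUnit1 η hη)).mono (by norm_num)
  refine UniformlySmooth.pi (forall_fin_three ?_ ?_ ?_)
  · exact (hq0.wienerMul ((hv' 0).wienerMul (hv' 0))).sub ((hv' 2).wienerMul (hv' 0))
  · exact (hq1.wienerMul ((hv' 1).wienerMul (hv' 1))).sub ((hv' 2).wienerMul (hv' 1))
  · exact (((hv' 0).wienerMul (hv' 0)).add ((hv' 1).wienerMul (hv' 1))).smul_const (4 * Real.pi)

theorem uniformlySmooth_src2 (hY : IsBranch ρ r Y) (hh₀ : 0 < h₀) (hr : h₀ < r) :
    UniformlySmooth 2 fun h : {h : Space → ℝ // Admissible h₀ K h} => src2 ρ Y h.1 :=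
  UniformlySmooth.bilin (ContinuousLinearMap.id ℝ (Triple b →L[ℝ] Triple b))
    ((uniformlySmooth_comp hh₀ hr fun _ hη => hY.contDiffAt_solveOp hη).mono (by norm_num))
    (((uniformlySmooth_mixOp (uniformlySmooth_src1 hY hh₀ hr)).add
      (uniformlySmooth_lapOp (uniformlySmooth_src0 hY hh₀ hr))).add
      (uniformlySmooth_quad hY hh₀ hr))

end Uniform

/-! ### The correctors of the two-scale expansion -/

theorem hasFDerivAt_resH3_comp {U : Space → Triple b} (hU : ContDiff ℝ ∞ U) (x : Space) :
    HasFDerivAt (fun x => resH3 b (U x)) ((resH3 b).comp (fderiv ℝ U x)) x := by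
  have h1 : HasFDerivAt U (fderiv ℝ U x) x := (hU.differentiable (by simp) x).hasFDerivAt
  rw [hasFDerivAt_pi'] at h1 ⊢
  intro i
  have h2 : HasFDerivAt (fun x => resH b (U x i)) _ x := (resH b).hasFDerivAt.comp x (h1 i)
  refine HasFDerivAt.congr_fderiv (f := fun x => resH b (U x i)) h2 ?_
  exact ContinuousLinearMap.ext fun v => rfl

theorem dx_resH3 (j : Fin 3) {U : Space → Triple b} (hU : ContDiff ℝ ∞ U) :
    dx j (fun x => resH3 b (U x)) = fun x => resH3 b (pd j U x) := by
  funext x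
  unfold dx
  rw [(hasFDerivAt_resH3_comp hU x).fderiv]
  rfl

theorem ae_sum_L2 {n : ℕ} (f : Fin 3 → L2 b n) :
    ⇑(∑ j, f j) =ᵐ[cellMeasure b n] fun x => ∑ j, f j x := by
  simp only [Fin.sum_univ_three]
  filter_upwards [Lp.coeFn_add (f 0 + f 1) (f 2), Lp.coeFn_add (f 0) (f 1)] with x h1 h2
  rw [h1, Pi.add_apply, h2, Pi.add_apply]

/-- The cross term `2 ∇_x · ∇_z` of a two-scale function, through its source. -/
theorem two_mul_mixed_resH3 {U : Space → Triple b} (hU : ContDiff ℝ ∞ U) (x : Space) (i : Fin 3) :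
    (fun z => 2 * mixed (fun x => resH3 b (U x)) x i z)
      =ᵐ[cellMeasure b 1] fun z => ev z (mixOp U x i) := by
  unfold mixed
  have h1 : ∀ᵐ z ∂(cellMeasure b 1), ∀ j,
      wderiv (Pi.single j 1) (resH b (pd j U x i)) z = ev z (resD b j (pd j U x i)) :=
    ae_all_iff.2 fun j => wderiv_resH j _
  filter_upwards [ae_sum_L2 fun j => wderiv (Pi.single j 1) (dx j (fun x => resH3 b (U x)) x i),
    h1] with z hz hz1
  rw [hz, Finset.mul_sum, mixOp, Finset.sum_apply, map_sum]
  refine Finset.sum_congr rfl fun j _ => ?_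
  rw [dx_resH3 j hU]
  change 2 * (wderiv (Pi.single j 1) (resH b (pd j U x i))) z = _
  rw [hz1 j, Pi.smul_apply, map_smul, smul_eq_mul, resD3_apply]

/-- The macroscopic Laplacian of a two-scale function, through its source. -/
theorem lapx_resH3 {U : Space → Triple b} (hU : ContDiff ℝ ∞ U) (x : Space) (i : Fin 3) :
    lapx (fun x => resH3 b (U x)) x i =ᵐ[cellMeasure b 1] fun z => ev z (lapOp U x i) := by
  unfold lapx
  have h1 : ∀ᵐ z ∂(cellMeasure b 1), ∀ j,
      toL2 (resH b (pd j (pd j U) x i)) z = ev z (res b (pd j (pd j U) x i)) :=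
    ae_all_iff.2 fun j => toL2_resH _
  filter_upwards [ae_sum_L2 fun j => toL2 (dx j (dx j (fun x => resH3 b (U x))) x i),
    h1] with z hz hz1
  rw [hz, lapOp, Finset.sum_apply, map_sum]
  refine Finset.sum_congr rfl fun j _ => ?_
  rw [dx_resH3 j hU, dx_resH3 j (contDiff_pd j hU)]
  exact hz1 j

theorem ev_inverse {w : Wiener b} (hw : IsUnit w) (x : Space) :
    ev x (Ring.inverse w) = (ev x w)⁻¹ := by
  have h : ev x w * ev x (Ring.inverse w) = 1 := by
    rw [← ev_mul, Ring.mul_inverse_cancel w hw, ev_one]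
  exact eq_inv_of_mul_eq_one_right h

section TwoScale

variable {h₀ K : ℝ}

/-- The right-hand side of the first cell problem, through the source of `u₀`. -/
theorem linRhs_rhs1 {U : Space → Triple b} (hU : ContDiff ℝ ∞ U) (x : Space) (i : Fin 3) :
    ∀ᵐ z ∂(cellMeasure b 1),
      linRhs (fun j => rhs1 (fun x => resH3 b (U x)) x j z) i = ev z (mixOp U x i) := by
  filter_upwards [two_mul_mixed_resH3 hU x 0, two_mul_mixed_resH3 hU x 1,
    two_mul_mixed_resH3 hU x 2] with z h0 h1 h2
  revert i
  refine forall_fin_three ?_ ?_ ?_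
  · exact h0
  · exact h1
  · rw [← h2]
    change -(8 * Real.pi) * (-(1 / (4 * Real.pi)) * mixed (fun x => resH3 b (U x)) x 2 z) = _
    have := Real.pi_pos
    field_simp
    ring

/-- The right-hand side of the second cell problem, through the sources of `u₀` and `u₁`. The
fractional powers of `ν₀ = w³` become `w` and `w⁻¹`. -/
theorem linRhs_rhs2 (hY : IsBranch ρ r Y) {x : Space} (hx : h x ∈ Ioo (-r) r)
    (h0 : ContDiff ℝ ∞ (src0 ρ Y h)) {U : Space → Triple b} (hU : ContDiff ℝ ∞ U) (i : Fin 3) :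
    ∀ᵐ z ∂(cellMeasure b 1),
      linRhs (fun j => rhs2 (fun y => branchState ρ Y (h y)) (fun y => resH3 b (U y)) x j z) i
        = ev z ((mixOp U x + lapOp (src0 ρ Y h) x + quad (Y (h x)) (res3 b (U x))) i) := by
  have m := fun i => two_mul_mixed_resH3 hU x i
  have l := fun i => lapx_resH3 h0 x i
  have s := fun i => hY.toL2_branchState hx i
  have t := fun i => toL2_resH (U x i)
  filter_upwards [ae_all_iff.2 m, ae_all_iff.2 l, ae_all_iff.2 s, ae_all_iff.2 t] with z m l s t
  have p0 := cube_rpow (hY.pos0 _ hx z)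
  have p1 := cube_rpow (hY.pos1 _ hx z)
  have s0 := s 0
  have s1 := s 1
  rw [ev_cube0] at s0
  rw [ev_cube1] at s1
  have l' : ∀ i, lapx (fun y => branchState ρ Y (h y)) x i z = ev z (lapOp (src0 ρ Y h) x i) := l
  have t' : ∀ i, toL2 (resH3 b (U x) i) z = ev z (res3 b (U x) i) := t
  revert i
  refine forall_fin_three ?_ ?_ ?_
  · change 2 * mixed (fun y => resH3 b (U y)) x 0 z + lapx (fun y => branchState ρ Y (h y)) x 0 z
      - 70 / 27 * (toL2 (branchState ρ Y (h x) 0) z) ^ (1 / 3 : ℝ) * (toL2 (resH3 b (U x) 0) z) ^ 2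
      + 20 / 27 * (toL2 (branchState ρ Y (h x) 0) z) ^ (-(1 / 3) : ℝ)
        * (toL2 (resH3 b (U x) 0) z) ^ 2
      - toL2 (resH3 b (U x) 2) z * toL2 (resH3 b (U x) 0) z = ev z (mixOp U x 0
        + lapOp (src0 ρ Y h) x 0 + (quadCoef (Y (h x) 0) * (res3 b (U x) 0 * res3 b (U x) 0)
        - res3 b (U x) 2 * res3 b (U x) 0))
    rw [m 0, l' 0, s0, t' 0, t' 2, p0.2.2.2.2.1, p0.2.2.2.2.2]
    simp only [map_add, map_sub, ev_mul, quadCoef, map_smul, smul_eq_mul,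
      ev_inverse (hY.isUnit0 _ hx)]
    ring
  · change 2 * mixed (fun y => resH3 b (U y)) x 1 z + lapx (fun y => branchState ρ Y (h y)) x 1 z
      - 70 / 27 * (toL2 (branchState ρ Y (h x) 1) z) ^ (1 / 3 : ℝ) * (toL2 (resH3 b (U x) 1) z) ^ 2
      + 20 / 27 * (toL2 (branchState ρ Y (h x) 1) z) ^ (-(1 / 3) : ℝ)
        * (toL2 (resH3 b (U x) 1) z) ^ 2
      - toL2 (resH3 b (U x) 2) z * toL2 (resH3 b (U x) 1) z = ev z (mixOp U x 1
        + lapOp (src0 ρ Y h) x 1 + (quadCoef (Y (h x) 1) * (res3 b (U x) 1 * res3 b (U x) 1)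
        - res3 b (U x) 2 * res3 b (U x) 1))
    rw [m 1, l' 1, s1, t' 1, t' 2, p1.2.2.2.2.1, p1.2.2.2.2.2]
    simp only [map_add, map_sub, ev_mul, quadCoef, map_smul, smul_eq_mul,
      ev_inverse (hY.isUnit1 _ hx)]
    ring
  · change -(8 * Real.pi) * (-(1 / (8 * Real.pi)) * (2 * mixed (fun y => resH3 b (U y)) x 2 z
        + lapx (fun y => branchState ρ Y (h y)) x 2 z)
      - 1 / 2 * ((toL2 (resH3 b (U x) 0) z) ^ 2 + (toL2 (resH3 b (U x) 1) z) ^ 2))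
      = ev z (mixOp U x 2 + lapOp (src0 ρ Y h) x 2
        + (4 * Real.pi) • (res3 b (U x) 0 * res3 b (U x) 0 + res3 b (U x) 1 * res3 b (U x) 1))
    rw [m 2, l' 2, t' 0, t' 1]
    simp only [map_add, ev_mul, map_smul, smul_eq_mul]
    have := Real.pi_pos
    field_simp
    ring

/-- Existence and uniqueness of the correctors `u₁, u₂`. -/
theorem isTwoScale_iff (hY : IsBranch ρ r Y) (hh₀ : 0 < h₀) (hr : h₀ < r)
    (hh : Admissible h₀ K h) {v₁ v₂ : Space → Fin 3 → H b 3 1} :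
    IsTwoScale (branchState ρ Y) h v₁ v₂ ↔
      v₁ = (fun x => resH3 b (src1 ρ Y h x)) ∧ v₂ = fun x => resH3 b (src2 ρ Y h x) := by
  have hx : ∀ x, h x ∈ Ioo (-r) r := fun x =>
    ⟨by linarith [(hh.mem x).1], by linarith [(hh.mem x).2]⟩
  have hs0 : ContDiff ℝ ∞ (src0 ρ Y h) := (uniformlySmooth_src0 hY hh₀ hr).1 ⟨h, hh⟩
  have hs1 : ContDiff ℝ ∞ (src1 ρ Y h) := (uniformlySmooth_src1 hY hh₀ hr).1 ⟨h, hh⟩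
  have hs2 : ContDiff ℝ ∞ (src2 ρ Y h) := (uniformlySmooth_src2 hY hh₀ hr).1 ⟨h, hh⟩
  have e1 : ∀ x (w : Fin 3 → H b 3 1), LinearizedEq (fun i => toL2 (branchState ρ Y (h x) i))
      (fun _ => h x) w (rhs1 (fun y => branchState ρ Y (h y)) x) ↔ w = resH3 b (src1 ρ Y h x) :=
    fun x w => linearizedEq_branch_iff hY (hx x) w (linRhs_rhs1 hs0 x)
  have e2 : ∀ x (w : Fin 3 → H b 3 1), LinearizedEq (fun i => toL2 (branchState ρ Y (h x) i))
      (fun _ => h x) w (rhs2 (fun y => branchState ρ Y (h y)) (fun x => resH3 b (src1 ρ Y h x)) x)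
        ↔ w = resH3 b (src2 ρ Y h x) :=
    fun x w => linearizedEq_branch_iff hY (hx x) w (linRhs_rhs2 hY (hx x) hs0 hs1)
  constructor
  · intro H
    have h1 : v₁ = fun x => resH3 b (src1 ρ Y h x) := funext fun x => (e1 x _).1 (H.order₁ x)
    refine ⟨h1, funext fun x => (e2 x _).1 ?_⟩
    rw [← h1]
    exact H.order₂ x
  · rintro ⟨rfl, rfl⟩
    exact ⟨contDiff_resH3.comp hs1, contDiff_resH3.comp hs2, fun x => (e1 x _).2 rfl,
      fun x => (e2 x _).2 rfl⟩

end TwoScale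

end Wiener

namespace Wiener

/-! ### Two-scale functions on the supercell -/

theorem norm_unitVec (j : Fin 3) : ‖unitVec j‖ = 1 := by simp [unitVec]

theorem abs_ev_sub_ev_le (a a' : Wiener b) (x y : Space) :
    |ev x a - ev y a'| ≤ ‖a - a'‖ + ‖a'‖ * ‖x - y‖ := by
  have h1 : ev x a - ev y a' = ev x (a - a') + (ev x a' - ev y a') := by rw [map_sub]; ring
  rw [h1]
  exact (abs_add_le _ _).trans (add_le_add (abs_ev_le x _) (abs_ev_sub_le a' x y))

theorem continuous_twoScale {V : Space → Wiener b} (hV : Continuous V) (ε : ℝ) :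
    Continuous fun x => ev x (V (ε • x)) := by
  rw [continuous_iff_continuousAt]
  intro x
  have h1 : Tendsto (fun y : Space => ‖V (ε • y) - V (ε • x)‖ + ‖V (ε • x)‖ * ‖y - x‖) (𝓝 x)
      (𝓝 0) := by
    have : Continuous fun y : Space => ‖V (ε • y) - V (ε • x)‖ + ‖V (ε • x)‖ * ‖y - x‖ := by
      fun_prop
    simpa using this.tendsto x
  rw [ContinuousAt, tendsto_iff_norm_sub_tendsto_zero]
  exact squeeze_zero (fun _ => norm_nonneg _) (fun y => abs_ev_sub_ev_le _ _ _ _) h1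

/-- For `ε = 1/n` a two-scale function that is periodic in both variables is periodic with respect
to the supercell: `x ↦ x + n b_i` shifts `εx` by `b_i`. -/
theorem isPeriodic_twoScale {n : ℕ} [NeZero n] {V : Space → Wiener b}
    (hV : ∀ i x, V (x + b i) = V x) : IsPeriodic b n fun x => ev x (V ((1 / (n : ℝ)) • x)) := by
  intro i x
  have hn : (n : ℝ) ≠ 0 := Nat.cast_ne_zero.2 (NeZero.ne n)
  have h1 : (1 / (n : ℝ)) • (x + (n : ℝ) • b i) = (1 / (n : ℝ)) • x + b i := by
    rw [smul_add, smul_smul, one_div_mul_cancel hn, one_smul]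
  have h2 := (isPeriodic_ev (V ((1 / (n : ℝ)) • x))).add_lattice (Pi.single i (n : ℤ)) x
  have h3 : ∑ j, ((Pi.single i (n : ℤ) : Fin 3 → ℤ) j : ℝ) • ((1 : ℕ) : ℝ) • b j
      = (n : ℝ) • b i := by
    rw [Finset.sum_eq_single i]
    · simp
    · intro j _ hj; simp [hj]
    · simp
  rw [h3] at h2
  simp only [h1, hV, h2]

/-- The chain rule for two-scale functions: the derivative of `x ↦ V(εx, x)` is the sum of the
microscopic derivative and `ε` times the macroscopic one. Evaluation is only Lipschitz in the point
for the operator norm; this suffices, since it is applied to a difference that tends to zero. -/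
theorem hasPartial_twoScale (ε : ℝ) (j : Fin 3) {V V' : Space → Wiener b} (hV : ContDiff ℝ ∞ V)
    (hD : ∀ x, HasPartial j (fun z => ev z (V x)) fun z => ev z (V' x)) :
    HasPartial j (fun x => ev x (V (ε • x)))
      fun x => ev x (V' (ε • x)) + ε * ev x (pd j V (ε • x)) := by
  intro x
  have hline : HasDerivAt (fun t : ℝ => ε • (x + t • unitVec j)) (ε • unitVec j) 0 := by
    have h := ((hasDerivAt_id (0 : ℝ)).smul_const (unitVec j)).const_add x
    rw [one_smul] at h
    exact h.const_smul ε
  have h0 : HasFDerivAt V (fderiv ℝ V (ε • x)) (ε • (x + (0 : ℝ) • unitVec j)) := by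
    simpa using (hV.differentiable (by simp) (ε • x)).hasFDerivAt
  have h1 : HasDerivAt (fun t : ℝ => ev x (V (ε • (x + t • unitVec j))))
      (ev x (fderiv ℝ V (ε • x) (ε • unitVec j))) 0 :=
    (ev x).hasFDerivAt.comp_hasDerivAt (0 : ℝ) (h0.comp_hasDerivAt (0 : ℝ) hline)
  have h2 : HasDerivAt (fun t : ℝ => ev (x + t • unitVec j) (V (ε • x)))
      (ev x (V' (ε • x))) 0 := hD (ε • x) x
  -- `V(ε(x + t e), x + t e)` is the sum of the two partial increments and a mixed difference, which
  -- is `o(t)`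
  set d := fun t : ℝ => V (ε • (x + t • unitVec j)) - V (ε • x) with hd
  have h3 : HasDerivAt (fun t : ℝ => ev (x + t • unitVec j) (d t) - ev x (d t)) 0 0 := by
    rw [hasDerivAt_iff_isLittleO_nhds_zero, Asymptotics.isLittleO_iff]
    intro c hc
    have hcont : Tendsto (fun t => ‖d t‖) (𝓝 0) (𝓝 0) := by
      have hc1 := hV.continuous
      have : Continuous fun t => ‖d t‖ := by
        simp only [hd]
        fun_prop
      simpa [hd] using this.tendsto 0
    filter_upwards [hcont.eventually (gt_mem_nhds hc)] with t ht
    have h0 : d 0 = 0 := by simp [hd]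
    rw [zero_add, h0, map_zero, map_zero, smul_zero, sub_zero, sub_zero, sub_zero]
    refine (abs_ev_sub_le _ _ _).trans ?_
    rw [add_sub_cancel_left, norm_smul, norm_unitVec, mul_one]
    exact mul_le_mul_of_nonneg_right ht.le (norm_nonneg _)
  have h4 := (h2.add h1).add h3
  refine (HasDerivAt.congr_deriv h4 ?_ |>.sub_const (ev x (V (ε • x)))).congr_of_eventuallyEq
    (Eventually.of_forall fun t => ?_)
  · rw [map_smul, map_smul, smul_eq_mul, add_zero]; rfl
  · simp only [hd, Pi.add_apply, map_sub]
    ring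

/-- The operator induced by `1 - Δ` on the two-scale function with `(1 - Δ_z)V = U`. -/
def twoScaleOp (ε : ℝ) (U : Space → Wiener b) (x : Space) : Wiener b :=
  U x - ∑ j, ((2 * ε) • resD b j (pd j U x) + ε ^ 2 • res b (pd j (pd j U) x))

/-- The two-scale function `x ↦ V(εx, x)`, `V = (1 - Δ_z)⁻¹ U`, `ε = 1/n`, lies in `H²ₙ`. -/
theorem exists_twoScale {n : ℕ} [NeZero n] {U : Space → Wiener b} (hU : ContDiff ℝ ∞ U)
    (hp : ∀ i x, U (x + b i) = U x) :
    ∃ f : H b 2 n, (toL2 f =ᵐ[cellMeasure b n] fun x => ev x (res b (U ((1 / (n : ℝ)) • x)))) ∧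
      ∀ᵐ x ∂(cellMeasure b n),
        toL2 f x - lap f x = ev x (twoScaleOp (1 / (n : ℝ)) U ((1 / (n : ℝ)) • x)) := by
  set ε : ℝ := 1 / (n : ℝ) with hε
  have hP := fun j => contDiff_pd j hU
  have hPP := fun j => contDiff_pd j (hP j)
  have pP := fun j => pd_add_period j hp
  have pPP := fun j => pd_add_period j (pP j)
  -- continuity and periodicity of the two-scale functions that occur
  have hc : ∀ (L : Wiener b →L[ℝ] Wiener b) {W : Space → Wiener b}, ContDiff ℝ ∞ W →
      Continuous fun x => ev x (L (W (ε • x))) := fun L W hW =>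
    continuous_twoScale (V := fun x => L (W x)) (L.continuous.comp hW.continuous) ε
  have hper : ∀ (L : Wiener b →L[ℝ] Wiener b) {W : Space → Wiener b},
      (∀ i x, W (x + b i) = W x) → IsPeriodic b n fun x => ev x (L (W (ε • x))) :=
    fun L W hW => isPeriodic_twoScale (V := fun x => L (W x)) fun i x => by rw [hW]
  -- their derivatives
  have dR : ∀ (j : Fin 3) {W : Space → Wiener b}, ContDiff ℝ ∞ W →
      HasPartial j (fun x => ev x (res b (W (ε • x))))
        fun x => ev x (resD b j (W (ε • x))) + ε * ev x (res b (pd j W (ε • x))) := by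
    intro j W hW
    have h := hasPartial_twoScale ε j (V := fun x => res b (W x)) ((res b).contDiff.comp hW)
      (V' := fun x => resD b j (W x)) fun x => (hasGrad_res _).hasPartial j
    rwa [pd_clm j (res b) hW] at h
  have dD : ∀ (j : Fin 3) {W : Space → Wiener b}, ContDiff ℝ ∞ W →
      HasPartial j (fun x => ev x (resD b j (W (ε • x))))
        fun x => ev x (resDD b j j (W (ε • x))) + ε * ev x (resD b j (pd j W (ε • x))) := by
    intro j W hW
    have h := hasPartial_twoScale ε j (V := fun x => resD b j (W x)) ((resD b j).contDiff.comp hW)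
      (V' := fun x => resDD b j j (W x)) fun x => (hasGrad_resD j _).hasPartial j
    rwa [pd_clm j (resD b j) hW] at h
  set φ := fun x => ev x (res b (U (ε • x))) with hφ
  set ψ := fun j x => ev x (resD b j (U (ε • x))) + ε * ev x (res b (pd j U (ε • x))) with hψ
  set χ := fun j x => (ev x (resDD b j j (U (ε • x))) + ε * ev x (resD b j (pd j U (ε • x))))
    + ε * (ev x (resD b j (pd j U (ε • x))) + ε * ev x (res b (pd j (pd j U) (ε • x)))) with hχ
  have cφ : Continuous φ := hc (res b) hU
  have cψ : ∀ j, Continuous (ψ j) := fun j =>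
    (hc (resD b j) hU).add (continuous_const.mul (hc (res b) (hP j)))
  have cχ : ∀ j, Continuous (χ j) := fun j =>
    ((hc (resDD b j j) hU).add (continuous_const.mul (hc (resD b j) (hP j)))).add
      (continuous_const.mul ((hc (resD b j) (hP j)).add
        (continuous_const.mul (hc (res b) (hPP j)))))
  have pφ : IsPeriodic b n φ := hper (res b) hp
  have hdφ : ∀ j, HasPartial j φ (ψ j) := fun j => dR j hU
  have hdψ : ∀ j, HasPartial j (ψ j) (χ j) := fun j x =>
    (dD j hU x).add ((dR j (hP j) x).const_mul ε)
  have pψ : ∀ j, IsPeriodic b n (ψ j) := fun j => (hdφ j).isPeriodic pφ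
  have coefχ : ∀ j k, coef b n (χ j) k = -(wave b n k j ^ 2 * coef b n φ k) := fun j k => by
    rw [coef_partial (hdψ j) (cψ j) (cχ j) (pψ j), coef_partial (hdφ j) cφ (cψ j) pφ,
      dcoef_dcoef_self]
  -- `g = φ - Δφ` in the classical sense; the function in `H²ₙ` is `(1 - Δ)⁻¹ g`
  set g := fun x => φ x - ∑ j, χ j x with hg
  have cg : Continuous g := cφ.sub (continuous_finsetSum _ fun j _ => cχ j)
  have coefg : ∀ k, coef b n g k = (1 + ‖wave b n k‖ ^ 2) * coef b n φ k := by
    intro k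
    have hi : ∀ {f : Space → ℝ}, Continuous f →
        Integrable (fun x => f x * mode b n k x) (cellMeasure b n) := fun hf =>
      integrable_of_continuous (hf.mul (continuous_mode k))
    have e : coef b n g k = coef b n φ k - ∑ j, coef b n (χ j) k := by
      simp only [coef, hg, sub_mul, Finset.sum_mul]
      rw [integral_sub (hi cφ) (integrable_finsetSum _ fun j _ => hi (cχ j)),
        integral_finsetSum _ fun j _ => hi (cχ j), sub_div, Finset.sum_div]
    rw [e]
    simp only [coefχ, norm_wave_sq, Finset.sum_neg_distrib, ← Finset.sum_mul]
    ring
  have hgL := (memLp_of_continuous (b := b) (n := n) cg 2).coeFn_toLp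
  obtain ⟨f, hf⟩ := exists_resolvent ((memLp_of_continuous (b := b) (n := n) cg 2).toLp g)
  have coeff : coef b n (toL2 f) = coef b n φ := by
    funext k
    have h1 := coef_sub_lap le_rfl f k
    rw [hf, coef_congr hgL, coefg] at h1
    exact (mul_left_cancel₀ (by positivity) h1).symm
  have hae : toL2 f =ᵐ[cellMeasure b n] φ := by
    have h1 := (memLp_of_continuous (b := b) (n := n) cφ 2).coeFn_toLp
    have h2 : toL2 f = (memLp_of_continuous (b := b) (n := n) cφ 2).toLp φ :=
      L2.ext_coef (by rw [coeff, coef_congr h1])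
    rw [h2]
    exact h1
  refine ⟨f, hae, ?_⟩
  have hs : ⇑(toL2 f - lap f) =ᵐ[cellMeasure b n] g := by rw [hf]; exact hgL
  filter_upwards [hs, Lp.coeFn_sub (toL2 f) (lap f)] with x h1 h2
  rw [Pi.sub_apply] at h2
  rw [← h2, h1]
  have h3 := congrArg (ev x) (sum_resDD (U (ε • x)))
  simp only [Fin.sum_univ_three, map_add, map_sub] at h3
  simp only [hg, hφ, hχ, twoScaleOp, Fin.sum_univ_three, map_add, map_sub, map_smul, smul_eq_mul]
  linarith

/-- The continuous representative used in the two-scale ansatz is evaluation in the Wiener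
algebra. -/
theorem contRep_resH (a : Wiener b) : contRep (resH b a) = fun x => ev x (res b a) := by
  have h : ∃ g : Space → ℝ, Continuous g ∧ IsPeriodic b 1 g ∧
      toL2 (resH b a) =ᵐ[cellMeasure b 1] g :=
    ⟨_, continuous_ev _, isPeriodic_ev _, toL2_resH a⟩
  unfold contRep
  rw [dif_pos h]
  exact h.choose_spec.2.1.eq_of_ae (isPeriodic_ev _) h.choose_spec.1 (continuous_ev _)
    (h.choose_spec.2.2.symm.trans (toL2_resH a))

/-- The evaluation of a two-scale function on the diagonal, through its source. -/
theorem diag_resH3 (ε : ℝ) (U : Space → Triple b) (i : Fin 3) (x : Space) :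
    diag ε (fun x => resH3 b (U x)) i x = ev x (res b (U (ε • x) i)) := by
  have h := congrFun (contRep_resH (U (ε • x) i)) x
  exact h

end Wiener

/-! ### Pointwise estimates of the nonlinearity -/

/-- The local nonlinearity `5/3 t^{7/3} - 4/3 t^{5/3}`. -/
def spin (t : ℝ) : ℝ := 5 / 3 * t ^ (7 / 3 : ℝ) - 4 / 3 * t ^ (5 / 3 : ℝ)

/-- The first derivative of `spin`. -/
def spinD (t : ℝ) : ℝ := 35 / 9 * t ^ (4 / 3 : ℝ) - 20 / 9 * t ^ (2 / 3 : ℝ)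

/-- The second derivative of `spin`. -/
def spinDD (t : ℝ) : ℝ := 140 / 27 * t ^ (1 / 3 : ℝ) - 40 / 27 * t ^ (-(1 / 3) : ℝ)

/-- The third derivative of `spin`. -/
def spinDDD (t : ℝ) : ℝ := 140 / 81 * t ^ (-(2 / 3) : ℝ) + 40 / 81 * t ^ (-(4 / 3) : ℝ)

theorem hasDerivAt_spin {t : ℝ} (ht : 0 < t) : HasDerivAt spin (spinD t) t := by
  have h := ((Real.hasDerivAt_rpow_const (p := (7 / 3 : ℝ)) (Or.inl ht.ne')).const_mul
    (5 / 3 : ℝ)).sub ((Real.hasDerivAt_rpow_const (p := (5 / 3 : ℝ)) (Or.inl ht.ne')).const_mul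
    (4 / 3 : ℝ))
  refine h.congr_deriv ?_
  unfold spinD
  norm_num
  ring

theorem hasDerivAt_spinD {t : ℝ} (ht : 0 < t) : HasDerivAt spinD (spinDD t) t := by
  have h := ((Real.hasDerivAt_rpow_const (p := (4 / 3 : ℝ)) (Or.inl ht.ne')).const_mul
    (35 / 9 : ℝ)).sub ((Real.hasDerivAt_rpow_const (p := (2 / 3 : ℝ)) (Or.inl ht.ne')).const_mul
    (20 / 9 : ℝ))
  refine h.congr_deriv ?_
  unfold spinDD
  norm_num
  ring

theorem hasDerivAt_spinDD {t : ℝ} (ht : 0 < t) : HasDerivAt spinDD (spinDDD t) t := by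
  have h := ((Real.hasDerivAt_rpow_const (p := (1 / 3 : ℝ)) (Or.inl ht.ne')).const_mul
    (140 / 27 : ℝ)).sub ((Real.hasDerivAt_rpow_const (p := (-(1 / 3) : ℝ))
    (Or.inl ht.ne')).const_mul (40 / 27 : ℝ))
  refine h.congr_deriv ?_
  unfold spinDDD
  norm_num
  ring

theorem continuous_spin : Continuous spin := by
  have h : ∀ p : ℝ, 0 < p → Continuous fun t : ℝ => t ^ p := fun p hp =>
    continuous_iff_continuousAt.2 fun t => Real.continuousAt_rpow_const t p (Or.inr hp.le)
  exact (continuous_const.mul (h _ (by norm_num))).sub (continuous_const.mul (h _ (by norm_num)))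

/-- The mean value inequality on an interval, in the form used for Taylor remainders. -/
theorem abs_sub_le_of_deriv {f f' : ℝ → ℝ} {s t B : ℝ}
    (hf : ∀ x ∈ uIcc s t, HasDerivAt f (f' x) x) (hB : ∀ x ∈ uIcc s t, |f' x| ≤ B) :
    |f t - f s| ≤ B * |t - s| :=
  (convex_uIcc s t).norm_image_sub_le_of_norm_hasDerivWithin_le
    (fun x hx => (hf x hx).hasDerivWithinAt) hB left_mem_uIcc right_mem_uIcc

/-- Lipschitz and Taylor bounds of `spin` on a compact interval of positive densities. -/
theorem exists_spin_bounds {c : ℝ} (hc : 0 < c) (A : ℝ) : ∃ M : ℝ, 0 ≤ M ∧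
    (∀ s ∈ Icc c A, ∀ t ∈ Icc c A, |spinD t - spinD s| ≤ M * |t - s|) ∧
    (∀ s ∈ Icc c A, |spinDD s| ≤ M) ∧
    ∀ s ∈ Icc c A, ∀ t ∈ Icc c A,
      |spin t - spin s - spinD s * (t - s) - 1 / 2 * spinDD s * (t - s) ^ 2| ≤ M * |t - s| ^ 3 := by
  have hpos : ∀ x ∈ Icc c A, 0 < x := fun x hx => hc.trans_le hx.1
  have hc2 : ContinuousOn spinDD (Icc c A) := fun x hx =>
    (hasDerivAt_spinDD (hpos x hx)).continuousAt.continuousWithinAt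
  have hc3 : ContinuousOn spinDDD (Icc c A) := by
    have h : ∀ p : ℝ, ContinuousOn (fun t : ℝ => t ^ p) (Icc c A) := fun p x hx =>
      (Real.continuousAt_rpow_const x p (Or.inl (hpos x hx).ne')).continuousWithinAt
    exact (continuousOn_const.mul (h _)).add (continuousOn_const.mul (h _))
  obtain ⟨M2, hM2⟩ := isCompact_Icc.exists_bound_of_continuousOn hc2
  obtain ⟨M3, hM3⟩ := isCompact_Icc.exists_bound_of_continuousOn hc3
  set M := max 0 (max M2 M3) with hM
  have h2 : ∀ x ∈ Icc c A, |spinDD x| ≤ M := fun x hx =>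
    (hM2 x hx).trans ((le_max_left _ _).trans (le_max_right _ _))
  have h3 : ∀ x ∈ Icc c A, |spinDDD x| ≤ M := fun x hx =>
    (hM3 x hx).trans ((le_max_right _ _).trans (le_max_right _ _))
  have hsub : ∀ s ∈ Icc c A, ∀ t ∈ Icc c A, uIcc s t ⊆ Icc c A := fun s hs t ht =>
    uIcc_subset_Icc hs ht
  have hM0 : 0 ≤ M := le_max_left _ _
  have e2 : ∀ s ∈ Icc c A, ∀ t ∈ Icc c A, |spinDD t - spinDD s| ≤ M * |t - s| :=
    fun s hs t ht => abs_sub_le_of_deriv (fun x hx => hasDerivAt_spinDD (hpos x (hsub s hs t ht hx)))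
      fun x hx => h3 x (hsub s hs t ht hx)
  have hdist : ∀ {s t x : ℝ}, x ∈ uIcc s t → |x - s| ≤ |t - s| := fun hx =>
    abs_sub_left_of_mem_uIcc hx
  have e1 : ∀ s ∈ Icc c A, ∀ t ∈ Icc c A,
      |spinD t - spinD s - spinDD s * (t - s)| ≤ M * |t - s| ^ 2 := by
    intro s hs t ht
    have h := abs_sub_le_of_deriv (f := fun x => spinD x - spinD s - spinDD s * (x - s))
      (f' := fun x => spinDD x - spinDD s) (s := s) (t := t) (B := M * |t - s|)
      (fun x hx => by
        have := ((hasDerivAt_spinD (hpos x (hsub s hs t ht hx))).sub_const (spinD s)).sub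
          (((hasDerivAt_id x).sub_const s).const_mul (spinDD s))
        exact this.congr_deriv (by simp))
      (fun x hx => (e2 s hs x (hsub s hs t ht hx)).trans
        (mul_le_mul_of_nonneg_left (hdist hx) hM0))
    simpa [pow_two, mul_assoc] using h
  refine ⟨M, hM0, fun s hs t ht => abs_sub_le_of_deriv
    (fun x hx => hasDerivAt_spinD (hpos x (hsub s hs t ht hx)))
    fun x hx => h2 x (hsub s hs t ht hx), h2, fun s hs t ht => ?_⟩
  have h := abs_sub_le_of_deriv
    (f := fun x => spin x - spin s - spinD s * (x - s) - 1 / 2 * spinDD s * (x - s) ^ 2)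
    (f' := fun x => spinD x - spinD s - spinDD s * (x - s)) (s := s) (t := t) (B := M * |t - s| ^ 2)
    (fun x hx => by
      have := (((hasDerivAt_spin (hpos x (hsub s hs t ht hx))).sub_const (spin s)).sub
        (((hasDerivAt_id x).sub_const s).const_mul (spinD s))).sub
        ((((hasDerivAt_id x).sub_const s).pow 2).const_mul (1 / 2 * spinDD s))
      refine this.congr_deriv ?_
      simp
      ring)
    (fun x hx => (e1 s hs x (hsub s hs t ht hx)).trans
      (mul_le_mul_of_nonneg_left (pow_le_pow_left₀ (abs_nonneg _) (hdist hx) 2) hM0))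
  refine (le_of_eq ?_).trans (h.trans (le_of_eq (by ring)))
  congr 1
  simp

/-- The zeroth order part of the Euler--Lagrange equations, with the third equation normalized to
the Laplacian: they read `-Δu + nonlin η ρ u = 0`. -/
def nonlin (η ρ : ℝ) (p : Fin 3 → ℝ) : Fin 3 → ℝ :=
  ![spin (p 0) + (p 2 - η) * p 0, spin (p 1) + (p 2 + η) * p 1,
    -(4 * Real.pi) * (p 0 ^ 2 + p 1 ^ 2 - ρ)]

/-- The derivative of `nonlin η ρ` at `s`. -/
def dnonlin (η : ℝ) (s z : Fin 3 → ℝ) : Fin 3 → ℝ :=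
  ![spinD (s 0) * z 0 + (s 2 - η) * z 0 + s 0 * z 2,
    spinD (s 1) * z 1 + (s 2 + η) * z 1 + s 1 * z 2,
    -(8 * Real.pi) * (s 0 * z 0 + s 1 * z 1)]

/-- The linearization of `spin` at `s` approximates differences near `s` with a small relative
error. -/
theorem abs_spin_sub_sub_le {c A M : ℝ} (hM : ∀ s ∈ Icc c A, ∀ t ∈ Icc c A,
    |spinD t - spinD s| ≤ M * |t - s|) (hc : 0 < c) (hM0 : 0 ≤ M) {s p q τ : ℝ} (hs : s ∈ Icc c A)
    (hp : p ∈ Icc c A) (hq : q ∈ Icc c A) (hps : |p - s| ≤ τ) (hqs : |q - s| ≤ τ) :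
    |spinD s * (p - q) - (spin p - spin q)| ≤ M * τ * |p - q| := by
  have hsub : uIcc q p ⊆ Icc c A := uIcc_subset_Icc hq hp
  have h := abs_sub_le_of_deriv (f := fun x => spin x - spinD s * x)
    (f' := fun x => spinD x - spinD s) (s := q) (t := p) (B := M * τ)
    (fun x hx => by
      have := (hasDerivAt_spin (hc.trans_le (hsub hx).1)).sub
        ((hasDerivAt_id x).const_mul (spinD s))
      exact this.congr_deriv (by simp))
    (fun x hx => by
      refine (hM s hs x (hsub hx)).trans (mul_le_mul_of_nonneg_left ?_ hM0)
      rw [abs_le] at hps hqs ⊢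
      rcases mem_uIcc.1 hx with h | h <;> constructor <;> linarith [h.1, h.2])
  refine (le_of_eq ?_).trans h
  rw [← abs_neg]
  congr 1
  ring

/-- Near a state `s` the nonlinearity differs from its linearization at `s` by a map with small
Lipschitz constant. The field enters as a perturbation, so that the linearization is taken at zero
field. -/
theorem exists_contraction {c : ℝ} (hc : 0 < c) (A : ℝ) {θ : ℝ} (hθ : 0 < θ) :
    ∃ τ > 0, τ ≤ c / 2 ∧ ∀ (η ρ : ℝ) (s p q : Fin 3 → ℝ), c ≤ s 0 → c ≤ s 1 → s 0 ≤ A → s 1 ≤ A →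
      (∀ i, |p i - s i| ≤ τ) → (∀ i, |q i - s i| ≤ τ) → |η| ≤ τ →
      ∀ i, |dnonlin 0 s (p - q) i - (nonlin η ρ p i - nonlin η ρ q i)| ≤ θ * ∑ j, |p j - q j| := by
  obtain ⟨M, hM0, hM, -⟩ := exists_spin_bounds (half_pos hc) (A + c / 2)
  have hpi := Real.pi_pos
  set L := M + 2 + 8 * Real.pi with hL
  have hL0 : 0 < L := by positivity
  refine ⟨min (c / 2) (θ / L), lt_min (half_pos hc) (div_pos hθ hL0), min_le_left _ _, ?_⟩
  intro η ρ s p q hs0 hs1 hA0 hA1 hp hq hη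
  set τ := min (c / 2) (θ / L) with hτ
  have hτ0 : 0 < τ := lt_min (half_pos hc) (div_pos hθ hL0)
  have hτc : τ ≤ c / 2 := min_le_left _ _
  have hτθ : L * τ ≤ θ := by
    rw [mul_comm, ← le_div_iff₀ hL0]; exact min_le_right _ _
  have mem : ∀ {a v : ℝ}, c ≤ a → a ≤ A → |v - a| ≤ τ → v ∈ Icc (c / 2) (A + c / 2) := by
    intro a v h1 h2 h3
    rw [abs_le] at h3
    constructor <;> linarith [h3.1, h3.2]
  have self : ∀ {a : ℝ}, c ≤ a → a ≤ A → a ∈ Icc (c / 2) (A + c / 2) := fun h1 h2 =>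
    mem h1 h2 (by simpa using hτ0.le)
  have hS : ∀ i, |p i - q i| ≤ ∑ j, |p j - q j| := fun i =>
    Finset.single_le_sum (f := fun j => |p j - q j|) (fun _ _ => abs_nonneg _) (Finset.mem_univ i)
  set S := ∑ j, |p j - q j| with hSdef
  have hS3 : S = |p 0 - q 0| + |p 1 - q 1| + |p 2 - q 2| := by rw [hSdef, Fin.sum_univ_three]
  have hS0 : 0 ≤ S := (abs_nonneg _).trans (hS 0)
  have fin : ∀ {v : ℝ}, |v| ≤ L * τ * S → |v| ≤ θ * S := fun h =>
    h.trans (mul_le_mul_of_nonneg_right hτθ hS0)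
  have mulb : ∀ {u v a : ℝ}, |u| ≤ a → |u * v| ≤ a * |v| := fun h => by
    rw [abs_mul]; exact mul_le_mul_of_nonneg_right h (abs_nonneg _)
  -- the two spin components, with the sign of the field left open
  have key : ∀ (i : Fin 3) (e : ℝ), c ≤ s i → s i ≤ A → |e| ≤ τ → |p i - q i| + |p 2 - q 2| ≤ S →
      |spinD (s i) * (p i - q i) + s 2 * (p i - q i) + s i * (p 2 - q 2)
        - ((spin (p i) + (p 2 - e) * p i) - (spin (q i) + (q 2 - e) * q i))| ≤ L * τ * S := by
    intro i e h1 h2 he hsum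
    have a1 := abs_spin_sub_sub_le hM (half_pos hc) hM0 (self h1 h2) (mem h1 h2 (hp i))
      (mem h1 h2 (hq i)) (hp i) (hq i)
    have a2 : |(s 2 - p 2) * (p i - q i)| ≤ τ * |p i - q i| :=
      mulb (by rw [abs_sub_comm]; exact hp 2)
    have a3 : |(s i - q i) * (p 2 - q 2)| ≤ τ * |p 2 - q 2| :=
      mulb (by rw [abs_sub_comm]; exact hq i)
    have a4 : |e * (p i - q i)| ≤ τ * |p i - q i| := mulb he
    have e1 : spinD (s i) * (p i - q i) + s 2 * (p i - q i) + s i * (p 2 - q 2)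
        - ((spin (p i) + (p 2 - e) * p i) - (spin (q i) + (q 2 - e) * q i))
        = (spinD (s i) * (p i - q i) - (spin (p i) - spin (q i)))
          + (s 2 - p 2) * (p i - q i) + (s i - q i) * (p 2 - q 2) + e * (p i - q i) := by ring
    rw [e1]
    refine (abs_add_le _ _).trans ((add_le_add_left ((abs_add_le _ _).trans
      (add_le_add_left (abs_add_le _ _) _)) _).trans ?_)
    have b1 : τ * (|p i - q i| + |p 2 - q 2|) ≤ τ * S := mul_le_mul_of_nonneg_left hsum hτ0.le
    have b2 : M * τ * |p i - q i| ≤ M * τ * S := mul_le_mul_of_nonneg_left (hS i) (by positivity)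
    have b3 : τ * |p i - q i| ≤ τ * S := mul_le_mul_of_nonneg_left (hS i) hτ0.le
    have b4 : 0 ≤ 8 * Real.pi * τ * S := by positivity
    rw [hL]
    nlinarith
  have hle : ∀ j : Fin 3, 0 ≤ |p j - q j| := fun j => abs_nonneg _
  refine forall_fin_three (fin ?_) (fin ?_) (fin ?_)
  · refine (le_of_eq ?_).trans (key 0 η hs0 hA0 hη (by rw [hS3]; linarith [hle 1]))
    congr 1
    change spinD (s 0) * (p 0 - q 0) + (s 2 - 0) * (p 0 - q 0) + s 0 * (p 2 - q 2) - _ = _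
    rw [sub_zero]
    rfl
  · refine (le_of_eq ?_).trans (key 1 (-η) hs1 hA1 (by rwa [abs_neg])
      (by rw [hS3]; linarith [hle 0]))
    congr 1
    change spinD (s 1) * (p 1 - q 1) + (s 2 + 0) * (p 1 - q 1) + s 1 * (p 2 - q 2)
      - ((spin (p 1) + (p 2 + η) * p 1) - (spin (q 1) + (q 2 + η) * q 1)) = _
    ring
  · change |-(8 * Real.pi) * (s 0 * (p 0 - q 0) + s 1 * (p 1 - q 1))
      - (-(4 * Real.pi) * (p 0 ^ 2 + p 1 ^ 2 - ρ) - -(4 * Real.pi) * (q 0 ^ 2 + q 1 ^ 2 - ρ))| ≤ _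
    have e1 : -(8 * Real.pi) * (s 0 * (p 0 - q 0) + s 1 * (p 1 - q 1))
      - (-(4 * Real.pi) * (p 0 ^ 2 + p 1 ^ 2 - ρ) - -(4 * Real.pi) * (q 0 ^ 2 + q 1 ^ 2 - ρ))
      = 4 * Real.pi * (((p 0 - s 0) + (q 0 - s 0)) * (p 0 - q 0)
        + ((p 1 - s 1) + (q 1 - s 1)) * (p 1 - q 1)) := by ring
    have a : ∀ i, |((p i - s i) + (q i - s i)) * (p i - q i)| ≤ 2 * τ * |p i - q i| := fun i =>
      mulb ((abs_add_le _ _).trans (by linarith [hp i, hq i]))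
    rw [e1, abs_mul, abs_of_pos (by positivity : (0 : ℝ) < 4 * Real.pi)]
    have a' := (abs_add_le (((p 0 - s 0) + (q 0 - s 0)) * (p 0 - q 0))
      (((p 1 - s 1) + (q 1 - s 1)) * (p 1 - q 1))).trans (add_le_add (a 0) (a 1))
    have a'' : 2 * τ * |p 0 - q 0| + 2 * τ * |p 1 - q 1| ≤ 2 * τ * S := by
      rw [hS3]; nlinarith [hle 2]
    calc 4 * Real.pi * _ ≤ 4 * Real.pi * (2 * τ * S) :=
          mul_le_mul_of_nonneg_left (a'.trans a'') (by positivity)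
      _ ≤ L * τ * S := by
          have : 0 ≤ (M + 2) * (τ * S) := by positivity
          rw [hL]; nlinarith

/-- Half the second derivative of `nonlin` at `s` in the direction `z`. -/
def quadR (s z : Fin 3 → ℝ) : Fin 3 → ℝ :=
  ![1 / 2 * spinDD (s 0) * z 0 ^ 2 + z 2 * z 0, 1 / 2 * spinDD (s 1) * z 1 ^ 2 + z 2 * z 1,
    -(4 * Real.pi) * (z 0 ^ 2 + z 1 ^ 2)]

theorem abs_mul_le_sq {A u v : ℝ} (hu : |u| ≤ A) (hv : |v| ≤ A) : |u * v| ≤ A ^ 2 := by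
  rw [abs_mul, pow_two]
  exact mul_le_mul hu hv (abs_nonneg _) ((abs_nonneg _).trans hu)

/-- The third order Taylor remainder of `nonlin` along `ε ↦ ν₀ + ε ν₁ + ε² ν₂`. -/
theorem exists_taylor {c : ℝ} (hc : 0 < c) (A : ℝ) (hA : 0 ≤ A) : ∃ C : ℝ, 0 ≤ C ∧
    ∀ (η ρ ε : ℝ) (s z w : Fin 3 → ℝ), c ≤ s 0 → c ≤ s 1 → s 0 ≤ A → s 1 ≤ A →
      (∀ i, |z i| ≤ A) → (∀ i, |w i| ≤ A) → 0 ≤ ε → ε ≤ 1 → ε * (2 * A) ≤ c / 2 →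
      ∀ i, |nonlin η ρ (fun i => s i + ε * z i + ε ^ 2 * w i) i - nonlin η ρ s i
        - ε * dnonlin η s z i - ε ^ 2 * (dnonlin η s w i + quadR s z i)| ≤ C * ε ^ 3 := by
  obtain ⟨M, hM0, -, hM2, hM3⟩ := exists_spin_bounds (half_pos hc) (A + c / 2)
  have hpi := Real.pi_pos
  set C := 8 * M * A ^ 3 + 2 * M * A ^ 2 + 3 * A ^ 2 + 24 * Real.pi * A ^ 2 with hC
  refine ⟨C, by positivity, ?_⟩
  intro η ρ ε s z w hs0 hs1 hA0 hA1 hz hw hε hε1 hεA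
  have hε3 : 0 ≤ ε ^ 3 := by positivity
  have hε43 : ε ^ 4 ≤ ε ^ 3 := pow_le_pow_of_le_one hε hε1 (by norm_num)
  have hε2 : ε ^ 2 ≤ ε := by simpa using pow_le_pow_of_le_one hε hε1 (m := 1) (n := 2) (by norm_num)
  have comb : ∀ {u v a a' : ℝ}, |u| ≤ a → |v| ≤ a' → |ε ^ 3 * u + ε ^ 4 * v| ≤ (a + a') * ε ^ 3 := by
    intro u v a a' hu hv
    refine (abs_add_le _ _).trans ?_
    rw [abs_mul, abs_mul, abs_of_nonneg hε3, abs_of_nonneg (by positivity : 0 ≤ ε ^ 4)]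
    have h1 := mul_le_mul_of_nonneg_left hu hε3
    have h2 : ε ^ 4 * |v| ≤ ε ^ 3 * a' := mul_le_mul hε43 hv (abs_nonneg _) hε3
    linarith
  -- the two spin components, with the sign of the field left open
  have key : ∀ (i : Fin 3) (e : ℝ), c ≤ s i → s i ≤ A →
      |(spin (s i + ε * z i + ε ^ 2 * w i) + (s 2 + ε * z 2 + ε ^ 2 * w 2 - e)
          * (s i + ε * z i + ε ^ 2 * w i)) - (spin (s i) + (s 2 - e) * s i)
        - ε * (spinD (s i) * z i + (s 2 - e) * z i + s i * z 2)
        - ε ^ 2 * ((spinD (s i) * w i + (s 2 - e) * w i + s i * w 2)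
          + (1 / 2 * spinDD (s i) * z i ^ 2 + z 2 * z i))| ≤ C * ε ^ 3 := by
    intro i e h1 h2
    set d := ε * z i + ε ^ 2 * w i with hd
    have hdabs : |d| ≤ 2 * A * ε := by
      refine (abs_add_le _ _).trans ?_
      rw [abs_mul, abs_mul, abs_of_nonneg hε, abs_of_nonneg (by positivity : 0 ≤ ε ^ 2)]
      have a1 := mul_le_mul_of_nonneg_left (hz i) hε
      have a2 : ε ^ 2 * |w i| ≤ ε * A := mul_le_mul hε2 (hw i) (abs_nonneg _) hε
      linarith
    have hd' := abs_le.1 hdabs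
    have m1 : s i ∈ Icc (c / 2) (A + c / 2) := ⟨by linarith, by linarith⟩
    have m2 : s i + d ∈ Icc (c / 2) (A + c / 2) :=
      ⟨by nlinarith [hd'.1], by nlinarith [hd'.2]⟩
    have t1 := hM3 _ m1 _ m2
    rw [add_sub_cancel_left] at t1
    have t2 : M * |d| ^ 3 ≤ 8 * M * A ^ 3 * ε ^ 3 := by
      have := mul_le_mul_of_nonneg_left (pow_le_pow_left₀ (abs_nonneg d) hdabs 3) hM0
      exact this.trans (le_of_eq (by ring))
    have half : |1 / 2 * spinDD (s i)| ≤ M / 2 := by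
      rw [abs_mul, abs_of_pos (by norm_num : (0 : ℝ) < 1 / 2)]
      linarith [hM2 _ m1]
    have t3 : |ε ^ 3 * (1 / 2 * spinDD (s i) * (2 * (z i * w i)))
        + ε ^ 4 * (1 / 2 * spinDD (s i) * (w i * w i))|
        ≤ (M / 2 * (2 * A ^ 2) + M / 2 * A ^ 2) * ε ^ 3 := by
      refine comb ?_ ?_
      · rw [abs_mul]
        refine mul_le_mul half ?_ (abs_nonneg _) (by positivity)
        rw [abs_mul, abs_of_pos (by norm_num : (0 : ℝ) < 2)]
        linarith [abs_mul_le_sq (hz i) (hw i)]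
      · rw [abs_mul]
        exact mul_le_mul half (abs_mul_le_sq (hw i) (hw i)) (abs_nonneg _) (by positivity)
    have t4 : |ε ^ 3 * (z 2 * w i + w 2 * z i) + ε ^ 4 * (w 2 * w i)|
        ≤ ((A ^ 2 + A ^ 2) + A ^ 2) * ε ^ 3 :=
      comb ((abs_add_le _ _).trans (add_le_add (abs_mul_le_sq (hz 2) (hw i))
        (abs_mul_le_sq (hw 2) (hz i)))) (abs_mul_le_sq (hw 2) (hw i))
    have e0 : s i + ε * z i + ε ^ 2 * w i = s i + d := by rw [hd]; ring
    have e1 : (spin (s i + ε * z i + ε ^ 2 * w i) + (s 2 + ε * z 2 + ε ^ 2 * w 2 - e)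
          * (s i + ε * z i + ε ^ 2 * w i)) - (spin (s i) + (s 2 - e) * s i)
        - ε * (spinD (s i) * z i + (s 2 - e) * z i + s i * z 2)
        - ε ^ 2 * ((spinD (s i) * w i + (s 2 - e) * w i + s i * w 2)
          + (1 / 2 * spinDD (s i) * z i ^ 2 + z 2 * z i))
        = (spin (s i + d) - spin (s i) - spinD (s i) * d - 1 / 2 * spinDD (s i) * d ^ 2)
          + (ε ^ 3 * (1 / 2 * spinDD (s i) * (2 * (z i * w i)))
            + ε ^ 4 * (1 / 2 * spinDD (s i) * (w i * w i)))
          + (ε ^ 3 * (z 2 * w i + w 2 * z i) + ε ^ 4 * (w 2 * w i)) := by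
      rw [e0, hd]; ring
    rw [e1]
    refine (abs_add_le _ _).trans ((add_le_add ((abs_add_le _ _).trans
      (add_le_add (t1.trans t2) t3)) t4).trans ?_)
    have b1 : 0 ≤ M * A ^ 2 * ε ^ 3 := by positivity
    have b2 : 0 ≤ Real.pi * A ^ 2 * ε ^ 3 := by positivity
    rw [hC]
    nlinarith
  refine forall_fin_three (key 0 η hs0 hA0) ?_ ?_
  · have h := key 1 (-η) hs1 hA1
    simp only [sub_neg_eq_add] at h
    exact h
  · change |-(4 * Real.pi) * ((s 0 + ε * z 0 + ε ^ 2 * w 0) ^ 2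
        + (s 1 + ε * z 1 + ε ^ 2 * w 1) ^ 2 - ρ) - -(4 * Real.pi) * (s 0 ^ 2 + s 1 ^ 2 - ρ)
      - ε * (-(8 * Real.pi) * (s 0 * z 0 + s 1 * z 1))
      - ε ^ 2 * (-(8 * Real.pi) * (s 0 * w 0 + s 1 * w 1)
        + -(4 * Real.pi) * (z 0 ^ 2 + z 1 ^ 2))| ≤ _
    have e1 : -(4 * Real.pi) * ((s 0 + ε * z 0 + ε ^ 2 * w 0) ^ 2
        + (s 1 + ε * z 1 + ε ^ 2 * w 1) ^ 2 - ρ) - -(4 * Real.pi) * (s 0 ^ 2 + s 1 ^ 2 - ρ)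
      - ε * (-(8 * Real.pi) * (s 0 * z 0 + s 1 * z 1))
      - ε ^ 2 * (-(8 * Real.pi) * (s 0 * w 0 + s 1 * w 1)
        + -(4 * Real.pi) * (z 0 ^ 2 + z 1 ^ 2))
      = -(4 * Real.pi) * (ε ^ 3 * (2 * (z 0 * w 0 + z 1 * w 1))
        + ε ^ 4 * (w 0 * w 0 + w 1 * w 1)) := by ring
    rw [e1, abs_mul, abs_neg, abs_of_pos (by positivity : (0 : ℝ) < 4 * Real.pi)]
    have t : |ε ^ 3 * (2 * (z 0 * w 0 + z 1 * w 1)) + ε ^ 4 * (w 0 * w 0 + w 1 * w 1)|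
        ≤ (2 * (A ^ 2 + A ^ 2) + (A ^ 2 + A ^ 2)) * ε ^ 3 := by
      refine comb ?_ ((abs_add_le _ _).trans (add_le_add (abs_mul_le_sq (hw 0) (hw 0))
        (abs_mul_le_sq (hw 1) (hw 1))))
      rw [abs_mul, abs_of_pos (by norm_num : (0 : ℝ) < 2)]
      exact mul_le_mul_of_nonneg_left ((abs_add_le _ _).trans (add_le_add
        (abs_mul_le_sq (hz 0) (hw 0)) (abs_mul_le_sq (hz 1) (hw 1)))) (by norm_num)
    refine (mul_le_mul_of_nonneg_left t (by positivity)).trans ?_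
    have b1 : 0 ≤ (8 * M * A ^ 3 + 2 * M * A ^ 2 + 3 * A ^ 2) * ε ^ 3 := by positivity
    rw [hC]
    nlinarith

/-! ### The equations on the supercell -/

theorem eulerLagrange_iff_nonlin {k n : ℕ} {ρb g : Space → ℝ} {u : Fin 3 → H b k n} :
    EulerLagrange ρb g u ↔ ∀ i, ∀ᵐ x ∂(cellMeasure b n),
      -(lap (u i) x) + nonlin (g x) (ρb x) (fun j => toL2 (u j) x) i = 0 := by
  rw [← ae_all_iff]
  refine eventually_congr (Eventually.of_forall fun x => ?_)
  constructor
  · rintro ⟨h0, h1, h2⟩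
    refine forall_fin_three ?_ ?_ ?_
    · refine (Eq.trans ?_ h0)
      change -(lap (u 0) x) + (5 / 3 * _ - 4 / 3 * _ + _) = _
      ring
    · refine (Eq.trans ?_ h1)
      change -(lap (u 1) x) + (5 / 3 * _ - 4 / 3 * _ + _) = _
      ring
    · change -(lap (u 2) x) + -(4 * Real.pi) * (toL2 (u 0) x ^ 2 + toL2 (u 1) x ^ 2 - ρb x) = 0
      rw [h2]; ring
  · intro h
    have h0 := h 0
    have h1 := h 1
    have h2 := h 2
    change -(lap (u 0) x) + (5 / 3 * _ - 4 / 3 * _ + _) = 0 at h0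
    change -(lap (u 1) x) + (5 / 3 * _ - 4 / 3 * _ + _) = 0 at h1
    change -(lap (u 2) x) + -(4 * Real.pi) * (toL2 (u 0) x ^ 2 + toL2 (u 1) x ^ 2 - ρb x) = 0 at h2
    exact ⟨by rw [← h0]; ring, by rw [← h1]; ring, by linarith⟩

/-- The linearized equations at zero field; `linRhs` accounts for the normalization of the third
equation. -/
theorem linearizedEq_iff_dnonlin {k n : ℕ} {c : Fin 3 → Space → ℝ} {w : Fin 3 → H b k n}
    {f : Fin 3 → Space → ℝ} :
    LinearizedEq c (fun _ => 0) w f ↔ ∀ i, ∀ᵐ x ∂(cellMeasure b n),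
      -(lap (w i) x) + dnonlin 0 (fun j => c j x) (fun j => toL2 (w j) x) i
        = Wiener.linRhs (fun j => f j x) i := by
  rw [← ae_all_iff]
  refine eventually_congr (Eventually.of_forall fun x => ?_)
  have hpi := Real.pi_pos
  constructor
  · rintro ⟨h0, h1, h2⟩
    refine forall_fin_three ?_ ?_ ?_
    · refine (Eq.trans ?_ h0)
      change -(lap (w 0) x) + ((35 / 9 * _ - 20 / 9 * _) * _ + _ + _) = _
      ring
    · refine (Eq.trans ?_ h1)
      change -(lap (w 1) x) + ((35 / 9 * _ - 20 / 9 * _) * _ + _ + _) = _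
      ring
    · change -(lap (w 2) x) + -(8 * Real.pi) * (c 0 x * toL2 (w 0) x + c 1 x * toL2 (w 1) x)
        = -(8 * Real.pi) * f 2 x
      rw [← h2]
      field_simp
      ring
  · intro h
    have h0 := h 0
    have h1 := h 1
    have h2 := h 2
    change -(lap (w 0) x) + ((35 / 9 * _ - 20 / 9 * _) * _ + _ + _) = f 0 x at h0
    change -(lap (w 1) x) + ((35 / 9 * _ - 20 / 9 * _) * _ + _ + _) = f 1 x at h1
    change -(lap (w 2) x) + -(8 * Real.pi) * (c 0 x * toL2 (w 0) x + c 1 x * toL2 (w 1) x)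
        = -(8 * Real.pi) * f 2 x at h2
    refine ⟨by rw [← h0]; ring, by rw [← h1]; ring, ?_⟩
    have e : lap (w 2) x = -(8 * Real.pi) * (c 0 x * toL2 (w 0) x + c 1 x * toL2 (w 1) x)
        + 8 * Real.pi * f 2 x := by linarith
    rw [e]
    field_simp
    ring

theorem lap_sub {k n : ℕ} [NeZero n] (hk : 2 ≤ k) (f g : H b k n) :
    lap (f - g) = lap f - lap g :=
  L2.ext_coef (by
    rw [coef_L2_sub]
    funext l
    rw [Pi.sub_apply, coef_lap hk, coef_lap hk, coef_lap hk, toL2_sub, coef_L2_sub, Pi.sub_apply]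
    ring)

theorem dnonlin_sub (η : ℝ) (s z w : Fin 3 → ℝ) :
    dnonlin η s (z - w) = dnonlin η s z - dnonlin η s w := by
  refine funext (forall_fin_three ?_ ?_ ?_)
  · change spinD (s 0) * (z 0 - w 0) + (s 2 - η) * (z 0 - w 0) + s 0 * (z 2 - w 2)
      = (spinD (s 0) * z 0 + (s 2 - η) * z 0 + s 0 * z 2)
        - (spinD (s 0) * w 0 + (s 2 - η) * w 0 + s 0 * w 2)
    ring
  · change spinD (s 1) * (z 1 - w 1) + (s 2 + η) * (z 1 - w 1) + s 1 * (z 2 - w 2)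
      = (spinD (s 1) * z 1 + (s 2 + η) * z 1 + s 1 * z 2)
        - (spinD (s 1) * w 1 + (s 2 + η) * w 1 + s 1 * w 2)
    ring
  · change -(8 * Real.pi) * (s 0 * (z 0 - w 0) + s 1 * (z 1 - w 1))
      = -(8 * Real.pi) * (s 0 * z 0 + s 1 * z 1) - -(8 * Real.pi) * (s 0 * w 0 + s 1 * w 1)
    ring

/-- `w` solves `-Δw + D(nonlin)(c) w = r` on `nΓ`. -/
def SolvesLin {n : ℕ} (c : Fin 3 → Space → ℝ) (w : Fin 3 → H b 2 n) (r : Fin 3 → L2 b n) : Prop :=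
  ∀ i, ∀ᵐ x ∂(cellMeasure b n),
    -(lap (w i) x) + dnonlin 0 (fun j => c j x) (fun j => toL2 (w j) x) i = r i x

theorem SolvesLin.sub {n : ℕ} [NeZero n] {c : Fin 3 → Space → ℝ} {w w' : Fin 3 → H b 2 n}
    {r r' : Fin 3 → L2 b n} (h : SolvesLin c w r) (h' : SolvesLin c w' r') :
    SolvesLin c (w - w') (r - r') := by
  intro i
  have ht : ∀ᵐ x ∂(cellMeasure b n), ∀ j,
      toL2 ((w - w') j) x = toL2 (w j) x - toL2 (w' j) x := ae_all_iff.2 fun j => by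
    rw [Pi.sub_apply, toL2_sub]
    exact Lp.coeFn_sub _ _
  filter_upwards [h i, h' i, ht, Lp.coeFn_sub (lap (w i)) (lap (w' i)),
    Lp.coeFn_sub (r i) (r' i)] with x h1 h2 h3 h4 h5
  have e : (fun j => toL2 ((w - w') j) x)
      = (fun j => toL2 (w j) x) - fun j => toL2 (w' j) x := funext h3
  rw [e, dnonlin_sub, Pi.sub_apply, Pi.sub_apply, Pi.sub_apply, lap_sub le_rfl, h4, h5,
    Pi.sub_apply, Pi.sub_apply, ← h1, ← h2]
  ring

/-- A pointwise bound by absolute values gives a bound of `L²` norms. -/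
theorem norm_le_sum_of_ae {n : ℕ} {ι : Type*} [Fintype ι] {f : L2 b n} {g : ι → L2 b n} {B : ℝ}
    (hB : 0 ≤ B) (h : ∀ᵐ x ∂(cellMeasure b n), |f x| ≤ B * ∑ j, |g j x|) :
    ‖f‖ ≤ B * ∑ j, ‖g j‖ := by
  have hG : ⇑(B • ∑ j, |g j|) =ᵐ[cellMeasure b n] fun x => B * ∑ j, |g j x| := by
    have h1 : ∀ᵐ x ∂(cellMeasure b n), ∀ j, |g j| x = |g j x| :=
      ae_all_iff.2 fun j => Lp.coeFn_abs (g j)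
    filter_upwards [Lp.coeFn_smul B (∑ j, |g j|), Lp.coeFn_fun_finsetSum Finset.univ fun j => |g j|,
      h1] with x h2 h3 h4
    rw [h2, Pi.smul_apply, h3, smul_eq_mul]
    simp only [h4]
  have h1 : ‖f‖ ≤ ‖B • ∑ j, |g j|‖ := by
    refine Lp.norm_le_norm_of_ae_le ?_
    filter_upwards [h, hG] with x hx hx2
    rw [hx2, Real.norm_eq_abs, Real.norm_eq_abs]
    exact hx.trans (le_abs_self _)
  refine h1.trans ?_
  rw [norm_smul, Real.norm_of_nonneg hB]
  refine mul_le_mul_of_nonneg_left ((norm_sum_le _ _).trans ?_) hB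
  exact Finset.sum_le_sum fun j _ => (norm_abs_eq_norm (g j)).le

/-- A uniform bound gives an `L²ₙ` bound that does not depend on `n`, because the measure of the
supercell is normalized. -/
theorem norm_le_of_ae_abs_le {n : ℕ} [NeZero n] {f : L2 b n} {κ : ℝ} (hκ : 0 ≤ κ)
    (h : ∀ᵐ x ∂(cellMeasure b n), |f x| ≤ κ) : ‖f‖ ≤ sqrtVol b * κ := by
  refine (Lp.norm_le_of_ae_bound hκ h).trans (le_of_eq ?_)
  have hm : (measureUnivNNReal (cellMeasure b n) : ℝ) = cellVol b := cellMeasure_real_univ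
  rw [hm, sqrtVol, Real.sqrt_eq_rpow]
  norm_num

theorem abs_dnonlin_le {A B : ℝ} {s z : Fin 3 → ℝ} (hs : ∀ i, |s i| ≤ A)
    (h0 : |spinD (s 0)| ≤ B) (h1 : |spinD (s 1)| ≤ B) (i : Fin 3) :
    |dnonlin 0 s z i| ≤ (B + 8 * Real.pi * A + 2 * A) * ∑ j, |z j| := by
  have hA : 0 ≤ A := (abs_nonneg _).trans (hs 0)
  have hB : 0 ≤ B := (abs_nonneg _).trans h0
  have hpi := Real.pi_pos
  have hz : ∀ j, 0 ≤ |z j| := fun j => abs_nonneg _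
  have m : ∀ {u a : ℝ} (v : ℝ), |u| ≤ a → |u * v| ≤ a * |v| := fun v h => by
    rw [abs_mul]; exact mul_le_mul_of_nonneg_right h (abs_nonneg _)
  have p1 : ∀ j, 0 ≤ B * |z j| := fun j => mul_nonneg hB (hz j)
  have p2 : ∀ j, 0 ≤ A * |z j| := fun j => mul_nonneg hA (hz j)
  have p3 : ∀ j, 0 ≤ 8 * Real.pi * A * |z j| := fun j => by have := hz j; positivity
  rw [Fin.sum_univ_three]
  revert i
  refine forall_fin_three ?_ ?_ ?_
  · change |spinD (s 0) * z 0 + (s 2 - 0) * z 0 + s 0 * z 2| ≤ _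
    rw [sub_zero]
    have h := (abs_add_le (spinD (s 0) * z 0 + s 2 * z 0) (s 0 * z 2)).trans
      (add_le_add ((abs_add_le _ _).trans (add_le_add (m _ h0) (m _ (hs 2)))) (m _ (hs 0)))
    linarith [p1 1, p1 2, p2 0, p2 1, p2 2, p3 0, p3 1, p3 2]
  · change |spinD (s 1) * z 1 + (s 2 + 0) * z 1 + s 1 * z 2| ≤ _
    rw [add_zero]
    have h := (abs_add_le (spinD (s 1) * z 1 + s 2 * z 1) (s 1 * z 2)).trans
      (add_le_add ((abs_add_le _ _).trans (add_le_add (m _ h1) (m _ (hs 2)))) (m _ (hs 1)))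
    linarith [p1 0, p1 2, p2 0, p2 1, p2 2, p3 0, p3 1, p3 2]
  · change |-(8 * Real.pi) * (s 0 * z 0 + s 1 * z 1)| ≤ _
    rw [abs_mul, abs_neg, abs_of_pos (by positivity : (0 : ℝ) < 8 * Real.pi)]
    have h := mul_le_mul_of_nonneg_left ((abs_add_le (s 0 * z 0) (s 1 * z 1)).trans
      (add_le_add (m _ (hs 0)) (m _ (hs 1)))) (by positivity : (0 : ℝ) ≤ 8 * Real.pi)
    linarith [p1 0, p1 1, p1 2, p2 0, p2 1, p2 2, p3 2]

/-- The stability estimate for the linearized problem at continuous states `c`, with the solution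
measured in `H²` on every supercell. -/
theorem exists_solvesLin {c : Fin 3 → Space → ℝ} {a A M : ℝ} (ha : 0 < a)
    (h0 : ∀ x, a ≤ c 0 x) (h1 : ∀ x, a ≤ c 1 x) (hA : ∀ i x, |c i x| ≤ A)
    (hstab : ∀ n : ℕ, 1 ≤ n → ∀ f : Fin 3 → L2 b n, ∃ w : Fin 3 → H b 2 n,
      LinearizedEq c (fun _ => 0) w (fun i => f i) ∧
      (∀ w' : Fin 3 → H b 2 n, LinearizedEq c (fun _ => 0) w' (fun i => f i) → w' = w) ∧
      ‖fun i => toL2 (w i)‖ ≤ M * ‖f‖) :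
    ∃ M' > 0, ∀ (n : ℕ) [NeZero n] (r : Fin 3 → L2 b n),
      (∃ w : Fin 3 → H b 2 n, SolvesLin c w r) ∧
      ∀ w : Fin 3 → H b 2 n, SolvesLin c w r → ‖w‖ ≤ M' * ‖r‖ := by
  have hpi := Real.pi_pos
  have hA0 : 0 ≤ A := (abs_nonneg _).trans (hA 0 0)
  obtain ⟨B, hB0, hB⟩ : ∃ B, 0 ≤ B ∧ ∀ t ∈ Icc a A, |spinD t| ≤ B := by
    obtain ⟨B, hB⟩ := (isCompact_Icc (a := a) (b := A)).exists_bound_of_continuousOn (f := spinD)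
      fun t ht => (hasDerivAt_spinD (ha.trans_le ht.1)).continuousAt.continuousWithinAt
    exact ⟨max B 0, le_max_right _ _, fun t ht => (hB t ht).trans (le_max_left _ _)⟩
  set B' := B + 8 * Real.pi * A + 2 * A with hB'
  have hB'0 : 0 ≤ B' := by positivity
  set N : ℝ := 4 * Fintype.card (MultiIndex 2) with hN
  have hN0 : 0 ≤ N := by positivity
  refine ⟨N * (1 + |M| + 3 * B' * |M|) + 1, by positivity, fun n _ r => ?_⟩
  have hn : 1 ≤ n := NeZero.one_le
  -- the right-hand side in the normalization of the linearized operator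
  let f : Fin 3 → L2 b n := ![r 0, r 1, (-(8 * Real.pi))⁻¹ • r 2]
  have hf : ∀ w : Fin 3 → H b 2 n, LinearizedEq c (fun _ => 0) w (fun i => f i) ↔
      SolvesLin c w r := by
    intro w
    rw [linearizedEq_iff_dnonlin]
    have e : ∀ i, ∀ᵐ x ∂(cellMeasure b n), Wiener.linRhs (fun j => f j x) i = r i x := by
      refine forall_fin_three ?_ ?_ ?_
      · exact Eventually.of_forall fun x => rfl
      · exact Eventually.of_forall fun x => rfl
      · filter_upwards [Lp.coeFn_smul (-(8 * Real.pi))⁻¹ (r 2)] with x hx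
        change -(8 * Real.pi) * (((-(8 * Real.pi))⁻¹ • r 2 : L2 b n) x) = r 2 x
        rw [hx, Pi.smul_apply, smul_eq_mul, mul_inv_cancel_left₀ (by linarith)]
    refine forall_congr' fun i => eventually_congr ?_
    filter_upwards [e i] with x hx
    rw [hx]
  have hfr : ‖f‖ ≤ ‖r‖ := by
    rw [pi_norm_le_iff_of_nonneg (norm_nonneg _)]
    refine forall_fin_three (norm_le_pi_norm r 0) (norm_le_pi_norm r 1) ?_
    change ‖(-(8 * Real.pi))⁻¹ • r 2‖ ≤ _
    rw [norm_smul, norm_inv, norm_neg, Real.norm_of_nonneg (by positivity)]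
    have h8 : (8 * Real.pi)⁻¹ ≤ 1 := inv_le_one_of_one_le₀ (by nlinarith [Real.pi_gt_three])
    exact (mul_le_of_le_one_left (norm_nonneg _) h8).trans (norm_le_pi_norm r 2)
  obtain ⟨w₀, hw₀, huniq, hbound⟩ := hstab n hn f
  refine ⟨⟨w₀, (hf w₀).1 hw₀⟩, fun w hw => ?_⟩
  obtain rfl := huniq w ((hf w).2 hw)
  have hL2 : ∀ i, ‖toL2 (w i)‖ ≤ |M| * ‖r‖ := fun i =>
    (norm_le_pi_norm (fun i => toL2 (w i)) i).trans (hbound.trans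
      (mul_le_mul (le_abs_self M) hfr (norm_nonneg _) (abs_nonneg _)))
  have hd : ∀ i, ‖r i + lap (w i)‖ ≤ B' * ∑ j, ‖toL2 (w j)‖ := fun i => by
    refine norm_le_sum_of_ae hB'0 ?_
    filter_upwards [hw i, Lp.coeFn_add (r i) (lap (w i))] with x hx hx2
    rw [hx2, Pi.add_apply, ← hx, neg_add_eq_sub, sub_add_cancel]
    exact abs_dnonlin_le (fun i => hA i x) (hB _ ⟨h0 x, (le_abs_self _).trans (hA 0 x)⟩)
      (hB _ ⟨h1 x, (le_abs_self _).trans (hA 1 x)⟩) i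
  have hsum : ∑ j, ‖toL2 (w j)‖ ≤ 3 * (|M| * ‖r‖) := by
    rw [Fin.sum_univ_three]; linarith [hL2 0, hL2 1, hL2 2]
  rw [pi_norm_le_iff_of_nonneg (by positivity)]
  intro i
  -- the elliptic estimate upgrades the `L²` bound to `H²`
  have e : toL2 (w i) - lap (w i) = toL2 (w i) + r i - (r i + lap (w i)) := by abel
  have h3 : ‖toL2 (w i) - lap (w i)‖ ≤ |M| * ‖r‖ + ‖r‖ + B' * (3 * (|M| * ‖r‖)) := by
    rw [e]
    refine (norm_sub_le _ _).trans (add_le_add ((norm_add_le _ _).trans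
      (add_le_add (hL2 i) (norm_le_pi_norm r i))) ((hd i).trans
      (mul_le_mul_of_nonneg_left hsum hB'0)))
  have h4 := (norm_H2_le (w i)).trans (mul_le_mul_of_nonneg_left h3 hN0)
  refine h4.trans ?_
  have := norm_nonneg r
  linarith

/-- The nonlinearity at essentially bounded states is square integrable. -/
theorem memLp_nonlin {n : ℕ} {g ρb : Space → ℝ} (hg : Continuous g) (hρ : Continuous ρb)
    {p : Fin 3 → Space → ℝ} (hp : ∀ i, MemLp (p i) ⊤ (cellMeasure b n)) (i : Fin 3) :
    MemLp (fun x => nonlin (g x) (ρb x) (fun j => p j x) i) 2 (cellMeasure b n) := by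
  have mul : ∀ {f h : Space → ℝ}, MemLp f ⊤ (cellMeasure b n) → MemLp h ⊤ (cellMeasure b n) →
      MemLp (fun x => f x * h x) ⊤ (cellMeasure b n) := fun hf hh => hh.mul hf
  have spin' : ∀ {f : Space → ℝ}, MemLp f ⊤ (cellMeasure b n) →
      MemLp (fun x => spin (f x)) ⊤ (cellMeasure b n) := by
    intro f hf
    obtain ⟨C, hC⟩ := (isCompact_Icc (a := -(eLpNormEssSup f (cellMeasure b n)).toReal)
      (b := (eLpNormEssSup f (cellMeasure b n)).toReal)).exists_bound_of_continuousOn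
      continuous_spin.continuousOn
    refine memLp_top_of_bound (continuous_spin.comp_aestronglyMeasurable hf.1) C ?_
    have hfin : eLpNormEssSup f (cellMeasure b n) ≠ ⊤ := by
      simpa using hf.2.ne
    filter_upwards [ae_le_eLpNormEssSup (f := f) (μ := cellMeasure b n)] with x hx
    refine hC _ (abs_le.1 ?_)
    rw [← Real.norm_eq_abs, ← toReal_enorm]
    exact ENNReal.toReal_mono hfin hx
  have hg' := memLp_of_continuous (b := b) (n := n) hg ⊤
  have hρ' := memLp_of_continuous (b := b) (n := n) hρ ⊤
  refine MemLp.mono_exponent (q := ⊤) ?_ le_top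
  revert i
  refine forall_fin_three ?_ ?_ ?_
  · exact (spin' (hp 0)).add (mul ((hp 2).sub hg') (hp 0))
  · exact (spin' (hp 1)).add (mul ((hp 2).add hg') (hp 1))
  · have h := (((mul (hp 0) (hp 0)).add (mul (hp 1) (hp 1))).sub hρ').const_mul (-(4 * Real.pi))
    refine h.ae_eq (Eventually.of_forall fun x => ?_)
    change -(4 * Real.pi) * (p 0 x * p 0 x + p 1 x * p 1 x - ρb x)
      = -(4 * Real.pi) * (p 0 x ^ 2 + p 1 x ^ 2 - ρb x)
    ring

theorem memLp_dnonlin {n : ℕ} {c : Fin 3 → Space → ℝ} {a : ℝ} (ha : 0 < a)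
    (hc : ∀ i, Continuous (c i)) (h0 : ∀ x, a ≤ c 0 x) (h1 : ∀ x, a ≤ c 1 x)
    (w : Fin 3 → L2 b n) (i : Fin 3) :
    MemLp (fun x => dnonlin 0 (fun j => c j x) (fun j => w j x) i) 2 (cellMeasure b n) := by
  have mul : ∀ {f : Space → ℝ} (_ : Continuous f) (j : Fin 3),
      MemLp (fun x => f x * w j x) 2 (cellMeasure b n) := fun hf j =>
    (Lp.memLp (w j)).mul (memLp_of_continuous hf ⊤)
  have cs : ∀ {f : Space → ℝ}, Continuous f → (∀ x, a ≤ f x) → Continuous fun x => spinD (f x) :=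
    fun hf h => continuous_iff_continuousAt.2 fun x => ContinuousAt.comp (g := spinD)
      (hasDerivAt_spinD (ha.trans_le (h x))).continuousAt hf.continuousAt
  revert i
  refine forall_fin_three ?_ ?_ ?_
  · exact ((mul (cs (hc 0) h0) 0).add (mul ((hc 2).sub continuous_const) 0)).add (mul (hc 0) 2)
  · exact ((mul (cs (hc 1) h1) 1).add (mul ((hc 2).add continuous_const) 1)).add (mul (hc 1) 2)
  · exact ((mul (hc 0) 0).add (mul (hc 1) 1)).const_mul (-(8 * Real.pi))

/-! ### Solutions near an approximate solution -/

theorem ae_abs_le_of_norm_le {n : ℕ} [NeZero n] {w : Fin 3 → H b 2 n} {D : ℝ} (hw : ‖w‖ ≤ D) :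
    ∀ᵐ x ∂(cellMeasure b n), ∀ i, |toL2 (w i) x| ≤ sobolevConst b * (n : ℝ) ^ 2 * D := by
  refine ae_all_iff.2 fun i => ?_
  filter_upwards [ae_abs_le_H2 (w i)] with x hx
  have h0 : 0 ≤ sobolevConst b := sobolevConst_nonneg
  exact hx.trans (mul_le_mul_of_nonneg_left ((norm_le_pi_norm w i).trans hw) (by positivity))

/-- Quantitative inverse function theorem on the supercells: if the linearized problem at `c` is
stable uniformly in `n`, then near an approximate solution `u⁰` that is uniformly close to `c` there
is a unique exact solution. The solution is the fixed point of a contraction of the residual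
`r = -Δω + D(nonlin)(c) ω ∈ L²` of the correction `ω = u - u⁰`. -/
theorem exists_unique_near {c : Fin 3 → Space → ℝ} {a A M : ℝ} (ha : 0 < a)
    (hc : ∀ i, Continuous (c i))
    (h0 : ∀ x, a ≤ c 0 x) (h1 : ∀ x, a ≤ c 1 x) (hA : ∀ i x, |c i x| ≤ A)
    (hstab : ∀ n : ℕ, 1 ≤ n → ∀ f : Fin 3 → L2 b n, ∃ w : Fin 3 → H b 2 n,
      LinearizedEq c (fun _ => 0) w (fun i => f i) ∧
      (∀ w' : Fin 3 → H b 2 n, LinearizedEq c (fun _ => 0) w' (fun i => f i) → w' = w) ∧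
      ‖fun i => toL2 (w i)‖ ≤ M * ‖f‖) :
    ∃ M₁ > 0, ∃ τ > 0, ∀ (n : ℕ) [NeZero n] (g ρb : Space → ℝ), Continuous g → Continuous ρb →
      (∀ x, |g x| ≤ τ) → ∀ u0 : Fin 3 → H b 2 n,
      (∀ᵐ x ∂(cellMeasure b n), ∀ i, |toL2 (u0 i) x - c i x| ≤ τ) →
      ∀ D κ : ℝ, sobolevConst b * (n : ℝ) ^ 2 * D ≤ τ → 0 ≤ κ → M₁ * κ ≤ D →
      (∀ i, ∀ᵐ x ∂(cellMeasure b n),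
        |-(lap (u0 i) x) + nonlin (g x) (ρb x) (fun j => toL2 (u0 j) x) i| ≤ κ) →
      ∃ u : Fin 3 → H b 2 n, EulerLagrange ρb g u ∧ ‖u - u0‖ ≤ M₁ * κ ∧
        ∀ u' : Fin 3 → H b 2 n, EulerLagrange ρb g u' → ‖u' - u0‖ ≤ D → u' = u := by
  obtain ⟨M', hM', hlin⟩ := exists_solvesLin ha h0 h1 hA hstab
  obtain ⟨τ, hτ, -, hcontr⟩ := exists_contraction ha A (θ := 1 / (6 * M')) (by positivity)
  set v := sqrtVol b with hv
  have hv0 : 0 < v := sqrtVol_pos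
  refine ⟨M' * (2 * v), by positivity, τ / 2, half_pos hτ, ?_⟩
  intro n _ g ρb hg hρ hgτ u0 hu0 D κ hD hκ hκD hres
  -- Only `L^∞` bounds that depend on `n` are available for functions in `H²ₙ`; they suffice for
  -- the nonlinearity to map into `L²`.
  have hbdd : ∀ u : Fin 3 → H b 2 n, ∀ i, MemLp (toL2 (u i)) ⊤ (cellMeasure b n) := fun u i =>
    memLp_top_of_bound (Lp.aestronglyMeasurable _) _ (ae_abs_le_H2 (u i))
  let N : (Fin 3 → H b 2 n) → Fin 3 → L2 b n := fun u i =>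
    (memLp_nonlin hg hρ (hbdd u) i).toLp _
  let Dc : (Fin 3 → H b 2 n) → Fin 3 → L2 b n := fun w i =>
    (memLp_dnonlin ha hc h0 h1 (fun j => toL2 (w j)) i).toLp _
  let Q : (Fin 3 → H b 2 n) → Fin 3 → L2 b n := fun w i => Dc w i + lap (u0 i) - N (u0 + w) i
  have hQ : ∀ w i, ∀ᵐ x ∂(cellMeasure b n), Q w i x
      = dnonlin 0 (fun j => c j x) (fun j => toL2 (w j) x) i + lap (u0 i) x
        - nonlin (g x) (ρb x) (fun j => toL2 ((u0 + w) j) x) i := by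
    intro w i
    filter_upwards [Lp.coeFn_sub (Dc w i + lap (u0 i)) (N (u0 + w) i),
      Lp.coeFn_add (Dc w i) (lap (u0 i)),
      (memLp_dnonlin ha hc h0 h1 (fun j => toL2 (w j)) i).coeFn_toLp,
      (memLp_nonlin hg hρ (hbdd (u0 + w)) i).coeFn_toLp] with x e1 e2 e3 e4
    rw [e1, Pi.sub_apply, e2, Pi.add_apply, e3, e4]
  -- the equations for `u⁰ + w` say that `w` solves the linearized problem with right-hand side `Q w`
  have hEL : ∀ w, EulerLagrange ρb g (u0 + w) ↔ SolvesLin c w (Q w) := by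
    intro w
    rw [eulerLagrange_iff_nonlin]
    refine forall_congr' fun i => eventually_congr ?_
    have hl : lap ((u0 + w) i) = lap (u0 i) + lap (w i) := by
      have h := lap_sub le_rfl ((u0 + w) i) (w i)
      rw [Pi.add_apply, add_sub_cancel_right] at h
      rw [h, Pi.add_apply, sub_add_cancel]
    filter_upwards [hQ w i, Lp.coeFn_add (lap (u0 i)) (lap (w i))] with x e1 e2
    rw [e1, hl, e2, Pi.add_apply]
    constructor <;> intro h <;> linarith
  have hdiff : ∀ w w' : Fin 3 → H b 2 n, ‖w‖ ≤ D → ‖w'‖ ≤ D →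
      ‖Q w - Q w'‖ ≤ 1 / (2 * M') * ‖w - w'‖ := by
    intro w w' hw hw'
    rw [pi_norm_le_iff_of_nonneg (by positivity)]
    intro i
    have hsum : ∀ᵐ x ∂(cellMeasure b n), ∀ j,
        toL2 ((u0 + w) j) x = toL2 (u0 j) x + toL2 (w j) x ∧
        toL2 ((u0 + w') j) x = toL2 (u0 j) x + toL2 (w' j) x ∧
        toL2 ((w - w') j) x = toL2 (w j) x - toL2 (w' j) x := ae_all_iff.2 fun j => by
      rw [Pi.add_apply, Pi.add_apply, Pi.sub_apply, toL2_add, toL2_add, toL2_sub]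
      filter_upwards [Lp.coeFn_add (toL2 (u0 j)) (toL2 (w j)),
        Lp.coeFn_add (toL2 (u0 j)) (toL2 (w' j)),
        Lp.coeFn_sub (toL2 (w j)) (toL2 (w' j))] with x e1 e2 e3
      exact ⟨e1, e2, e3⟩
    have hle : ‖(Q w - Q w') i‖ ≤ 1 / (6 * M') * ∑ j, ‖toL2 ((w - w') j)‖ := by
      refine norm_le_sum_of_ae (by positivity) ?_
      filter_upwards [hQ w i, hQ w' i, Lp.coeFn_sub (Q w i) (Q w' i), hsum, hu0,
        ae_abs_le_of_norm_le hw, ae_abs_le_of_norm_le hw'] with x e1 e2 e3 e4 e5 e6 e7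
      have near : ∀ {z : Fin 3 → H b 2 n}, (∀ i, |toL2 (z i) x| ≤ sobolevConst b * (n : ℝ) ^ 2 * D) →
          ∀ i, |toL2 (u0 i) x + toL2 (z i) x - c i x| ≤ τ := fun hz i => by
        rw [add_sub_right_comm]
        exact (abs_add_le _ _).trans (by linarith [e5 i, hz i])
      have key := hcontr (g x) (ρb x) (fun j => c j x) (fun j => toL2 (u0 j) x + toL2 (w j) x)
        (fun j => toL2 (u0 j) x + toL2 (w' j) x) (h0 x) (h1 x) ((le_abs_self _).trans (hA 0 x))
        ((le_abs_self _).trans (hA 1 x)) (near e6) (near e7) ((hgτ x).trans (by linarith)) i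
      rw [Pi.sub_apply, e3, Pi.sub_apply, e1, e2]
      have s1 : (fun j => toL2 ((u0 + w) j) x) = fun j => toL2 (u0 j) x + toL2 (w j) x :=
        funext fun j => (e4 j).1
      have s2 : (fun j => toL2 ((u0 + w') j) x) = fun j => toL2 (u0 j) x + toL2 (w' j) x :=
        funext fun j => (e4 j).2.1
      have s3 : ∀ j, toL2 ((w - w') j) x = toL2 (w j) x - toL2 (w' j) x := fun j => (e4 j).2.2
      have s4 : ((fun j => toL2 (u0 j) x + toL2 (w j) x) - fun j => toL2 (u0 j) x + toL2 (w' j) x)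
          = (fun j => toL2 (w j) x) - fun j => toL2 (w' j) x := by
        funext j; simp
      rw [s4, dnonlin_sub, Pi.sub_apply] at key
      rw [s1, s2]
      simp only [s3]
      simp only [add_sub_add_left_eq_sub] at key
      refine (le_of_eq ?_).trans key
      congr 1
      ring
    refine hle.trans ?_
    have hj : ∀ j, ‖toL2 ((w - w') j)‖ ≤ ‖w - w'‖ := fun j =>
      (norm_toL2_le _).trans (norm_le_pi_norm (w - w') j)
    have h3 : ∑ j, ‖toL2 ((w - w') j)‖ ≤ 3 * ‖w - w'‖ := by
      rw [Fin.sum_univ_three]; linarith [hj 0, hj 1, hj 2]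
    refine (mul_le_mul_of_nonneg_left h3 (by positivity)).trans (le_of_eq ?_)
    field_simp
    ring
  have hQ0 : ‖Q 0‖ ≤ v * κ := by
    rw [pi_norm_le_iff_of_nonneg (by positivity)]
    intro i
    have hae : ∀ᵐ x ∂(cellMeasure b n), |Q 0 i x| ≤ κ := by
      have hz : ∀ᵐ x ∂(cellMeasure b n), ∀ j, toL2 ((0 : Fin 3 → H b 2 n) j) x = 0 :=
        ae_all_iff.2 fun j => by
          have h : toL2 ((0 : Fin 3 → H b 2 n) j) = (0 : L2 b n) := rfl
          rw [h]
          filter_upwards [Lp.coeFn_zero ℝ 2 (cellMeasure b n)] with x hx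
          rw [hx, Pi.zero_apply]
      filter_upwards [hQ 0 i, hres i, hz] with x e1 e2 e3
      have e4 : (fun j => toL2 ((0 : Fin 3 → H b 2 n) j) x) = 0 := funext e3
      have e5 : dnonlin 0 (fun j => c j x) 0 = 0 := by
        simpa using dnonlin_sub 0 (fun j => c j x) 0 0
      rw [e1, e4, e5, Pi.zero_apply, zero_add, ← abs_neg, add_zero]
      refine (le_of_eq ?_).trans e2
      congr 1
      ring
    exact norm_le_of_ae_abs_le hκ hae
  -- `T` is the inverse of the linearized operator; the solution is `u⁰ + T r` with `Q (T r) = r`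
  choose T hT using fun r => (hlin n r).1
  have hTsub : ∀ r r', ‖T r - T r'‖ ≤ M' * ‖r - r'‖ := fun r r' =>
    (hlin n (r - r')).2 _ ((hT r).sub (hT r'))
  have hTnorm : ∀ r, ‖T r‖ ≤ M' * ‖r‖ := fun r => (hlin n r).2 _ (hT r)
  set R := 2 * v * κ with hR
  have hR0 : 0 ≤ R := by positivity
  have hRD : ∀ r : Fin 3 → L2 b n, ‖r‖ ≤ R → ‖T r‖ ≤ D := fun r hr =>
    (hTnorm r).trans ((mul_le_mul_of_nonneg_left hr hM'.le).trans (by rw [hR]; linarith))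
  have hD0 : 0 ≤ D := (by positivity : 0 ≤ M' * (2 * v) * κ).trans hκD
  have hlip : ∀ r r' : Fin 3 → L2 b n, ‖r‖ ≤ R → ‖r'‖ ≤ R →
      ‖Q (T r) - Q (T r')‖ ≤ 1 / 2 * ‖r - r'‖ := fun r r' hr hr' => by
    refine (hdiff _ _ (hRD r hr) (hRD r' hr')).trans
      ((mul_le_mul_of_nonneg_left (hTsub r r') (by positivity)).trans (le_of_eq ?_))
    field_simp
  have hmaps : MapsTo (fun r => Q (T r)) (Metric.closedBall 0 R) (Metric.closedBall 0 R) := by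
    intro r hr
    rw [mem_closedBall_zero_iff] at hr ⊢
    have h2 : ‖Q (T r) - Q 0‖ ≤ 1 / 2 * R := by
      refine (hdiff (T r) 0 (hRD r hr) (by rwa [norm_zero])).trans ?_
      rw [sub_zero]
      refine (mul_le_mul_of_nonneg_left ((hTnorm r).trans (mul_le_mul_of_nonneg_left hr hM'.le))
        (by positivity)).trans (le_of_eq ?_)
      field_simp
    calc ‖Q (T r)‖ = ‖(Q (T r) - Q 0) + Q 0‖ := by rw [sub_add_cancel]
      _ ≤ 1 / 2 * R + v * κ := (norm_add_le _ _).trans (add_le_add h2 hQ0)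
      _ = R := by rw [hR]; ring
  obtain ⟨r, hr, hfix⟩ : ∃ r ∈ Metric.closedBall (0 : Fin 3 → L2 b n) R, Q (T r) = r := by
    have hcw : ContractingWith (1 / 2) (hmaps.restrict _ _ _) := by
      refine ⟨NNReal.half_lt_self one_ne_zero, LipschitzWith.of_dist_le_mul
        fun r r' => ?_⟩
      have h := hlip r.1 r'.1 (mem_closedBall_zero_iff.1 r.2) (mem_closedBall_zero_iff.1 r'.2)
      rw [Subtype.dist_eq, Subtype.dist_eq, dist_eq_norm, dist_eq_norm]
      simpa using h
    obtain ⟨r, hr, hf, -⟩ := ContractingWith.exists_fixedPoint' Metric.isClosed_closedBall.isComplete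
      hmaps hcw (Metric.mem_closedBall_self hR0) (edist_ne_top _ _)
    exact ⟨r, hr, hf⟩
  rw [mem_closedBall_zero_iff] at hr
  have hsol : EulerLagrange ρb g (u0 + T r) := (hEL _).2 (by rw [hfix]; exact hT r)
  refine ⟨u0 + T r, hsol, ?_, fun u' hu' hD' => ?_⟩
  · rw [add_sub_cancel_left]
    refine (hTnorm r).trans ((mul_le_mul_of_nonneg_left hr hM'.le).trans (le_of_eq ?_))
    rw [hR]; ring
  · -- the contraction estimate holds for all corrections of norm at most `D`, not only for `T r`
    -- with `‖r‖ ≤ R`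
    set w := u' - u0 with hw
    have hu'w : u' = u0 + w := by rw [hw, add_sub_cancel]
    rw [hu'w] at hu'
    have h1 := (hlin n _).2 _ (((hEL w).1 hu').sub ((hEL (T r)).1 hsol))
    have h2 := hdiff w (T r) hD' (hRD r hr)
    have h3 : ‖w - T r‖ ≤ 1 / 2 * ‖w - T r‖ := by
      refine h1.trans ((mul_le_mul_of_nonneg_left h2 hM'.le).trans (le_of_eq ?_))
      field_simp
    have h4 : ‖w - T r‖ = 0 := le_antisymm (by linarith [norm_nonneg (w - T r)]) (norm_nonneg _)
    rw [hu'w, sub_eq_zero.1 (norm_eq_zero.1 h4)]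

namespace Wiener

/-! ### The residual of the two-scale approximation -/

theorem mixOp_add_smul (ε : ℝ) {U V : Space → Triple b} (hU : ContDiff ℝ ∞ U)
    (hV : ContDiff ℝ ∞ V) (x : Space) :
    mixOp (fun x => U x + ε • V x) x = mixOp U x + ε • mixOp V x := by
  unfold mixOp
  rw [Finset.smul_sum, ← Finset.sum_add_distrib]
  refine Finset.sum_congr rfl fun j _ => ?_
  rw [pd_add_smul j ε hU hV, map_add, map_smul, smul_add, smul_comm]

theorem lapOp_add_smul (ε : ℝ) {U V : Space → Triple b} (hU : ContDiff ℝ ∞ U)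
    (hV : ContDiff ℝ ∞ V) (x : Space) :
    lapOp (fun x => U x + ε • V x) x = lapOp U x + ε • lapOp V x := by
  unfold lapOp
  rw [Finset.smul_sum, ← Finset.sum_add_distrib]
  refine Finset.sum_congr rfl fun j _ => ?_
  rw [pd_add_smul j ε hU hV, pd_add_smul j ε (contDiff_pd j hU) (contDiff_pd j hV), map_add,
    map_smul]

/-- The operator of `exists_twoScale` for a component of a triple. -/
theorem twoScaleOp_component (ε : ℝ) {U : Space → Triple b} (hU : ContDiff ℝ ∞ U) (x : Space)
    (i : Fin 3) :
    twoScaleOp ε (fun x => U x i) x = U x i - ε • mixOp U x i - ε ^ 2 • lapOp U x i := by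
  have hp : ∀ (j : Fin 3) {V : Space → Triple b}, ContDiff ℝ ∞ V →
      pd j (fun x => V x i) = fun x => pd j V x i := fun j V hV =>
    pd_clm j (ContinuousLinearMap.proj (R := ℝ) (φ := fun _ : Fin 3 => Wiener b) i) hV
  unfold twoScaleOp mixOp lapOp
  rw [Finset.sum_apply, Finset.sum_apply, Finset.smul_sum, Finset.smul_sum, sub_sub,
    ← Finset.sum_add_distrib]
  refine congrArg (U x i - ·) (Finset.sum_congr rfl fun j _ => ?_)
  rw [hp j hU, hp j (contDiff_pd j hU), Pi.smul_apply, smul_smul, mul_comm ε 2]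
  rfl

theorem mixOp_add_period {U : Space → Triple b} (hU : ∀ i x, U (x + b i) = U x) (i : Fin 3)
    (x : Space) : mixOp U (x + b i) = mixOp U x := by
  unfold mixOp
  simp only [pd_add_period _ hU]

theorem lapOp_add_period {U : Space → Triple b} (hU : ∀ i x, U (x + b i) = U x) (i : Fin 3)
    (x : Space) : lapOp U (x + b i) = lapOp U x := by
  unfold lapOp
  simp only [pd_add_period _ (pd_add_period _ hU)]

variable {ρ : Wiener b} {Y : ℝ → Triple b} {h : Space → ℝ} {r : ℝ}

theorem src0_add_period (hp : ∀ i x, h (x + b i) = h x) (i : Fin 3) (x : Space) :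
    src0 ρ Y h (x + b i) = src0 ρ Y h x := by
  unfold src0; rw [hp]

theorem src1_add_period (hp : ∀ i x, h (x + b i) = h x) (i : Fin 3) (x : Space) :
    src1 ρ Y h (x + b i) = src1 ρ Y h x := by
  unfold src1; rw [hp, mixOp_add_period (src0_add_period hp)]

theorem src2_add_period (hp : ∀ i x, h (x + b i) = h x) (i : Fin 3) (x : Space) :
    src2 ρ Y h (x + b i) = src2 ρ Y h x := by
  unfold src2
  rw [hp, mixOp_add_period (src1_add_period hp), lapOp_add_period (src0_add_period hp),
    src1_add_period hp]

/-- The source at `y` is `u - nonlin u` at `u = cube y`. -/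
theorem ev_source {y : Triple b} (hy0 : ∀ x, 0 < ev x (y 0)) (hy1 : ∀ x, 0 < ev x (y 1)) (η : ℝ)
    (x : Space) (i : Fin 3) :
    ev x (source ρ η y i)
      = ev x (cube y i) - nonlin η (ev x ρ) (fun j => ev x (cube y j)) i := by
  have p0 := cube_rpow (hy0 x)
  have p1 := cube_rpow (hy1 x)
  revert i
  refine forall_fin_three ?_ ?_ ?_
  · change ev x (spinSource η (y 0) (y 2)) = ev x (cube y 0)
      - (spin (ev x (cube y 0)) + (ev x (cube y 2) - η) * ev x (cube y 0))
    rw [ev_cube0, cube_two, spin, p0.1, p0.2.1]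
    simp only [spinSource, map_add, map_sub, map_smul, ev_mul, ev_pow, ev_one, smul_eq_mul]
    ring
  · change ev x (spinSource (-η) (y 1) (y 2)) = ev x (cube y 1)
      - (spin (ev x (cube y 1)) + (ev x (cube y 2) + η) * ev x (cube y 1))
    rw [ev_cube1, cube_two, spin, p1.1, p1.2.1]
    simp only [spinSource, map_add, map_sub, map_smul, ev_mul, ev_pow, ev_one, smul_eq_mul]
    ring
  · change ev x (y 2 + (4 * Real.pi) • (y 0 ^ 6 + y 1 ^ 6 - ρ)) = ev x (cube y 2)
      - -(4 * Real.pi) * (ev x (cube y 0) ^ 2 + ev x (cube y 1) ^ 2 - ev x ρ)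
    rw [ev_cube0, ev_cube1, cube_two]
    simp only [map_add, map_sub, map_smul, ev_pow, smul_eq_mul]
    ring

/-- The linearized source is `z - D(nonlin) z`. -/
theorem ev_matOp_linMat {y : Triple b} (hy0 : ∀ x, 0 < ev x (y 0)) (hy1 : ∀ x, 0 < ev x (y 1))
    (η : ℝ) (z : Triple b) (x : Space) (i : Fin 3) :
    ev x (matOp (linMat η y) z i)
      = ev x (z i) - dnonlin η (fun j => ev x (cube y j)) (fun j => ev x (z j)) i := by
  have p0 := cube_rpow (hy0 x)
  have p1 := cube_rpow (hy1 x)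
  rw [matOp_apply]
  revert i
  refine forall_fin_three ?_ ?_ ?_
  · change ev x (spinCoef η (y 0) (y 2) * z 0 + 0 * z 1 + -y 0 ^ 3 * z 2) = ev x (z 0)
      - (spinD (ev x (cube y 0)) * ev x (z 0) + (ev x (cube y 2) - η) * ev x (z 0)
        + ev x (cube y 0) * ev x (z 2))
    rw [ev_cube0, cube_two, spinD, p0.2.2.1, p0.2.2.2.1]
    simp only [spinCoef, map_add, map_sub, map_neg, map_smul, ev_mul, ev_pow, ev_one, smul_eq_mul,
      map_zero]
    ring
  · change ev x (0 * z 0 + spinCoef (-η) (y 1) (y 2) * z 1 + -y 1 ^ 3 * z 2) = ev x (z 1)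
      - (spinD (ev x (cube y 1)) * ev x (z 1) + (ev x (cube y 2) + η) * ev x (z 1)
        + ev x (cube y 1) * ev x (z 2))
    rw [ev_cube1, cube_two, spinD, p1.2.2.1, p1.2.2.2.1]
    simp only [spinCoef, map_add, map_sub, map_neg, map_smul, ev_mul, ev_pow, ev_one, smul_eq_mul,
      map_zero]
    ring
  · change ev x ((8 * Real.pi) • y 0 ^ 3 * z 0 + (8 * Real.pi) • y 1 ^ 3 * z 1 + 1 * z 2)
      = ev x (z 2) - -(8 * Real.pi) * (ev x (cube y 0) * ev x (z 0) + ev x (cube y 1) * ev x (z 1))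
    rw [ev_cube0, ev_cube1]
    simp only [map_add, map_smul, ev_mul, ev_pow, ev_one, smul_eq_mul]
    ring

/-- The quadratic terms of the second cell problem are the second order Taylor term of the
nonlinearity. -/
theorem ev_quad {y : Triple b} (hy0 : ∀ x, 0 < ev x (y 0)) (hy1 : ∀ x, 0 < ev x (y 1))
    (hu0 : IsUnit (y 0)) (hu1 : IsUnit (y 1)) (v : Triple b) (x : Space) (i : Fin 3) :
    ev x (quad y v i) = -quadR (fun j => ev x (cube y j)) (fun j => ev x (v j)) i := by
  have p0 := cube_rpow (hy0 x)
  have p1 := cube_rpow (hy1 x)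
  revert i
  refine forall_fin_three ?_ ?_ ?_
  · change ev x (quadCoef (y 0) * (v 0 * v 0) - v 2 * v 0)
      = -(1 / 2 * spinDD (ev x (cube y 0)) * ev x (v 0) ^ 2 + ev x (v 2) * ev x (v 0))
    rw [ev_cube0, spinDD, p0.2.2.2.2.1, p0.2.2.2.2.2]
    simp only [map_add, map_sub, ev_mul, quadCoef, map_smul, smul_eq_mul, ev_inverse hu0]
    ring
  · change ev x (quadCoef (y 1) * (v 1 * v 1) - v 2 * v 1)
      = -(1 / 2 * spinDD (ev x (cube y 1)) * ev x (v 1) ^ 2 + ev x (v 2) * ev x (v 1))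
    rw [ev_cube1, spinDD, p1.2.2.2.2.1, p1.2.2.2.2.2]
    simp only [map_add, map_sub, ev_mul, quadCoef, map_smul, smul_eq_mul, ev_inverse hu1]
    ring
  · change ev x ((4 * Real.pi) • (v 0 * v 0 + v 1 * v 1))
      = -(-(4 * Real.pi) * (ev x (v 0) ^ 2 + ev x (v 1) ^ 2))
    simp only [map_add, ev_mul, map_smul, smul_eq_mul]
    ring

/-- The sum `U₀ + ε U₁ + ε² U₂` of the sources of the two-scale expansion. -/
def srcSum (ρ : Wiener b) (Y : ℝ → Triple b) (h : Space → ℝ) (ε : ℝ) (x : Space) : Triple b :=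
  src0 ρ Y h x + ε • (src1 ρ Y h x + ε • src2 ρ Y h x)

/-- Inserting the two-scale expansion into the equation, the terms of order `1`, `ε` and `ε²`
cancel up to the Taylor remainder of the nonlinearity. -/
theorem residual_eq (hY : IsBranch ρ r Y) (hr : ∀ x, h x ∈ Ioo (-r) r)
    (c0 : ContDiff ℝ ∞ (src0 ρ Y h)) (c1 : ContDiff ℝ ∞ (src1 ρ Y h))
    (c2 : ContDiff ℝ ∞ (src2 ρ Y h)) (ε : ℝ) (X x : Space) (i : Fin 3) :
    ev x (twoScaleOp ε (fun X => srcSum ρ Y h ε X i) X) - ev x (res b (srcSum ρ Y h ε X i))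
      + nonlin (h X) (ev x ρ) (fun j => ev x (res b (srcSum ρ Y h ε X j))) i
    = (nonlin (h X) (ev x ρ) (fun j => ev x (cube (Y (h X)) j)
          + ε * ev x (res b (src1 ρ Y h X j)) + ε ^ 2 * ev x (res b (src2 ρ Y h X j))) i
        - nonlin (h X) (ev x ρ) (fun j => ev x (cube (Y (h X)) j)) i
        - ε * dnonlin (h X) (fun j => ev x (cube (Y (h X)) j))
            (fun j => ev x (res b (src1 ρ Y h X j))) i
        - ε ^ 2 * (dnonlin (h X) (fun j => ev x (cube (Y (h X)) j))
            (fun j => ev x (res b (src2 ρ Y h X j))) i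
          + quadR (fun j => ev x (cube (Y (h X)) j)) (fun j => ev x (res b (src1 ρ Y h X j))) i))
      - ε ^ 3 * (ev x (mixOp (src2 ρ Y h) X i) + ev x (lapOp (src1 ρ Y h) X i))
      - ε ^ 4 * ev x (lapOp (src2 ρ Y h) X i) := by
  have hX := hr X
  have q0 := hY.pos0 _ hX
  have q1 := hY.pos1 _ hX
  have r0 : ∀ j, ev x (res b (src0 ρ Y h X j)) = ev x (cube (Y (h X)) j) := fun j =>
    congrArg (fun z : Triple b => ev x (z j)) (hY.res3_source hX)
  have rs : ∀ j, ev x (res b (srcSum ρ Y h ε X j)) = ev x (cube (Y (h X)) j)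
      + ε * ev x (res b (src1 ρ Y h X j)) + ε ^ 2 * ev x (res b (src2 ρ Y h X j)) := fun j => by
    rw [← r0]
    change ev x (res b (src0 ρ Y h X j + ε • (src1 ρ Y h X j + ε • src2 ρ Y h X j))) = _
    simp only [map_add, map_smul, smul_eq_mul]
    ring
  -- the equations for `u₀`, `u₁`, `u₂` at the point `x`, in terms of the sources
  have s0 : ev x (src0 ρ Y h X i) = _ := ev_source q0 q1 (h X) x i
  have s1 : ev x (src1 ρ Y h X i) = ev x (res b (src1 ρ Y h X i))
      - dnonlin (h X) (fun j => ev x (cube (Y (h X)) j))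
        (fun j => ev x (res b (src1 ρ Y h X j))) i + ev x (mixOp (src0 ρ Y h) X i) := by
    have e := (eq_solveOp_iff (hY.isUnit _ hX) (mixOp (src0 ρ Y h) X) (src1 ρ Y h X)).2 rfl
    have e2 := congrArg (fun z : Triple b => ev x (z i)) e
    simp only [Pi.add_apply, map_add] at e2
    rw [e2, ev_matOp_linMat q0 q1]
    rfl
  have s2 : ev x (src2 ρ Y h X i) = ev x (res b (src2 ρ Y h X i))
      - dnonlin (h X) (fun j => ev x (cube (Y (h X)) j))
        (fun j => ev x (res b (src2 ρ Y h X j))) i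
      + (ev x (mixOp (src1 ρ Y h) X i) + ev x (lapOp (src0 ρ Y h) X i)
        - quadR (fun j => ev x (cube (Y (h X)) j)) (fun j => ev x (res b (src1 ρ Y h X j))) i) := by
    have e := (eq_solveOp_iff (hY.isUnit _ hX) (mixOp (src1 ρ Y h) X + lapOp (src0 ρ Y h) X
      + quad (Y (h X)) (res3 b (src1 ρ Y h X))) (src2 ρ Y h X)).2 rfl
    have e2 := congrArg (fun z : Triple b => ev x (z i)) e
    simp only [Pi.add_apply, map_add] at e2
    rw [e2, ev_matOp_linMat q0 q1, ev_quad q0 q1 (hY.isUnit0 _ hX) (hY.isUnit1 _ hX),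
      sub_eq_add_neg (ev x (mixOp (src1 ρ Y h) X i) + _)]
    rfl
  have c12 : ContDiff ℝ ∞ fun x => src1 ρ Y h x + ε • src2 ρ Y h x := c1.add (c2.const_smul ε)
  have cs : ContDiff ℝ ∞ (srcSum ρ Y h ε) := c0.add (c12.const_smul ε)
  have t : ev x (twoScaleOp ε (fun X => srcSum ρ Y h ε X i) X)
      = ev x (src0 ρ Y h X i) + ε * (ev x (src1 ρ Y h X i) + ε * ev x (src2 ρ Y h X i))
        - ε * (ev x (mixOp (src0 ρ Y h) X i) + ε * (ev x (mixOp (src1 ρ Y h) X i)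
          + ε * ev x (mixOp (src2 ρ Y h) X i)))
        - ε ^ 2 * (ev x (lapOp (src0 ρ Y h) X i) + ε * (ev x (lapOp (src1 ρ Y h) X i)
          + ε * ev x (lapOp (src2 ρ Y h) X i))) := by
    have em : mixOp (srcSum ρ Y h ε) X = _ := mixOp_add_smul ε c0 c12 X
    have el : lapOp (srcSum ρ Y h ε) X = _ := lapOp_add_smul ε c0 c12 X
    rw [mixOp_add_smul ε c1 c2] at em
    rw [lapOp_add_smul ε c1 c2] at el
    rw [twoScaleOp_component ε cs, em, el]
    simp only [srcSum, Pi.add_apply, Pi.smul_apply, map_add, map_sub, map_smul, smul_eq_mul]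
  simp only [rs]
  rw [t, s0, s1, s2]
  ring

end Wiener

namespace Wiener

/-! ### Uniform estimates of the approximate solution -/

theorem abs_ev_apply_le (x : Space) (z : Triple b) (i : Fin 3) : |ev x (z i)| ≤ ‖z‖ :=
  (abs_ev_le x (z i)).trans (norm_le_pi_norm z i)

set_option maxHeartbeats 1000000 in
/-- The approximate solution and the Cauchy--Born state on the supercells, with estimates that are
uniform in the admissible field. -/
theorem exists_approx {ρ : Wiener b} {Y : ℝ → Triple b} {r h₀ a : ℝ} (hY : IsBranch ρ r Y)
    (hh₀ : 0 < h₀) (hr : h₀ < r) (ha : 0 < a)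
    (low0 : ∀ η ∈ Icc (-h₀) h₀, ∀ x, a ≤ ev x (cube (Y η) 0))
    (low1 : ∀ η ∈ Icc (-h₀) h₀, ∀ x, a ≤ ev x (cube (Y η) 1)) (K : ℝ) :
    ∃ C, 0 ≤ C ∧ ∃ ε₁ > 0, ε₁ ≤ 1 ∧ ∀ h : Space → ℝ, Admissible h₀ K h → IsPeriodic b 1 h →
      ∀ (n : ℕ) [NeZero n] (ε : ℝ), ε = 1 / (n : ℝ) → ε ≤ ε₁ → ∃ u0 v0 : Fin 3 → H b 2 n,
        (∀ i, toL2 (u0 i) =ᵐ[cellMeasure b n]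
          fun x => ev x (res b (srcSum ρ Y h ε (ε • x) i))) ∧
        (∀ i, toL2 (v0 i) =ᵐ[cellMeasure b n] fun x => ev x (res b (src0 ρ Y h (ε • x) i))) ∧
        (∀ i, ∀ᵐ x ∂(cellMeasure b n),
          |-(lap (u0 i) x) + nonlin (h (ε • x)) (ev x ρ) (fun j => toL2 (u0 j) x) i|
            ≤ C * ε ^ 3) ∧
        ‖u0 - v0‖ ≤ C * ε ∧
        ∀ i, ∀ᵐ x ∂(cellMeasure b n), |toL2 (u0 i) x - toL2 (v0 i) x| ≤ C * ε := by
  have U0 := uniformlySmooth_src0 (K := K) hY hh₀ hr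
  have U1 := uniformlySmooth_src1 (K := K) hY hh₀ hr
  have U2 := uniformlySmooth_src2 (K := K) hY hh₀ hr
  obtain ⟨B1, hB1⟩ := U1.bound
  obtain ⟨B2, hB2⟩ := U2.bound
  obtain ⟨m1, hm1⟩ := (uniformlySmooth_mixOp U1).bound
  obtain ⟨m2, hm2⟩ := (uniformlySmooth_mixOp (U2.mono (m' := 1) (by norm_num))).bound
  obtain ⟨l1, hl1⟩ := (uniformlySmooth_lapOp U1).bound
  obtain ⟨l2, hl2⟩ := (uniformlySmooth_lapOp U2).bound
  obtain ⟨A0, hA0⟩ := (U0.clm (res3 b)).bound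
  obtain ⟨A1, hA1⟩ := (U1.clm (res3 b)).bound
  obtain ⟨A2, hA2⟩ := (U2.clm (res3 b)).bound
  -- a common bound, which depends on the field only through `h₀` and `K`
  set B := |B1| + |B2| + |m1| + |m2| + |l1| + |l2| + |A0| + |A1| + |A2| with hB
  have hB0 : 0 ≤ B := by positivity
  have le : ∀ {u v : ℝ}, u ≤ v → |v| ≤ B → u ≤ B := fun h1 h2 =>
    h1.trans ((le_abs_self _).trans h2)
  have n1 := abs_nonneg B1
  have n2 := abs_nonneg B2
  have n3 := abs_nonneg m1
  have n4 := abs_nonneg m2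
  have n5 := abs_nonneg l1
  have n6 := abs_nonneg l2
  have n7 := abs_nonneg A0
  have n8 := abs_nonneg A1
  have n9 := abs_nonneg A2
  obtain ⟨C0, hC0, hT⟩ := exists_taylor ha B hB0
  set N : ℝ := 4 * Fintype.card (MultiIndex 2) with hN
  set v := sqrtVol b with hv
  have hv0 : 0 < v := sqrtVol_pos
  have hN0 : 0 ≤ N := by positivity
  refine ⟨C0 + 3 * B + N * (v * (6 * B)), by positivity, min 1 (a / (4 * (B + 1))), by positivity,
    min_le_left _ _, ?_⟩
  intro h hh hper n _ ε hε hε1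
  have hn0 : (0 : ℝ) < n := Nat.cast_pos.2 (NeZero.pos n)
  have ε0 : 0 < ε := by rw [hε]; positivity
  have ε1 : ε ≤ 1 := hε1.trans (min_le_left _ _)
  have hεA : ε * (2 * B) ≤ a / 2 := by
    have h1 := hε1.trans (min_le_right _ _)
    rw [le_div_iff₀ (by positivity)] at h1
    linarith
  have hp : ∀ i x, h (x + b i) = h x := fun i x => by simpa using hper i x
  have c0 : ContDiff ℝ ∞ (src0 ρ Y h) := U0.1 ⟨h, hh⟩
  have c1 : ContDiff ℝ ∞ (src1 ρ Y h) := U1.1 ⟨h, hh⟩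
  have c2 : ContDiff ℝ ∞ (src2 ρ Y h) := U2.1 ⟨h, hh⟩
  have c12 : ContDiff ℝ ∞ fun x => src1 ρ Y h x + ε • src2 ρ Y h x := c1.add (c2.const_smul ε)
  have cs : ContDiff ℝ ∞ (srcSum ρ Y h ε) := c0.add (c12.const_smul ε)
  have bB1 : ∀ x, ‖src1 ρ Y h x‖ ≤ B := fun x => le (hB1 ⟨h, hh⟩ x) (by linarith)
  have bB2 : ∀ x, ‖src2 ρ Y h x‖ ≤ B := fun x => le (hB2 ⟨h, hh⟩ x) (by linarith)
  have bm1 : ∀ x, ‖mixOp (src1 ρ Y h) x‖ ≤ B := fun x => le (hm1 ⟨h, hh⟩ x) (by linarith)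
  have bm2 : ∀ x, ‖mixOp (src2 ρ Y h) x‖ ≤ B := fun x => le (hm2 ⟨h, hh⟩ x) (by linarith)
  have bl1 : ∀ x, ‖lapOp (src1 ρ Y h) x‖ ≤ B := fun x => le (hl1 ⟨h, hh⟩ x) (by linarith)
  have bl2 : ∀ x, ‖lapOp (src2 ρ Y h) x‖ ≤ B := fun x => le (hl2 ⟨h, hh⟩ x) (by linarith)
  have bA0 : ∀ x, ‖res3 b (src0 ρ Y h x)‖ ≤ B := fun x => le (hA0 ⟨h, hh⟩ x) (by linarith)
  have bA1 : ∀ x, ‖res3 b (src1 ρ Y h x)‖ ≤ B := fun x => le (hA1 ⟨h, hh⟩ x) (by linarith)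
  have bA2 : ∀ x, ‖res3 b (src2 ρ Y h x)‖ ≤ B := fun x => le (hA2 ⟨h, hh⟩ x) (by linarith)
  have hrange : ∀ x, h x ∈ Ioo (-r) r := fun x =>
    ⟨by linarith [(hh.mem x).1], by linarith [(hh.mem x).2]⟩
  have comp : ∀ {W : Space → Triple b}, ContDiff ℝ ∞ W → ∀ i, ContDiff ℝ ∞ fun x => W x i :=
    fun hW i => contDiff_pi.1 hW i
  have hE0 := fun i => exists_twoScale (n := n) (comp c0 i) fun j x => by
    rw [src0_add_period hp]
  have hEs := fun i => exists_twoScale (n := n) (comp cs i) fun j x => by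
    simp only [srcSum, src0_add_period hp, src1_add_period hp, src2_add_period hp]
  rw [← hε] at hE0 hEs
  choose v0 hv0L hv0R using hE0
  choose u0 hu0L hu0R using hEs
  -- `1 - Δ` applied to the two-scale correction `u⁰ - u_CB` is of order `ε`
  have hcorr : ∀ i x X, |ev x (twoScaleOp ε (fun x => srcSum ρ Y h ε x i) X)
      - ev x (twoScaleOp ε (fun x => src0 ρ Y h x i) X)| ≤ 6 * B * ε := by
    intro i x X
    have em : mixOp (srcSum ρ Y h ε) X = _ := mixOp_add_smul ε c0 c12 X
    have el : lapOp (srcSum ρ Y h ε) X = _ := lapOp_add_smul ε c0 c12 X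
    rw [mixOp_add_smul ε c1 c2] at em
    rw [lapOp_add_smul ε c1 c2] at el
    have e : ev x (twoScaleOp ε (fun x => srcSum ρ Y h ε x i) X)
        - ev x (twoScaleOp ε (fun x => src0 ρ Y h x i) X)
        = ε * ((ev x (src1 ρ Y h X i) + ε * ev x (src2 ρ Y h X i))
          - ε * (ev x (mixOp (src1 ρ Y h) X i) + ε * ev x (mixOp (src2 ρ Y h) X i))
          - ε ^ 2 * (ev x (lapOp (src1 ρ Y h) X i) + ε * ev x (lapOp (src2 ρ Y h) X i))) := by
      rw [twoScaleOp_component ε cs, twoScaleOp_component ε c0, em, el]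
      simp only [srcSum, Pi.add_apply, Pi.smul_apply, map_add, map_sub, map_smul, smul_eq_mul]
      ring
    have pair : ∀ {s t : ℝ}, |s| ≤ B → |t| ≤ B → |s + ε * t| ≤ 2 * B := fun hs ht => by
      refine (abs_add_le _ _).trans ?_
      rw [abs_mul, abs_of_pos ε0]
      have := mul_le_mul ε1 ht (abs_nonneg _) zero_le_one
      linarith
    have k1 := pair ((abs_ev_apply_le x _ i).trans (bB1 X)) ((abs_ev_apply_le x _ i).trans (bB2 X))
    have k2 := pair ((abs_ev_apply_le x _ i).trans (bm1 X)) ((abs_ev_apply_le x _ i).trans (bm2 X))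
    have k3 := pair ((abs_ev_apply_le x _ i).trans (bl1 X)) ((abs_ev_apply_le x _ i).trans (bl2 X))
    rw [e, abs_mul, abs_of_pos ε0, mul_comm]
    refine mul_le_mul_of_nonneg_right ((abs_sub _ _).trans (((add_le_add (abs_sub _ _) le_rfl)).trans
      ?_)) ε0.le
    rw [abs_mul, abs_mul, abs_of_pos ε0, abs_of_pos (by positivity : 0 < ε ^ 2)]
    have k4 := mul_le_mul ε1 k2 (abs_nonneg _) zero_le_one
    have k5 := mul_le_mul (pow_le_one₀ ε0.le ε1 : ε ^ 2 ≤ 1) k3 (abs_nonneg _) zero_le_one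
    linarith
  have hc3 : ∀ {s t : ℝ}, |s| ≤ B → |t| ≤ B → |ε * s + ε ^ 2 * t| ≤ 3 * B * ε := fun hs ht => by
    refine (abs_add_le _ _).trans ?_
    rw [abs_mul, abs_mul, abs_of_pos ε0, abs_of_pos (by positivity : 0 < ε ^ 2)]
    have h1 := mul_le_mul_of_nonneg_left hs ε0.le
    have h2 : ε ^ 2 * |_| ≤ ε * B := mul_le_mul
      (by simpa using pow_le_pow_of_le_one ε0.le ε1 (m := 1) (n := 2) (by norm_num)) ht
      (abs_nonneg _) ε0.le
    nlinarith
  have hrs : ∀ i x X, ev x (res b (srcSum ρ Y h ε X i)) = ev x (res b (src0 ρ Y h X i))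
      + (ε * ev x (res b (src1 ρ Y h X i)) + ε ^ 2 * ev x (res b (src2 ρ Y h X i))) := by
    intro i x X
    simp only [srcSum, Pi.add_apply, Pi.smul_apply, map_add, map_smul, smul_eq_mul]
    ring
  have bR : ∀ {W : Triple b}, ‖res3 b W‖ ≤ B → ∀ x i, |ev x (res b (W i))| ≤ B := fun hW x i =>
    (abs_ev_apply_le x (res3 b _) i).trans hW
  refine ⟨u0, v0, hu0L, hv0L, fun i => ?_, ?_, fun i => ?_⟩
  · filter_upwards [ae_all_iff.2 hu0L, hu0R i] with x e1 e2
    have e3 : -(lap (u0 i) x) = ev x (twoScaleOp ε (fun x => srcSum ρ Y h ε x i) (ε • x))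
        - ev x (res b (srcSum ρ Y h ε (ε • x) i)) := by rw [← e2, e1 i]; ring
    have e4 : (fun j => toL2 (u0 j) x) = fun j => ev x (res b (srcSum ρ Y h ε (ε • x) j)) :=
      funext e1
    have hX := hh.mem (ε • x)
    rw [e3, e4, residual_eq hY hrange c0 c1 c2]
    have hs : ∀ j, |ev x (cube (Y (h (ε • x))) j)| ≤ B := fun j => by
      rw [← hY.res3_source (hrange _)]
      exact bR (bA0 _) x j
    have t := hT (h (ε • x)) (ev x ρ) ε (fun j => ev x (cube (Y (h (ε • x))) j))
      (fun j => ev x (res b (src1 ρ Y h (ε • x) j))) (fun j => ev x (res b (src2 ρ Y h (ε • x) j)))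
      (low0 _ hX x) (low1 _ hX x) ((le_abs_self _).trans (hs 0)) ((le_abs_self _).trans (hs 1))
      (bR (bA1 _) x) (bR (bA2 _) x) ε0.le ε1 hεA i
    have t1 : |ε ^ 3 * (ev x (mixOp (src2 ρ Y h) (ε • x) i)
        + ev x (lapOp (src1 ρ Y h) (ε • x) i))| ≤ ε ^ 3 * (B + B) := by
      rw [abs_mul, abs_of_pos (by positivity : 0 < ε ^ 3)]
      exact mul_le_mul_of_nonneg_left ((abs_add_le _ _).trans (add_le_add
        ((abs_ev_apply_le x _ i).trans (bm2 _)) ((abs_ev_apply_le x _ i).trans (bl1 _))))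
        (by positivity)
    have t2 : |ε ^ 4 * ev x (lapOp (src2 ρ Y h) (ε • x) i)| ≤ ε ^ 3 * B := by
      rw [abs_mul, abs_of_pos (by positivity : 0 < ε ^ 4)]
      exact mul_le_mul (pow_le_pow_of_le_one ε0.le ε1 (by norm_num))
        ((abs_ev_apply_le x _ i).trans (bl2 _)) (abs_nonneg _) (by positivity)
    refine (abs_sub _ _).trans ((add_le_add ((abs_sub _ _).trans (add_le_add t t1)) t2).trans ?_)
    have : 0 ≤ N * (v * (6 * B)) * ε ^ 3 := by positivity
    nlinarith
  · rw [pi_norm_le_iff_of_nonneg (by positivity)]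
    intro i
    have hle : ‖toL2 ((u0 - v0) i) - lap ((u0 - v0) i)‖ ≤ v * (6 * B * ε) := by
      refine norm_le_of_ae_abs_le (by positivity) ?_
      have e : toL2 ((u0 - v0) i) - lap ((u0 - v0) i)
          = (toL2 (u0 i) - lap (u0 i)) - (toL2 (v0 i) - lap (v0 i)) := by
        rw [Pi.sub_apply, toL2_sub, lap_sub le_rfl]; abel
      rw [e]
      filter_upwards [Lp.coeFn_sub (toL2 (u0 i) - lap (u0 i)) (toL2 (v0 i) - lap (v0 i)),
        Lp.coeFn_sub (toL2 (u0 i)) (lap (u0 i)), Lp.coeFn_sub (toL2 (v0 i)) (lap (v0 i)), hu0R i,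
        hv0R i] with x e1 e2 e3 e4 e5
      rw [e1, Pi.sub_apply, e2, e3, Pi.sub_apply, Pi.sub_apply, e4, e5]
      exact hcorr i x _
    refine (norm_H2_le _).trans ((mul_le_mul_of_nonneg_left hle hN0).trans ?_)
    have : 0 ≤ (C0 + 3 * B) * ε := by positivity
    linarith
  · filter_upwards [hu0L i, hv0L i] with x e1 e2
    rw [e1, e2, hrs, add_sub_cancel_left]
    refine (hc3 (bR (bA1 _) x i) (bR (bA2 _) x i)).trans ?_
    have : 0 ≤ (C0 + N * (v * (6 * B))) * ε := by positivity
    linarith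

end Wiener

namespace Wiener

/-! ### The unperturbed state -/

/-- A state that solves the Euler--Lagrange equations on the unit cell with densities bounded below
is of the form `cube y` with `y` in the Wiener algebra. -/
theorem exists_state {ρb : Space → ℝ} (hρs : ContDiff ℝ ∞ ρb) (hρp : IsPeriodic b 1 ρb)
    {uper : Fin 3 → H b 2 1} (huper : EulerLagrange ρb (fun _ => 0) uper) {c : ℝ} (hc : 0 < c)
    (hpos : ∀ᵐ x ∂(cellMeasure b 1), c ≤ toL2 (uper 0) x ∧ c ≤ toL2 (uper 1) x) :
    ∃ y y' : Triple b, y 0 * y' 0 = 1 ∧ y 1 * y' 1 = 1 ∧ (∀ x, 0 < ev x (y 0)) ∧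
      (∀ x, 0 < ev x (y 1)) ∧ (∀ x, c ≤ ev x (cube y 0)) ∧ (∀ x, c ≤ ev x (cube y 1)) ∧
      ∀ i, toL2 (uper i) =ᵐ[cellMeasure b 1] fun x => ev x (cube y i) := by
  obtain ⟨w, w', hw, hw0, hwc, hwe⟩ := exists_cbrt (uper 0) (uper 2) hc
    (hpos.mono fun x hx => hx.1) (by
      filter_upwards [huper] with x hx
      simpa using hx.1)
  obtain ⟨z, z', hz, hz0, hzc, hze⟩ := exists_cbrt (uper 1) (uper 2) hc
    (hpos.mono fun x hx => hx.2) (by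
      filter_upwards [huper] with x hx
      simpa using hx.2.1)
  obtain ⟨v, hv⟩ := exists_potential (uper 0) (uper 1) (uper 2)
    (HasH1.of_contDiff hρs hρp) (huper.mono fun x hx => hx.2.2)
  refine ⟨![w, z, v], ![w', z', 0], hw, hz, hw0, hz0, fun x => ?_, fun x => ?_, ?_⟩
  · rw [ev_cube0]; exact hwc x
  · rw [ev_cube1]; exact hzc x
  · refine forall_fin_three ?_ ?_ ?_
    · simp only [ev_cube0]
      exact hwe
    · simp only [ev_cube1]
      exact hze
    · exact hv

/-- The periodic extension of a function with a continuous periodic representative, on all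
supercells. -/
theorem perExt_ae_eq_supercell {k n : ℕ} (f : H b k 1) {a : Wiener b}
    (h : toL2 f =ᵐ[cellMeasure b 1] fun x => ev x a) :
    perExt f =ᵐ[cellMeasure b n] fun x => ev x a := by
  have h1 : ∀ᵐ x : Space, perExt f x = ev x a := by
    refine ae_of_ae_cell (n := 1) (perExt_ae_eq f h) fun x m => ?_
    rw [(isPeriodic_ev a).add_lattice m x]
    have e : ZSpan.fract b (x + ∑ i, (m i : ℝ) • ((1 : ℕ) : ℝ) • b i) = ZSpan.fract b x := by
      rw [add_comm]
      have hm : ∑ i, (m i : ℝ) • ((1 : ℕ) : ℝ) • b i ∈ Submodule.span ℤ (Set.range b) := by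
        refine Submodule.sum_mem _ fun i _ => ?_
        rw [Nat.cast_one, one_smul, Int.cast_smul_eq_zsmul]
        exact Submodule.smul_mem _ _ (Submodule.subset_span ⟨i, rfl⟩)
      exact ZSpan.fract_zSpan_add b _ hm
    unfold perExt
    rw [e]
  exact Measure.ae_smul_measure (ae_restrict_of_ae h1) _

theorem linearizedEq_congr {k n : ℕ} {c c' : Fin 3 → Space → ℝ} {g : Space → ℝ}
    (h : ∀ i, c i =ᵐ[cellMeasure b n] c' i) (w : Fin 3 → H b k n) (f : Fin 3 → Space → ℝ) :
    LinearizedEq c g w f ↔ LinearizedEq c' g w f := by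
  refine eventually_congr ?_
  filter_upwards [h 0, h 1, h 2] with x h0 h1 h2
  rw [h0, h1, h2]

end Wiener

end TFDW

end

open TFDW.Wiener

theorem mainTheorem1
    (b : Module.Basis (Fin 3) ℝ Space)
    (ρb : Space → ℝ) (hρ_smooth : ContDiff ℝ ∞ ρb) (hρ_per : IsPeriodic b 1 ρb)
    (uper : Fin 3 → H b 2 1)
    (huper : EulerLagrange ρb (fun _ => 0) uper)
    (Cν : ℝ) (hCν : 0 < Cν)
    (hpos : ∀ᵐ x ∂(cellMeasure b 1), Cν ≤ toL2 (uper 0) x ∧ Cν ≤ toL2 (uper 1) x)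
    (hstab : Stability uper) :
    ∃ h₀ : ℝ, 0 < h₀ ∧ ∃ δ₁ : ℝ, 0 < δ₁ ∧ ∃ uCB : ℝ → Fin 3 → H b 3 1,
      IsCauchyBorn ρb uper h₀ δ₁ uCB ∧
      ∀ K : ℝ, ∃ ε₀ : ℝ, 0 < ε₀ ∧ ∃ δ : ℝ, 0 < δ ∧
        ∀ h : Space → ℝ, ContDiff ℝ ∞ h → IsPeriodic b 1 h → (∀ x, |h x| ≤ h₀) →
          (∀ j : ℕ, j ≤ 4 → ∀ x, ‖iteratedFDeriv ℝ j h x‖ ≤ K) →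
          ∃ u₁ u₂ : Space → Fin 3 → H b 3 1,
            IsTwoScale uCB h u₁ u₂ ∧
            (∀ v₁ v₂, IsTwoScale uCB h v₁ v₂ → v₁ = u₁ ∧ v₂ = u₂) ∧
            ∀ n : ℕ, 1 ≤ n → ∀ ε : ℝ, ε = 1 / (n : ℝ) → ε ≤ ε₀ →
              ∃ u0 uCBn : Fin 3 → H b 2 n,
                Represents u0 (approxSolution uCB h u₁ u₂ ε) ∧
                Represents uCBn (cauchyBornState uCB h ε) ∧
                ∃ u : Fin 3 → H b 2 n,
                  EulerLagrange ρb (fun x => h (ε • x)) u ∧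
                  ‖u - u0‖ ≤ δ * ε ^ 3 ∧
                  (∀ u' : Fin 3 → H b 2 n,
                    EulerLagrange ρb (fun x => h (ε • x)) u' → ‖u' - u0‖ ≤ δ * ε ^ 3 → u' = u) ∧
                  ‖u - uCBn‖ ≤ δ * ε := by
  obtain ⟨ρ, hρ⟩ := exists_of_contDiff hρ_smooth hρ_per
  obtain ⟨y, y', e0, e1, y0, y1, low0, low1, hy⟩ :=
    exists_state hρ_smooth hρ_per huper hCν hpos
  -- the contraction on the supercells around the state `cube y`
  obtain ⟨M₁, hM₁, τ, hτ, hnear⟩ := exists_unique_near (b := b) (c := fun i x => ev x (cube y i))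
    (A := ‖cube y‖) (M := hstab.choose) hCν (fun i => continuous_ev _) low0 low1
    (fun i x => abs_ev_apply_le x _ i) (fun n hn f => by
      have : NeZero n := ⟨by omega⟩
      obtain ⟨w, hw1, hw2, hw3⟩ := hstab.choose_spec n hn f
      have hc := fun i => perExt_ae_eq_supercell (n := n) (uper i) (hy i)
      exact ⟨w, (linearizedEq_congr hc w _).1 hw1,
        fun w' hw' => hw2 w' ((linearizedEq_congr hc w' _).2 hw'), hw3⟩)
  obtain ⟨r, Y, hY, h₀, hh₀, hr, hh₀τ, hclose, δ₁, hδ₁, hCB⟩ := exists_isCauchyBorn hρ huper e0 e1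
    y0 y1 hy hstab (τ := min (τ / 2) (Cν / 2)) (lt_min (half_pos hτ) (half_pos hCν))
  refine ⟨h₀, hh₀, δ₁, hδ₁, branchState ρ Y, hCB, fun K => ?_⟩
  have hdist : ∀ η ∈ Icc (-h₀) h₀, ∀ x i, |ev x (cube (Y η) i) - ev x (cube y i)| ≤
      min (τ / 2) (Cν / 2) := fun η hη x i => by
    rw [← map_sub]
    exact (abs_ev_apply_le x (cube (Y η) - cube y) i).trans (hclose η hη)
  have hlow : ∀ i, (∀ x, Cν ≤ ev x (cube y i)) → ∀ η ∈ Icc (-h₀) h₀, ∀ x,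
      Cν / 2 ≤ ev x (cube (Y η) i) := fun i hi η hη x => by
    have h1 := abs_le.1 ((hdist η hη x i).trans (min_le_right _ _))
    linarith [h1.1, hi x]
  obtain ⟨C, hC, ε₁, hε₁, hε₁1, happ⟩ := exists_approx hY hh₀ hr (half_pos hCν) (hlow 0 low0)
    (hlow 1 low1) K
  -- `M₁ C` bounds the correction `u - u⁰` by `δ ε³`, and `C` is needed for the distance of `u⁰` to
  -- the Cauchy--Born state
  set δ := M₁ * C + C + 1 with hδ
  have hδ0 : 0 < δ := by positivity
  have hS : 0 ≤ sobolevConst b := sobolevConst_nonneg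
  refine ⟨min ε₁ (min (τ / (2 * (C + 1))) (τ / (sobolevConst b * δ + 1))), by positivity, δ, hδ0, ?_⟩
  intro h hsmooth hper habs hderiv
  have hh : Admissible h₀ K h := ⟨hsmooth, habs, hderiv⟩
  have two := fun v₁ v₂ => isTwoScale_iff (v₁ := v₁) (v₂ := v₂) hY hh₀ hr hh
  refine ⟨_, _, (two _ _).2 ⟨rfl, rfl⟩, fun v₁ v₂ hv => (two _ _).1 hv, ?_⟩
  intro n hn ε hε hεle
  have : NeZero n := ⟨by omega⟩
  have hn0 : (0 : ℝ) < n := Nat.cast_pos.2 (NeZero.pos n)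
  have ε0 : 0 < ε := by rw [hε]; positivity
  have hεε₁ : ε ≤ ε₁ := hεle.trans (min_le_left _ _)
  have ε1 : ε ≤ 1 := hεε₁.trans hε₁1
  have hεC : C * ε ≤ τ / 2 := by
    have h1 := hεle.trans ((min_le_right _ _).trans (min_le_left _ _))
    rw [le_div_iff₀ (by positivity)] at h1
    linarith
  have hεS : sobolevConst b * δ * ε ≤ τ := by
    have h1 := hεle.trans ((min_le_right _ _).trans (min_le_right _ _))
    rw [le_div_iff₀ (by positivity)] at h1
    linarith
  obtain ⟨u0, v0, hu0, hv0, hres, hnorm, hsup⟩ := happ h hh hper n ε hε hεε₁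
  have hrange : ∀ x, h x ∈ Ioo (-r) r := fun x =>
    ⟨by linarith [(hh.mem x).1], by linarith [(hh.mem x).2]⟩
  have d0 : ∀ i x, cauchyBornState (branchState ρ Y) h ε i x
      = ev x (res b (src0 ρ Y h (ε • x) i)) := fun i x => diag_resH3 ε (src0 ρ Y h) i x
  refine ⟨u0, v0, fun i => ?_, fun i => ?_, ?_⟩
  · filter_upwards [hu0 i] with x hx
    rw [hx]
    simp only [approxSolution, d0, diag_resH3, srcSum, Pi.add_apply, Pi.smul_apply, map_add,
      map_smul, smul_eq_mul]
    ring
  · filter_upwards [hv0 i] with x hx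
    rw [hx, d0]
  have hτh : ∀ x, |h (ε • x)| ≤ τ := fun x =>
    (habs _).trans (hh₀τ.trans ((min_le_left _ _).trans (by linarith)))
  -- the loss of `n²` in the Sobolev inequality is compensated by the order `ε³` of the residual
  have hD : sobolevConst b * (n : ℝ) ^ 2 * (δ * ε ^ 3) ≤ τ := by
    have hnε : (n : ℝ) * ε = 1 := by rw [hε]; field_simp
    have e : sobolevConst b * (n : ℝ) ^ 2 * (δ * ε ^ 3)
        = sobolevConst b * δ * ε * ((n : ℝ) * ε) ^ 2 := by ring
    rw [e, hnε]
    linarith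
  have hMD : M₁ * (C * ε ^ 3) ≤ δ * ε ^ 3 := by
    have : 0 ≤ (C + 1) * ε ^ 3 := by positivity
    rw [hδ]
    linarith
  have hu0c : ∀ᵐ x ∂(cellMeasure b n), ∀ i, |toL2 (u0 i) x - ev x (cube y i)| ≤ τ := by
    refine ae_all_iff.2 fun i => ?_
    filter_upwards [hsup i, hv0 i] with x h1 h2
    have h3 := (hdist _ (hh.mem (ε • x)) x i).trans (min_le_left _ _)
    have h4 : toL2 (v0 i) x = ev x (cube (Y (h (ε • x))) i) := by
      rw [h2, ← hY.res3_source (hrange _)]; rfl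
    have e : toL2 (u0 i) x - ev x (cube y i)
        = (toL2 (u0 i) x - toL2 (v0 i) x) + (toL2 (v0 i) x - ev x (cube y i)) := by ring
    rw [e]
    refine (abs_add_le _ _).trans ?_
    rw [h4] at h1 ⊢
    linarith
  obtain ⟨u, hu, hubound, huniq⟩ := hnear n (fun x => h (ε • x)) ρb
    (hsmooth.continuous.comp (continuous_const_smul ε)) hρ_smooth.continuous hτh u0 hu0c
    (δ * ε ^ 3) (C * ε ^ 3) hD (by positivity) hMD (fun i => by simpa only [hρ] using hres i)
  refine ⟨u, hu, hubound.trans hMD, huniq, ?_⟩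
  have hε3 : ε ^ 3 ≤ ε := by simpa using pow_le_pow_of_le_one ε0.le ε1 (m := 1) (n := 3) (by norm_num)
  calc ‖u - v0‖ = ‖(u - u0) + (u0 - v0)‖ := by rw [sub_add_sub_cancel]
    _ ≤ M₁ * (C * ε ^ 3) + C * ε := (norm_add_le _ _).trans (add_le_add hubound hnorm)
    _ ≤ δ * ε := by
      have h1 : M₁ * (C * ε ^ 3) ≤ M₁ * (C * ε) := by gcongr
      rw [hδ]
      linarith
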